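/- **Setting.** Let $\Gamma\subset SL(2,\mathbb R)$ be a non-uniform lattice with a system $z_k=A_k\cdot\infty$ ($k=1,\dots,p$) of representatives of its inequivalent parabolic fixed points, let $\Gamma_0\le\Gamma$ be a free subgroup of finite index, and let $\varphi(z)=\frac{z-i}{z+i}$. For $G\in SL(2,\mathbb R)$ the map $F=\varphi\circ G\circ\varphi^{-1}$ has the form $F(z)=\frac{\alpha z+\overline\beta}{\beta z+\overline\alpha}$ with $|\alpha|^2-|\beta|^2=1$, and we set $U_F=\{|\beta z+\overline\alpha|<1\}$, the interior of its isometric circle (empty if $\beta=0$). We assume that the region $\Omega=\overline{\mathbb D\setminus\bigcup_{F\in\Gamma_0}U_F}$ is an ideal polygon with sides $s_a$, $a\in\mathcal A$, where $\mathcal A$ is a finite alphabet with a fixed point free involution $a\mapsto\hat a$, and with side pairings $F_a\in\Gamma_0$, $F_{\hat a}=F_a^{-1}$, such that $s_a$ lies on the isometric circle $\partial U_{F_{\hat a}}$ and $F_a(s_{\hat a})=s_a$. Let $[a]$ be the right-open arc of $\partial\mathbb D$, oriented clockwise, cut by $s_a$, with left and right end points $\xi_a^L,\xi_a^R$; these arcs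 partition $\partial\mathbb D$. Write $o(b)=o(a)+1$ if $\xi^R_a=\xi^L_b$. **Cuspidal words.** A non-empty word $W=(a_0,\dots,a_n)$ is admissible if $a_{k+1}\ne\hat a_k$ for all $k$, and $F_W:=F_{a_0}\cdots F_{a_n}$. It is *cuspidal* if it is an initial factor of an admissible word $V$ such that $F_V$ is a parabolic element fixing a vertex of $\Omega$; for $n\ge1$ it is *right* (resp. *left*) if $o(a_{k+1})=o(\hat a_k)-1$ (resp. $+1$) for all $k$. Let $\xi_W:=\xi_{a_0}^L$ if $W$ is left and $\xi_W:=\xi^R_{a_0}$ otherwise. The *geometric length* is $|W|=0$ if $n=0$; if $n\ge1$ then $$|W|=\big|\mathrm{Re}\,(A_k^{-1}B^{-1}\varphi^{-1}s)-\mathrm{Re}\,(A_k^{-1}B^{-1}\varphi^{-1}s')\big|,\qquad s=s_{a_0},\quad s'=F_{a_0,\dots,a_{n-1}}(s_{a_n}),$$ where $B\in\Gamma$ and $k$ are such that $\xi_W=\varphi(BA_k\cdot\infty)$ (the two geodesics become vertical lines). For $a\in\mathcal A$ let $\mathcal W(a)$ be the set of cuspidal words $W=(b_0,\dots,b_m)$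 such that: $a\neq\hat b_m$; if $m=0$, then $o(a)\ne o(\hat b_0)\pm1$; if $W$ is left, then $o(a)\neq o(\hat b_m)+1$; if $W$ is right, then $o(a)\ne o(\hat b_m)-1$. For $0<T\le\infty$ let $\mathcal W(a,T)=\{W\in\mathcal W(a):|W|\le T\}$. **Operators.** Let $\mathcal B$ be the Banach space of functions $f:\partial\mathbb D\to\mathbb C$ which are Lipschitz on every arc $[a]$, with norm $\|f\|_\infty+\mathrm{Lip}(f)$, where $\mathrm{Lip}(f)$ is the largest of the Lipschitz constants of $f$ on the arcs $[a]$. For $x\in[a]$ set $$L_{(s,T)}f(x)=\sum_{W\in\mathcal W(a,T)}|D_xF_W|^sf(F_Wx),\qquad \Delta_{(s,T)}f(x)=\sum_{W\in\mathcal W(a)\setminus\mathcal W(a,T)}|D_xF_W|^sf(F_Wx),$$ $$A_\infty f(x)=\sum_{W\in\mathcal W(a)}\ln|D_xF_W|\cdot|D_xF_W|\,f(F_Wx).$$ The *leading eigenvalue* $\lambda(s,T)>0$ of $L_{(s,T)}$ is a simple eigenvalue with a strictly positive eigenfunction $g_{(s,T)}$, all other eigenvalues having strictly smaller modulus. **Statement.**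 (a) These series define bounded operators on $\mathcal B$: $L_{(s,T)}$ for $0<T\le\infty$ and $s>1/2$, or $T<\infty$ and $s\ge0$; $\Delta_{(s,T)}$ for $0<T<\infty$ and $s>1/2$; and $A_\infty$. Moreover $\lambda(1,\infty)=1$, and there is $\epsilon_0>0$ such that the spectrum of $L_{(1,\infty)}$ is contained in $\{1\}\cup B(0,1-2\epsilon_0)$. For any such $\epsilon_0$ there are $\eta>0$, $T_0>0$ and $C$ such that the following holds. (b) If $|s-1|\le\eta$ and $T_0\le T\le\infty$, then $L_{(s,T)}$ has a leading eigenvalue $\lambda(s,T)$, $|\lambda(s,T)-1|<\epsilon_0$, and the circle $|z-1|=\epsilon_0$ is in the resolvent set of $L_{(s,T)}$; so $P_{(s,T)}=\frac{-1}{2\pi i}\oint_{|z-1|=\epsilon_0}(L_{(s,T)}-z)^{-1}dz$ is defined. (c) Let $\delta$ be the component of $A_\infty g_{(1,\infty)}$ along $g_{(1,\infty)}$, that is $A_\infty g_{(1,\infty)}-\delta\, g_{(1,\infty)}\in\ker P_{(1,\infty)}$. Then $\delta$ is real, $\delta<0$, and $$|\lambda(s,\infty)-(1+\delta(s-1))|\le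 C|s-1|^2\qquad\text{for }|s-1|\le\eta.$$ (d) For every $T_0\le T<\infty$ there is exactly one $s_T\in[0,1]$ with $\lambda(s_T,T)=1$; it satisfies $s_T>9/10$ and $|s_T-1|\le\eta$. Let $\beta_T$ be the component of $\Delta_{(s_T,T)}g_{(s_T,\infty)}$ along $g_{(s_T,\infty)}$, that is $\Delta_{(s_T,T)}g_{(s_T,\infty)}-\beta_T\,g_{(s_T,\infty)}\in\ker P_{(s_T,\infty)}$. Then $\beta_T$ is real and $$\big|\lambda(s_T,T)-\big(\lambda(s_T,\infty)-\beta_T\big)\big|\le C\,T^{-(2s_T-1)}\big(|s_T-1|+T^{-(2s_T-1)}\big).$$ -/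

import Mathlib

open scoped MatrixGroups UpperHalfPlane

noncomputable section

namespace BowenSeries

/-! ### Fuchsian groups and non-uniform lattices -/

/-- The Dirichlet region centred at `w` of a subgroup of `SL(2, ℝ)` acting on the upper half
plane. -/
def dirichletRegion (Γ : Subgroup SL(2, ℝ)) (w : ℍ) : Set ℍ :=
  {z | ∀ G ∈ Γ, dist z w ≤ dist z (G • w)}

/-- A non-uniform lattice: a discrete subgroup of `SL(2, ℝ)` having a Dirichlet region (centred at a
point fixed only by the elements that act trivially) which has finite hyperbolic area and is not
compact. The measure on `ℍ` is the hyperbolic area `dx dy / y ^ 2`. -/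
def IsNonuniformLattice (Γ : Subgroup SL(2, ℝ)) : Prop :=
  DiscreteTopology Γ ∧
    ∃ w : ℍ, (∀ G ∈ Γ, G • w = w → ∀ z : ℍ, G • z = z) ∧
      MeasureTheory.volume (dirichletRegion Γ w) < ⊤ ∧ ¬ IsCompact (dirichletRegion Γ w)

/-- The point `G · ∞` of `ℝ ∪ {∞}`. -/
def atInfinity (G : SL(2, ℝ)) : OnePoint ℝ :=
  (Matrix.SpecialLinearGroup.toGL G) • (OnePoint.infty : OnePoint ℝ)

/-- `z_k = A_k · ∞`, `k = 1, …, p`, is a complete set of inequivalent parabolic fixed points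
of `Γ`. -/
def IsCuspRepresentatives (Γ : Subgroup SL(2, ℝ)) {p : ℕ} (A : Fin p → SL(2, ℝ)) : Prop :=
  (∀ c : OnePoint ℝ, IsCusp c (Γ.map Matrix.SpecialLinearGroup.toGL) ↔
      ∃ k, ∃ B ∈ Γ, c = atInfinity (B * A k)) ∧
    ∀ j k, ∀ B ∈ Γ, atInfinity (B * A j) = atInfinity (A k) → j = k

/-! ### The unit disc model -/

/-- The inverse of the map `φ z = (z - i) / (z + i)` from the upper half plane to the unit disc. -/
def cayleyInv (z : ℂ) : ℂ := Complex.I * (1 + z) / (1 - z)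

/-- The extension of `φ` to the boundary `ℝ ∪ {∞}`. -/
def cayleyBoundary (c : OnePoint ℝ) : ℂ :=
  OnePoint.elim c 1 (fun x : ℝ => ((x : ℂ) - Complex.I) / (x + Complex.I))

/-- The coefficient `α` of the matrix `(α, conj β; β, conj α)` of `SU(1, 1)` which is conjugate to
`G` under `φ`. -/
def coeffAlpha (G : SL(2, ℝ)) : ℂ :=
  (((G 0 0 + G 1 1 : ℝ) : ℂ) + ((G 0 1 - G 1 0 : ℝ) : ℂ) * Complex.I) / 2

/-- The coefficient `β` of the matrix `(α, conj β; β, conj α)` of `SU(1, 1)` which is conjugate to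
`G` under `φ`. -/
def coeffBeta (G : SL(2, ℝ)) : ℂ :=
  (((G 0 0 - G 1 1 : ℝ) : ℂ) + ((G 0 1 + G 1 0 : ℝ) : ℂ) * Complex.I) / 2

/-- The denominator `β z + conj α`. -/
def den (G : SL(2, ℝ)) (z : ℂ) : ℂ := coeffBeta G * z + starRingEnd ℂ (coeffAlpha G)

/-- The action `F z = (α z + conj β) / (β z + conj α)` of `F = φ ∘ G ∘ φ⁻¹`. -/
def discMap (G : SL(2, ℝ)) (z : ℂ) : ℂ :=
  (coeffAlpha G * z + starRingEnd ℂ (coeffBeta G)) / den G z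

/-- The modulus `|D_z F| = 1 / |β z + conj α| ^ 2` of the derivative of `F = φ ∘ G ∘ φ⁻¹`. -/
def derivNorm (G : SL(2, ℝ)) (z : ℂ) : ℝ := (‖den G z‖ ^ 2)⁻¹

/-- The interior `U_F = {|z - ω| < 1 / |β|}` of the isometric circle of `F`, where `ω = - conj α / β`
is the pole of `F` (empty if `β = 0`). -/
def isomDisc (G : SL(2, ℝ)) : Set ℂ := {z | ‖den G z‖ < 1}

/-- The intersection of the isometric circle of `F` with the open unit disc. -/
def isomGeodesic (G : SL(2, ℝ)) : Set ℂ := {z | ‖z‖ < 1 ∧ ‖den G z‖ = 1}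

lemma norm_num_eq_norm_den (G : SL(2, ℝ)) (ξ : Circle) :
    ‖coeffAlpha G * ξ + starRingEnd ℂ (coeffBeta G)‖ = ‖den G ξ‖ := by
  have h1 : (ξ : ℂ) * starRingEnd ℂ (ξ : ℂ) = 1 := by
    rw [Complex.mul_conj, Complex.normSq_eq_norm_sq, Circle.norm_coe]; norm_num
  have h2 : coeffAlpha G * ξ + starRingEnd ℂ (coeffBeta G)
      = ξ * starRingEnd ℂ (den G ξ) := by
    simp only [den, map_add, map_mul, Complex.conj_conj]
    linear_combination (-(starRingEnd ℂ (coeffBeta G))) * h1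
  rw [h2, norm_mul, Circle.norm_coe, one_mul]; simp

lemma det_coeff (G : SL(2, ℝ)) :
    coeffAlpha G * starRingEnd ℂ (coeffAlpha G) - coeffBeta G * starRingEnd ℂ (coeffBeta G) = 1 := by
  have h : G 0 0 * G 1 1 - G 0 1 * G 1 0 = 1 := by
    have := G.det_coe
    rwa [Matrix.det_fin_two] at this
  have hI := Complex.I_sq
  have h' : (G 0 0 : ℂ) * G 1 1 - G 0 1 * G 1 0 = 1 := by exact_mod_cast h
  simp only [coeffAlpha, coeffBeta, map_div₀, map_add, map_sub, map_mul, Complex.conj_ofReal,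
    Complex.conj_I, map_ofNat, Complex.ofReal_add, Complex.ofReal_sub]
  linear_combination h' + (G 0 1 * G 1 0 : ℂ) * hI

lemma den_ne_zero (G : SL(2, ℝ)) (ξ : Circle) : den G ξ ≠ 0 := by
  intro h0
  have h1 := norm_num_eq_norm_den G ξ
  rw [h0, norm_zero, norm_eq_zero] at h1
  have h2 := det_coeff G
  have h3 : coeffBeta G * (ξ : ℂ) + starRingEnd ℂ (coeffAlpha G) = 0 := h0
  have : (1 : ℂ) = 0 := by
    rw [← h2]
    linear_combination coeffAlpha G * h3 - coeffBeta G * h1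
  exact one_ne_zero this

/-- The action of `F = φ ∘ G ∘ φ⁻¹` on the unit circle. -/
def circleMap (G : SL(2, ℝ)) (ξ : Circle) : Circle :=
  ⟨discMap G ξ, by
    change discMap G ξ ∈ Metric.sphere (0 : ℂ) 1
    rw [mem_sphere_zero_iff_norm, discMap, norm_div, norm_num_eq_norm_den]
    exact div_self (norm_ne_zero_iff.2 (den_ne_zero G ξ))⟩

/-! ### Labelled ideal polygons -/

/-- The labelled ideal polygon of a subgroup `Γ₀`, whose sides `s_a`, `a ∈ 𝒜`, lie on isometric
circles.

Arcs of the unit circle are parametrized clockwise by `t ↦ exp (-i t)`; the arc `[a]` is the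
right-open arc with end points `ξ_a^L = exp (-i (lo a))` and `ξ_a^R = exp (-i (hi a))` cut by the
side `s_a`. -/
structure LabelledIdealPolygon (Γ₀ : Subgroup SL(2, ℝ)) (𝒜 : Type*) where
  /-- the involution `a ↦ â` -/
  hat : 𝒜 → 𝒜
  hat_hat : ∀ a, hat (hat a) = a
  hat_ne : ∀ a, hat a ≠ a
  /-- the side pairings, with `F_a (s_â) = s_a` -/
  F : 𝒜 → SL(2, ℝ)
  F_mem : ∀ a, F a ∈ Γ₀
  F_hat : ∀ a, F (hat a) = (F a)⁻¹
  lo : 𝒜 → ℝ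
  hi : 𝒜 → ℝ
  lo_lt_hi : ∀ a, lo a < hi a
  /-- `s_a` lies on the isometric circle of `F_â`, and cuts the arc from `ξ_a^L` to `ξ_a^R` -/
  arc_interior : ∀ a, {ξ : Circle | (ξ : ℂ) ∈ isomDisc (F (hat a))} =
    (fun t : ℝ => Circle.exp (-t)) '' Set.Ioo (lo a) (hi a)
  /-- the arcs cut by the sides tile the unit circle: all vertices lie on the circle -/
  partition : ∀ ξ : Circle, ∃! a, ξ ∈ (fun t : ℝ => Circle.exp (-t)) '' Set.Ico (lo a) (hi a)
  /-- the polygon bounded by the sides `s_a` is the closure of the exterior, in the unit disc, of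
  all isometric circles of `Γ₀`, that is the Dirichlet region of `Γ₀` centred at the origin -/
  region : closure (Metric.ball (0 : ℂ) 1 \ ⋃ G ∈ Γ₀, isomDisc G) =
    closure (Metric.ball (0 : ℂ) 1 \ ⋃ a, isomDisc (F a))

namespace LabelledIdealPolygon

variable {Γ₀ : Subgroup SL(2, ℝ)} {𝒜 : Type*} (Ω : LabelledIdealPolygon Γ₀ 𝒜)

/-- The right-open arc `[a]`. -/
def arc (a : 𝒜) : Set Circle := (fun t : ℝ => Circle.exp (-t)) '' Set.Ico (Ω.lo a) (Ω.hi a)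

/-- The left end point `ξ_a^L` of `[a]`. -/
def xiL (a : 𝒜) : Circle := Circle.exp (-(Ω.lo a))

/-- The right end point `ξ_a^R` of `[a]`. -/
def xiR (a : 𝒜) : Circle := Circle.exp (-(Ω.hi a))

/-- The side `s_a`. -/
def side (a : 𝒜) : Set ℂ := isomGeodesic (Ω.F (Ω.hat a))

/-- `o b = o a + 1` for the cyclic order `o` of the letters. -/
def Next (a b : 𝒜) : Prop := Ω.xiR a = Ω.xiL b

/-! ### Cuspidal words -/

/-- The no backtracking condition for a word `(a_0, …, a_n)`. -/
def Admissible (W : List 𝒜) : Prop := W.IsChain (fun a b => b ≠ Ω.hat a)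

/-- `F_W = F_{a_0} ∘ ⋯ ∘ F_{a_n}` for `W = (a_0, …, a_n)`. -/
def word (W : List 𝒜) : SL(2, ℝ) := (W.map Ω.F).prod

/-- A non-empty word is cuspidal if it is an initial factor of an admissible word `V` such that
`F_V` is a parabolic element fixing a vertex of the polygon. -/
def IsCuspidal (W : List 𝒜) : Prop :=
  W ≠ [] ∧ ∃ V, W <+: V ∧ Ω.Admissible V ∧
    (Matrix.SpecialLinearGroup.toGL (Ω.word V)).IsParabolic ∧
    ∃ a, circleMap (Ω.word V) (Ω.xiL a) = Ω.xiL a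

/-- Right type: at least two letters, and `o (a_{k+1}) = o (â_k) - 1` for any `k`. -/
def IsRight (W : List 𝒜) : Prop :=
  2 ≤ W.length ∧ W.IsChain (fun a b => Ω.Next b (Ω.hat a))

/-- Left type: at least two letters, and `o (a_{k+1}) = o (â_k) + 1` for any `k`. -/
def IsLeft (W : List 𝒜) : Prop :=
  2 ≤ W.length ∧ W.IsChain (fun a b => Ω.Next (Ω.hat a) b)

/-- The transition from the cuspidal word `W = (b_0, …, b_m)` to a cuspidal word with first letter
`a` is allowed, that is `[a]` is contained in the domain of `W`. -/
def Allowed (W : List 𝒜) (a : 𝒜) : Prop :=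
  ∃ b, W.getLast? = some b ∧ a ≠ Ω.hat b ∧
    (W.length = 1 → ¬ Ω.Next (Ω.hat b) a ∧ ¬ Ω.Next a (Ω.hat b)) ∧
    (Ω.IsLeft W → ¬ Ω.Next (Ω.hat b) a) ∧
    (Ω.IsRight W → ¬ Ω.Next a (Ω.hat b))

/-- The set `𝒲(a)`. -/
def words (a : 𝒜) : Set (List 𝒜) := {W | Ω.IsCuspidal W ∧ Ω.Allowed W a}

/-! ### Geometric length -/

/-- The real part of `G⁻¹ (φ⁻¹ z)`. -/
def cuspCoord (G : SL(2, ℝ)) (z : ℂ) : ℝ :=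
  (((G⁻¹ 0 0 : ℝ) * cayleyInv z + (G⁻¹ 0 1 : ℝ)) /
    ((G⁻¹ 1 0 : ℝ) * cayleyInv z + (G⁻¹ 1 1 : ℝ))).re

/-- The distance `|Re (A_k⁻¹ B⁻¹ φ⁻¹ s) - Re (A_k⁻¹ B⁻¹ φ⁻¹ s')|` for two geodesics `s`, `s'` with
common end point `ξ`, where `B ∈ Γ` and `k` are such that `ξ = φ (B A_k · ∞)`. For geodesics `s`, `s'`
as above the set is a singleton, because `A_k⁻¹ B⁻¹ φ⁻¹` maps them to vertical half lines. -/
def cuspDist (Γ : Subgroup SL(2, ℝ)) {p : ℕ} (A : Fin p → SL(2, ℝ)) (s s' : Set ℂ) (ξ : Circle) :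
    ℝ :=
  sSup {r | ∃ B ∈ Γ, ∃ k, cayleyBoundary (atInfinity (B * A k)) = (ξ : ℂ) ∧
    ∃ z ∈ s, ∃ z' ∈ s', r = |cuspCoord (B * A k) z - cuspCoord (B * A k) z'|}

open Classical in
/-- The vertex `ξ_W` of a word with first letter `a`. -/
def vertex (W : List 𝒜) (a : 𝒜) : Circle := if Ω.IsLeft W then Ω.xiL a else Ω.xiR a

/-- The geometric length `|W|` of a cuspidal word `W = (a_0, …, a_n)`: the distance of the geodesics
`s_{a_0}` and `F_{a_0, …, a_{n-1}} (s_{a_n})` at their common end point `ξ_W` if `n ≥ 1`, and `0` if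
`n = 0`. -/
def length (Γ : Subgroup SL(2, ℝ)) {p : ℕ} (A : Fin p → SL(2, ℝ)) : List 𝒜 → ℝ
  | [] => 0
  | [_] => 0
  | a :: b :: V =>
    cuspDist Γ A (Ω.side a)
      (discMap (Ω.word (a :: b :: V).dropLast) '' Ω.side ((b :: V).getLast (List.cons_ne_nil b V)))
      (Ω.vertex (a :: b :: V) a)

/-- The set `𝒲(a, T)`, for `0 < T ≤ ∞`. -/
def wordsLE (Γ : Subgroup SL(2, ℝ)) {p : ℕ} (A : Fin p → SL(2, ℝ)) (T : EReal) (a : 𝒜) :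
    Set (List 𝒜) :=
  {W | W ∈ Ω.words a ∧ (Ω.length Γ A W : EReal) ≤ T}

/-- The set `𝒱(a, T) = 𝒲(a) \ 𝒲(a, T)`. -/
def wordsGT (Γ : Subgroup SL(2, ℝ)) {p : ℕ} (A : Fin p → SL(2, ℝ)) (T : EReal) (a : 𝒜) :
    Set (List 𝒜) :=
  Ω.words a \ Ω.wordsLE Γ A T a

/-! ### The Banach space of piecewise Lipschitz functions -/

/-- Functions on the circle which are Lipschitz on every arc `[a]`. -/
def plSubmodule : Submodule ℂ (Circle → ℂ) where
  carrier := {f | ∀ a, ∃ K, LipschitzOnWith K f (Ω.arc a)}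
  add_mem' := fun {f g} hf hg a => by
    obtain ⟨K, hK⟩ := hf a
    obtain ⟨K', hK'⟩ := hg a
    exact ⟨K + K', hK.add hK'⟩
  zero_mem' := fun a => ⟨0, LipschitzOnWith.of_dist_le_mul (by simp)⟩
  smul_mem' := fun c f hf a => by
    obtain ⟨K, hK⟩ := hf a
    refine ⟨‖c‖₊ * K, LipschitzOnWith.of_dist_le_mul fun x hx y hy => ?_⟩
    have := hK.dist_le_mul x hx y hy
    simp only [Pi.smul_apply, dist_smul₀, NNReal.coe_mul, coe_nnnorm, mul_assoc]
    gcongr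

/-- The space `ℬ` of functions on the circle which are Lipschitz on every arc `[a]`. -/
def PLip : Type := ↥Ω.plSubmodule

instance : AddCommGroup Ω.PLip := inferInstanceAs (AddCommGroup Ω.plSubmodule)
instance : Module ℂ Ω.PLip := inferInstanceAs (Module ℂ Ω.plSubmodule)
instance : CoeFun Ω.PLip (fun _ => Circle → ℂ) := ⟨fun f => f.1⟩

variable {Ω}

lemma coe_add (f g : Ω.PLip) (x : Circle) : (f + g) x = f x + g x := rfl
lemma coe_sub (f g : Ω.PLip) (x : Circle) : (f - g) x = f x - g x := rfl
lemma coe_neg (f : Ω.PLip) (x : Circle) : (-f) x = - f x := rfl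
lemma coe_zero (x : Circle) : (0 : Ω.PLip) x = 0 := rfl
lemma coe_smul (c : ℂ) (f : Ω.PLip) (x : Circle) : (c • f) x = c * f x := rfl

variable (Ω) in
/-- Pairs of points in a common arc `[a]`. -/
def Pairs : Type := {q : Circle × Circle // ∃ a, q.1 ∈ Ω.arc a ∧ q.2 ∈ Ω.arc a}

/-- The sup norm. -/
def supNorm (f : Ω.PLip) : ℝ := ⨆ ξ : Circle, ‖f ξ‖

/-- The Lipschitz constant: the maximum over `a` of the supremum of the difference quotients of `f`
on `[a]`. -/
def lipConst (f : Ω.PLip) : ℝ :=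
  ⨆ q : Pairs Ω, dist (f q.1.1) (f q.1.2) / dist q.1.1 q.1.2

lemma exists_mem_arc (ξ : Circle) : ∃ a, ξ ∈ Ω.arc a := (Ω.partition ξ).exists

instance : Nonempty (Pairs Ω) :=
  ⟨⟨(1, 1), by obtain ⟨a, ha⟩ := exists_mem_arc (Ω := Ω) 1; exact ⟨a, ha, ha⟩⟩⟩

lemma supNorm_le {f : Ω.PLip} {M : ℝ} (h : ∀ ξ, ‖f ξ‖ ≤ M) : supNorm f ≤ M := ciSup_le h

lemma lipConst_le {f : Ω.PLip} {K : ℝ} (hK : 0 ≤ K)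
    (h : ∀ a, ∀ x ∈ Ω.arc a, ∀ y ∈ Ω.arc a, dist (f x) (f y) ≤ K * dist x y) : lipConst f ≤ K :=
  ciSup_le fun ⟨_, a, h1, h2⟩ => div_le_of_le_mul₀ dist_nonneg hK (h a _ h1 _ h2)

lemma supNorm_nonneg (f : Ω.PLip) : 0 ≤ supNorm f := Real.iSup_nonneg fun _ => norm_nonneg _

lemma lipConst_nonneg (f : Ω.PLip) : 0 ≤ lipConst f :=
  Real.iSup_nonneg fun _ => div_nonneg dist_nonneg dist_nonneg

variable [Finite 𝒜]

lemma exists_lip (f : Ω.PLip) : ∃ K : ℝ, 0 ≤ K ∧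
    ∀ a, ∀ x ∈ Ω.arc a, ∀ y ∈ Ω.arc a, dist (f x) (f y) ≤ K * dist x y := by
  choose K hK using f.2
  obtain ⟨M, hM⟩ := Set.finite_range K |>.bddAbove
  refine ⟨M, M.2, fun a x hx y hy => ((hK a).dist_le_mul x hx y hy).trans ?_⟩
  have : K a ≤ M := hM ⟨a, rfl⟩
  gcongr

lemma bddAbove_sup (f : Ω.PLip) : BddAbove (Set.range fun ξ : Circle => ‖f ξ‖) := by
  obtain ⟨K, hK0, hK⟩ := exists_lip f
  have hb : ∀ a, ∃ M : ℝ, ∀ x ∈ Ω.arc a, ‖f x‖ ≤ M := by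
    intro a
    have h0 : Circle.exp (-(Ω.lo a)) ∈ Ω.arc a :=
      ⟨Ω.lo a, Set.left_mem_Ico.2 (Ω.lo_lt_hi a), rfl⟩
    refine ⟨‖f (Circle.exp (-(Ω.lo a)))‖ + K * 2, fun x hx => ?_⟩
    have h1 := hK a x hx _ h0
    have h2 : dist x (Circle.exp (-(Ω.lo a))) ≤ 2 := by
      change dist (x : ℂ) (Circle.exp (-(Ω.lo a)) : ℂ) ≤ 2
      rw [dist_eq_norm]
      refine (norm_sub_le _ _).trans ?_
      simp only [Circle.norm_coe]; norm_num
    have h3 : ‖f x‖ ≤ ‖f (Circle.exp (-(Ω.lo a)))‖ + dist (f x) (f (Circle.exp (-(Ω.lo a)))) := by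
      rw [dist_eq_norm]
      have := norm_add_le (f (Circle.exp (-(Ω.lo a)))) (f x - f (Circle.exp (-(Ω.lo a))))
      simpa using this
    have h4 : K * dist x (Circle.exp (-(Ω.lo a))) ≤ K * 2 := by gcongr
    linarith
  choose M hM using hb
  obtain ⟨B, hB⟩ := Set.finite_range M |>.bddAbove
  refine ⟨B, ?_⟩
  rintro _ ⟨ξ, rfl⟩
  obtain ⟨a, ha⟩ := exists_mem_arc (Ω := Ω) ξ
  exact (hM a ξ ha).trans (hB ⟨a, rfl⟩)

lemma bddAbove_lip (f : Ω.PLip) :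
    BddAbove (Set.range fun q : Pairs Ω => dist (f q.1.1) (f q.1.2) / dist q.1.1 q.1.2) := by
  obtain ⟨K, hK0, hK⟩ := exists_lip f
  refine ⟨K, ?_⟩
  rintro _ ⟨⟨q, a, h1, h2⟩, rfl⟩
  exact div_le_of_le_mul₀ dist_nonneg hK0 (hK a _ h1 _ h2)

lemma norm_apply_le (f : Ω.PLip) (ξ : Circle) : ‖f ξ‖ ≤ supNorm f := le_ciSup (bddAbove_sup f) ξ

lemma dist_apply_le (f : Ω.PLip) {a : 𝒜} {x y : Circle} (hx : x ∈ Ω.arc a) (hy : y ∈ Ω.arc a) :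
    dist (f x) (f y) ≤ lipConst f * dist x y := by
  rcases eq_or_ne x y with rfl | h
  · simp
  · rw [← div_le_iff₀ (dist_pos.2 h)]
    exact le_ciSup (bddAbove_lip f) (⟨(x, y), a, hx, hy⟩ : Pairs Ω)

/-- The norm `‖f‖_* = ‖f‖_∞ + Lip f`. -/
instance : NormedAddCommGroup Ω.PLip :=
  AddGroupNorm.toNormedAddCommGroup
    { toFun := fun f => supNorm f + lipConst f
      map_zero' := by
        have h1 : supNorm (0 : Ω.PLip) ≤ 0 := supNorm_le fun ξ => by simp [coe_zero]
        have h2 : lipConst (0 : Ω.PLip) ≤ 0 := lipConst_le le_rfl fun a x _ y _ => by simp [coe_zero]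
        linarith [supNorm_nonneg (0 : Ω.PLip), lipConst_nonneg (0 : Ω.PLip)]
      add_le' := fun f g => by
        have h1 : supNorm (f + g) ≤ supNorm f + supNorm g := supNorm_le fun ξ => by
          rw [coe_add]
          exact (norm_add_le _ _).trans (add_le_add (norm_apply_le f ξ) (norm_apply_le g ξ))
        have h2 : lipConst (f + g) ≤ lipConst f + lipConst g :=
          lipConst_le (add_nonneg (lipConst_nonneg f) (lipConst_nonneg g)) fun a x hx y hy => by
            rw [coe_add, coe_add, add_mul]
            exact (dist_add_add_le _ _ _ _).trans
              (add_le_add (dist_apply_le f hx hy) (dist_apply_le g hx hy))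
        linarith
      neg' := fun f => by
        have h1 : supNorm (-f) = supNorm f := by simp [supNorm, coe_neg]
        have h2 : lipConst (-f) = lipConst f := by simp [lipConst, coe_neg, dist_neg_neg]
        rw [h1, h2]
      eq_zero_of_map_eq_zero' := fun f hf => by
        have h1 : supNorm f = 0 := by linarith [supNorm_nonneg f, lipConst_nonneg f]
        refine Subtype.ext (funext fun ξ => ?_)
        exact norm_le_zero_iff.1 (h1 ▸ norm_apply_le f ξ) }

lemma norm_def (f : Ω.PLip) : ‖f‖ = supNorm f + lipConst f := rfl

instance : NormedSpace ℂ Ω.PLip where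
  norm_smul_le c f := by
    have h1 : supNorm (c • f) ≤ ‖c‖ * supNorm f := supNorm_le fun ξ => by
      rw [coe_smul, norm_mul]
      exact mul_le_mul_of_nonneg_left (norm_apply_le f ξ) (norm_nonneg c)
    have h2 : lipConst (c • f) ≤ ‖c‖ * lipConst f :=
      lipConst_le (mul_nonneg (norm_nonneg c) (lipConst_nonneg f)) fun a x hx y hy => by
        rw [coe_smul, coe_smul, dist_eq_norm, ← mul_sub, norm_mul, mul_assoc, ← dist_eq_norm]
        exact mul_le_mul_of_nonneg_left (dist_apply_le f hx hy) (norm_nonneg c)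
    rw [norm_def, norm_def, mul_add]
    linarith

instance : CompleteSpace Ω.PLip := by
  refine Metric.complete_of_cauchySeq_tendsto fun u hu => ?_
  have hpt : ∀ ξ, CauchySeq fun n => u n ξ := fun ξ => by
    rw [Metric.cauchySeq_iff] at hu ⊢
    intro ε hε
    obtain ⟨N, hN⟩ := hu ε hε
    refine ⟨N, fun m hm n hn => lt_of_le_of_lt ?_ (hN m hm n hn)⟩
    rw [dist_eq_norm, dist_eq_norm, norm_def, ← coe_sub]
    linarith [norm_apply_le (u m - u n) ξ, lipConst_nonneg (u m - u n)]
  choose f hf using fun ξ => cauchySeq_tendsto_of_complete (hpt ξ)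
  have key : ∀ ε > 0, ∃ N, ∀ n ≥ N, (∀ ξ, ‖u n ξ - f ξ‖ ≤ ε) ∧
      ∀ a, ∀ x ∈ Ω.arc a, ∀ y ∈ Ω.arc a,
        ‖(u n x - f x) - (u n y - f y)‖ ≤ ε * dist x y := by
    intro ε hε
    rw [Metric.cauchySeq_iff] at hu
    obtain ⟨N, hN⟩ := hu ε hε
    refine ⟨N, fun n hn => ⟨fun ξ => ?_, fun a x hx y hy => ?_⟩⟩
    · refine le_of_tendsto ((tendsto_const_nhds.sub (hf ξ)).norm) ?_
      filter_upwards [Filter.eventually_ge_atTop N] with m hm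
      have h := hN n hn m hm
      rw [dist_eq_norm, norm_def] at h
      have h' := norm_apply_le (u n - u m) ξ
      rw [coe_sub] at h'
      linarith [lipConst_nonneg (u n - u m)]
    · refine le_of_tendsto (((tendsto_const_nhds.sub (hf x)).sub
        (tendsto_const_nhds.sub (hf y))).norm) ?_
      filter_upwards [Filter.eventually_ge_atTop N] with m hm
      have h := hN n hn m hm
      rw [dist_eq_norm, norm_def] at h
      have h' := dist_apply_le (u n - u m) hx hy
      rw [coe_sub, coe_sub, dist_eq_norm] at h'
      refine h'.trans (mul_le_mul_of_nonneg_right ?_ dist_nonneg)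
      linarith [supNorm_nonneg (u n - u m)]
  have hmem : f ∈ Ω.plSubmodule := by
    obtain ⟨N, hN⟩ := key 1 one_pos
    intro a
    refine ⟨⟨lipConst (u N) + 1, add_nonneg (lipConst_nonneg _) zero_le_one⟩,
      LipschitzOnWith.of_dist_le_mul fun x hx y hy => ?_⟩
    have h1 := (hN N le_rfl).2 a x hx y hy
    have h2 := dist_apply_le (u N) hx hy
    rw [dist_eq_norm] at h2 ⊢
    have h3 := norm_sub_le (u N x - u N y) ((u N x - f x) - (u N y - f y))
    have h4 : u N x - u N y - ((u N x - f x) - (u N y - f y)) = f x - f y := by ring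
    rw [h4] at h3
    change ‖f x - f y‖ ≤ (lipConst (u N) + 1) * dist x y
    linarith
  let F : Ω.PLip := ⟨f, hmem⟩
  refine ⟨F, Metric.tendsto_atTop.2 fun ε hε => ?_⟩
  obtain ⟨N, hN⟩ := key (ε / 3) (by positivity)
  refine ⟨N, fun n hn => ?_⟩
  rw [dist_eq_norm, norm_def]
  have h1 : supNorm (u n - F) ≤ ε / 3 := supNorm_le fun ξ => (hN n hn).1 ξ
  have h2 : lipConst (u n - F) ≤ ε / 3 := lipConst_le (by positivity) fun a x hx y hy => by
    rw [dist_eq_norm]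
    exact (hN n hn).2 a x hx y hy
  linarith

/-! ### Transfer operators -/

/-- `L` is the operator `L f ξ = ∑_{W ∈ 𝒱(a)} w(|D_ξ F_W|) f(F_W ξ)`, for `ξ ∈ [a]`. -/
def IsWeightedOp (𝒱 : 𝒜 → Set (List 𝒜)) (w : ℝ → ℝ) (L : Ω.PLip →L[ℂ] Ω.PLip) : Prop :=
  ∀ (f : Ω.PLip) (a : 𝒜), ∀ ξ ∈ Ω.arc a,
    HasSum (fun W : 𝒱 a =>
      (w (derivNorm (Ω.word (W : List 𝒜)) ξ) : ℂ) * f (circleMap (Ω.word (W : List 𝒜)) ξ)) (L f ξ)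

variable (Ω)

open Classical in
/-- The bounded operator on `ℬ` characterized by `IsWeightedOp` (and `0` if there is none). -/
def weightedOp (𝒱 : 𝒜 → Set (List 𝒜)) (w : ℝ → ℝ) : Ω.PLip →L[ℂ] Ω.PLip :=
  if h : ∃ L : Ω.PLip →L[ℂ] Ω.PLip, IsWeightedOp 𝒱 w L then h.choose else 0

variable (Γ : Subgroup SL(2, ℝ)) {p : ℕ} (A : Fin p → SL(2, ℝ))

/-- The transfer operator `L_(s,T)`, for `0 < T ≤ ∞`. -/
def transferOp (s : ℝ) (T : EReal) : Ω.PLip →L[ℂ] Ω.PLip :=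
  Ω.weightedOp (Ω.wordsLE Γ A T) (fun x => x ^ s)

/-- The operator `Δ_(s,T)`. -/
def deltaOp (s : ℝ) (T : EReal) : Ω.PLip →L[ℂ] Ω.PLip :=
  Ω.weightedOp (Ω.wordsGT Γ A T) (fun x => x ^ s)

/-- The operator `A_∞`, with weights `ln |D_ξ F_W| · |D_ξ F_W|`. -/
def derivativeOp : Ω.PLip →L[ℂ] Ω.PLip :=
  Ω.weightedOp Ω.words (fun x => Real.log x * x)

/-! ### Leading eigenvalue and spectral projector -/

variable {Ω}

/-- `lam > 0` is an (algebraically) simple eigenvalue of `L` with strictly positive eigenfunction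
`g`, and any other eigenvalue has strictly smaller modulus. -/
def IsLeadingPair (L : Ω.PLip →L[ℂ] Ω.PLip) (lam : ℝ) (g : Ω.PLip) : Prop :=
  0 < lam ∧ (∀ ξ, 0 < (g ξ).re ∧ (g ξ).im = 0) ∧ L g = (lam : ℂ) • g ∧
    Module.finrank ℂ (Module.End.maxGenEigenspace (L : Ω.PLip →ₗ[ℂ] Ω.PLip) (lam : ℂ)) = 1 ∧
    ∀ z : ℂ, Module.End.HasEigenvalue (L : Ω.PLip →ₗ[ℂ] Ω.PLip) z → z ≠ lam → ‖z‖ < lam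

open Classical in
/-- The leading eigenvalue of `L` (and `0` if there is none). -/
def leadingEigenvalue (L : Ω.PLip →L[ℂ] Ω.PLip) : ℝ :=
  if h : ∃ lam : ℝ, ∃ g : Ω.PLip, IsLeadingPair L lam g then h.choose else 0

/-- The spectral projector `(-1 / 2πi) ∮ (L - z)⁻¹ dz` along the circle of centre `1` and
radius `ε`. -/
def spectralProjector (ε : ℝ) (L : Ω.PLip →L[ℂ] Ω.PLip) : Ω.PLip →L[ℂ] Ω.PLip :=
  (2 * Real.pi * Complex.I : ℂ)⁻¹ • ∮ z in C(1, ε), resolvent L z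

/-- `c` is the component of `f` along `g` in the decomposition `ℬ = ker P ⊕ ker (1 - P)`, where `g`
spans `ker (1 - P)`. -/
def IsComponent (P : Ω.PLip →L[ℂ] Ω.PLip) (g f : Ω.PLip) (c : ℝ) : Prop :=
  ∃ u : Ω.PLip, P u = 0 ∧ f = (c : ℂ) • g + u

end LabelledIdealPolygon

end BowenSeries

end

open scoped MatrixGroups
open BowenSeries BowenSeries.LabelledIdealPolygon

open scoped MatrixGroups UpperHalfPlane

noncomputable section

namespace BowenSeries

open Complex MeasureTheory Set

/-! ### Möbius transformations of the disc -/

/-! A cuspidal word turns about one vertex of the polygon. Following a vertex through an admissible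
word (`word_vertex_cases`) shows that a cuspidal word is an orbit segment of a permutation `step` of
the alphabet, hence is determined by its type, its first letter and its number n of letters. In the
half plane coordinate with the vertex at infinity every letter is a translation by twice `ct`,
always in the same direction, so F_W is a translation by an amount comparable to n
(`sideWord_spec`). Therefore |D F_W| is comparable to n⁻² on the domain of W, with bounded
distortion (`exists_den_bounds`, `exists_tau_bounds`), and the geometric length is comparable to n
up to an additive constant (`exists_length_bounds`). As there are at most 2 card 𝒜 words for each n,
all series are compared with ∑ n^(-2s): they converge for s > 1/2, they have a second order
expansion in operator norm at s = 1 (`exists_norm_transferOp_expansion`), and the words of length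
greater than T contribute O(T^(-(2s-1))) (`exists_norm_deltaOp_le`).

At s = 1, T = ∞ the operator preserves the integral: F_b maps the complement of [b̂] onto [b], so
the integral can be transferred letter by letter, a word being split off as soon as it cannot be
prolonged to a longer cuspidal word; what is left after n letters tends to 0
(`integral_eq_of_isWeightedOp`). All branches contract uniformly, and any arc is mapped into any
other one by a single branch with at most four letters. Hence the operator improves a cone of
functions with Lipschitz logarithm, and at each step a fixed proportion of the integral can be
removed as a constant; these constants cancel in the difference of two functions with the same
integral, which decays geometrically (`exists_gap_of_isWeightedOp`). So 1 is a simple isolated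
eigenvalue, with a positive density g₀ as eigenvector and the integral as dual eigenvector.

The rest is perturbation theory. Operators near L_(1,∞) keep an eigenvalue, an eigenvector and a
dual eigenvector at distance O(‖L - L_(1,∞)‖) (`exists_spectralSplit`, `exists_leadingSplit`).
Pairing the eigenvalue equation of one operator with the dual eigenvector of another gives an exact
formula for the difference of the eigenvalues, from which both expansions follow
(`LeadingSplit.abs_sub_le_sq`, `LeadingSplit.abs_sub_add_le`). The slope δ is the integral of A_∞
g₀, negative because all derivatives are at most some θ < 1. Truncation gives λ(1,T) ≤ 1, the
negative slope gives λ(1-η,T) ≥ 1 for large T, and the intermediate value theorem yields s_T; it is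
unique because positive eigenfunctions for two exponents could be compared (`not_lt_of_fixed`). -/

lemma coeffAlpha_mul (G H : SL(2, ℝ)) : coeffAlpha (G * H) =
    coeffAlpha G * coeffAlpha H + starRingEnd ℂ (coeffBeta G) * coeffBeta H := by
  have hI := Complex.I_sq
  simp only [coeffAlpha, coeffBeta, Matrix.SpecialLinearGroup.coe_mul, Matrix.mul_apply,
    Fin.sum_univ_two, map_div₀, map_add, map_sub, map_mul, Complex.conj_ofReal, Complex.conj_I,
    map_ofNat, Complex.ofReal_add, Complex.ofReal_sub, Complex.ofReal_mul]
  linear_combination ((1 / 2 : ℂ) * ((G 0 1 : ℂ) * H 1 0 + (G 1 0 : ℂ) * H 0 1)) * hI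

lemma coeffBeta_mul (G H : SL(2, ℝ)) : coeffBeta (G * H) =
    coeffBeta G * coeffAlpha H + starRingEnd ℂ (coeffAlpha G) * coeffBeta H := by
  have hI := Complex.I_sq
  simp only [coeffAlpha, coeffBeta, Matrix.SpecialLinearGroup.coe_mul, Matrix.mul_apply,
    Fin.sum_univ_two, map_div₀, map_add, map_sub, map_mul, Complex.conj_ofReal, Complex.conj_I,
    map_ofNat, Complex.ofReal_add, Complex.ofReal_sub, Complex.ofReal_mul]
  linear_combination ((1 / 2 : ℂ) * ((G 0 1 : ℂ) * H 1 0 - (G 1 0 : ℂ) * H 0 1)) * hI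

lemma coeffAlpha_one : coeffAlpha 1 = 1 := by simp [coeffAlpha]

lemma coeffBeta_one : coeffBeta 1 = 0 := by simp [coeffBeta]

lemma norm_sq_coeff (G : SL(2, ℝ)) : ‖coeffAlpha G‖ ^ 2 - ‖coeffBeta G‖ ^ 2 = 1 := by
  have h := det_coeff G
  rw [Complex.mul_conj, Complex.mul_conj, Complex.normSq_eq_norm_sq, Complex.normSq_eq_norm_sq] at h
  exact_mod_cast h

lemma norm_coeffBeta_lt (G : SL(2, ℝ)) : ‖coeffBeta G‖ < ‖coeffAlpha G‖ := by
  have := norm_sq_coeff G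
  nlinarith [norm_nonneg (coeffAlpha G), norm_nonneg (coeffBeta G)]

lemma one_le_norm_coeffAlpha (G : SL(2, ℝ)) : 1 ≤ ‖coeffAlpha G‖ := by
  have := norm_sq_coeff G
  nlinarith [norm_nonneg (coeffAlpha G), norm_nonneg (coeffBeta G)]

lemma den_ne_zero_of_norm_le_one (G : SL(2, ℝ)) {z : ℂ} (hz : ‖z‖ ≤ 1) : den G z ≠ 0 := by
  intro h
  have h1 : starRingEnd ℂ (coeffAlpha G) = -(coeffBeta G * z) := by
    rw [den] at h; linear_combination h
  have h2 : ‖coeffAlpha G‖ = ‖coeffBeta G‖ * ‖z‖ := by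
    rw [← norm_mul, ← norm_neg (coeffBeta G * z), ← h1]; simp
  have := norm_coeffBeta_lt G
  nlinarith [norm_nonneg (coeffBeta G)]

lemma den_one (z : ℂ) : den 1 z = 1 := by simp [den, coeffAlpha_one, coeffBeta_one]

lemma discMap_one (z : ℂ) : discMap 1 z = z := by
  simp [discMap, den_one, coeffAlpha_one, coeffBeta_one]

/-- The cocycle identity of the automorphy factor, that is the chain rule; only the pole of H has to
be avoided. -/
lemma den_mul (G H : SL(2, ℝ)) {z : ℂ} (hz : den H z ≠ 0) :
    den (G * H) z = den G (discMap H z) * den H z := by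
  rw [den, discMap, coeffAlpha_mul, coeffBeta_mul]
  conv_rhs => rw [den, add_mul, mul_assoc, div_mul_cancel₀ _ hz]
  simp only [den, map_add, map_mul, Complex.conj_conj]
  ring

lemma discMap_mul (G H : SL(2, ℝ)) {z : ℂ} (hz : den H z ≠ 0) (hz' : den G (discMap H z) ≠ 0) :
    discMap (G * H) z = discMap G (discMap H z) := by
  rw [discMap, den_mul G H hz, div_eq_iff (mul_ne_zero hz' hz), discMap, ← mul_assoc,
    div_mul_cancel₀ _ hz', discMap, add_mul, mul_assoc, div_mul_cancel₀ _ hz, coeffAlpha_mul,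
    coeffBeta_mul]
  simp only [den, map_add, map_mul, Complex.conj_conj]
  ring

lemma discMap_sub (G : SL(2, ℝ)) {z w : ℂ} (hz : den G z ≠ 0) (hw : den G w ≠ 0) :
    discMap G z - discMap G w = (z - w) / (den G z * den G w) := by
  rw [discMap, discMap, div_sub_div _ _ hz hw]
  congr 1
  have := det_coeff G
  simp only [den]
  linear_combination (z - w) * this

lemma den_sub (G : SL(2, ℝ)) (z w : ℂ) : den G z - den G w = coeffBeta G * (z - w) := by
  simp only [den]; ring

lemma coe_circleMap (G : SL(2, ℝ)) (ξ : Circle) : (circleMap G ξ : ℂ) = discMap G ξ := rfl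

lemma circleMap_mul (G H : SL(2, ℝ)) (ξ : Circle) :
    circleMap (G * H) ξ = circleMap G (circleMap H ξ) := by
  refine Circle.ext ?_
  exact discMap_mul G H (den_ne_zero H ξ) (den_ne_zero G (circleMap H ξ))

lemma circleMap_one (ξ : Circle) : circleMap 1 ξ = ξ := Circle.ext (discMap_one _)

lemma circleMap_inv_apply (G : SL(2, ℝ)) (ξ : Circle) : circleMap G⁻¹ (circleMap G ξ) = ξ := by
  rw [← circleMap_mul, inv_mul_cancel, circleMap_one]

lemma circleMap_injective (G : SL(2, ℝ)) : Function.Injective (circleMap G) :=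
  Function.LeftInverse.injective (circleMap_inv_apply G)

lemma den_mul_circle (G H : SL(2, ℝ)) (ξ : Circle) :
    den (G * H) ξ = den G (circleMap H ξ) * den H ξ := den_mul G H (den_ne_zero H ξ)

lemma den_inv_circleMap (G : SL(2, ℝ)) (ξ : Circle) :
    den G⁻¹ (circleMap G ξ) * den G ξ = 1 := by
  rw [← den_mul_circle, inv_mul_cancel, den_one]

lemma derivNorm_mul (G H : SL(2, ℝ)) (ξ : Circle) :
    derivNorm (G * H) ξ = derivNorm G (circleMap H ξ) * derivNorm H ξ := by
  simp only [derivNorm, den_mul_circle, norm_mul, mul_pow, mul_inv]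

lemma derivNorm_pos (G : SL(2, ℝ)) (ξ : Circle) : 0 < derivNorm G ξ :=
  inv_pos.2 (pow_pos (norm_pos_iff.2 (den_ne_zero G ξ)) 2)

/-- Chords are scaled exactly by the geometric mean of the derivatives at their end points, so
bounds for `den` give contraction without a mean value argument. -/
lemma dist_circleMap (G : SL(2, ℝ)) (ξ ζ : Circle) :
    dist (circleMap G ξ) (circleMap G ζ) = dist ξ ζ / (‖den G ξ‖ * ‖den G ζ‖) := by
  change dist (discMap G ξ) (discMap G ζ) = dist (ξ : ℂ) ζ / _
  rw [dist_eq_norm, dist_eq_norm, discMap_sub G (den_ne_zero G ξ) (den_ne_zero G ζ), norm_div,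
    norm_mul]

lemma continuous_den (G : SL(2, ℝ)) : Continuous (den G) := by
  unfold den; fun_prop

lemma continuous_circle_coe : Continuous ((↑) : Circle → ℂ) := continuous_subtype_val

lemma continuous_derivNorm (G : SL(2, ℝ)) : Continuous fun ξ : Circle => derivNorm G ξ := by
  unfold derivNorm
  refine Continuous.inv₀ (((continuous_den G).comp continuous_circle_coe).norm.pow 2) fun ξ => ?_
  exact pow_ne_zero 2 (norm_ne_zero_iff.2 (den_ne_zero G ξ))

lemma continuous_circleMap (G : SL(2, ℝ)) : Continuous (circleMap G) := by
  refine Continuous.subtype_mk ?_ _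
  unfold discMap
  refine Continuous.div ?_ ((continuous_den G).comp continuous_circle_coe) fun ξ => den_ne_zero G ξ
  exact (continuous_const.mul continuous_circle_coe).add continuous_const

/-! ### The clockwise parametrization of the circle -/

/-- The clockwise parametrization of the circle. -/
def cw (t : ℝ) : Circle := Circle.exp (-t)

lemma coe_cw (t : ℝ) : (cw t : ℂ) = Complex.exp (-(t * I)) := by
  rw [cw, Circle.coe_exp]; push_cast; ring_nf

lemma continuous_cw : Continuous cw := Circle.exp.continuous.comp continuous_neg

lemma cw_add_two_pi (t : ℝ) : cw (t + 2 * Real.pi) = cw t := by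
  rw [cw, cw, neg_add', Circle.exp_sub_two_pi]

lemma cw_add_int (t : ℝ) (k : ℤ) : cw (t + k * (2 * Real.pi)) = cw t :=
  Circle.exp_eq_exp.2 ⟨-k, by push_cast; ring⟩

lemma cw_eq_cw {s t : ℝ} : cw s = cw t ↔ ∃ k : ℤ, s = t + k * (2 * Real.pi) := by
  rw [cw, cw, Circle.exp_eq_exp]
  constructor
  · rintro ⟨k, hk⟩; exact ⟨-k, by push_cast; linarith⟩
  · rintro ⟨k, hk⟩; exact ⟨-k, by push_cast; linarith⟩

lemma cw_injOn {s t : ℝ} (h : cw s = cw t) (h' : |s - t| < 2 * Real.pi) : s = t := by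
  obtain ⟨k, hk⟩ := cw_eq_cw.1 h
  have hpi := Real.pi_pos
  have h1 : s - t = k * (2 * Real.pi) := by linarith
  rw [h1, abs_mul, abs_of_pos (by positivity : 0 < 2 * Real.pi)] at h'
  have h2 : |(k : ℝ)| < 1 := by nlinarith
  have h3 : |k| < 1 := by exact_mod_cast h2
  rw [Int.abs_lt_one_iff.1 h3] at hk
  simpa using hk

lemma exists_cw (ξ : Circle) (t₀ : ℝ) : ∃ t ∈ Ico t₀ (t₀ + 2 * Real.pi), cw t = ξ := by
  obtain ⟨y, hy⟩ : ∃ y, cw y = ξ := ⟨-Complex.arg ξ, by rw [cw, neg_neg, Circle.exp_arg]⟩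
  refine ⟨toIcoMod Real.two_pi_pos t₀ y, toIcoMod_mem_Ico _ _ _, ?_⟩
  rw [← hy, cw_eq_cw]
  refine ⟨-toIcoDiv Real.two_pi_pos t₀ y, ?_⟩
  have := toIcoMod_add_toIcoDiv_zsmul Real.two_pi_pos t₀ y
  rw [zsmul_eq_mul] at this
  push_cast; linarith

lemma hasDerivAt_cw (t : ℝ) : HasDerivAt (fun t => (cw t : ℂ)) (-(I * cw t)) t := by
  simp only [coe_cw]
  have h : HasDerivAt (fun t : ℝ => -((t : ℂ) * I)) (-(1 * I)) t :=
    ((Complex.ofRealCLM.hasDerivAt (x := t)).mul_const I).neg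
  refine h.cexp.congr_deriv ?_
  ring

/-- On the circle, `F ξ * conj (den) = ξ * conj(den)^2 / den`. -/
lemma circleMap_mul_den (G : SL(2, ℝ)) (ξ : Circle) :
    (circleMap G ξ : ℂ) * den G ξ = ξ * starRingEnd ℂ (den G ξ) := by
  rw [coe_circleMap, discMap, div_mul_cancel₀ _ (den_ne_zero G ξ)]
  have h1 : (ξ : ℂ) * starRingEnd ℂ (ξ : ℂ) = 1 := by
    rw [Complex.mul_conj, Circle.normSq_coe]; norm_num
  simp only [den, map_add, map_mul, Complex.conj_conj]
  linear_combination (-(starRingEnd ℂ (coeffBeta G))) * h1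

/-- The complex derivative is 1 / den². By `circleMap_mul_den` its product with ξ is F ξ times the
positive number |den|⁻², so the argument of the image moves with speed `derivNorm`. -/
lemma hasDerivAt_circleMap_cw (G : SL(2, ℝ)) (t : ℝ) :
    HasDerivAt (fun t => (circleMap G (cw t) : ℂ))
      (-(I * circleMap G (cw t) * derivNorm G (cw t))) t := by
  have hd := den_ne_zero G (cw t)
  have h1 : HasDerivAt (fun z => discMap G z) (1 / (den G (cw t)) ^ 2) (cw t : ℂ) := by
    have hn : HasDerivAt (fun z => coeffAlpha G * z + starRingEnd ℂ (coeffBeta G))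
        (coeffAlpha G) (cw t : ℂ) := by
      simpa using ((hasDerivAt_id (cw t : ℂ)).const_mul (coeffAlpha G)).add_const
        (starRingEnd ℂ (coeffBeta G))
    have hden : HasDerivAt (fun z => den G z) (coeffBeta G) (cw t : ℂ) := by
      simpa [den] using ((hasDerivAt_id (cw t : ℂ)).const_mul (coeffBeta G)).add_const
        (starRingEnd ℂ (coeffAlpha G))
    refine (hn.div hden hd).congr_deriv ?_
    rw [div_left_inj' (pow_ne_zero 2 hd)]
    have := det_coeff G
    simp only [den]
    linear_combination this
  refine (h1.comp t (hasDerivAt_cw t)).congr_deriv ?_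
  have h2 := circleMap_mul_den G (cw t)
  have h3 : (derivNorm G (cw t) : ℂ) * (den G (cw t) * starRingEnd ℂ (den G (cw t))) = 1 := by
    rw [Complex.mul_conj, Complex.normSq_eq_norm_sq, derivNorm]
    push_cast
    exact inv_mul_cancel₀ (by simpa using hd)
  rw [div_mul_eq_mul_div, div_eq_iff (pow_ne_zero 2 hd)]
  linear_combination I * (cw t : ℂ) * h3 + I * (derivNorm G (cw t) : ℂ) * den G (cw t) * h2

/-- A lift of the action of `G` on the circle to the real line. -/
lemma exists_lift (G : SL(2, ℝ)) : ∃ φ : ℝ → ℝ, (∀ t, circleMap G (cw t) = cw (φ t)) ∧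
    (∀ t, HasDerivAt φ (derivNorm G (cw t)) t) ∧ StrictMono φ ∧
    ∀ t, φ (t + 2 * Real.pi) = φ t + 2 * Real.pi := by
  obtain ⟨c, -, hc⟩ := exists_cw (circleMap G (cw 0)) 0
  have hcont : Continuous fun t => derivNorm G (cw t) := (continuous_derivNorm G).comp continuous_cw
  set φ : ℝ → ℝ := fun t => c + ∫ u in (0 : ℝ)..t, derivNorm G (cw u) with hφ
  have hder : ∀ t, HasDerivAt φ (derivNorm G (cw t)) t := fun t =>
    (intervalIntegral.integral_hasDerivAt_right (hcont.intervalIntegrable _ _)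
      (hcont.stronglyMeasurableAtFilter _ _) hcont.continuousAt).const_add c
  have hmono : StrictMono φ := strictMono_of_hasDerivAt_pos hder fun t => derivNorm_pos G _
  have hlift : ∀ t, circleMap G (cw t) = cw (φ t) := by
    -- The integral of the speed is a lift because this product has derivative 0, and c was chosen
    -- to make it 1 at t = 0.
    have hconst : ∀ t, (circleMap G (cw t) : ℂ) * Complex.exp (φ t * I) = 1 := by
      have hd : ∀ t, HasDerivAt (fun t => (circleMap G (cw t) : ℂ) * Complex.exp (φ t * I)) 0 t := by
        intro t
        have h1 := hasDerivAt_circleMap_cw G t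
        have h2 : HasDerivAt (fun t => Complex.exp (φ t * I))
            (Complex.exp (φ t * I) * ((derivNorm G (cw t) : ℂ) * I)) t :=
          ((hder t).ofReal_comp.mul_const I).cexp
        refine (h1.mul h2).congr_deriv ?_
        ring
      intro t
      have := is_const_of_deriv_eq_zero (fun t => (hd t).differentiableAt) (fun t => (hd t).deriv) t 0
      rw [this, ← hc, coe_cw]
      simp only [hφ, intervalIntegral.integral_same, add_zero]
      rw [← Complex.exp_add]; simp
    intro t
    refine Circle.ext ?_
    rw [coe_cw, Complex.exp_neg]
    exact eq_inv_of_mul_eq_one_left (hconst t)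
  refine ⟨φ, hlift, hder, hmono, fun t => ?_⟩
  have hcts : Continuous φ := continuous_iff_continuousAt.2 fun t => (hder t).continuousAt
  have hpi := Real.two_pi_pos
  have h1 : cw (φ (t + 2 * Real.pi)) = cw (φ t) := by rw [← hlift, ← hlift, cw_add_two_pi]
  obtain ⟨k, hk⟩ := cw_eq_cw.1 h1
  have hlt := hmono (by linarith : t < t + 2 * Real.pi)
  have hk0 : 0 < k := by
    by_contra h
    have : (k : ℝ) ≤ 0 := by exact_mod_cast not_lt.1 h
    nlinarith
  have hk1 : (1 : ℝ) ≤ k := by exact_mod_cast hk0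
  -- If the lift gained more than one turn over a period, some point strictly inside the period
  -- would have the same image as its beginning, against injectivity.
  by_contra hne
  have hk2 : φ t + 2 * Real.pi < φ (t + 2 * Real.pi) := by
    refine lt_of_le_of_ne ?_ (Ne.symm hne)
    rw [hk]; nlinarith
  obtain ⟨u, hu, hu'⟩ := intermediate_value_Ioo (by linarith : t ≤ t + 2 * Real.pi) hcts.continuousOn
    (⟨by linarith, hk2⟩ : φ t + 2 * Real.pi ∈ Ioo (φ t) (φ (t + 2 * Real.pi)))
  have h2 : cw u = cw t := circleMap_injective G (by rw [hlift, hlift, hu', cw_add_two_pi])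
  have := cw_injOn h2 (by rw [abs_of_pos] <;> linarith [hu.1, hu.2])
  linarith [hu.1]

/-! ### Change of variables on the circle. -/

/-- The integral over the circle. -/
def circInt (f : Circle → ℂ) : ℂ := ∫ t in (0 : ℝ)..(2 * Real.pi), f (cw t)

lemma circInt_eq (f : Circle → ℂ) (a : ℝ) :
    circInt f = ∫ t in a..(a + 2 * Real.pi), f (cw t) := by
  have h : Function.Periodic (fun t => f (cw t)) (2 * Real.pi) := fun t => by
    simp only [cw_add_two_pi]
  rw [circInt, ← h.intervalIntegral_add_eq 0 a, zero_add]

/-- The lift maps a period increasingly onto a period, and its derivative is `derivNorm`. -/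
lemma circInt_comp (G : SL(2, ℝ)) (f : Circle → ℂ) :
    circInt (fun ξ => (derivNorm G ξ : ℂ) * f (circleMap G ξ)) = circInt f := by
  obtain ⟨φ, h1, h2, h3, h4⟩ := exists_lift G
  have hpi := Real.two_pi_pos
  have hcts : Continuous φ := continuous_iff_continuousAt.2 fun t => (h2 t).continuousAt
  rw [circInt_eq f (φ 0), ← h4, zero_add, circInt, intervalIntegral.integral_of_le hpi.le,
    intervalIntegral.integral_of_le (h3 hpi).le]
  have himg : φ '' Ioc 0 (2 * Real.pi) = Ioc (φ 0) (φ (2 * Real.pi)) := by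
    refine Subset.antisymm ?_ ?_
    · rintro _ ⟨x, hx, rfl⟩
      exact ⟨h3 hx.1, h3.monotone hx.2⟩
    · exact intermediate_value_Ioc hpi.le hcts.continuousOn
  rw [← himg, integral_image_eq_integral_abs_deriv_smul measurableSet_Ioc
    (fun x _ => (h2 x).hasDerivWithinAt) h3.injective.injOn]
  refine setIntegral_congr_fun measurableSet_Ioc fun t _ => ?_
  simp only [abs_of_pos (derivNorm_pos G _), h1, Complex.real_smul]

end BowenSeries

namespace BowenSeries

namespace LabelledIdealPolygon

open Complex MeasureTheory Set

variable {Γ₀ : Subgroup SL(2, ℝ)} {𝒜 : Type*} (Ω : LabelledIdealPolygon Γ₀ 𝒜)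

/-! ### Arcs and isometric circles -/

lemma xiL_eq (a : 𝒜) : Ω.xiL a = cw (Ω.lo a) := rfl

lemma xiR_eq (a : 𝒜) : Ω.xiR a = cw (Ω.hi a) := rfl

lemma xiL_mem_arc (a : 𝒜) : Ω.xiL a ∈ Ω.arc a := ⟨_, left_mem_Ico.2 (Ω.lo_lt_hi a), rfl⟩

variable {Ω} in
lemma eq_of_mem_arc {a b : 𝒜} {ξ : Circle} (ha : ξ ∈ Ω.arc a) (hb : ξ ∈ Ω.arc b) : a = b :=
  (Ω.partition ξ).unique ha hb

lemma norm_den_lt_one_iff (a : 𝒜) (ξ : Circle) :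
    ‖den (Ω.F (Ω.hat a)) ξ‖ < 1 ↔ ∃ t ∈ Ioo (Ω.lo a) (Ω.hi a), cw t = ξ :=
  Set.ext_iff.1 (Ω.arc_interior a) ξ

variable {Ω} in
lemma mem_arc_of_norm_den_lt_one {a : 𝒜} {ξ : Circle} (h : ‖den (Ω.F (Ω.hat a)) ξ‖ < 1) :
    ξ ∈ Ω.arc a := by
  obtain ⟨t, ht, rfl⟩ := (Ω.norm_den_lt_one_iff a ξ).1 h
  exact ⟨t, Ioo_subset_Ico_self ht, rfl⟩

lemma norm_den_le_one (a : 𝒜) {t : ℝ} (ht : t ∈ Icc (Ω.lo a) (Ω.hi a)) :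
    ‖den (Ω.F (Ω.hat a)) (cw t)‖ ≤ 1 := by
  have hc : Continuous fun t => ‖den (Ω.F (Ω.hat a)) (cw t)‖ :=
    ((continuous_den _).comp (continuous_circle_coe.comp continuous_cw)).norm
  rw [← closure_Ioo (Ω.lo_lt_hi a).ne] at ht
  have : closure (Ioo (Ω.lo a) (Ω.hi a)) ⊆ {t | ‖den (Ω.F (Ω.hat a)) (cw t)‖ ≤ 1} :=
    closure_minimal (fun t ht => ((Ω.norm_den_lt_one_iff a _).2 ⟨t, ht, rfl⟩).le)
      (isClosed_le hc continuous_const)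
  exact this ht

/-- With β = 0 the denominator has constant modulus |α| ≥ 1, and the isometric disc could not cut
out the nonempty arc [â]. -/
lemma coeffBeta_F_ne_zero (a : 𝒜) : coeffBeta (Ω.F a) ≠ 0 := by
  intro h
  have hm : (Ω.lo (Ω.hat a) + Ω.hi (Ω.hat a)) / 2 ∈ Ioo (Ω.lo (Ω.hat a)) (Ω.hi (Ω.hat a)) := by
    have := Ω.lo_lt_hi (Ω.hat a)
    constructor <;> linarith
  have h1 := (Ω.norm_den_lt_one_iff (Ω.hat a) _).2 ⟨_, hm, rfl⟩
  rw [Ω.hat_hat, den, h, zero_mul, zero_add, RCLike.norm_conj] at h1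
  linarith [one_le_norm_coeffAlpha (Ω.F a)]

/-- An arc of at least half a circle contains antipodal points in its closure. The denominators
there have modulus at most 1 and sum to 2 conj α, whereas |α| > 1. -/
lemma hi_sub_lo_lt_pi (a : 𝒜) : Ω.hi a - Ω.lo a < Real.pi := by
  by_contra! h
  have h1 := Ω.norm_den_le_one a (t := Ω.lo a) ⟨le_rfl, (Ω.lo_lt_hi a).le⟩
  have h2 := Ω.norm_den_le_one a (t := Ω.lo a + Real.pi) ⟨by linarith [Real.pi_pos], by linarith⟩
  have h3 : (cw (Ω.lo a + Real.pi) : ℂ) = -cw (Ω.lo a) := by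
    rw [coe_cw, coe_cw]
    push_cast
    rw [add_mul, neg_add, Complex.exp_add, Complex.exp_neg (Real.pi * I), Complex.exp_pi_mul_I]
    norm_num
  rw [h3] at h2
  have h4 : den (Ω.F (Ω.hat a)) (cw (Ω.lo a)) + den (Ω.F (Ω.hat a)) (-cw (Ω.lo a)) =
      2 * starRingEnd ℂ (coeffAlpha (Ω.F (Ω.hat a))) := by simp only [den]; ring
  have h5 : 2 * ‖coeffAlpha (Ω.F (Ω.hat a))‖ ≤ 2 := by
    have := norm_add_le (den (Ω.F (Ω.hat a)) (cw (Ω.lo a))) (den (Ω.F (Ω.hat a)) (-cw (Ω.lo a)))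
    rw [h4, norm_mul, RCLike.norm_conj] at this
    norm_num at this
    linarith
  have h6 := norm_sq_coeff (Ω.F (Ω.hat a))
  have h7 := norm_pos_iff.2 (Ω.coeffBeta_F_ne_zero (Ω.hat a))
  nlinarith [norm_nonneg (coeffAlpha (Ω.F (Ω.hat a)))]

/-- The values of the parametrization of a closed arc are pairwise distinct. -/
lemma cw_injOn_arc {a : 𝒜} {s t : ℝ} (h : cw s = cw t) (hs : Ω.lo a - Real.pi ≤ s)
    (hs' : s ≤ Ω.hi a + Real.pi) (ht : Ω.lo a ≤ t) (ht' : t ≤ Ω.hi a) : s = t := by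
  refine cw_injOn h ?_
  have := Ω.hi_sub_lo_lt_pi a
  rw [abs_lt]; constructor <;> linarith

lemma xiL_ne_xiR (a : 𝒜) : Ω.xiL a ≠ Ω.xiR a := fun h => by
  have := Ω.lo_lt_hi a
  have := Ω.cw_injOn_arc (a := a) h (by linarith [Real.pi_pos]) (by linarith [Real.pi_pos])
    this.le le_rfl
  linarith

lemma norm_den_xiL (a : 𝒜) : ‖den (Ω.F (Ω.hat a)) (Ω.xiL a)‖ = 1 := by
  have hlt := Ω.lo_lt_hi a
  refine le_antisymm (Ω.norm_den_le_one a ⟨le_rfl, hlt.le⟩) (not_lt.1 fun h => ?_)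
  obtain ⟨t, ht, h⟩ := (Ω.norm_den_lt_one_iff a _).1 h
  have := Ω.cw_injOn_arc (a := a) h.symm (by linarith [Real.pi_pos]) (by linarith [Real.pi_pos])
    ht.1.le ht.2.le
  linarith [ht.1]

lemma norm_den_xiR (a : 𝒜) : ‖den (Ω.F (Ω.hat a)) (Ω.xiR a)‖ = 1 := by
  have hlt := Ω.lo_lt_hi a
  refine le_antisymm (Ω.norm_den_le_one a ⟨hlt.le, le_rfl⟩) (not_lt.1 fun h => ?_)
  obtain ⟨t, ht, h⟩ := (Ω.norm_den_lt_one_iff a _).1 h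
  have := Ω.cw_injOn_arc (a := a) h.symm (by linarith [Real.pi_pos]) (by linarith [Real.pi_pos])
    ht.1.le ht.2.le
  linarith [ht.2]

/-- On the unit circle conj ξ = 1/ξ turns |den| = 1 into a quadratic equation for ξ. -/
lemma quadratic_of_norm_den_eq_one {G : SL(2, ℝ)} {ξ : Circle} (h : ‖den G ξ‖ = 1) :
    coeffAlpha G * coeffBeta G * (ξ : ℂ) ^ 2
      + 2 * (coeffBeta G * starRingEnd ℂ (coeffBeta G)) * ξ
      + starRingEnd ℂ (coeffAlpha G * coeffBeta G) = 0 := by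
  have h1 : (ξ : ℂ) * starRingEnd ℂ (ξ : ℂ) = 1 := by
    rw [Complex.mul_conj, Circle.normSq_coe]; norm_num
  have h2 : den G ξ * starRingEnd ℂ (den G ξ) = 1 := by
    rw [Complex.mul_conj, Complex.normSq_eq_norm_sq, h]; norm_num
  have h3 := det_coeff G
  simp only [den, map_add, map_mul, Complex.conj_conj] at h2 ⊢
  linear_combination (ξ : ℂ) * h2 - ξ * h3 - (coeffBeta G * starRingEnd ℂ (coeffBeta G) * ξ
    + starRingEnd ℂ (coeffAlpha G) * starRingEnd ℂ (coeffBeta G)) * h1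

/-- The quadratic equation has nonzero leading coefficient αβ and the two end points of the arc as
roots; a third root is impossible. -/
lemma norm_den_eq_one_iff (a : 𝒜) (ξ : Circle) :
    ‖den (Ω.F (Ω.hat a)) ξ‖ = 1 ↔ ξ = Ω.xiL a ∨ ξ = Ω.xiR a := by
  constructor
  · intro h
    by_contra! hne
    have h1 := quadratic_of_norm_den_eq_one h
    have h2 := quadratic_of_norm_den_eq_one (Ω.norm_den_xiL a)
    have h3 := quadratic_of_norm_den_eq_one (Ω.norm_den_xiR a)
    set γ := coeffAlpha (Ω.F (Ω.hat a)) * coeffBeta (Ω.F (Ω.hat a))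
    set b := coeffBeta (Ω.F (Ω.hat a)) * starRingEnd ℂ (coeffBeta (Ω.F (Ω.hat a)))
    have hγ : γ ≠ 0 := mul_ne_zero
      (norm_pos_iff.1 (lt_of_lt_of_le one_pos (one_le_norm_coeffAlpha _)))
      (Ω.coeffBeta_F_ne_zero _)
    have hL : (ξ : ℂ) - Ω.xiL a ≠ 0 := sub_ne_zero.2 fun h => hne.1 (Circle.ext h)
    have hR : (ξ : ℂ) - Ω.xiR a ≠ 0 := sub_ne_zero.2 fun h => hne.2 (Circle.ext h)
    have h4 : γ * ((ξ : ℂ) + Ω.xiL a) + 2 * b = 0 := by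
      refine mul_left_cancel₀ hL ?_
      linear_combination h1 - h2
    have h5 : γ * ((ξ : ℂ) + Ω.xiR a) + 2 * b = 0 := by
      refine mul_left_cancel₀ hR ?_
      linear_combination h1 - h3
    have h6 : γ * ((Ω.xiL a : ℂ) - Ω.xiR a) = 0 := by linear_combination h4 - h5
    rcases mul_eq_zero.1 h6 with h | h
    · exact hγ h
    · exact Ω.xiL_ne_xiR a (Circle.ext (sub_eq_zero.1 h))
  · rintro (rfl | rfl)
    exacts [Ω.norm_den_xiL a, Ω.norm_den_xiR a]

lemma norm_den_F_lt_one_iff (a : 𝒜) (ξ : Circle) :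
    ‖den (Ω.F a) ξ‖ < 1 ↔ ∃ t ∈ Ioo (Ω.lo (Ω.hat a)) (Ω.hi (Ω.hat a)), cw t = ξ := by
  rw [← norm_den_lt_one_iff, Ω.hat_hat]

lemma norm_den_F_eq_one_iff (a : 𝒜) (ξ : Circle) :
    ‖den (Ω.F a) ξ‖ = 1 ↔ ξ = Ω.xiL (Ω.hat a) ∨ ξ = Ω.xiR (Ω.hat a) := by
  rw [← norm_den_eq_one_iff, Ω.hat_hat]

/-- The interior of the arc `[a]` as the set where the denominator of `F_â` is small. -/
lemma norm_den_hat_mul (a : 𝒜) (ξ : Circle) :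
    ‖den (Ω.F (Ω.hat a)) (circleMap (Ω.F a) ξ)‖ * ‖den (Ω.F a) ξ‖ = 1 := by
  rw [← norm_mul, Ω.F_hat, den_inv_circleMap, norm_one]

lemma norm_den_hat_lt_one_iff (a : 𝒜) (ξ : Circle) :
    ‖den (Ω.F (Ω.hat a)) (circleMap (Ω.F a) ξ)‖ < 1 ↔ 1 < ‖den (Ω.F a) ξ‖ := by
  have h := Ω.norm_den_hat_mul a ξ
  have h0 := norm_pos_iff.2 (den_ne_zero (Ω.F a) ξ)
  rw [eq_inv_of_mul_eq_one_left h, inv_lt_one₀ h0]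

lemma norm_den_hat_eq_one_iff (a : 𝒜) (ξ : Circle) :
    ‖den (Ω.F (Ω.hat a)) (circleMap (Ω.F a) ξ)‖ = 1 ↔ ‖den (Ω.F a) ξ‖ = 1 := by
  rw [eq_inv_of_mul_eq_one_left (Ω.norm_den_hat_mul a ξ), inv_eq_one]

lemma one_lt_norm_den_F {a : 𝒜} {t : ℝ} (h : t ∉ Icc (Ω.lo (Ω.hat a)) (Ω.hi (Ω.hat a)))
    (h1 : Ω.lo (Ω.hat a) - Real.pi ≤ t) (h2 : t ≤ Ω.hi (Ω.hat a) + Real.pi) :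
    1 < ‖den (Ω.F a) (cw t)‖ := by
  have key : ∀ s ∈ Icc (Ω.lo (Ω.hat a)) (Ω.hi (Ω.hat a)), cw t ≠ cw s := fun s hs hts =>
    h (Ω.cw_injOn_arc hts h1 h2 hs.1 hs.2 ▸ hs)
  have hlt := Ω.lo_lt_hi (Ω.hat a)
  rcases lt_trichotomy ‖den (Ω.F a) (cw t)‖ 1 with h | h | h
  · obtain ⟨s, hs, hst⟩ := (Ω.norm_den_F_lt_one_iff a _).1 h
    exact absurd hst.symm (key s (Ioo_subset_Icc_self hs))
  · rcases (Ω.norm_den_F_eq_one_iff a _).1 h with h | h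
    · exact absurd h (key _ ⟨le_rfl, hlt.le⟩)
    · exact absurd h (key _ ⟨hlt.le, le_rfl⟩)
  · exact h

/-- F_a preserves the orientation and carries the exterior of [â] to the interior of [a]. Clockwise,
the exterior begins at ξ_â^R and the arc begins at ξ_a^L. -/
lemma circleMap_F_xiR (a : 𝒜) : circleMap (Ω.F a) (Ω.xiR (Ω.hat a)) = Ω.xiL a := by
  have h1 : ‖den (Ω.F a) (Ω.xiR (Ω.hat a))‖ = 1 := (Ω.norm_den_F_eq_one_iff a _).2 (Or.inr rfl)
  refine ((Ω.norm_den_eq_one_iff a _).1 ((Ω.norm_den_hat_eq_one_iff a _).2 h1)).resolve_right ?_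
  intro h2
  obtain ⟨φ, hφ, hd, hm, -⟩ := exists_lift (Ω.F a)
  have hpi := Real.pi_pos
  -- A point shortly after ξ_â^R has its image inside [a]. If ξ_â^R went to ξ_a^R, the increasing
  -- lift would put this image shortly after ξ_a^R, outside [a].
  have hev : ∀ᶠ t in nhdsWithin (Ω.hi (Ω.hat a)) (Ioi (Ω.hi (Ω.hat a))),
      φ t < φ (Ω.hi (Ω.hat a)) + Real.pi ∧ t < Ω.hi (Ω.hat a) + Real.pi ∧ Ω.hi (Ω.hat a) < t := by
    have hc := (hd (Ω.hi (Ω.hat a))).continuousAt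
    have e1 : ∀ᶠ t in nhds (Ω.hi (Ω.hat a)), φ t < φ (Ω.hi (Ω.hat a)) + Real.pi :=
      hc.eventually_lt continuousAt_const (by linarith)
    have e2 : ∀ᶠ t in nhds (Ω.hi (Ω.hat a)), t < Ω.hi (Ω.hat a) + Real.pi :=
      gt_mem_nhds (by linarith)
    filter_upwards [nhdsWithin_le_nhds e1, nhdsWithin_le_nhds e2, self_mem_nhdsWithin]
      with t h1 h2 h3 using ⟨h1, h2, h3⟩
  obtain ⟨t, ht1, ht2, ht3⟩ := hev.exists
  have h3 : 1 < ‖den (Ω.F a) (cw t)‖ := Ω.one_lt_norm_den_F (fun h => by linarith [h.2])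
    (by linarith [Ω.lo_lt_hi (Ω.hat a)]) ht2.le
  obtain ⟨s, hs, hs'⟩ := (Ω.norm_den_lt_one_iff a _).1 ((Ω.norm_den_hat_lt_one_iff a _).2 h3)
  have h4 : cw (φ (Ω.hi (Ω.hat a))) = cw (Ω.hi a) := by rw [← hφ]; exact h2
  obtain ⟨k, hk⟩ := cw_eq_cw.1 h4
  have h5 : cw (φ t - k * (2 * Real.pi)) = cw s := by
    rw [hs', hφ, ← cw_add_int _ k, sub_add_cancel]
  have h6 := hm ht3
  have h7 := Ω.cw_injOn_arc (a := a) h5 (by linarith [Ω.lo_lt_hi a]) (by linarith) hs.1.le hs.2.le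
  linarith [hs.2]

lemma circleMap_F_xiL (a : 𝒜) : circleMap (Ω.F a) (Ω.xiL (Ω.hat a)) = Ω.xiR a := by
  have h1 : ‖den (Ω.F a) (Ω.xiL (Ω.hat a))‖ = 1 := (Ω.norm_den_F_eq_one_iff a _).2 (Or.inl rfl)
  refine ((Ω.norm_den_eq_one_iff a _).1 ((Ω.norm_den_hat_eq_one_iff a _).2 h1)).resolve_left ?_
  intro h2
  exact Ω.xiL_ne_xiR _ (circleMap_injective _ (h2.trans (Ω.circleMap_F_xiR a).symm))

/-- The right-open convention is consistent with the side pairings: [â] omits its right end point,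
which F_a sends to the left end point of [a], and contains its left one, which goes to the omitted
right end point. So the Markov property holds without exceptional points. -/
lemma circleMap_F_mem_arc_iff (a : 𝒜) (ξ : Circle) :
    circleMap (Ω.F a) ξ ∈ Ω.arc a ↔ ξ ∉ Ω.arc (Ω.hat a) := by
  have hR : ∀ b, Ω.xiR b ∉ Ω.arc b := by
    rintro b ⟨t, ht, h⟩
    have := Ω.cw_injOn_arc (a := b) (s := Ω.hi b) (t := t) h.symm
      (by linarith [Ω.lo_lt_hi b, Real.pi_pos]) (by linarith [Real.pi_pos]) ht.1 ht.2.le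
    linarith [ht.2]
  have key : ∀ b ζ, ζ ∈ Ω.arc b ↔ ‖den (Ω.F (Ω.hat b)) ζ‖ < 1 ∨ ζ = Ω.xiL b := by
    intro b ζ
    rw [norm_den_lt_one_iff]
    constructor
    · rintro ⟨t, ht, rfl⟩
      rcases ht.1.eq_or_lt with h | h
      · right; rw [xiL_eq, h]; rfl
      · exact Or.inl ⟨t, ⟨h, ht.2⟩, rfl⟩
    · rintro (⟨t, ht, rfl⟩ | rfl)
      · exact ⟨t, Ioo_subset_Ico_self ht, rfl⟩
      · exact Ω.xiL_mem_arc b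
  rw [key, key, norm_den_hat_lt_one_iff, Ω.hat_hat, ← circleMap_F_xiR,
    (circleMap_injective _).eq_iff]
  constructor
  · rintro (h | h)
    · rintro (h' | h')
      · linarith
      · have := (Ω.norm_den_F_eq_one_iff a ξ).2 (Or.inl h'); linarith
    · rintro (h' | h')
      · have := (Ω.norm_den_F_eq_one_iff a ξ).2 (Or.inr h); linarith
      · exact Ω.xiL_ne_xiR _ (h'.symm.trans h)
  · intro h
    push Not at h
    rcases h.1.eq_or_lt with h1 | h1
    · exact Or.inr (((Ω.norm_den_F_eq_one_iff a ξ).1 h1.symm).resolve_left h.2)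
    · exact Or.inl h1

lemma xiR_injective : Function.Injective Ω.xiR := by
  intro a b h
  obtain ⟨ε, hε, ha, hb⟩ : ∃ ε > 0, ε ≤ Ω.hi a - Ω.lo a ∧ ε ≤ Ω.hi b - Ω.lo b :=
    ⟨min (Ω.hi a - Ω.lo a) (Ω.hi b - Ω.lo b), lt_min (sub_pos.2 (Ω.lo_lt_hi a))
      (sub_pos.2 (Ω.lo_lt_hi b)), min_le_left _ _, min_le_right _ _⟩
  obtain ⟨k, hk⟩ := cw_eq_cw.1 h
  have h1 : cw (Ω.hi a - ε) = cw (Ω.hi b - ε) := by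
    rw [hk, ← cw_add_int (Ω.hi b - ε) k]; congr 1; ring
  exact eq_of_mem_arc (Ω := Ω) (ξ := cw (Ω.hi a - ε)) ⟨_, ⟨by linarith, by linarith⟩, rfl⟩
    ⟨Ω.hi b - ε, ⟨by linarith, by linarith⟩, h1.symm⟩

lemma xiL_injective : Function.Injective Ω.xiL := fun a b h =>
  eq_of_mem_arc (Ω.xiL_mem_arc a) (h ▸ Ω.xiL_mem_arc b)

/-! ### The cyclic order -/

/-- The letter following `a` in the cyclic order. -/
def succ (a : 𝒜) : 𝒜 := (Ω.partition (Ω.xiR a)).choose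

/-- If ξ_a^R were not the left end of the arc that contains it, this arc would meet [a] just before
ξ_a^R and would be [a], which omits its right end. -/
lemma xiL_succ (a : 𝒜) : Ω.xiL (Ω.succ a) = Ω.xiR a := by
  obtain ⟨t, ht, h⟩ := (Ω.partition (Ω.xiR a)).choose_spec.1
  change t ∈ Ico (Ω.lo (Ω.succ a)) (Ω.hi (Ω.succ a)) at ht
  change cw t = cw (Ω.hi a) at h
  rcases ht.1.eq_or_lt with h1 | h1
  · rw [xiL_eq, h1, h]; rfl
  · exfalso
    obtain ⟨ε, hε, ha, hb⟩ : ∃ ε > 0, ε ≤ Ω.hi a - Ω.lo a ∧ ε ≤ t - Ω.lo (Ω.succ a) :=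
      ⟨min (Ω.hi a - Ω.lo a) (t - Ω.lo (Ω.succ a)), lt_min (sub_pos.2 (Ω.lo_lt_hi a))
        (sub_pos.2 h1), min_le_left _ _, min_le_right _ _⟩
    obtain ⟨k, hk⟩ := cw_eq_cw.1 h
    have h2 : cw (t - ε) = cw (Ω.hi a - ε) := by
      rw [hk, ← cw_add_int (Ω.hi a - ε) k]; congr 1; ring
    have h3 : a = Ω.succ a := eq_of_mem_arc (Ω := Ω) (ξ := cw (t - ε))
      ⟨Ω.hi a - ε, ⟨by linarith, by linarith⟩, h2.symm⟩ ⟨t - ε, ⟨by linarith, by linarith [ht.2]⟩, rfl⟩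
    rw [← h3] at ht
    have h4 := Ω.cw_injOn_arc (a := a) (s := Ω.hi a) (t := t) h.symm
      (by linarith [Ω.lo_lt_hi a, Real.pi_pos]) (by linarith [Real.pi_pos]) ht.1 ht.2.le
    linarith [ht.2]

lemma next_iff (a b : 𝒜) : Ω.Next a b ↔ b = Ω.succ a := by
  rw [Next, ← xiL_succ, Ω.xiL_injective.eq_iff, eq_comm]

lemma succ_injective : Function.Injective Ω.succ := fun a b h =>
  Ω.xiR_injective (by rw [← xiL_succ, ← xiL_succ, h])

lemma succ_ne (a : 𝒜) : Ω.succ a ≠ a := fun h =>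
  Ω.xiL_ne_xiR a (by rw [← xiL_succ, h])

/-- Two arcs do not close up: their widths are positive and less than π, so the sum is not a
multiple of 2π. Hence the two neighbours of a letter differ, and the right and the left type are
distinct. -/
lemma succ_succ_ne (a : 𝒜) : Ω.succ (Ω.succ a) ≠ a := by
  intro h
  have h1 := Ω.xiL_succ a
  have h2 := Ω.xiL_succ (Ω.succ a)
  rw [h] at h2
  obtain ⟨k, hk⟩ := cw_eq_cw.1 h1
  obtain ⟨j, hj⟩ := cw_eq_cw.1 h2
  have w1 := Ω.hi_sub_lo_lt_pi a
  have w2 := Ω.hi_sub_lo_lt_pi (Ω.succ a)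
  have w3 := Ω.lo_lt_hi a
  have w4 := Ω.lo_lt_hi (Ω.succ a)
  have hpi := Real.pi_pos
  have e1 : (Ω.hi a - Ω.lo a) + (Ω.hi (Ω.succ a) - Ω.lo (Ω.succ a)) =
      ((-(k + j) : ℤ) : ℝ) * (2 * Real.pi) := by push_cast; linarith
  have e2 : (0 : ℝ) < ((-(k + j) : ℤ) : ℝ) := by
    by_contra! h; nlinarith
  have e3 : ((-(k + j) : ℤ) : ℝ) < 1 := by
    by_contra! h; nlinarith
  have e4 : 0 < -(k + j) := by exact_mod_cast e2
  have e5 : -(k + j) < 1 := by exact_mod_cast e3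
  omega

/-- The involution as a permutation. -/
def hatEquiv : Equiv.Perm 𝒜 := Function.Involutive.toPerm Ω.hat Ω.hat_hat

variable [Finite 𝒜]

/-- The successor map as a permutation. -/
def succEquiv : Equiv.Perm 𝒜 :=
  Equiv.ofBijective Ω.succ (Finite.injective_iff_bijective.1 Ω.succ_injective)

/-- The letter which follows `a` in the cuspidal words of right (`true`) and of left (`false`)
type. -/
def step : Bool → Equiv.Perm 𝒜
  | true => Ω.hatEquiv.trans Ω.succEquiv.symm
  | false => Ω.hatEquiv.trans Ω.succEquiv

lemma succ_step_true (a : 𝒜) : Ω.succ (Ω.step true a) = Ω.hat a :=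
  Ω.succEquiv.apply_symm_apply (Ω.hat a)

lemma step_false (a : 𝒜) : Ω.step false a = Ω.succ (Ω.hat a) := rfl

lemma eq_step_true_iff (a b : 𝒜) : b = Ω.step true a ↔ Ω.Next b (Ω.hat a) := by
  rw [next_iff, ← Ω.succ_step_true, Ω.succ_injective.eq_iff, eq_comm]

lemma eq_step_false_iff (a b : 𝒜) : b = Ω.step false a ↔ Ω.Next (Ω.hat a) b := by
  rw [next_iff, step_false]

lemma step_ne_hat (e : Bool) (a : 𝒜) : Ω.step e a ≠ Ω.hat a := by
  cases e
  · exact Ω.succ_ne _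
  · intro h
    have := Ω.succ_step_true a
    rw [h] at this
    exact Ω.succ_ne _ this

lemma step_true_ne_step_false (a : 𝒜) : Ω.step true a ≠ Ω.step false a := by
  intro h
  have := Ω.succ_step_true a
  rw [h, step_false] at this
  exact Ω.succ_succ_ne _ this

/-- The right (`true`) or left (`false`) end point of `[a]`. -/
def vtx (e : Bool) (a : 𝒜) : Circle := if e then Ω.xiR a else Ω.xiL a

omit [Finite 𝒜] in
lemma vtx_injective (e : Bool) : Function.Injective (Ω.vtx e) := by
  cases e
  · exact Ω.xiL_injective
  · exact Ω.xiR_injective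

omit [Finite 𝒜] in
lemma vtx_ne (e : Bool) (a : 𝒜) : Ω.vtx e a ≠ Ω.vtx (!e) a := by
  cases e
  · exact Ω.xiL_ne_xiR a
  · exact (Ω.xiL_ne_xiR a).symm

/-- The letter that follows a has as its e-vertex the very point that F_a sends to the e-vertex of a
(`circleMap_F_vtx`). This is why the words of one type turn about a single vertex. -/
lemma vtx_step (e : Bool) (a : 𝒜) : Ω.vtx e (Ω.step e a) = Ω.vtx (!e) (Ω.hat a) := by
  cases e
  · exact Ω.xiL_succ _
  · change Ω.xiR (Ω.step true a) = Ω.xiL (Ω.hat a)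
    rw [← xiL_succ, succ_step_true]

omit [Finite 𝒜] in
lemma circleMap_F_vtx (e : Bool) (a : 𝒜) :
    circleMap (Ω.F a) (Ω.vtx (!e) (Ω.hat a)) = Ω.vtx e a := by
  cases e
  · exact Ω.circleMap_F_xiR a
  · exact Ω.circleMap_F_xiL a

omit [Finite 𝒜] in
lemma norm_den_F_vtx (e : Bool) (a : 𝒜) : ‖den (Ω.F a) (Ω.vtx e (Ω.hat a))‖ = 1 := by
  rw [norm_den_F_eq_one_iff]
  cases e
  · exact Or.inl rfl
  · exact Or.inr rfl

omit [Finite 𝒜] in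
lemma norm_den_F_eq_one_iff_vtx (a : 𝒜) (ξ : Circle) :
    ‖den (Ω.F a) ξ‖ = 1 ↔ ∃ e, ξ = Ω.vtx e (Ω.hat a) := by
  rw [norm_den_F_eq_one_iff, Bool.exists_bool]; rfl

omit [Finite 𝒜] in
lemma exists_vtx_eq_xiL (e : Bool) (a : 𝒜) : ∃ b, Ω.vtx e a = Ω.xiL b := by
  cases e
  · exact ⟨a, rfl⟩
  · exact ⟨Ω.succ a, (Ω.xiL_succ a).symm⟩

omit [Finite 𝒜] in
/-- A vertex of the polygon is not contained in the interior of an arc. -/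
lemma one_le_norm_den_vertex (a b : 𝒜) : 1 ≤ ‖den (Ω.F a) (Ω.xiL b)‖ := by
  by_contra! h
  rw [← Ω.hat_hat a] at h
  have h1 := mem_arc_of_norm_den_lt_one h
  have h2 := eq_of_mem_arc h1 (Ω.xiL_mem_arc b)
  rw [h2, norm_den_xiL] at h
  exact lt_irrefl _ h

/-! ### Classification of the cuspidal words -/

omit [Finite 𝒜] in
lemma word_cons (a : 𝒜) (W : List 𝒜) : Ω.word (a :: W) = Ω.F a * Ω.word W := by
  simp [word]

omit [Finite 𝒜] in
lemma word_append (V W : List 𝒜) : Ω.word (V ++ W) = Ω.word V * Ω.word W := by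
  simp [word]

omit [Finite 𝒜] in
lemma word_singleton (a : 𝒜) : Ω.word [a] = Ω.F a := by simp [word]

/-- The words of right (`true`) or left (`false`) type, including the words with one letter. -/
def IsSide (e : Bool) (W : List 𝒜) : Prop := W.IsChain (fun a b => b = Ω.step e a)

lemma isRight_iff (W : List 𝒜) : Ω.IsRight W ↔ 2 ≤ W.length ∧ Ω.IsSide true W := by
  simp only [IsRight, IsSide, eq_step_true_iff]

lemma isLeft_iff (W : List 𝒜) : Ω.IsLeft W ↔ 2 ≤ W.length ∧ Ω.IsSide false W := by
  simp only [IsLeft, IsSide, eq_step_false_iff]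

/-- The vertex is followed through the letters from the last to the first. Once its image is inside
an arc it stays inside arcs, because without backtracking it is not in the closure of the arc
reversed by the next letter. It remains a vertex only as long as no letter dilates there, and this
forces consecutive letters to be related by `step e` with a constant e. -/
lemma word_vertex_cases (V : List 𝒜) (a b : 𝒜) (hV : Ω.Admissible (a :: V)) :
    ‖den (Ω.F (Ω.hat a)) (circleMap (Ω.word (a :: V)) (Ω.xiL b))‖ < 1 ∨
      ∃ e, circleMap (Ω.word (a :: V)) (Ω.xiL b) = Ω.vtx e a ∧ Ω.IsSide e (a :: V) := by
  induction V generalizing a with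
  | nil =>
    rw [word_singleton]
    rcases (Ω.one_le_norm_den_vertex a b).eq_or_lt with h | h
    · right
      obtain ⟨e, he⟩ := (Ω.norm_den_F_eq_one_iff_vtx a _).1 h.symm
      refine ⟨!e, ?_, List.isChain_singleton _⟩
      rw [he]; simpa using Ω.circleMap_F_vtx (!e) a
    · exact Or.inl ((Ω.norm_den_hat_lt_one_iff a _).2 h)
  | cons c V ih =>
    have hc : c ≠ Ω.hat a := (List.isChain_cons_cons.1 hV).1
    have ih' := ih c (List.isChain_cons_cons.1 hV).2
    rw [word_cons, circleMap_mul]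
    set u := circleMap (Ω.word (c :: V)) (Ω.xiL b)
    rcases lt_trichotomy ‖den (Ω.F a) u‖ 1 with h | h | h
    · exfalso
      have hu : u ∈ Ω.arc (Ω.hat a) := mem_arc_of_norm_den_lt_one (by rwa [Ω.hat_hat])
      rcases ih' with h1 | ⟨e, he, -⟩
      · exact hc (eq_of_mem_arc (mem_arc_of_norm_den_lt_one h1) hu)
      · obtain ⟨d, hd⟩ := Ω.exists_vtx_eq_xiL e c
        rw [he, hd] at h
        exact absurd h (not_lt.2 (Ω.one_le_norm_den_vertex a d))
    · right
      obtain ⟨e, he⟩ := (Ω.norm_den_F_eq_one_iff_vtx a _).1 h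
      rcases ih' with h1 | ⟨e', he', hs⟩
      · obtain ⟨d, hd⟩ := Ω.exists_vtx_eq_xiL e (Ω.hat a)
        rw [he, hd] at h1
        exact absurd h1 (not_lt.2 (Ω.one_le_norm_den_vertex _ d))
      -- If the two vertices were on the same side, the letter c would be the inverse of a.
      · obtain rfl : e = !e' := by
          by_contra hne
          have hee : e' = e := by revert hne; cases e <;> cases e' <;> simp
          rw [hee] at he'
          exact hc (Ω.vtx_injective e (he'.symm.trans he))
        refine ⟨e', ?_, ?_⟩
        · rw [he, circleMap_F_vtx]
        · refine List.isChain_cons_cons.2 ⟨?_, hs⟩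
          refine Ω.vtx_injective e' ?_
          rw [vtx_step, ← he, he']
    · exact Or.inl ((Ω.norm_den_hat_lt_one_iff a _).2 h)

/-- A fixed vertex is not inside an arc, so the first alternative of `word_vertex_cases` fails for
V; the type passes to initial factors. -/
lemma exists_isSide_of_isCuspidal {W : List 𝒜} (h : Ω.IsCuspidal W) : ∃ e, Ω.IsSide e W := by
  obtain ⟨hne, V, hWV, hV, -, b, hb⟩ := h
  obtain ⟨a, V', rfl⟩ : ∃ a V', V = a :: V' := by
    cases V with
    | nil => exact absurd (List.prefix_nil.1 hWV) hne
    | cons a V' => exact ⟨a, V', rfl⟩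
  rcases Ω.word_vertex_cases V' a b hV with h | ⟨e, -, he⟩
  · rw [hb] at h
    exact absurd h (not_lt.2 (Ω.one_le_norm_den_vertex _ b))
  · exact ⟨e, List.IsChain.prefix he hWV⟩

end LabelledIdealPolygon

end BowenSeries

namespace BowenSeries

open Complex MeasureTheory Set

/-! ### The half plane coordinate at a point of the circle -/

/-- The real part of the half plane coordinate of `z` in which the boundary point `v` is at
infinity. -/
def xcoord (v z : ℂ) : ℝ := (I * (v + z) / (v - z)).re

/-- The translation which an element with derivative one at `v` induces on half plane coordinates. -/
def shift (G : SL(2, ℝ)) (v : ℂ) : ℝ := (-2 * I * discMap G v * den G v * coeffBeta G).re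

lemma xcoord_symm (v z : ℂ) : xcoord z v = -xcoord v z := by
  rw [xcoord, xcoord, ← Complex.neg_re, ← neg_sub v z, add_comm, div_neg]

/-- For z on the circle i(v+z)/(v-z) is real, being the cotangent of half an angle, and 1 + cot² =
1/sin². -/
lemma one_add_xcoord_sq {v z : Circle} (h : z ≠ v) :
    1 + xcoord v z ^ 2 = 4 / dist z v ^ 2 := by
  have h0 : (v : ℂ) - z ≠ 0 := sub_ne_zero.2 fun h' => h (Circle.ext h'.symm)
  have hd : dist z v = ‖(v : ℂ) - z‖ := by rw [dist_comm]; exact dist_eq_norm (v : ℂ) z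
  have hv : (v : ℂ) * starRingEnd ℂ v = 1 := by
    rw [Complex.mul_conj, Circle.normSq_coe]; norm_num
  have hz : (z : ℂ) * starRingEnd ℂ z = 1 := by
    rw [Complex.mul_conj, Circle.normSq_coe]; norm_num
  have h0' : starRingEnd ℂ (v : ℂ) - starRingEnd ℂ z ≠ 0 := by
    rw [← map_sub]; exact (map_ne_zero _).2 h0
  set w := I * ((v : ℂ) + z) / (v - z) with hw
  have hreal : starRingEnd ℂ w = w := by
    rw [hw]
    simp only [map_div₀, map_mul, map_add, map_sub, Complex.conj_I]
    rw [div_eq_div_iff h0' h0]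
    linear_combination (-2 * I) * hv + 2 * I * hz
  have h1 : ((xcoord v z : ℝ) : ℂ) = w := Complex.conj_eq_iff_re.1 hreal
  have h2 : ((‖(v : ℂ) - z‖ ^ 2 : ℝ) : ℂ) = (v - z) * (starRingEnd ℂ v - starRingEnd ℂ z) := by
    rw [← map_sub, Complex.mul_conj, Complex.normSq_eq_norm_sq]
  have h3 : ((1 + xcoord v z ^ 2 : ℝ) : ℂ) * ((‖(v : ℂ) - z‖ ^ 2 : ℝ) : ℂ) = 4 := by
    rw [h2]
    push_cast
    rw [h1, hw]
    field_simp
    have hI := Complex.I_sq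
    linear_combination (((v : ℂ) + z) ^ 2 * (starRingEnd ℂ v - starRingEnd ℂ z)) * hI + 4 * (v - z) * hz
      + (-4 * z) * (hv - hz) 
  rw [hd, eq_div_iff (pow_ne_zero 2 (norm_ne_zero_iff.2 h0))]
  exact_mod_cast h3

/-- A map between half plane coordinates that fixes infinity is affine; its dilation is 1 because
|den G v| = 1. -/
lemma xcoord_circleMap {G : SL(2, ℝ)} {v : Circle} (hv : ‖den G v‖ = 1) {z : ℂ} (hz : den G z ≠ 0)
    (hzv : z ≠ v) : xcoord (discMap G v) (discMap G z) = xcoord v z + shift G v := by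
  have hdv := den_ne_zero G v
  have h1 : discMap G z - discMap G v = (z - v) / (den G z * den G v) := discMap_sub G hz hdv
  have h0 : z - v ≠ 0 := sub_ne_zero.2 hzv
  have h2 : den G z = den G v + coeffBeta G * (z - v) := by rw [← den_sub]; ring
  -- The only place where |den G v| = 1 enters the computation.
  have h3 : discMap G v * den G v ^ 2 = v := by
    have h4 := circleMap_mul_den G v
    have h5 : den G v * starRingEnd ℂ (den G v) = 1 := by
      rw [Complex.mul_conj, Complex.normSq_eq_norm_sq, hv]; norm_num
    rw [coe_circleMap] at h4
    linear_combination den G v * h4 + v * h5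
  rw [xcoord, xcoord, shift, ← Complex.add_re]
  congr 1
  have h6 : I * (discMap G v + discMap G z) / (discMap G v - discMap G z) =
      -I * (1 + 2 * (discMap G v * (den G z * den G v)) / (z - v)) := by
    have h7 : discMap G z = discMap G v + (z - v) / (den G z * den G v) := by rw [← h1]; ring
    rw [h7, sub_add_cancel_left]
    generalize z - (v : ℂ) = w at h0
    field_simp
    ring
  have h8 : I * (v + z) / (v - z) = -I * (1 + 2 * v / (z - v)) := by
    have : (v : ℂ) - z ≠ 0 := sub_ne_zero.2 hzv.symm
    field_simp
    ring
  rw [h6, h8]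
  field_simp
  rw [h2]
  linear_combination -2 * h3

/-- Translations compose; the constants are compared at the antipode of v, a point different from v.
-/
lemma shift_mul (G H : SL(2, ℝ)) {v : Circle} (hH : ‖den H v‖ = 1)
    (hG : ‖den G (circleMap H v)‖ = 1) : shift (G * H) v = shift G (circleMap H v) + shift H v := by
  have hne : ((-v : Circle) : ℂ) ≠ v := fun h => Circle.neg_ne_self v (Circle.ext h)
  have h1 := xcoord_circleMap hH (den_ne_zero H (-v)) hne
  have h2 : ((circleMap H (-v) : Circle) : ℂ) ≠ circleMap H v := fun h =>
    Circle.neg_ne_self v (circleMap_injective H (Circle.ext h))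
  have h3 := xcoord_circleMap hG (den_ne_zero G _) h2
  have hGH : ‖den (G * H) v‖ = 1 := by rw [den_mul_circle, norm_mul, hG, hH, one_mul]
  have h4 := xcoord_circleMap hGH (den_ne_zero (G * H) (-v)) hne
  rw [← coe_circleMap, ← coe_circleMap, circleMap_mul, circleMap_mul] at h4
  rw [← coe_circleMap, ← coe_circleMap] at h1 h3
  linarith

/-- Both chords from the point to v, before and after G, are expressed by coordinates, and
`dist_circleMap` gives their ratio. All derivative estimates for cuspidal words come from this
formula. -/
lemma norm_den_sq {G : SL(2, ℝ)} {v z : Circle} (hv : ‖den G v‖ = 1) (hzv : z ≠ v) :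
    ‖den G z‖ ^ 2 = (1 + (xcoord v z + shift G v) ^ 2) / (1 + xcoord v z ^ 2) := by
  have h1 := xcoord_circleMap hv (den_ne_zero G z) fun h => hzv (Circle.ext h)
  rw [← coe_circleMap, ← coe_circleMap] at h1
  have h2 := one_add_xcoord_sq hzv
  have h3 := one_add_xcoord_sq ((circleMap_injective G).ne hzv)
  have h4 := dist_circleMap G z v
  rw [h1] at h3
  rw [h3, h2, h4, hv]
  have hd : dist z v ≠ 0 := dist_ne_zero.2 hzv
  have hn := norm_ne_zero_iff.2 (den_ne_zero G z)
  field_simp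

lemma xcoord_cw {s u : ℝ} (hu : Real.sin (u / 2) ≠ 0) :
    xcoord (cw s) (cw (s + u)) = Real.cos (u / 2) / Real.sin (u / 2) := by
  have h : I * ((cw s : ℂ) + cw (s + u)) / (cw s - cw (s + u)) =
      ((Real.cos (u / 2) / Real.sin (u / 2) : ℝ) : ℂ) := by
    set E := Complex.exp (-((u / 2 : ℝ) * I)) with hE
    have hE0 : E ≠ 0 := Complex.exp_ne_zero _
    have h1 : (cw (s + u) : ℂ) = cw s * E * E := by
      rw [coe_cw, coe_cw, hE, ← Complex.exp_add, ← Complex.exp_add]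
      congr 1; push_cast; ring
    have hEi : Complex.exp ((u / 2 : ℝ) * I) = E⁻¹ := by rw [hE, Complex.exp_neg, inv_inv]
    have hc : ((Real.cos (u / 2) : ℝ) : ℂ) = (E⁻¹ + E) / 2 := by
      rw [Complex.ofReal_cos, Complex.cos, hEi, hE, neg_mul]
    have hs : ((Real.sin (u / 2) : ℝ) : ℂ) = (E - E⁻¹) * I / 2 := by
      rw [Complex.ofReal_sin, Complex.sin, hEi, hE, neg_mul]
    have hs0 : (E - E⁻¹) * I / 2 ≠ 0 := by rw [← hs]; exact_mod_cast hu
    have h2 : E - E⁻¹ ≠ 0 := fun h => hs0 (by rw [h]; ring)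
    have h3 : (1 : ℂ) - E * E ≠ 0 := fun h => h2 (by field_simp; linear_combination -h)
    have hv : (cw s : ℂ) ≠ 0 := Circle.coe_ne_zero _
    rw [Complex.ofReal_div, hc, hs, h1, div_eq_div_iff (by
      intro h; apply h3; apply mul_left_cancel₀ hv; linear_combination h) hs0]
    have hEE : E * E⁻¹ = 1 := mul_inv_cancel₀ hE0
    have hI := Complex.I_sq
    linear_combination (1 / 2 * cw s * (1 + E * E) * (E - E⁻¹)) * hI
      + E * (cw s : ℂ) * hEE
  rw [xcoord, h, Complex.ofReal_re]

lemma cot_half_lt {u u' : ℝ} (h0 : 0 < u) (h : u < u') (h' : u' < 2 * Real.pi) :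
    Real.cos (u' / 2) / Real.sin (u' / 2) < Real.cos (u / 2) / Real.sin (u / 2) := by
  have s1 := Real.sin_pos_of_pos_of_lt_pi (x := u / 2) (by linarith) (by linarith)
  have s2 := Real.sin_pos_of_pos_of_lt_pi (x := u' / 2) (by linarith) (by linarith)
  have s3 := Real.sin_pos_of_pos_of_lt_pi (x := u' / 2 - u / 2) (by linarith) (by linarith)
  rw [Real.sin_sub] at s3
  rw [div_lt_div_iff₀ s2 s1]
  linarith

lemma xcoord_cw_lt {s u u' : ℝ} (h0 : 0 < u) (h : u < u') (h' : u' < 2 * Real.pi) :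
    xcoord (cw s) (cw (s + u')) < xcoord (cw s) (cw (s + u)) := by
  have s1 := Real.sin_pos_of_pos_of_lt_pi (x := u / 2) (by linarith) (by linarith)
  have s2 := Real.sin_pos_of_pos_of_lt_pi (x := u' / 2) (by linarith) (by linarith)
  rw [xcoord_cw s1.ne', xcoord_cw s2.ne']
  exact cot_half_lt h0 h h'

lemma xcoord_cw_le {s u u' : ℝ} (h0 : 0 < u) (h : u ≤ u') (h' : u' < 2 * Real.pi) :
    xcoord (cw s) (cw (s + u')) ≤ xcoord (cw s) (cw (s + u)) := by
  rcases h.eq_or_lt with rfl | h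
  · exact le_rfl
  · exact (xcoord_cw_lt h0 h h').le

/-- At a fixed point without dilation the eigenvalue `den G v` is real of modulus 1, so the trace is
±2; β ≠ 0 excludes scalar matrices. -/
lemma isParabolic_of_fixed {G : SL(2, ℝ)} {v : Circle} (hG : circleMap G v = v)
    (hd : ‖den G v‖ = 1) (hb : coeffBeta G ≠ 0) :
    (Matrix.SpecialLinearGroup.toGL G).IsParabolic := by
  have h1 := circleMap_mul_den G v
  rw [hG] at h1
  have h2 : den G v = starRingEnd ℂ (den G v) := mul_left_cancel₀ (Circle.coe_ne_zero v) h1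
  have h3 : den G v * den G v = 1 := by
    have h : den G v * starRingEnd ℂ (den G v) = 1 := by
      rw [Complex.mul_conj, Complex.normSq_eq_norm_sq, hd]; norm_num
    rwa [← h2] at h
  have h4 : coeffAlpha G * v + starRingEnd ℂ (coeffBeta G) = den G v * v := by
    have : (circleMap G v : ℂ) = v := by rw [hG]
    rw [coe_circleMap, discMap, div_eq_iff (den_ne_zero G v)] at this
    linear_combination this
  have h5 : coeffBeta G * v + starRingEnd ℂ (coeffAlpha G) = den G v := rfl
  have h6 := det_coeff G
  have h7 : den G v * (coeffAlpha G + starRingEnd ℂ (coeffAlpha G)) = 2 := by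
    refine mul_right_cancel₀ (Circle.coe_ne_zero v) ?_
    linear_combination v * h6 + v * h3 - (starRingEnd ℂ (coeffAlpha G) - den G v) * h4 +
      starRingEnd ℂ (coeffBeta G) * h5
  have h8 : (coeffAlpha G + starRingEnd ℂ (coeffAlpha G)) ^ 2 = 4 := by
    linear_combination (den G v * (coeffAlpha G + starRingEnd ℂ (coeffAlpha G)) + 2) * h7 -
      (coeffAlpha G + starRingEnd ℂ (coeffAlpha G)) ^ 2 * h3
  have h9 : coeffAlpha G + starRingEnd ℂ (coeffAlpha G) = ((G 0 0 + G 1 1 : ℝ) : ℂ) := by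
    simp only [coeffAlpha, map_div₀, map_add, map_mul, Complex.conj_ofReal, Complex.conj_I,
      map_ofNat]
    ring
  rw [h9] at h8
  refine ⟨?_, ?_⟩
  · rintro ⟨r, hr⟩
    apply hb
    have e0 : G 0 0 = r := by simpa using (congr_fun₂ hr 0 0).symm
    have e1 : G 1 1 = r := by simpa using (congr_fun₂ hr 1 1).symm
    have e2 : G 0 1 = 0 := by simpa using (congr_fun₂ hr 0 1).symm
    have e3 : G 1 0 = 0 := by simpa using (congr_fun₂ hr 1 0).symm
    simp [coeffBeta, e0, e1, e2, e3]
  · have e1 : (G 0 0 + G 1 1) ^ 2 = 4 := by exact_mod_cast h8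
    have e2 : G.1.det = 1 := G.2
    rw [Matrix.discr_fin_two, Matrix.SpecialLinearGroup.toGL]
    change (G.1.trace) ^ 2 - 4 * G.1.det = 0
    rw [e2, Matrix.trace_fin_two]
    linarith

end BowenSeries

/-! ### Translation lengths of the side pairings and of cuspidal words. -/

namespace BowenSeries

namespace LabelledIdealPolygon

open Complex MeasureTheory Set

variable {Γ₀ : Subgroup SL(2, ℝ)} {𝒜 : Type*} (Ω : LabelledIdealPolygon Γ₀ 𝒜)

/-- The cotangent of half of the angular half width of `[a]`. -/
def ct (a : 𝒜) : ℝ := xcoord (Ω.xiL a) (Ω.xiR a)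

/-- The sign of a type. -/
def sgn (e : Bool) : ℝ := if e then 1 else -1

lemma sgn_sq (e : Bool) : sgn e ^ 2 = 1 := by cases e <;> simp [sgn]

lemma sgn_not (e : Bool) : sgn (!e) = -sgn e := by cases e <;> simp [sgn]

lemma ct_eq (a : 𝒜) : Ω.ct a = xcoord (cw (Ω.lo a)) (cw (Ω.lo a + (Ω.hi a - Ω.lo a))) := by
  rw [add_sub_cancel]; rfl

lemma ct_pos (a : 𝒜) : 0 < Ω.ct a := by
  have h1 := Ω.lo_lt_hi a
  have h2 := Ω.hi_sub_lo_lt_pi a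
  have hs := Real.sin_pos_of_pos_of_lt_pi (x := (Ω.hi a - Ω.lo a) / 2) (by linarith)
    (by linarith [Real.pi_pos])
  have hc := Real.cos_pos_of_mem_Ioo (x := (Ω.hi a - Ω.lo a) / 2)
    ⟨by linarith [Real.pi_pos], by linarith⟩
  rw [ct_eq, xcoord_cw hs.ne']
  exact div_pos hc hs

/-- F_a has derivative 1 at both ends of [â], so the chords of [â] and of [a] have equal length. -/
lemma ct_hat (a : 𝒜) : Ω.ct (Ω.hat a) = Ω.ct a := by
  have h1 := one_add_xcoord_sq (Ω.xiL_ne_xiR a).symm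
  have h2 := one_add_xcoord_sq (Ω.xiL_ne_xiR (Ω.hat a)).symm
  have h3 : dist (Ω.xiR a) (Ω.xiL a) = dist (Ω.xiR (Ω.hat a)) (Ω.xiL (Ω.hat a)) := by
    have e1 := Ω.norm_den_F_vtx true a
    have e2 := Ω.norm_den_F_vtx false a
    simp only [vtx, if_true, Bool.false_eq_true, if_false] at e1 e2
    have h := dist_circleMap (Ω.F a) (Ω.xiL (Ω.hat a)) (Ω.xiR (Ω.hat a))
    rw [circleMap_F_xiL, circleMap_F_xiR, e1, e2] at h
    rw [h, dist_comm]; simp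
  rw [← h3, ← h1] at h2
  change 1 + Ω.ct (Ω.hat a) ^ 2 = 1 + Ω.ct a ^ 2 at h2
  nlinarith [Ω.ct_pos a, Ω.ct_pos (Ω.hat a)]

lemma sgn_mul_xcoord_vtx (e : Bool) (a : 𝒜) :
    sgn e * xcoord (Ω.vtx e a) (Ω.vtx (!e) a) = -Ω.ct a := by
  cases e
  · simp [sgn, vtx, ct]
  · simp [sgn, vtx, ct, xcoord_symm (Ω.xiL a : ℂ) (Ω.xiR a)]

/-- The translation is read off at the other end point of [â], whose coordinate, up to the sign of
the type, changes from `ct` to its negative. -/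
lemma shift_F (e : Bool) (a : 𝒜) :
    sgn e * shift (Ω.F a) (Ω.vtx (!e) (Ω.hat a)) = -(2 * Ω.ct a) := by
  have hne : ((Ω.vtx e (Ω.hat a) : Circle) : ℂ) ≠ Ω.vtx (!e) (Ω.hat a) := fun h =>
    Ω.vtx_ne e _ (Circle.ext h)
  have h := xcoord_circleMap (Ω.norm_den_F_vtx (!e) a) (den_ne_zero (Ω.F a) (Ω.vtx e (Ω.hat a))) hne
  have h1 := Ω.circleMap_F_vtx (!e) a
  rw [Bool.not_not] at h1
  rw [← coe_circleMap, ← coe_circleMap, circleMap_F_vtx, h1] at h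
  have h2 := Ω.sgn_mul_xcoord_vtx e a
  have h3 := Ω.sgn_mul_xcoord_vtx (!e) (Ω.hat a)
  rw [Bool.not_not, sgn_not, ct_hat] at h3
  rw [h] at h2
  linarith

variable [Finite 𝒜]

/-! ### Words of right and left type -/

/-- The word of right or left type with `n` letters and first letter `a`. -/
def sideWord (e : Bool) (a : 𝒜) (n : ℕ) : List 𝒜 := List.iterate (Ω.step e) a n

lemma sideWord_succ (e : Bool) (a : 𝒜) (n : ℕ) :
    Ω.sideWord e a (n + 1) = a :: Ω.sideWord e (Ω.step e a) n := rfl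

lemma sideWord_succ' (e : Bool) (a : 𝒜) (n : ℕ) :
    Ω.sideWord e a (n + 1) = Ω.sideWord e a n ++ [(Ω.step e)^[n] a] := by
  rw [sideWord, List.iterate_add]; rfl

lemma length_sideWord (e : Bool) (a : 𝒜) (n : ℕ) : (Ω.sideWord e a n).length = n :=
  List.length_iterate _ _ _

lemma isSide_sideWord (e : Bool) (a : 𝒜) (n : ℕ) : Ω.IsSide e (Ω.sideWord e a n) := by
  induction n generalizing a with
  | zero => exact List.isChain_nil
  | succ n ih =>
    cases n with
    | zero => exact List.isChain_singleton _
    | succ n => exact List.isChain_cons_cons.2 ⟨rfl, ih _⟩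

lemma eq_sideWord {e : Bool} {a : 𝒜} {V : List 𝒜} (h : Ω.IsSide e (a :: V)) :
    a :: V = Ω.sideWord e a (V.length + 1) := by
  induction V generalizing a with
  | nil => rfl
  | cons b V ih =>
    obtain ⟨hb, h'⟩ := List.isChain_cons_cons.1 h
    rw [List.length_cons, sideWord_succ, ← hb, ← ih h']

/-- The translation length of the word of given type. -/
def sideShift (e : Bool) (a : 𝒜) (n : ℕ) : ℝ := ∑ k ∈ Finset.range n, 2 * Ω.ct ((Ω.step e)^[k] a)

/-- By `vtx_step` every letter acts at the vertex reached by the preceding ones and does not dilate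
there, so the translations add. They have the same sign and cannot cancel. -/
lemma sideWord_spec (e : Bool) (a : 𝒜) (n : ℕ) :
    circleMap (Ω.word (Ω.sideWord e a n)) (Ω.vtx e ((Ω.step e)^[n] a)) = Ω.vtx e a ∧
    ‖den (Ω.word (Ω.sideWord e a n)) (Ω.vtx e ((Ω.step e)^[n] a))‖ = 1 ∧
    sgn e * shift (Ω.word (Ω.sideWord e a n)) (Ω.vtx e ((Ω.step e)^[n] a)) =
      -Ω.sideShift e a n := by
  induction n generalizing a with
  | zero =>
    simp [sideWord, word, circleMap_one, den_one, shift, coeffBeta_one, sideShift]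
  | succ n ih =>
    obtain ⟨h1, h2, h3⟩ := ih (Ω.step e a)
    rw [sideWord_succ, word_cons, Function.iterate_succ_apply]
    have h4 : ‖den (Ω.F a) (Ω.vtx e (Ω.step e a))‖ = 1 := by rw [vtx_step, norm_den_F_vtx]
    refine ⟨?_, ?_, ?_⟩
    · rw [circleMap_mul, h1, vtx_step, circleMap_F_vtx]
    · rw [den_mul_circle, norm_mul, h1, h2, h4, one_mul]
    · rw [shift_mul _ _ h2 (by rw [h1, h4]), h1, mul_add, h3, vtx_step, shift_F, sideShift,
        sideShift, Finset.sum_range_succ']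
      simp only [Function.iterate_succ_apply, Function.iterate_zero, id]
      ring

lemma sideShift_pos (e : Bool) (a : 𝒜) {n : ℕ} (hn : n ≠ 0) : 0 < Ω.sideShift e a n :=
  Finset.sum_pos (fun k _ => by linarith [Ω.ct_pos ((Ω.step e)^[k] a)])
    (Finset.nonempty_range_iff.2 hn)

lemma exists_ct_bounds : ∃ c C : ℝ, 0 < c ∧ 0 < C ∧ ∀ a, c ≤ Ω.ct a ∧ Ω.ct a ≤ C := by
  rcases isEmpty_or_nonempty 𝒜 with h | h
  · exact ⟨1, 1, one_pos, one_pos, fun a => h.elim a⟩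
  · obtain ⟨a, ha⟩ := Finite.exists_min Ω.ct
    obtain ⟨b, hb⟩ := Finite.exists_max Ω.ct
    exact ⟨Ω.ct a, Ω.ct b, Ω.ct_pos a, Ω.ct_pos b, fun d => ⟨ha d, hb d⟩⟩

lemma isParabolic_period (e : Bool) (a : 𝒜) {n : ℕ} (hn : n ≠ 0) (h : (Ω.step e)^[n] a = a) :
    (Matrix.SpecialLinearGroup.toGL (Ω.word (Ω.sideWord e a n))).IsParabolic ∧
      circleMap (Ω.word (Ω.sideWord e a n)) (Ω.vtx e a) = Ω.vtx e a := by
  obtain ⟨h1, h2, h3⟩ := Ω.sideWord_spec e a n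
  rw [h] at h1 h2 h3
  refine ⟨isParabolic_of_fixed h1 h2 fun hb => ?_, h1⟩
  have := Ω.sideShift_pos e a hn
  rw [shift, hb, mul_zero, Complex.zero_re, mul_zero] at h3
  linarith

lemma exists_step_period (e : Bool) : ∃ N ≠ 0, ∀ a, (Ω.step e)^[N] a = a := by
  refine ⟨orderOf (Ω.step e), (orderOf_pos _).ne', fun a => ?_⟩
  rw [← Equiv.Perm.coe_pow, pow_orderOf_eq_one]; rfl

/-- Conversely, `step e` is a permutation of a finite set, so a word of type e is prolonged
periodically. After a full period the vertex is fixed with a nonzero translation, hence the element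
is parabolic; the multiple `N * (V.length + 1)` of the period is long enough to contain the word. -/
lemma isCuspidal_iff (W : List 𝒜) : Ω.IsCuspidal W ↔ W ≠ [] ∧ ∃ e, Ω.IsSide e W := by
  refine ⟨fun h => ⟨h.1, Ω.exists_isSide_of_isCuspidal h⟩, fun ⟨hne, e, he⟩ => ⟨hne, ?_⟩⟩
  obtain ⟨a, V, rfl⟩ := List.exists_cons_of_ne_nil hne
  obtain ⟨N, hN, hper⟩ := Ω.exists_step_period e
  have hper' : ∀ m, (Ω.step e)^[N * m] a = a := fun m => by
    rw [Function.iterate_mul]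
    exact Function.iterate_fixed (hper a) m
  obtain ⟨h1, h2⟩ := Ω.isParabolic_period e a (n := N * (V.length + 1)) (by simp [hN]) (hper' _)
  obtain ⟨b, hb⟩ := Ω.exists_vtx_eq_xiL e a
  refine ⟨Ω.sideWord e a (N * (V.length + 1)), ?_, ?_, h1, b, hb ▸ h2⟩
  · rw [Ω.eq_sideWord he, List.prefix_iff_eq_take, sideWord, sideWord, List.take_iterate,
      List.length_iterate, min_eq_left]
    exact Nat.le_mul_of_pos_left _ (Nat.pos_of_ne_zero hN)
  · refine List.IsChain.imp (fun c d h => ?_) (Ω.isSide_sideWord e a _)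
    rw [h]; exact Ω.step_ne_hat e c

lemma isCuspidal_iff_exists (W : List 𝒜) :
    Ω.IsCuspidal W ↔ ∃ e a n, W = Ω.sideWord e a (n + 1) := by
  rw [isCuspidal_iff]
  constructor
  · rintro ⟨hne, e, he⟩
    obtain ⟨a, V, rfl⟩ := List.exists_cons_of_ne_nil hne
    exact ⟨e, a, V.length, Ω.eq_sideWord he⟩
  · rintro ⟨e, a, n, rfl⟩
    exact ⟨by simp [sideWord_succ], e, Ω.isSide_sideWord e a _⟩

/-- A word with one letter has both types, so the separate condition for m = 0 merges with those for
left and right words. -/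
lemma allowed_append_iff (V : List 𝒜) (b c : 𝒜) : Ω.Allowed (V ++ [b]) c ↔
    c ≠ Ω.hat b ∧ ∀ e, Ω.IsSide e (V ++ [b]) → c ≠ Ω.step e b := by
  have hlast : (V ++ [b]).getLast? = some b := by simp
  simp only [Allowed, hlast, Option.some.injEq, exists_eq_left', isLeft_iff, isRight_iff,
    ← eq_step_true_iff, ← eq_step_false_iff]
  refine and_congr_right fun _ => ?_
  rw [Bool.forall_bool]
  rcases Nat.lt_or_ge (V ++ [b]).length 2 with h | h
  · have hV : V = [] := by
      simp only [List.length_append, List.length_singleton] at h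
      exact List.length_eq_zero_iff.1 (by omega)
    subst hV
    simp [IsSide]
  · have h1 : (V ++ [b]).length ≠ 1 := by omega
    simp only [h, true_and, h1, false_implies]

/-- A cuspidal word may be followed by another one exactly where it cannot be prolonged as a
cuspidal word. This dichotomy makes the transfer of integrals telescope. -/
lemma allowed_append_iff_not_isCuspidal (V : List 𝒜) (b c : 𝒜) : Ω.Allowed (V ++ [b]) c ↔
    c ≠ Ω.hat b ∧ ¬ Ω.IsCuspidal (V ++ [b] ++ [c]) := by
  rw [allowed_append_iff, isCuspidal_iff]
  refine and_congr_right fun _ => ?_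
  have : ∀ e, Ω.IsSide e (V ++ [b] ++ [c]) ↔ Ω.IsSide e (V ++ [b]) ∧ c = Ω.step e b := by
    intro e
    rw [IsSide, IsSide, List.isChain_append]
    simp
  simp only [this]
  push Not
  simp

lemma allowed_sideWord {e : Bool} {a c : 𝒜} {n : ℕ} (h : Ω.Allowed (Ω.sideWord e a (n + 1)) c) :
    c ≠ Ω.hat ((Ω.step e)^[n] a) ∧ c ≠ Ω.step e ((Ω.step e)^[n] a) ∧
      (n = 0 → c ≠ Ω.step (!e) a) := by
  rw [sideWord_succ', allowed_append_iff, ← sideWord_succ'] at h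
  refine ⟨h.1, h.2 e (Ω.isSide_sideWord e a _), ?_⟩
  rintro rfl
  exact h.2 (!e) (List.isChain_singleton _)

/-! ### Estimates on the domain of a cuspidal word -/

omit [Finite 𝒜] in
-- Clockwise from the vertex the coordinate decreases from +∞ to -∞. Outside of the two arcs that
-- meet at the vertex it lies between its values at their far ends.
lemma xcoord_bounds {p q : 𝒜} (hpq : Ω.succ p = q) {ξ : Circle} (hp : ξ ∉ Ω.arc p)
    (hq : ξ ∉ Ω.arc q) : ξ ≠ Ω.xiL q ∧
    -Ω.ct p ≤ xcoord (Ω.xiL q) ξ ∧ xcoord (Ω.xiL q) ξ ≤ Ω.ct q := by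
  obtain ⟨t, ht, rfl⟩ := exists_cw ξ (Ω.lo q)
  obtain ⟨u, rfl⟩ : ∃ u, t = Ω.lo q + u := ⟨t - Ω.lo q, by ring⟩
  have hpi := Real.pi_pos
  have h1 : Ω.hi q - Ω.lo q ≤ u := by
    by_contra! h
    exact hq ⟨_, ⟨ht.1, by linarith⟩, rfl⟩
  have h2 : u < 2 * Real.pi - (Ω.hi p - Ω.lo p) := by
    by_contra! h
    have h3 := Ω.xiL_succ p
    rw [hpq] at h3
    obtain ⟨k, hk⟩ := cw_eq_cw.1 h3
    refine hp ⟨Ω.lo q + u + ((-k - 1 : ℤ) : ℝ) * (2 * Real.pi), ⟨?_, ?_⟩, cw_add_int _ _⟩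
    · push_cast; linarith
    · push_cast; linarith [ht.2]
  have hlq := Ω.lo_lt_hi q
  have hlp := Ω.lo_lt_hi p
  have hwp := Ω.hi_sub_lo_lt_pi p
  refine ⟨fun h => hq (h ▸ Ω.xiL_mem_arc q), ?_, ?_⟩
  · have h3 : xcoord (cw (Ω.lo q)) (cw (Ω.lo q + (2 * Real.pi - (Ω.hi p - Ω.lo p)))) = -Ω.ct p := by
      rw [ct, xiL_eq, xiR_eq, ← xcoord_symm]
      have e1 : cw (Ω.lo q) = cw (Ω.hi p) := by
        have := Ω.xiL_succ p; rw [hpq] at this; exact this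
      rw [e1]
      congr 2
      obtain ⟨k, hk⟩ := cw_eq_cw.1 e1
      rw [hk, ← cw_add_int (Ω.lo p) (k + 1)]
      congr 1; push_cast; ring
    rw [← h3, xiL_eq]
    exact xcoord_cw_le (by linarith) h2.le (by linarith)
  · rw [ct_eq, xiL_eq]
    exact xcoord_cw_le (by linarith) h1 (by linarith)

lemma sgn_xcoord_bounds (e : Bool) {b : 𝒜} {ξ : Circle} (h1 : ξ ∉ Ω.arc (Ω.hat b))
    (h2 : ξ ∉ Ω.arc (Ω.step e b)) : ξ ≠ Ω.vtx (!e) (Ω.hat b) ∧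
    -Ω.ct (Ω.step e b) ≤ sgn e * xcoord (Ω.vtx (!e) (Ω.hat b)) ξ ∧
    sgn e * xcoord (Ω.vtx (!e) (Ω.hat b)) ξ ≤ Ω.ct b := by
  rw [← Ω.ct_hat b]
  cases e
  · obtain ⟨h3, h4, h5⟩ := Ω.xcoord_bounds rfl h1 h2
    rw [xiL_succ] at h3 h4 h5
    simp only [vtx, sgn, Bool.not_false, if_true, Bool.false_eq_true, if_false, neg_mul, one_mul]
    exact ⟨h3, neg_le_neg h5, by linarith⟩
  · obtain ⟨h3, h4, h5⟩ := Ω.xcoord_bounds (Ω.succ_step_true b) h2 h1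
    simp only [vtx, sgn, Bool.not_true, if_true, Bool.false_eq_true, if_false, one_mul]
    exact ⟨h3, h4, h5⟩

/-- A point which is moreover outside of the other neighbour of `[b̂]`. -/
lemma exists_gap (b : 𝒜) : ∃ g > 0, ∀ ξ : Circle, ξ ∉ Ω.arc (Ω.hat b) →
    ξ ∉ Ω.arc (Ω.step true b) → ξ ∉ Ω.arc (Ω.step false b) →
    xcoord (Ω.xiL (Ω.hat b)) ξ ≤ Ω.ct b - g := by
  have hL := Ω.xiL_succ (Ω.hat b)
  set q := Ω.hat b with hq
  set r := Ω.succ q with hr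
  have w1 := Ω.lo_lt_hi q
  have w2 := Ω.lo_lt_hi r
  have w3 := Ω.hi_sub_lo_lt_pi q
  have w4 := Ω.hi_sub_lo_lt_pi r
  have hpi := Real.pi_pos
  -- The gap is the drop of the coordinate across the arc that follows [b̂].
  refine ⟨Ω.ct b - xcoord (cw (Ω.lo q))
    (cw (Ω.lo q + ((Ω.hi q - Ω.lo q) + (Ω.hi r - Ω.lo r)))), ?_, ?_⟩
  · rw [← Ω.ct_hat b, ← hq, ct_eq]
    exact sub_pos.2 (xcoord_cw_lt (by linarith) (by linarith) (by linarith))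
  · intro ξ h1 h2 h3
    change ξ ∉ Ω.arc r at h3
    rw [sub_sub_cancel]
    obtain ⟨t, ht, rfl⟩ := exists_cw ξ (Ω.lo q)
    obtain ⟨u, rfl⟩ : ∃ u, t = Ω.lo q + u := ⟨t - Ω.lo q, by ring⟩
    have h4 : Ω.hi q - Ω.lo q ≤ u := by
      by_contra! h
      exact h1 ⟨_, ⟨ht.1, by linarith⟩, rfl⟩
    have h5 : (Ω.hi q - Ω.lo q) + (Ω.hi r - Ω.lo r) ≤ u := by
      by_contra! h
      obtain ⟨k, hk⟩ := cw_eq_cw.1 hL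
      exact h3 ⟨Ω.lo q + u + (k : ℝ) * (2 * Real.pi), ⟨by linarith, by linarith⟩, cw_add_int _ _⟩
    exact xcoord_cw_le (by linarith) h5 (by linarith [ht.2])

/-- The derivative of a cuspidal word with `n` letters is comparable to `n⁻²` on its domain. -/
lemma exists_den_bounds : ∃ c C : ℝ, 0 < c ∧ 0 < C ∧ ∀ (a : 𝒜), ∀ W ∈ Ω.words a, ∀ ξ ∈ Ω.arc a,
    1 + c * (W.length : ℝ) ^ 2 ≤ ‖den (Ω.word W) ξ‖ ^ 2 ∧
    ‖den (Ω.word W) ξ‖ ≤ C * W.length ∧ ‖coeffBeta (Ω.word W)‖ ≤ C * W.length ∧ 1 ≤ W.length := by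
  obtain ⟨c₀, C₀, hc₀, hC₀, hct⟩ := Ω.exists_ct_bounds
  choose g hg0 hg using Ω.exists_gap
  obtain ⟨g₀, hg₀, hgg⟩ : ∃ g₀ > 0, ∀ b, g₀ ≤ g b := by
    rcases isEmpty_or_nonempty 𝒜 with h | h
    · exact ⟨1, one_pos, fun a => h.elim a⟩
    · obtain ⟨b, hb⟩ := Finite.exists_min g
      exact ⟨g b, hg0 b, hb⟩
  set κ := min c₀ g₀ with hκ
  have hκ0 : 0 < κ := lt_min hc₀ hg₀
  have hκc : κ ≤ c₀ := min_le_left _ _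
  have hκg : κ ≤ g₀ := min_le_right _ _
  refine ⟨κ ^ 2 / (1 + C₀ ^ 2), 2 * (1 + 2 * C₀), by positivity, by positivity, ?_⟩
  rintro a W ⟨hW, hall⟩ ξ hξ
  -- A word with one letter has both types; it is regarded as a right one, to which `exists_gap`
  -- applies.
  obtain ⟨e, d, n, rfl, hn0⟩ : ∃ e d n, W = Ω.sideWord e d (n + 1) ∧ (n = 0 → e = true) := by
    obtain ⟨e, d, n, rfl⟩ := (Ω.isCuspidal_iff_exists W).1 hW
    cases n with
    | zero => exact ⟨true, d, 0, rfl, fun _ => rfl⟩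
    | succ n => exact ⟨e, d, n + 1, rfl, fun h => absurd h (Nat.succ_ne_zero n)⟩
  obtain ⟨-, s2, s3⟩ := Ω.sideWord_spec e d (n + 1)
  obtain ⟨a1, a2, a3⟩ := Ω.allowed_sideWord hall
  rw [Function.iterate_succ_apply', vtx_step] at s2 s3
  rw [length_sideWord]
  set b := (Ω.step e)^[n] d with hb
  set G := Ω.word (Ω.sideWord e d (n + 1)) with hG
  set t := Ω.sideShift e d (n + 1) with ht
  have m1 : ξ ∉ Ω.arc (Ω.hat b) := fun h => a1 (eq_of_mem_arc hξ h)
  have m2 : ξ ∉ Ω.arc (Ω.step e b) := fun h => a2 (eq_of_mem_arc hξ h)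
  obtain ⟨y0, y1, y2⟩ := Ω.sgn_xcoord_bounds e m1 m2
  set v := Ω.vtx (!e) (Ω.hat b) with hv
  have hn : (0 : ℝ) ≤ n := Nat.cast_nonneg n
  -- The contribution of the last letter is kept exactly, because on the domain the coordinate
  -- itself is only bounded by `Ω.ct b`.
  have t1 : 2 * c₀ * n + 2 * Ω.ct b ≤ t := by
    rw [ht, sideShift, Finset.sum_range_succ, ← hb]
    have : ∑ k ∈ Finset.range n, 2 * c₀ ≤
        ∑ k ∈ Finset.range n, 2 * Ω.ct ((Ω.step e)^[k] d) :=
      Finset.sum_le_sum fun k _ => by linarith [(hct ((Ω.step e)^[k] d)).1]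
    rw [Finset.sum_const, Finset.card_range, nsmul_eq_mul] at this
    linarith
  have t2 : t ≤ 2 * C₀ * (n + 1) := by
    rw [ht, sideShift]
    have : ∑ k ∈ Finset.range (n + 1), 2 * Ω.ct ((Ω.step e)^[k] d) ≤
        ∑ k ∈ Finset.range (n + 1), 2 * C₀ :=
      Finset.sum_le_sum fun k _ => by linarith [(hct ((Ω.step e)^[k] d)).2]
    rw [Finset.sum_const, Finset.card_range, nsmul_eq_mul] at this
    push_cast at this
    linarith
  have hform : ∀ z : Circle, z ≠ v → ‖den G z‖ ^ 2 =
      (1 + (sgn e * xcoord v z - t) ^ 2) / (1 + (sgn e * xcoord v z) ^ 2) := by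
    intro z hz
    have e1 := sgn_sq e
    have e2 : sgn e * xcoord v z - t = sgn e * (xcoord v z + shift G v) := by linarith
    rw [norm_den_sq s2 hz, e2, mul_pow, mul_pow, e1, one_mul, one_mul]
  have t0 : 0 < t := Ω.sideShift_pos e d (Nat.succ_ne_zero n)
  have hupper : ∀ z : Circle, ‖den G z‖ ≤ 2 * (1 + t) := by
    intro z
    rcases eq_or_ne z v with rfl | hz
    · rw [s2]; linarith
    · refine le_of_sq_le_sq ?_ (by positivity)
      rw [hform z hz, div_le_iff₀ (by positivity)]
      nlinarith [sq_nonneg (sgn e * xcoord v z + t), sq_nonneg (sgn e * xcoord v z),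
        mul_nonneg (sq_nonneg (sgn e * xcoord v z)) (sq_nonneg t),
        mul_nonneg (sq_nonneg (sgn e * xcoord v z)) t0.le]
  have hD : 2 * (1 + t) ≤ 2 * (1 + 2 * C₀) * ((n + 1 : ℕ) : ℝ) := by push_cast; nlinarith
  refine ⟨?_, (hupper ξ).trans hD, ?_, by omega⟩
  · rw [hform ξ y0]
    set y := sgn e * xcoord v ξ with hy
    -- Since ‖den‖² - 1 = t (t - 2y) / (1 + y²), a lower bound for t - 2y is needed. With n ≥ 1 the
    -- earlier letters provide it; with n = 0 the right side of t1 only gives t - 2y ≥ 0, and the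
    -- gap is used.
    have hty : κ * (n + 1) ≤ t - 2 * y := by
      rcases Nat.eq_zero_or_pos n with h0 | h0
      · have he := hn0 h0
        subst he
        have hbd : b = d := by rw [hb, h0]; rfl
        have h3 : ξ ∉ Ω.arc (Ω.step false b) := fun h => a3 h0 (by
          rw [hbd] at h; exact eq_of_mem_arc hξ h)
        have h4 := hg b ξ m1 m2 h3
        have h5 : y = xcoord (Ω.xiL (Ω.hat b)) ξ := by
          rw [hy, hv]; simp [sgn, vtx]
        rw [← h5] at h4
        rw [h0] at t1 ⊢
        have := hgg b
        push_cast at t1 ⊢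
        linarith
      · have h1n : (1 : ℝ) ≤ n := by exact_mod_cast h0
        nlinarith
    have htn : κ * (n + 1) ≤ t := by nlinarith [(hct b).1]
    have hy2 : y ^ 2 ≤ C₀ ^ 2 := sq_le_sq' (by linarith [(hct (Ω.step e b)).2])
      (y2.trans (hct b).2)
    have h6 : κ * (n + 1) * (κ * (n + 1)) ≤ t * (t - 2 * y) :=
      mul_le_mul htn hty (by positivity) t0.le
    rw [le_div_iff₀ (by positivity)]
    have h7 : κ ^ 2 / (1 + C₀ ^ 2) * (1 + y ^ 2) ≤ κ ^ 2 := by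
      rw [div_mul_eq_mul_div, div_le_iff₀ (by positivity)]
      nlinarith [sq_nonneg κ]
    push_cast
    nlinarith [mul_le_mul_of_nonneg_right h7 (by positivity : (0 : ℝ) ≤ ((n : ℝ) + 1) ^ 2)]
  -- The coefficient β is recovered from the values of the affine function `den` at the antipodal
  -- points v and -v.
  · have h1 := den_sub G (v : ℂ) ((-v : Circle) : ℂ)
    have h2 : ‖coeffBeta G * ((v : ℂ) - ((-v : Circle) : ℂ))‖ ≤ 2 * (1 + t) + 2 * (1 + t) := by
      rw [← h1]
      exact (norm_sub_le _ _).trans (add_le_add (hupper _) (hupper _))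
    have h3 : (v : ℂ) - ((-v : Circle) : ℂ) = 2 * v := by rw [Circle.coe_neg]; ring
    rw [h3, norm_mul, norm_mul, Circle.norm_coe] at h2
    norm_num at h2
    linarith

end LabelledIdealPolygon

end BowenSeries

namespace BowenSeries

open Complex MeasureTheory Set

/-! ### Cusps -/

/-- A unipotent upper triangular matrix. -/
def unip (x : ℝ) : SL(2, ℝ) := ⟨!![1, x; 0, 1], by simp [Matrix.det_fin_two]⟩

lemma coe_unip (x : ℝ) : (unip x : Matrix (Fin 2) (Fin 2) ℝ) = !![1, x; 0, 1] := rfl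

lemma continuous_unip : Continuous unip := by
  refine Continuous.subtype_mk ?_ _
  refine continuous_matrix fun i j => ?_
  fin_cases i <;> fin_cases j <;> simp <;> fun_prop

lemma unip_zero : unip 0 = 1 := by
  ext i j; fin_cases i <;> fin_cases j <;> simp [unip]

lemma unip_injective : Function.Injective unip := fun x y h => by
  have := congr_arg (fun G : SL(2, ℝ) => G 0 1) h
  simpa [unip] using this

lemma mul_unip {h : SL(2, ℝ)} (h0 : h 1 0 = 0) (x : ℝ) : h * unip x = unip (h 0 0 ^ 2 * x) * h := by
  have hd : h 0 0 * h 1 1 = 1 := by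
    have := h.det_coe
    rw [Matrix.det_fin_two, h0, mul_zero, sub_zero] at this
    exact this
  refine Subtype.ext ?_
  rw [Matrix.SpecialLinearGroup.coe_mul, Matrix.SpecialLinearGroup.coe_mul, coe_unip, coe_unip,
    Matrix.eta_fin_two (h : Matrix (Fin 2) (Fin 2) ℝ), Matrix.mul_fin_two, Matrix.mul_fin_two]
  congr! 3 <;> try simp [h0]
  linear_combination (-h 0 0 * x) * hd

/-- In the coordinate given by N, an element h fixing infinity rescales the unipotent element by the
square of its diagonal entry. If that square is not 1, conjugating by powers of h or of its inverse
gives nontrivial elements tending to 1, against discreteness. -/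
lemma sq_eq_one_of_discrete {Γ : Subgroup SL(2, ℝ)} [DiscreteTopology Γ] {N h : SL(2, ℝ)} {x : ℝ}
    (hx : x ≠ 0) (hN : N * unip x * N⁻¹ ∈ Γ) (hh : N * h * N⁻¹ ∈ Γ) (h0 : h 1 0 = 0) :
    h 0 0 ^ 2 = 1 := by
  have key : ∀ g : SL(2, ℝ), N * g * N⁻¹ ∈ Γ → g 1 0 = 0 → ¬ g 0 0 ^ 2 < 1 := by
    intro g hg g0 hlt
    have hd : g 0 0 * g 1 1 = 1 := by
      have := g.det_coe
      rw [Matrix.det_fin_two, g0, mul_zero, sub_zero] at this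
      exact this
    have hmem : ∀ n : ℕ, N * unip ((g 0 0 ^ 2) ^ n * x) * N⁻¹ ∈ Γ := by
      intro n
      induction n with
      | zero => simpa using hN
      | succ n ih =>
        have := Γ.mul_mem (Γ.mul_mem hg ih) (Γ.inv_mem hg)
        convert this using 1
        rw [pow_succ', mul_assoc (g 0 0 ^ 2)]
        have e := mul_unip g0 ((g 0 0 ^ 2) ^ n * x)
        have e' : unip (g 0 0 ^ 2 * ((g 0 0 ^ 2) ^ n * x)) =
          g * unip ((g 0 0 ^ 2) ^ n * x) * g⁻¹ := by rw [e]; group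
        rw [e']; group
    have hlim : Filter.Tendsto (fun n : ℕ => N * unip ((g 0 0 ^ 2) ^ n * x) * N⁻¹) Filter.atTop
        (nhds 1) := by
      have h1 : Filter.Tendsto (fun n : ℕ => (g 0 0 ^ 2) ^ n * x) Filter.atTop (nhds 0) := by
        simpa using (tendsto_pow_atTop_nhds_zero_of_lt_one (sq_nonneg _) hlt).mul_const x
      have h2 : Continuous fun y => N * unip y * N⁻¹ :=
        (continuous_const.mul continuous_unip).mul continuous_const
      have h3 := (h2.tendsto 0).comp h1
      simpa [unip_zero, Function.comp_def] using h3
    have hlim' : Filter.Tendsto (fun n : ℕ => (⟨_, hmem n⟩ : Γ)) Filter.atTop (nhds 1) :=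
      tendsto_subtype_rng.2 hlim
    rw [nhds_discrete, Filter.tendsto_pure] at hlim'
    obtain ⟨n, hn⟩ := hlim'.exists
    have h1 : N * unip ((g 0 0 ^ 2) ^ n * x) * N⁻¹ = 1 := congr_arg Subtype.val hn
    have h2 : unip ((g 0 0 ^ 2) ^ n * x) = unip 0 := by
      rw [unip_zero]
      calc unip ((g 0 0 ^ 2) ^ n * x) = N⁻¹ * (N * unip ((g 0 0 ^ 2) ^ n * x) * N⁻¹) * N := by group
        _ = 1 := by rw [h1]; group
    have h3 := unip_injective h2
    have h4 : g 0 0 ≠ 0 := left_ne_zero_of_mul_eq_one hd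
    exact hx ((mul_eq_zero.1 h3).resolve_left (pow_ne_zero _ (pow_ne_zero _ h4)))
  have hd : h 0 0 * h 1 1 = 1 := by
    have := h.det_coe
    rw [Matrix.det_fin_two, h0, mul_zero, sub_zero] at this
    exact this
  refine le_antisymm (not_lt.1 fun hlt => ?_) (not_lt.1 (key h hh h0))
  refine key h⁻¹ ?_ ?_ ?_
  · have := Γ.inv_mem hh
    convert this using 1; group
  · rw [Matrix.SpecialLinearGroup.SL2_inv_expl]; simp [h0]
  · rw [Matrix.SpecialLinearGroup.SL2_inv_expl]
    simp only [Matrix.cons_val', Matrix.cons_val_zero, Matrix.cons_val_fin_one]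
    have e : h 1 1 ^ 2 * h 0 0 ^ 2 = 1 := by rw [← mul_pow, mul_comm, hd, one_pow]
    change h 1 1 ^ 2 < 1
    nlinarith [sq_nonneg (h 1 1)]

lemma atInfinity_mul (G M : SL(2, ℝ)) :
    atInfinity (G * M) = (Matrix.SpecialLinearGroup.toGL G) • atInfinity M := by
  rw [atInfinity, atInfinity, map_mul, mul_smul]

/-- The first column of `M` as a complex number. -/
def col (M : SL(2, ℝ)) : ℂ := (M 0 0 : ℂ) + M 1 0 * I

lemma col_ne_zero (M : SL(2, ℝ)) : col M ≠ 0 := by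
  intro h
  have h1 : M 0 0 = 0 := by simpa [col] using congr_arg Complex.re h
  have h2 : M 1 0 = 0 := by simpa [col] using congr_arg Complex.im h
  have := M.det_coe
  rw [Matrix.det_fin_two, h1, h2] at this
  simp at this

/-- The point 1 of the circle is ∞ in the half plane, so its image depends on the first column only.
-/
lemma discMap_apply_one (M : SL(2, ℝ)) : discMap M 1 = starRingEnd ℂ (col M) / col M := by
  rw [discMap, den]
  congr 1
  · simp only [coeffAlpha, coeffBeta, col, map_div₀, map_add, map_mul, Complex.conj_ofReal, Complex.conj_I,
      map_ofNat]
    push_cast; ring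
  · simp only [coeffAlpha, coeffBeta, col, map_div₀, map_add, map_mul, Complex.conj_ofReal, Complex.conj_I,
      map_ofNat]
    push_cast; ring

lemma cayleyBoundary_atInfinity (M : SL(2, ℝ)) :
    cayleyBoundary (atInfinity M) = circleMap M 1 := by
  have hc := col_ne_zero M
  rw [coe_circleMap, Circle.coe_one, discMap_apply_one, atInfinity, OnePoint.smul_infty_eq_ite]
  change cayleyBoundary (if M 1 0 = 0 then _ else ((M 0 0 / M 1 0 : ℝ) : OnePoint ℝ)) = _
  split_ifs with h
  · change (1 : ℂ) = _
    rw [eq_div_iff hc, col, h]; simp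
  · change (((M 0 0 / M 1 0 : ℝ) : ℂ) - I) / (((M 0 0 / M 1 0 : ℝ) : ℂ) + I) = _
    have h1 : (M 1 0 : ℂ) ≠ 0 := by exact_mod_cast h
    have h2 : ((M 0 0 / M 1 0 : ℝ) : ℂ) + I = col M / M 1 0 := by
      rw [col]; push_cast; field_simp
    have h3 : ((M 0 0 / M 1 0 : ℝ) : ℂ) - I = starRingEnd ℂ (col M) / M 1 0 := by
      rw [col]; simp only [map_add, map_mul, Complex.conj_ofReal, Complex.conj_I]
      push_cast; field_simp; ring
    rw [h2, h3]
    field_simp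

lemma cayleyBoundary_injective : Function.Injective cayleyBoundary := by
  have hne : ∀ x : ℝ, (x : ℂ) + I ≠ 0 := fun x h => by
    have := congr_arg Complex.im h; simp at this
  have key : ∀ x : ℝ, ((x : ℂ) - I) / (x + I) ≠ 1 := fun x h => by
    rw [div_eq_one_iff_eq (hne x)] at h
    have := congr_arg Complex.im h
    norm_num at this
  intro c d h
  cases c with
  | infty =>
    cases d with
    | infty => rfl
    | coe y => exact absurd h.symm (key y)
  | coe x =>
    cases d with
    | infty => exact absurd h (key x)
    | coe y =>
      change ((x : ℂ) - I) / (x + I) = ((y : ℂ) - I) / (y + I) at h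
      rw [div_eq_div_iff (hne x) (hne y)] at h
      have : (x : ℂ) = y := by
        refine mul_left_cancel₀ Complex.I_ne_zero ?_
        linear_combination (1 / 2 : ℂ) * h
      rw [Complex.ofReal_inj.1 this]

lemma atInfinity_eq_iff (M M' : SL(2, ℝ)) :
    atInfinity M = atInfinity M' ↔ circleMap M 1 = circleMap M' 1 := by
  rw [← cayleyBoundary_injective.eq_iff, cayleyBoundary_atInfinity, cayleyBoundary_atInfinity,
    Circle.coe_inj]

lemma exists_circleMap_one_eq (v : Circle) : ∃ M : SL(2, ℝ), circleMap M 1 = v := by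
  obtain ⟨s, -, rfl⟩ := exists_cw v 0
  have hM : ∃ M : SL(2, ℝ), M 0 0 = Real.cos (s / 2) ∧ M 1 0 = Real.sin (s / 2) :=
    ⟨⟨!![Real.cos (s / 2), -Real.sin (s / 2); Real.sin (s / 2), Real.cos (s / 2)], by
      rw [Matrix.det_fin_two_of]; nlinarith [Real.sin_sq_add_cos_sq (s / 2)]⟩, rfl, rfl⟩
  obtain ⟨M, hM0, hM1⟩ := hM
  refine ⟨M, Circle.ext ?_⟩
  · rw [coe_circleMap, Circle.coe_one, discMap_apply_one, div_eq_iff (col_ne_zero _), coe_cw, col,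
      hM0, hM1]
    have h1 : ∀ x : ℝ, ((Real.cos x : ℝ) : ℂ) + (Real.sin x : ℝ) * I = Complex.exp (x * I) := by
      intro x; rw [Complex.exp_mul_I]; push_cast; ring
    have h2 : ∀ x : ℝ, starRingEnd ℂ (((Real.cos x : ℝ) : ℂ) + (Real.sin x : ℝ) * I) =
        Complex.exp (-(x * I)) := by
      intro x
      rw [h1, ← Complex.exp_conj]; simp
    change starRingEnd ℂ (((Real.cos (s / 2) : ℝ) : ℂ) + (Real.sin (s / 2) : ℝ) * I) =
      _ * (((Real.cos (s / 2) : ℝ) : ℂ) + (Real.sin (s / 2) : ℝ) * I)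
    rw [h2, h1, ← Complex.exp_add]
    congr 1; push_cast; ring

lemma col_mul_of_upper (M : SL(2, ℝ)) {h : SL(2, ℝ)} (h0 : h 1 0 = 0) :
    col (M * h) = h 0 0 * col M := by
  simp only [col, Matrix.SpecialLinearGroup.coe_mul, Matrix.mul_apply, Fin.sum_univ_two, h0]
  push_cast; ring

lemma circleMap_one_of_upper {h : SL(2, ℝ)} (hh : circleMap h 1 = 1) : h 1 0 = 0 := by
  have h1 : (circleMap h 1 : ℂ) = 1 := by rw [hh]; rfl
  rw [coe_circleMap, Circle.coe_one, discMap_apply_one, div_eq_one_iff_eq (col_ne_zero h)] at h1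
  have := congr_arg Complex.im h1
  simp [col] at this
  linarith

/-- A point of the circle fixed by a parabolic element of a discrete group determines the scale
of the half plane coordinate. -/
lemma exists_scale {Γ : Subgroup SL(2, ℝ)} (hΓ : DiscreteTopology Γ) {p : ℕ}
    {A : Fin p → SL(2, ℝ)} (hA : IsCuspRepresentatives Γ A) {v : Circle} {g : SL(2, ℝ)}
    (hg : g ∈ Γ) (hp : (Matrix.SpecialLinearGroup.toGL g).IsParabolic) (hv : circleMap g v = v) :
    ∃ m > (0 : ℝ), (∃ B ∈ Γ, ∃ k, circleMap (B * A k) 1 = v) ∧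
      ∀ B ∈ Γ, ∀ k, circleMap (B * A k) 1 = v → ‖col (B * A k)‖ = m := by
  obtain ⟨M, rfl⟩ := exists_circleMap_one_eq v
  have hcusp : IsCusp (atInfinity M) (Γ.map Matrix.SpecialLinearGroup.toGL) := by
    refine ⟨_, ⟨g, hg, rfl⟩, hp, ?_⟩
    rw [← atInfinity_mul, atInfinity_eq_iff, circleMap_mul, hv]
  obtain ⟨k, B, hB, hBk⟩ := (hA.1 _).1 hcusp
  rw [atInfinity_eq_iff] at hBk
  refine ⟨‖col (B * A k)‖, norm_pos_iff.2 (col_ne_zero _), ⟨B, hB, k, hBk.symm⟩, ?_⟩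
  intro B' hB' k' h
  -- Inequivalence of the representatives forces k' = k; then B' A_k and B A_k differ by an upper
  -- triangular h conjugate into Γ, and its diagonal must be shown to be ±1.
  have hC : circleMap (B⁻¹ * B' * A k') 1 = circleMap (A k) 1 := by
    rw [mul_assoc, circleMap_mul, h, hBk, ← circleMap_mul]; group
  obtain rfl : k' = k := hA.2 k' k (B⁻¹ * B') (Γ.mul_mem (Γ.inv_mem hB) hB')
    ((atInfinity_eq_iff _ _).2 hC)
  set N := A k' with hN
  set h := N⁻¹ * (B⁻¹ * B') * N with hh
  have h1 : circleMap h 1 = 1 := by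
    rw [hh, mul_assoc, circleMap_mul, hC, circleMap_inv_apply]
  have h0 := circleMap_one_of_upper h1
  have e1 : B' * N = (B * N) * h := by rw [hh]; group
  set w := (B * N)⁻¹ * g * (B * N) with hw
  have w1 : circleMap w 1 = 1 := by
    rw [hw, mul_assoc, circleMap_mul, circleMap_mul, ← hBk, hv, hBk, circleMap_inv_apply]
  have w0 := circleMap_one_of_upper w1
  have wd : w 0 0 * w 1 1 = 1 := by
    have := w.det_coe
    rw [Matrix.det_fin_two, w0, mul_zero, sub_zero] at this
    exact this
  have wp : (Matrix.SpecialLinearGroup.toGL w).IsParabolic := by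
    rw [hw, map_mul, map_mul, map_inv, Matrix.GeneralLinearGroup.isParabolic_conj_iff']
    exact hp
  obtain ⟨w2, w3⟩ := (Matrix.GeneralLinearGroup.isParabolic_iff_of_upperTriangular w0).1 wp
  change w 0 0 = w 1 1 at w2
  change w 0 1 ≠ 0 at w3
  have w4 : w 0 0 ≠ 0 := left_ne_zero_of_mul_eq_one wd
  -- The conjugate w of the parabolic element has equal diagonal entries ±1; squaring removes the
  -- sign.
  have hsq : w * w = unip (2 * (w 0 0 * w 0 1)) := by
    refine Subtype.ext ?_
    have e11 : w 0 0 * w 0 0 + w 0 1 * w 1 0 = 1 := by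
      rw [w0]; linear_combination wd + w 0 0 * w2
    have e12 : w 0 0 * w 0 1 + w 0 1 * w 1 1 = 2 * (w 0 0 * w 0 1) := by
      linear_combination -w 0 1 * w2
    have e21 : w 1 0 * w 0 0 + w 1 1 * w 1 0 = 0 := by rw [w0]; ring
    have e22 : w 1 0 * w 0 1 + w 1 1 * w 1 1 = 1 := by
      rw [w0]; linear_combination wd - w 1 1 * w2
    rw [Matrix.SpecialLinearGroup.coe_mul, coe_unip]
    conv_lhs => rw [Matrix.eta_fin_two (w : Matrix (Fin 2) (Fin 2) ℝ), Matrix.mul_fin_two]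
    rw [e11, e12, e21, e22]
  have hu : N * unip (2 * (w 0 0 * w 0 1)) * N⁻¹ ∈ Γ := by
    have := Γ.mul_mem (Γ.mul_mem (Γ.inv_mem hB) (Γ.mul_mem hg hg)) hB
    convert this using 1
    rw [← hsq, hw]; group
  have hhm : N * h * N⁻¹ ∈ Γ := by
    have := Γ.mul_mem (Γ.inv_mem hB) hB'
    convert this using 1
    rw [hh]; group
  have h2 := sq_eq_one_of_discrete (by simp [w3, w4]) hu hhm h0
  have habs : |h 0 0| = 1 := by
    rcases eq_or_eq_neg_of_sq_eq_sq (h 0 0) 1 (by rw [h2, one_pow]) with e | e <;> rw [e] <;> simp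
  rw [e1, col_mul_of_upper _ h0, norm_mul, Complex.norm_real, Real.norm_eq_abs, habs, one_mul]

end BowenSeries

/-! ### Sides as vertical lines, and the geometric length. -/

namespace BowenSeries

open Complex MeasureTheory Set

lemma norm_discMap_lt_one (G : SL(2, ℝ)) {z : ℂ} (hz : ‖z‖ < 1) : ‖discMap G z‖ < 1 := by
  have hd := den_ne_zero_of_norm_le_one G hz.le
  rw [discMap, norm_div, div_lt_one (norm_pos_iff.2 hd)]
  refine lt_of_pow_lt_pow_left₀ 2 (norm_nonneg _) ?_
  have key : ((‖den G z‖ ^ 2 - ‖coeffAlpha G * z + starRingEnd ℂ (coeffBeta G)‖ ^ 2 : ℝ) : ℂ) =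
      ((1 - ‖z‖ ^ 2 : ℝ) : ℂ) := by
    push_cast
    rw [← Complex.mul_conj', ← Complex.mul_conj', ← Complex.mul_conj', den]
    simp only [map_add, map_mul, Complex.conj_conj]
    linear_combination (1 - z * starRingEnd ℂ z) * det_coeff G
  have := Complex.ofReal_injective key
  nlinarith [norm_nonneg z]

/-- The isometric circle of a transformation without dilation at `v` is a vertical line in the
coordinate `xcoord v`. -/
lemma xcoord_of_norm_den_eq_one {G : SL(2, ℝ)} {v : Circle} (hv : ‖den G v‖ = 1) {z : ℂ}
    (hz : ‖den G z‖ = 1) (hzv : z ≠ v) : shift G v * (2 * xcoord v z + shift G v) = 0 := by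
  set d := den G v with hd
  have hdd : d * starRingEnd ℂ d = 1 := by rw [Complex.mul_conj', hv]; norm_num
  have hvv : (v : ℂ) * starRingEnd ℂ (v : ℂ) = 1 := by
    rw [Complex.mul_conj', Circle.norm_coe]; norm_num
  have hzz : den G z * starRingEnd ℂ (den G z) = 1 := by rw [Complex.mul_conj', hz]; norm_num
  set κ : ℂ := -2 * I * (v * starRingEnd ℂ d) * coeffBeta G with hκ
  have hβ : coeffBeta G * v = d - starRingEnd ℂ (coeffAlpha G) := by rw [hd, den]; ring
  have hβ' : starRingEnd ℂ (coeffBeta G) * starRingEnd ℂ (v : ℂ) =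
      starRingEnd ℂ d - coeffAlpha G := by
    rw [← map_mul, hβ, map_sub, Complex.conj_conj]
  have hκr : starRingEnd ℂ κ = κ := by
    rw [hκ]
    simp only [map_mul, map_neg, map_ofNat, Complex.conj_I, Complex.conj_conj]
    have h1 : coeffBeta G * starRingEnd ℂ (coeffBeta G) =
        (d - starRingEnd ℂ (coeffAlpha G)) * (starRingEnd ℂ d - coeffAlpha G) := by
      rw [← hβ, ← hβ']; linear_combination (-(coeffBeta G * starRingEnd ℂ (coeffBeta G))) * hvv
    have h2 := det_coeff G
    linear_combination 2 * I * d * hβ' + 2 * I * starRingEnd ℂ d * hβ + 4 * I * hdd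
      - 2 * I * (h1 + h2) - 2 * I * hdd
  have hsh : shift G v = κ.re := by
    rw [shift, hκ]
    have h1 : discMap G v * den G v = v * starRingEnd ℂ d := by
      rw [← coe_circleMap, circleMap_mul_den]
    rw [mul_assoc (-2 * I), h1]
  have hκre : κ = (shift G v : ℂ) := by
    rw [hsh]; exact (Complex.conj_eq_iff_re.1 hκr).symm
  have hne : (v : ℂ) - z ≠ 0 := sub_ne_zero.2 (Ne.symm hzv)
  set H : ℂ := I * (v + z) / (v - z) with hH
  have hHi : (H + I) * (v - z) = 2 * I * v := by rw [hH]; field_simp; ring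
  have hden : den G z = d - coeffBeta G * (v - z) := by
    rw [hd, ← den_sub G]; ring
  have e1 : (H + κ + I) * (v - z) = 2 * I * v * starRingEnd ℂ d * den G z := by
    rw [hden]; rw [hκ]; linear_combination hHi - 2 * I * v * hdd
  -- Multiplied by v - z, the numbers H + κ + i and H + i become 2iv conj d den(z) and 2iv, so they
  -- have equal modulus. As κ is real, this determines the real part of H unless κ = 0.
  have e2 : (H + κ + I) * starRingEnd ℂ (H + κ + I) = (H + I) * starRingEnd ℂ (H + I) := by
    have hne' : starRingEnd ℂ ((v : ℂ) - z) ≠ 0 :=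
      (map_ne_zero _).2 hne
    refine mul_right_cancel₀ (mul_ne_zero hne hne') ?_
    have e3 := congr_arg (starRingEnd ℂ) e1
    have e4 := congr_arg (starRingEnd ℂ) hHi
    simp only [map_mul, map_ofNat, Complex.conj_I, Complex.conj_conj] at e3 e4
    calc _ = ((H + κ + I) * (v - z)) * (starRingEnd ℂ (H + κ + I) * starRingEnd ℂ ((v : ℂ) - z)) := by
          ring
      _ = ((H + I) * (v - z)) * (starRingEnd ℂ (H + I) * starRingEnd ℂ ((v : ℂ) - z)) := by
          rw [e1, e3, hHi, e4]
          linear_combination (-4 * I ^ 2 * v * starRingEnd ℂ (v : ℂ)) * (hzz + (den G z * starRingEnd ℂ (den G z)) * hdd)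
      _ = _ := by ring
  have hx : xcoord v z = H.re := rfl
  rw [hx]
  rw [hκre] at e2
  have e5 := congr_arg Complex.re e2
  simp only [map_add, Complex.conj_ofReal, Complex.conj_I, Complex.mul_re, Complex.add_re,
    Complex.ofReal_re, Complex.I_re, Complex.add_im, Complex.ofReal_im, Complex.I_im,
    Complex.conj_re, Complex.conj_im, Complex.neg_re, Complex.neg_im] at e5
  linarith

lemma isomGeodesic_nonempty {G : SL(2, ℝ)} (hβ : coeffBeta G ≠ 0) : (isomGeodesic G).Nonempty := by
  have h1 := norm_sq_coeff G
  have h2 := one_le_norm_coeffAlpha G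
  have hb : 0 < ‖coeffBeta G‖ := norm_pos_iff.2 hβ
  have ha : (‖coeffAlpha G‖ : ℂ) ≠ 0 := by
    rw [Complex.ofReal_ne_zero]; linarith
  -- The point of the isometric circle on the segment from 0 to its centre -conj α / β.
  refine ⟨-(starRingEnd ℂ (coeffAlpha G) / coeffBeta G) * ((‖coeffAlpha G‖ - 1 : ℝ) / (‖coeffAlpha G‖ : ℝ) : ℂ),
    ?_, ?_⟩
  · rw [norm_mul, norm_neg, norm_div, norm_div, Complex.norm_real, Complex.norm_real, RCLike.norm_conj,
      Real.norm_of_nonneg (by linarith), Real.norm_of_nonneg (norm_nonneg _)]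
    rw [div_mul_div_comm, div_lt_one (by positivity)]
    have : ‖coeffAlpha G‖ - 1 < ‖coeffBeta G‖ := by nlinarith
    rw [mul_comm ‖coeffBeta G‖]
    exact mul_lt_mul_of_pos_left this (by linarith)
  · have : den G (-(starRingEnd ℂ (coeffAlpha G) / coeffBeta G) *
        ((‖coeffAlpha G‖ - 1 : ℝ) / (‖coeffAlpha G‖ : ℝ) : ℂ)) =
        starRingEnd ℂ (coeffAlpha G) / (‖coeffAlpha G‖ : ℝ) := by
      rw [den]; push_cast; field_simp; ring
    rw [this, norm_div, Complex.norm_real, RCLike.norm_conj, Real.norm_of_nonneg (norm_nonneg _)]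
    exact div_self (by linarith)

/-- Two half plane coordinates with the same point at infinity differ by a real affine map. Its
dilation depends only on the first column of M, so the scale of a cusp determines all lengths
measured there. -/
lemma exists_cuspCoord_eq (M : SL(2, ℝ)) : ∃ ν : ℝ, ∀ z : ℂ, ‖z‖ < 1 →
    LabelledIdealPolygon.cuspCoord M z = (‖col M‖ ^ 2)⁻¹ * xcoord (circleMap M 1) z + ν := by
  have hm := col_ne_zero M
  set m1 := M 0 0 with hm1
  set m2 := M 1 0 with hm2
  have hdet : m1 * M 1 1 - M 0 1 * m2 = 1 := by
    have := M.det_coe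
    rwa [Matrix.det_fin_two] at this
  have hsq : ‖col M‖ ^ 2 = m1 ^ 2 + m2 ^ 2 := by
    rw [Complex.sq_norm, Complex.normSq_apply, col]
    simp [← hm1, ← hm2]; ring
  have hpos : 0 < ‖col M‖ ^ 2 := by have := norm_pos_iff.2 hm; positivity
  refine ⟨-(M 1 1 * m2 + M 0 1 * m1) * (‖col M‖ ^ 2)⁻¹, fun z hz => ?_⟩
  set μ := (‖col M‖ ^ 2)⁻¹ with hμ
  set ν := -(M 1 1 * m2 + M 0 1 * m1) * μ with hν
  have hμ1 : μ * (m1 ^ 2 + m2 ^ 2) = 1 := by rw [hμ, ← hsq]; exact inv_mul_cancel₀ hpos.ne'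
  have r1 : M 1 1 = μ * m1 - ν * m2 := by
    rw [hν]; linear_combination (-M 1 1) * hμ1 + μ * m1 * hdet
  have r2 : -M 0 1 = μ * m2 + ν * m1 := by
    rw [hν]; linear_combination (M 0 1) * hμ1 + μ * m2 * hdet
  have r1' : (M 1 1 : ℂ) = μ * m1 - ν * m2 := by exact_mod_cast r1
  have r2' : -(M 0 1 : ℂ) = μ * m2 + ν * m1 := by exact_mod_cast r2
  have hz1 : 1 - z ≠ 0 := by
    intro h
    rw [← sub_eq_zero.1 h] at hz; simp at hz
  set v := circleMap M 1 with hv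
  have hvz : (v : ℂ) - z ≠ 0 := by
    intro h
    rw [← sub_eq_zero.1 h, Circle.norm_coe] at hz; simp at hz
  have hvm : (v : ℂ) * col M = starRingEnd ℂ (col M) := by
    rw [hv, coe_circleMap, Circle.coe_one, discMap_apply_one, div_mul_cancel₀ _ hm]
  have hcm : col M = m1 + m2 * I := rfl
  have hcm' : starRingEnd ℂ (col M) = m1 - m2 * I := by
    rw [hcm]; simp; ring
  have hfin : (((M⁻¹ 0 0 : ℝ) * cayleyInv z + (M⁻¹ 0 1 : ℝ)) /
      ((M⁻¹ 1 0 : ℝ) * cayleyInv z + (M⁻¹ 1 1 : ℝ)) : ℂ) = μ * (I * (v + z) / (v - z)) + ν := by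
    have i1 : M⁻¹ 0 0 = M 1 1 := by rw [Matrix.SpecialLinearGroup.SL2_inv_expl]; rfl
    have i2 : M⁻¹ 0 1 = -M 0 1 := by rw [Matrix.SpecialLinearGroup.SL2_inv_expl]; rfl
    have i3 : M⁻¹ 1 0 = -m2 := by rw [Matrix.SpecialLinearGroup.SL2_inv_expl]; rfl
    have i4 : M⁻¹ 1 1 = m1 := by rw [Matrix.SpecialLinearGroup.SL2_inv_expl]; rfl
    rw [i1, i2, i3, i4, Complex.ofReal_neg, Complex.ofReal_neg, r1', r2']
    have q1 : (-(m2 : ℂ) * cayleyInv z + m1) = col M * (v - z) / (1 - z) := by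
      have : col M * (v - z) = v * col M - col M * z := by ring
      rw [eq_div_iff hz1, cayleyInv, this, hvm, hcm', hcm]
      field_simp; ring
    have q2 : ((μ * m1 - ν * m2) * cayleyInv z + (μ * m2 + ν * m1) : ℂ) =
        col M * (μ * I * (v + z) + ν * (v - z)) / (1 - z) := by
      have : col M * (μ * I * (v + z) + ν * (v - z)) =
          μ * I * (v * col M + col M * z) + ν * (v * col M - col M * z) := by ring
      rw [eq_div_iff hz1, cayleyInv, this, hvm, hcm', hcm]
      field_simp
      linear_combination ((μ : ℂ) * m2 * (1 - z)) * I_sq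
    rw [q1, q2]
    field_simp
  rw [LabelledIdealPolygon.cuspCoord, hfin, Complex.add_re, Complex.re_ofReal_mul,
    Complex.ofReal_re]; rfl

namespace LabelledIdealPolygon

variable {Γ₀ : Subgroup SL(2, ℝ)} {𝒜 : Type*} (Ω : LabelledIdealPolygon Γ₀ 𝒜)

lemma word_mem (W : List 𝒜) : Ω.word W ∈ Γ₀ := by
  refine Subgroup.list_prod_mem _ fun x hx => ?_
  obtain ⟨a, -, rfl⟩ := List.mem_map.1 hx
  exact Ω.F_mem a

variable [Finite 𝒜]

omit [Finite 𝒜] in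
-- By `xcoord_of_norm_den_eq_one` the side is a vertical line with abscissa minus half of the
-- translation of F_â, which is known from `shift_F`.
lemma sgn_mul_xcoord_side (e : Bool) (a : 𝒜) {z : ℂ} (hz : z ∈ Ω.side a) :
    sgn e * xcoord (Ω.vtx e a) z = -Ω.ct a := by
  have h1 := Ω.shift_F (!e) (Ω.hat a)
  rw [Bool.not_not, Ω.hat_hat, ct_hat, sgn_not] at h1
  have h2 : ‖den (Ω.F (Ω.hat a)) (Ω.vtx e a)‖ = 1 := by
    have := Ω.norm_den_F_vtx e (Ω.hat a)
    rwa [Ω.hat_hat] at this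
  have hne : z ≠ Ω.vtx e a := by
    rintro rfl
    have := hz.1
    rw [Circle.norm_coe] at this
    exact lt_irrefl _ this
  have h3 := xcoord_of_norm_den_eq_one h2 hz.2 hne
  have h4 := Ω.ct_pos a
  have h5 : shift (Ω.F (Ω.hat a)) (Ω.vtx e a) ≠ 0 := by
    intro h; rw [h] at h1; simp at h1; linarith
  have h6 := (mul_eq_zero.1 h3).resolve_left h5
  linear_combination (sgn e / 2) * h6 + (1 / 2 : ℝ) * h1

lemma vertex_sideWord (e : Bool) (a : 𝒜) (n : ℕ) :
    Ω.vertex (Ω.sideWord e a (n + 2)) a = Ω.vtx e a := by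
  have h2 : 2 ≤ (Ω.sideWord e a (n + 2)).length := by rw [length_sideWord]; omega
  rw [vertex]
  cases e
  · rw [if_pos]
    · simp [vtx]
    · exact (Ω.isLeft_iff _).2 ⟨h2, Ω.isSide_sideWord false a _⟩
  · rw [if_neg]
    · simp [vtx]
    · intro h
      have h3 := ((Ω.isLeft_iff _).1 h).2
      rw [sideWord_succ, sideWord_succ, IsSide, List.isChain_cons_cons] at h3
      exact Ω.step_true_ne_step_false a h3.1

variable {Γ : Subgroup SL(2, ℝ)} {p : ℕ} {A : Fin p → SL(2, ℝ)}

/-- Geometric length of a cuspidal word in terms of the scale of its cusp. -/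
lemma exists_length_sideWord (hle : Γ₀ ≤ Γ) (hΓ : DiscreteTopology Γ)
    (hA : IsCuspRepresentatives Γ A) (e : Bool) (a : 𝒜) : ∃ μ > 0, ∀ n,
    Ω.length Γ A (Ω.sideWord e a (n + 2)) =
      μ * (Ω.ct ((Ω.step e)^[n + 1] a) + Ω.sideShift e a (n + 1) - Ω.ct a) := by
  obtain ⟨N, hN, hper⟩ := Ω.exists_step_period e
  obtain ⟨h1, h2⟩ := Ω.isParabolic_period e a hN (hper a)
  obtain ⟨m, hm, ⟨B₀, hB₀, k₀, hBk₀⟩, huniq⟩ := exists_scale hΓ hA (hle (Ω.word_mem _)) h1 h2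
  -- The scale m is common to all B and k that send ∞ to this vertex, so the set in `cuspDist` has a
  -- single element, a difference of abscissae divided by m².
  refine ⟨(m ^ 2)⁻¹, by positivity, fun n => ?_⟩
  have hlen : Ω.length Γ A (Ω.sideWord e a (n + 2)) = cuspDist Γ A (Ω.side a)
      (discMap (Ω.word (Ω.sideWord e a (n + 1))) '' Ω.side ((Ω.step e)^[n + 1] a))
      (Ω.vtx e a) := by
    have hd : (Ω.sideWord e a (n + 2)).dropLast = Ω.sideWord e a (n + 1) := by
      rw [sideWord_succ', List.dropLast_concat]
    have hl : ∀ h, (Ω.sideWord e a (n + 2)).getLast h = (Ω.step e)^[n + 1] a := by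
      rw [sideWord_succ']; intro h; simp
    have hv := Ω.vertex_sideWord e a n
    rw [← hd, ← hv, ← hl (by simp [sideWord_succ])]
    have : Ω.sideWord e a (n + 2) = a :: Ω.step e a :: Ω.sideWord e (Ω.step e (Ω.step e a)) n := by
      rw [sideWord_succ, sideWord_succ]
    simp only [this, length, List.getLast_cons_cons]
  rw [hlen, cuspDist]
  obtain ⟨s1, s2, s3⟩ := Ω.sideWord_spec e a (n + 1)
  set G := Ω.word (Ω.sideWord e a (n + 1)) with hG
  set b := (Ω.step e)^[n + 1] a with hb
  have hx' : ∀ z ∈ Ω.side b, sgn e * xcoord (Ω.vtx e a) (discMap G z) =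
      -Ω.ct b - Ω.sideShift e a (n + 1) := by
    intro z hz
    have hzv : z ≠ Ω.vtx e b := by
      rintro rfl
      have := hz.1
      rw [Circle.norm_coe] at this
      exact lt_irrefl _ this
    have := xcoord_circleMap s2 (den_ne_zero_of_norm_le_one G hz.1.le) hzv
    rw [← s1, coe_circleMap, this, mul_add, s3, Ω.sgn_mul_xcoord_side e b hz]; ring
  -- The first letter alone translates by 2 `Ω.ct a`, so the absolute value can be dropped.
  have hval : 0 ≤ Ω.ct b + Ω.sideShift e a (n + 1) - Ω.ct a := by
    have h3 := Ω.ct_pos b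
    have h4 : 2 * Ω.ct a ≤ Ω.sideShift e a (n + 1) := by
      rw [sideShift, Finset.sum_range_succ']
      have : 0 ≤ ∑ k ∈ Finset.range n, 2 * Ω.ct ((Ω.step e)^[k + 1] a) :=
        Finset.sum_nonneg fun k _ => by linarith [Ω.ct_pos ((Ω.step e)^[k + 1] a)]
      simpa using this
    linarith [Ω.ct_pos a]
  have key : ∀ B ∈ Γ, ∀ k, cayleyBoundary (atInfinity (B * A k)) = (Ω.vtx e a : ℂ) →
      ∀ z ∈ Ω.side a, ∀ z' ∈ discMap G '' Ω.side b,
      |cuspCoord (B * A k) z - cuspCoord (B * A k) z'| =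
        (m ^ 2)⁻¹ * (Ω.ct b + Ω.sideShift e a (n + 1) - Ω.ct a) := by
    rintro B hB k hk z hz _ ⟨z', hz', rfl⟩
    rw [cayleyBoundary_atInfinity, Circle.coe_inj] at hk
    obtain ⟨ν, hν⟩ := exists_cuspCoord_eq (B * A k)
    rw [hν z hz.1, hν _ (norm_discMap_lt_one G hz'.1), huniq B hB k hk, hk, add_sub_add_right_eq_sub,
      ← mul_sub, abs_mul, abs_of_pos (by positivity : 0 < (m ^ 2)⁻¹)]
    congr 1
    have q1 := hx' z' hz'
    have q2 := Ω.sgn_mul_xcoord_side e a hz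
    have q3 : xcoord (Ω.vtx e a) z - xcoord (Ω.vtx e a) (discMap G z') =
        sgn e * (Ω.ct b + Ω.sideShift e a (n + 1) - Ω.ct a) := by
      have q4 := sgn_sq e
      linear_combination sgn e * q2 - sgn e * q1 - (xcoord (Ω.vtx e a) z - xcoord (Ω.vtx e a) (discMap G z')) * q4
    have q5 : |sgn e| = 1 := by cases e <;> simp [sgn]
    rw [q3, abs_mul, q5, one_mul, abs_of_nonneg hval]
  have hset : {r | ∃ B ∈ Γ, ∃ k, cayleyBoundary (atInfinity (B * A k)) = (Ω.vtx e a : ℂ) ∧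
      ∃ z ∈ Ω.side a, ∃ z' ∈ discMap G '' Ω.side b,
        r = |cuspCoord (B * A k) z - cuspCoord (B * A k) z'|} =
      {(m ^ 2)⁻¹ * (Ω.ct b + Ω.sideShift e a (n + 1) - Ω.ct a)} := by
    refine Set.Subset.antisymm ?_ ?_
    · rintro r ⟨B, hB, k, hk, z, hz, z', hz', rfl⟩
      exact key B hB k hk z hz z' hz'
    · rintro r rfl
      have hk₀ : cayleyBoundary (atInfinity (B₀ * A k₀)) = (Ω.vtx e a : ℂ) := by
        rw [cayleyBoundary_atInfinity, hBk₀]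
      obtain ⟨z, hz⟩ : (Ω.side a).Nonempty := isomGeodesic_nonempty (Ω.coeffBeta_F_ne_zero _)
      obtain ⟨z', hz'⟩ : (Ω.side b).Nonempty := isomGeodesic_nonempty (Ω.coeffBeta_F_ne_zero _)
      exact ⟨B₀, hB₀, k₀, hk₀, z, hz, _, ⟨z', hz', rfl⟩,
        (key B₀ hB₀ k₀ hk₀ z hz _ ⟨z', hz', rfl⟩).symm⟩
  rw [hset, csSup_singleton]

/-- The geometric length of a cuspidal word is comparable to its number of letters. -/
lemma exists_length_bounds (hle : Γ₀ ≤ Γ) (hΓ : DiscreteTopology Γ)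
    (hA : IsCuspRepresentatives Γ A) : ∃ C : ℝ, 0 < C ∧ ∀ W, Ω.IsCuspidal W →
    0 ≤ Ω.length Γ A W ∧ Ω.length Γ A W ≤ C * W.length ∧
      (W.length : ℝ) ≤ C * (Ω.length Γ A W + 1) := by
  obtain ⟨c₀, C₀, hc₀, hC₀, hct⟩ := Ω.exists_ct_bounds
  choose μ hμ hlen using fun q : Bool × 𝒜 => Ω.exists_length_sideWord hle hΓ hA q.1 q.2
  obtain ⟨κ, K, hκ, hK, hb⟩ : ∃ κ K : ℝ, 0 < κ ∧ 0 < K ∧ ∀ q, κ ≤ μ q ∧ μ q ≤ K := by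
    rcases isEmpty_or_nonempty (Bool × 𝒜) with h | h
    · exact ⟨1, 1, one_pos, one_pos, fun a => h.elim a⟩
    · obtain ⟨a, ha⟩ := Finite.exists_min μ
      obtain ⟨b, hb⟩ := Finite.exists_max μ
      exact ⟨μ a, μ b, hμ a, hμ b, fun d => ⟨ha d, hb d⟩⟩
  -- The second summand serves the upper bound, the third one the lower bound, and 2 covers the
  -- words with one letter, whose length is 0.
  refine ⟨2 + K * (3 * C₀) + 1 / (κ * c₀), by positivity, fun W hW => ?_⟩
  have hpos : 0 < 1 / (κ * c₀) := by positivity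
  have hpos' : 0 < K * (3 * C₀) := by positivity
  obtain ⟨e, a, n, rfl⟩ := (Ω.isCuspidal_iff_exists W).1 hW
  rw [length_sideWord]
  cases n with
  | zero =>
    have : Ω.length Γ A (Ω.sideWord e a (0 + 1)) = 0 := rfl
    rw [this]
    refine ⟨le_rfl, by positivity, ?_⟩
    simp only [zero_add, Nat.cast_one, mul_one]; linarith
  | succ n =>
    have h := hlen (e, a) n
    obtain ⟨b1, b2⟩ := hb (e, a)
    simp only at h
    have hn : (0 : ℝ) ≤ n := Nat.cast_nonneg n
    obtain ⟨l1, l2⟩ : c₀ * (n + 2) ≤ Ω.ct ((Ω.step e)^[n + 1] a) + Ω.sideShift e a (n + 1) - Ω.ct a ∧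
        Ω.ct ((Ω.step e)^[n + 1] a) + Ω.sideShift e a (n + 1) - Ω.ct a ≤ 3 * C₀ * (n + 2) := by
      have d1 := hct ((Ω.step e)^[n + 1] a)
      have d2 := hct a
      rw [sideShift, Finset.sum_range_succ']
      have t1 : ∑ k ∈ Finset.range n, 2 * c₀ ≤
          ∑ k ∈ Finset.range n, 2 * Ω.ct ((Ω.step e)^[k + 1] a) :=
        Finset.sum_le_sum fun k _ => by linarith [(hct ((Ω.step e)^[k + 1] a)).1]
      have t2 : ∑ k ∈ Finset.range n, 2 * Ω.ct ((Ω.step e)^[k + 1] a) ≤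
          ∑ k ∈ Finset.range n, 2 * C₀ :=
        Finset.sum_le_sum fun k _ => by linarith [(hct ((Ω.step e)^[k + 1] a)).2]
      rw [Finset.sum_const, Finset.card_range, nsmul_eq_mul] at t1 t2
      rw [Function.iterate_zero, id_eq]
      constructor <;> nlinarith
    have m1 : κ * (c₀ * (n + 2)) ≤ Ω.length Γ A (Ω.sideWord e a (n + 1 + 1)) := by
      rw [show n + 1 + 1 = n + 2 from rfl, h]
      exact mul_le_mul b1 l1 (by positivity) (hμ _).le
    have m2 : Ω.length Γ A (Ω.sideWord e a (n + 1 + 1)) ≤ K * (3 * C₀ * (n + 2)) := by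
      rw [show n + 1 + 1 = n + 2 from rfl, h]
      exact mul_le_mul b2 l2 (le_trans (by positivity) l1) hK.le
    have m0 : 0 ≤ Ω.length Γ A (Ω.sideWord e a (n + 1 + 1)) := le_trans (by positivity) m1
    refine ⟨m0, ?_, ?_⟩
    · push_cast; nlinarith
    · have : ((n : ℝ) + 2) ≤ 1 / (κ * c₀) * Ω.length Γ A (Ω.sideWord e a (n + 1 + 1)) := by
        rw [div_mul_eq_mul_div, le_div_iff₀ (by positivity)]; linarith
      push_cast; nlinarith

end LabelledIdealPolygon

end BowenSeries

namespace BowenSeries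

open Complex MeasureTheory Set

namespace LabelledIdealPolygon

variable {Γ₀ : Subgroup SL(2, ℝ)} {𝒜 : Type*} (Ω : LabelledIdealPolygon Γ₀ 𝒜)

/-! ### Weighted operators -/

/-- The letter `a` with `ξ ∈ [a]`. -/
def letter (ξ : Circle) : 𝒜 := (Ω.partition ξ).choose

lemma mem_arc_letter (ξ : Circle) : ξ ∈ Ω.arc (Ω.letter ξ) := (Ω.partition ξ).choose_spec.1

variable {Ω} in
lemma letter_eq {ξ : Circle} {a : 𝒜} (h : ξ ∈ Ω.arc a) : Ω.letter ξ = a :=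
  eq_of_mem_arc (Ω.mem_arc_letter ξ) h

variable [Finite 𝒜]

/-- Letter by letter, from the last one on, the image avoids the arc that the next map reverses, by
`step_ne_hat`. So Lipschitz bounds on single arcs can be used at the image points. -/
lemma exists_mapsTo {W : List 𝒜} {a : 𝒜} (hW : W ∈ Ω.words a) : ∃ c, W.head? = some c ∧
    ∀ ξ ∈ Ω.arc a, circleMap (Ω.word W) ξ ∈ Ω.arc c := by
  obtain ⟨hcusp, hall⟩ := hW
  obtain ⟨e, c, n, rfl⟩ := (Ω.isCuspidal_iff_exists W).1 hcusp
  refine ⟨c, by simp [sideWord_succ], fun ξ hξ => ?_⟩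
  have h1 := (Ω.allowed_sideWord hall).1
  clear hcusp hall
  induction n generalizing c with
  | zero =>
    have : Ω.word (Ω.sideWord e c (0 + 1)) = Ω.F c := by simp [sideWord, word]
    rw [this, circleMap_F_mem_arc_iff]
    exact fun h => h1 (eq_of_mem_arc hξ h)
  | succ n ih =>
    have h2 := ih (Ω.step e c) h1
    rw [sideWord_succ, word_cons, circleMap_mul, circleMap_F_mem_arc_iff]
    exact fun h => Ω.step_ne_hat e c (eq_of_mem_arc h2 h)

/-- Type and first letter leave at most 2 card 𝒜 cuspidal words with a given number of letters. -/
lemma summable_words {b : ℕ → ℝ} (hb0 : ∀ n, 0 ≤ b n) (hb : Summable b) {a : 𝒜}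
    {𝒱 : Set (List 𝒜)} (h𝒱 : 𝒱 ⊆ Ω.words a) :
    Summable (fun W : 𝒱 => b (W : List 𝒜).length) ∧
      ∑' W : 𝒱, b (W : List 𝒜).length ≤ Nat.card (Bool × 𝒜) * ∑' n, b n := by
  have := Fintype.ofFinite 𝒜
  have hc : ∀ W : 𝒱, ∃ q : (Bool × 𝒜) × ℕ, (W : List 𝒜) = Ω.sideWord q.1.1 q.1.2 (q.2 + 1) := by
    intro W
    obtain ⟨e, d, n, h⟩ := (Ω.isCuspidal_iff_exists _).1 (h𝒱 W.2).1
    exact ⟨((e, d), n), h⟩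
  choose q hq using hc
  have hinj : Function.Injective q := fun W W' h => Subtype.ext (by rw [hq, hq W', h])
  have hb1 : Summable fun n => b (n + 1) := (summable_nat_add_iff 1).2 hb
  have h1 : Summable fun r : (Bool × 𝒜) × ℕ => (1 : ℝ) * b (r.2 + 1) :=
    Summable.mul_of_nonneg (f := fun _ : Bool × 𝒜 => (1 : ℝ)) (g := fun n => b (n + 1))
      (hasSum_fintype _).summable hb1 (fun _ => zero_le_one) (fun _ => hb0 _)
  have h2 : ∑' r : (Bool × 𝒜) × ℕ, (1 : ℝ) * b (r.2 + 1) = Nat.card (Bool × 𝒜) * ∑' n, b (n + 1) := by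
    have h3 : Summable (fun _ : Bool × 𝒜 => (1 : ℝ)) := (hasSum_fintype _).summable
    rw [← h3.tsum_mul_tsum hb1 h1, tsum_fintype]
    simp
  have h3 : (fun W : 𝒱 => b (W : List 𝒜).length) =
      (fun r : (Bool × 𝒜) × ℕ => (1 : ℝ) * b (r.2 + 1)) ∘ q := by
    funext W
    simp only [Function.comp, one_mul]
    conv_lhs => rw [hq W, length_sideWord]
  rw [h3]
  refine ⟨h1.comp_injective hinj, ?_⟩
  calc _ ≤ ∑' r : (Bool × 𝒜) × ℕ, (1 : ℝ) * b (r.2 + 1) :=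
        (h1.comp_injective hinj).tsum_le_tsum_of_inj q hinj
          (fun r _ => mul_nonneg zero_le_one (hb0 _)) (fun W => le_rfl) h1
    _ = _ := h2
    _ ≤ _ := by
      refine mul_le_mul_of_nonneg_left ?_ (Nat.cast_nonneg _)
      rw [hb.tsum_eq_zero_add]
      linarith [hb0 0]

lemma dist_circleMap_word_le {a : 𝒜} {W : List 𝒜} (hW : W ∈ Ω.words a) {ξ ζ : Circle}
    (hξ : ξ ∈ Ω.arc a) (hζ : ζ ∈ Ω.arc a) :
    dist (circleMap (Ω.word W) ξ) (circleMap (Ω.word W) ζ) ≤ dist ξ ζ := by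
  obtain ⟨c, C, hc, hC, h⟩ := Ω.exists_den_bounds
  have h1 : ∀ z ∈ Ω.arc a, 1 ≤ ‖den (Ω.word W) z‖ := by
    intro z hz
    have := (h a W hW z hz).1
    have h2 : 0 ≤ c * (W.length : ℝ) ^ 2 := by positivity
    nlinarith [norm_nonneg (den (Ω.word W) z)]
  rw [dist_circleMap]
  refine div_le_self dist_nonneg ?_
  nlinarith [h1 ξ hξ, h1 ζ hζ]

variable {Ω}

lemma IsWeightedOp.unique {𝒱 : 𝒜 → Set (List 𝒜)} {w : ℝ → ℝ} {L L' : Ω.PLip →L[ℂ] Ω.PLip}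
    (h : IsWeightedOp 𝒱 w L) (h' : IsWeightedOp 𝒱 w L') : L = L' := by
  refine ContinuousLinearMap.ext fun f => Subtype.ext (funext fun ξ => ?_)
  exact (h f _ ξ (Ω.mem_arc_letter ξ)).unique (h' f _ ξ (Ω.mem_arc_letter ξ))

lemma IsWeightedOp.weightedOp_eq {𝒱 : 𝒜 → Set (List 𝒜)} {w : ℝ → ℝ} {L : Ω.PLip →L[ℂ] Ω.PLip}
    (h : IsWeightedOp 𝒱 w L) : Ω.weightedOp 𝒱 w = L := by
  have h' : ∃ L : Ω.PLip →L[ℂ] Ω.PLip, IsWeightedOp 𝒱 w L := ⟨L, h⟩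
  rw [weightedOp, dif_pos h']
  exact h'.choose_spec.unique h

lemma IsWeightedOp.sub {𝒱 : 𝒜 → Set (List 𝒜)} {w w' : ℝ → ℝ} {L L' : Ω.PLip →L[ℂ] Ω.PLip}
    (h : IsWeightedOp 𝒱 w L) (h' : IsWeightedOp 𝒱 w' L') :
    IsWeightedOp 𝒱 (fun x => w x - w' x) (L - L') := by
  intro f a ξ hξ
  simp only [Complex.ofReal_sub, sub_mul]
  exact (h f a ξ hξ).sub (h' f a ξ hξ)

lemma IsWeightedOp.const_smul {𝒱 : 𝒜 → Set (List 𝒜)} {w : ℝ → ℝ} {L : Ω.PLip →L[ℂ] Ω.PLip}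
    (h : IsWeightedOp 𝒱 w L) (c : ℝ) :
    IsWeightedOp 𝒱 (fun x => c * w x) ((c : ℂ) • L) := by
  intro f a ξ hξ
  simp only [Complex.ofReal_mul, mul_assoc]
  exact (h f a ξ hξ).mul_left (c : ℂ)

lemma IsWeightedOp.add_disjoint {𝒱 𝒱' : 𝒜 → Set (List 𝒜)} {w : ℝ → ℝ}
    {L L' : Ω.PLip →L[ℂ] Ω.PLip} (h : IsWeightedOp 𝒱 w L) (h' : IsWeightedOp 𝒱' w L')
    (hd : ∀ a, Disjoint (𝒱 a) (𝒱' a)) : IsWeightedOp (fun a => 𝒱 a ∪ 𝒱' a) w (L + L') := by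
  intro f a ξ hξ
  exact HasSum.add_disjoint (f := fun W : List 𝒜 =>
    (w (derivNorm (Ω.word W) ξ) : ℂ) * f (circleMap (Ω.word W) ξ)) (hd a) (h f a ξ hξ) (h' f a ξ hξ)

lemma norm_le_of_bounds {f : Ω.PLip} {M K : ℝ} (hM : ∀ ξ, ‖f ξ‖ ≤ M) (hK : 0 ≤ K)
    (h : ∀ a, ∀ x ∈ Ω.arc a, ∀ y ∈ Ω.arc a, dist (f x) (f y) ≤ K * dist x y) : ‖f‖ ≤ M + K :=
  add_le_add (supNorm_le hM) (lipConst_le hK h)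

variable (Ω) in
/-- Weighted operators whose weights and their Lipschitz constants are bounded by a summable
function of the number of letters. -/
lemma exists_weightedOp : ∃ K : ℝ, 0 < K ∧ ∀ (𝒱 : 𝒜 → Set (List 𝒜)), (∀ a, 𝒱 a ⊆ Ω.words a) →
    ∀ (w : ℝ → ℝ) (b : ℕ → ℝ), (∀ n, 0 ≤ b n) → Summable b →
    (∀ a, ∀ W ∈ 𝒱 a, ∀ ξ ∈ Ω.arc a, |w (derivNorm (Ω.word W) ξ)| ≤ b W.length) →
    (∀ a, ∀ W ∈ 𝒱 a, ∀ ξ ∈ Ω.arc a, ∀ ζ ∈ Ω.arc a,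
      |w (derivNorm (Ω.word W) ξ) - w (derivNorm (Ω.word W) ζ)| ≤ b W.length * dist ξ ζ) →
    ∃ L : Ω.PLip →L[ℂ] Ω.PLip, IsWeightedOp 𝒱 w L ∧ ‖L‖ ≤ K * ∑' n, b n := by
  set N : ℝ := ((Nat.card (Bool × 𝒜) : ℕ) : ℝ) with hN
  have hN0 : 0 ≤ N := Nat.cast_nonneg _
  -- One N + 1 for the sup norm and one for the Lipschitz constant.
  refine ⟨2 * (N + 1), by positivity, fun 𝒱 h𝒱 w b hb0 hb h1 h2 => ?_⟩
  set S := ∑' n, b n with hS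
  have hS0 : 0 ≤ S := tsum_nonneg hb0
  have hsum : ∀ a, Summable (fun W : 𝒱 a => b (W : List 𝒜).length) :=
    fun a => (Ω.summable_words hb0 hb (h𝒱 a)).1
  have htsum : ∀ a, ∑' W : 𝒱 a, b (W : List 𝒜).length ≤ (N + 1) * S := fun a =>
    (Ω.summable_words hb0 hb (h𝒱 a)).2.trans (by nlinarith)
  let t : Ω.PLip → Circle → List 𝒜 → ℂ := fun f ξ W =>
    (w (derivNorm (Ω.word W) ξ) : ℂ) * f (circleMap (Ω.word W) ξ)
  have ht : ∀ f a, ∀ ξ ∈ Ω.arc a, ∀ W : 𝒱 a, ‖t f ξ W‖ ≤ b (W : List 𝒜).length * supNorm f := by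
    intro f a ξ hξ W
    rw [norm_mul, Complex.norm_real]
    exact mul_le_mul (h1 a W W.2 ξ hξ) (norm_apply_le f _) (norm_nonneg _) (hb0 _)
  have hts : ∀ f a, ∀ ξ ∈ Ω.arc a, Summable fun W : 𝒱 a => t f ξ W := fun f a ξ hξ =>
    Summable.of_norm_bounded ((hsum a).mul_right _) (ht f a ξ hξ)
  have hsup : ∀ f a, ∀ ξ ∈ Ω.arc a, ‖∑' W : 𝒱 a, t f ξ W‖ ≤ (N + 1) * S * supNorm f := by
    intro f a ξ hξ
    refine (tsum_of_norm_bounded ((hsum a).mul_right _).hasSum (ht f a ξ hξ)).trans ?_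
    rw [tsum_mul_right]
    exact mul_le_mul_of_nonneg_right (htsum a) (supNorm_nonneg f)
  have hlip : ∀ f a, ∀ ξ ∈ Ω.arc a, ∀ ζ ∈ Ω.arc a,
      ‖∑' W : 𝒱 a, t f ξ W - ∑' W : 𝒱 a, t f ζ W‖ ≤ (N + 1) * S * ‖f‖ * dist ξ ζ := by
    intro f a ξ hξ ζ hζ
    rw [← (hts f a ξ hξ).tsum_sub (hts f a ζ hζ)]
    have hb' : ∀ W : 𝒱 a, ‖t f ξ W - t f ζ W‖ ≤ b (W : List 𝒜).length * (‖f‖ * dist ξ ζ) := by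
      intro W
      obtain ⟨c, -, hc⟩ := Ω.exists_mapsTo (h𝒱 a W.2)
      -- Product rule: one term for the variation of f between two points of the same arc, one for
      -- the variation of the weight.
      have e : t f ξ W - t f ζ W = (w (derivNorm (Ω.word W) ξ) : ℂ) *
          (f (circleMap (Ω.word W) ξ) - f (circleMap (Ω.word W) ζ)) +
          ((w (derivNorm (Ω.word W) ξ) - w (derivNorm (Ω.word W) ζ) : ℝ) : ℂ) *
            f (circleMap (Ω.word W) ζ) := by
        simp only [t]; push_cast; ring
      rw [e, norm_def, add_mul, mul_add, add_comm (b _ * _)]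
      refine (norm_add_le _ _).trans (add_le_add ?_ ?_)
      · rw [norm_mul, Complex.norm_real]
        refine mul_le_mul (h1 a W W.2 ξ hξ) ?_ (norm_nonneg _) (hb0 _)
        rw [← dist_eq_norm]
        refine (dist_apply_le f (hc ξ hξ) (hc ζ hζ)).trans ?_
        exact mul_le_mul_of_nonneg_left (Ω.dist_circleMap_word_le (h𝒱 a W.2) hξ hζ)
          (lipConst_nonneg f)
      · rw [norm_mul, Complex.norm_real, Real.norm_eq_abs, mul_comm (supNorm f), ← mul_assoc]
        exact mul_le_mul (h2 a W W.2 ξ hξ ζ hζ) (norm_apply_le f _) (norm_nonneg _)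
          (mul_nonneg (hb0 _) dist_nonneg)
    refine (tsum_of_norm_bounded ((hsum a).mul_right _).hasSum hb').trans ?_
    rw [tsum_mul_right, mul_assoc ((N + 1) * S)]
    exact mul_le_mul_of_nonneg_right (htsum a) (mul_nonneg (norm_nonneg f) dist_nonneg)
  let g : Ω.PLip → Circle → ℂ := fun f ξ => ∑' W : 𝒱 (Ω.letter ξ), t f ξ W
  have hg : ∀ f a, ∀ ξ ∈ Ω.arc a, g f ξ = ∑' W : 𝒱 a, t f ξ W := by
    intro f a ξ hξ
    simp only [g]; rw [letter_eq hξ]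
  have hNS : 0 ≤ (N + 1) * S := by positivity
  have hmem : ∀ f, g f ∈ Ω.plSubmodule := by
    intro f a
    refine ⟨⟨(N + 1) * S * ‖f‖, mul_nonneg hNS (norm_nonneg f)⟩,
      LipschitzOnWith.of_dist_le_mul fun x hx y hy => ?_⟩
    rw [dist_eq_norm, hg f a x hx, hg f a y hy]
    exact hlip f a x hx y hy
  let L₀ : Ω.PLip →ₗ[ℂ] Ω.PLip :=
    { toFun := fun f => ⟨g f, hmem f⟩
      map_add' := fun f f' => by
        refine Subtype.ext (funext fun ξ => ?_)
        change ∑' W : 𝒱 (Ω.letter ξ), t (f + f') ξ W = ∑' W : 𝒱 (Ω.letter ξ), t f ξ W +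
          ∑' W : 𝒱 (Ω.letter ξ), t f' ξ W
        rw [← (hts f _ ξ (Ω.mem_arc_letter ξ)).tsum_add (hts f' _ ξ (Ω.mem_arc_letter ξ))]
        exact tsum_congr fun W => by simp only [t]; rw [coe_add, mul_add]
      map_smul' := fun c f => by
        refine Subtype.ext (funext fun ξ => ?_)
        change ∑' W : 𝒱 (Ω.letter ξ), t (c • f) ξ W = c * ∑' W : 𝒱 (Ω.letter ξ), t f ξ W
        rw [← tsum_mul_left]
        exact tsum_congr fun W => by simp only [t]; rw [coe_smul]; ring }
  refine ⟨L₀.mkContinuous (2 * (N + 1) * S) fun f => ?_, fun f a ξ hξ => ?_, ?_⟩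
  · have h3 : ‖L₀ f‖ ≤ (N + 1) * S * supNorm f + (N + 1) * S * ‖f‖ := by
      refine norm_le_of_bounds (fun ξ => hsup f _ ξ (Ω.mem_arc_letter ξ))
        (mul_nonneg hNS (norm_nonneg f)) fun a x hx y hy => ?_
      rw [dist_eq_norm]
      change ‖g f x - g f y‖ ≤ _
      rw [hg f a x hx, hg f a y hy]
      exact hlip f a x hx y hy
    have h4 : supNorm f ≤ ‖f‖ := by rw [norm_def]; linarith [lipConst_nonneg f]
    nlinarith
  · change HasSum _ (g f ξ)
    rw [hg f a ξ hξ]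
    exact (hts f a ξ hξ).hasSum
  · exact LinearMap.mkContinuous_norm_le _ (by positivity) _

end LabelledIdealPolygon

end BowenSeries

namespace BowenSeries

open Complex MeasureTheory Set

/-! ### Estimates for the weights -/

/-- The weight `w (exp (-τ))`, together with its derivative, decays like `M exp (-σ τ)`. -/
def WeightDecay (w : ℝ → ℝ) (σ M : ℝ) : Prop :=
  ∃ u' : ℝ → ℝ, ∀ τ > 0, HasDerivAt (fun τ => w (Real.exp (-τ))) (u' τ) τ ∧
    |w (Real.exp (-τ))| ≤ M * Real.exp (-(σ * τ)) ∧ |u' τ| ≤ M * Real.exp (-(σ * τ))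

lemma exp_neg_rpow (s τ : ℝ) : Real.exp (-τ) ^ s = Real.exp (-(s * τ)) := by
  rw [← Real.exp_mul]; congr 1; ring

lemma hasDerivAt_exp_neg_mul (s τ : ℝ) :
    HasDerivAt (fun τ => Real.exp (-(s * τ))) (-s * Real.exp (-(s * τ))) τ := by
  have := (((hasDerivAt_id' τ).const_mul s).fun_neg).exp
  convert this using 1; ring

/-- Lowering the rate from 7/8 to 3/4 absorbs the powers of τ produced by differentiating in s. The
rate 3/4 is still above 1/2, so the resulting series converge. -/
lemma mul_exp_le {τ : ℝ} (hτ : 0 ≤ τ) :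
    τ * Real.exp (-(7 / 8 * τ)) ≤ 8 * Real.exp (-(3 / 4 * τ)) ∧
      τ ^ 2 * Real.exp (-(7 / 8 * τ)) ≤ 128 * Real.exp (-(3 / 4 * τ)) := by
  have h1 : Real.exp (-(3 / 4 * τ)) = Real.exp (τ / 8) * Real.exp (-(7 / 8 * τ)) := by
    rw [← Real.exp_add]; congr 1; ring
  have h2 := Real.add_one_le_exp (τ / 8)
  have h3 := Real.quadratic_le_exp_of_nonneg (x := τ / 8) (by positivity)
  have h4 := Real.exp_pos (-(7 / 8 * τ))
  rw [h1]
  constructor <;> nlinarith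

lemma abs_exp_sub_one_sub_le (x : ℝ) : |Real.exp x - 1 - x| ≤ x ^ 2 * Real.exp |x| := by
  have h := Complex.norm_exp_sub_sum_le_norm_mul_exp (x : ℂ) 2
  have h1 : Complex.exp x - ∑ m ∈ Finset.range 2, (x : ℂ) ^ m / m.factorial =
      ((Real.exp x - 1 - x : ℝ) : ℂ) := by
    simp [Finset.sum_range_succ]; ring
  rw [h1, Complex.norm_real, Complex.norm_real, Real.norm_eq_abs, Real.norm_eq_abs, sq_abs] at h
  exact h

lemma weightDecay_rpow {s : ℝ} (hs : 0 ≤ s) : WeightDecay (fun x => x ^ s) s (1 + s) := by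
  refine ⟨fun τ => -s * Real.exp (-(s * τ)), fun τ _ => ?_⟩
  have h0 := Real.exp_pos (-(s * τ))
  simp only [exp_neg_rpow]
  refine ⟨hasDerivAt_exp_neg_mul s τ, ?_, ?_⟩
  · rw [abs_of_pos h0]; nlinarith
  · rw [abs_mul, abs_neg, abs_of_pos h0, abs_of_nonneg hs]; nlinarith

lemma exp_neg_mul_le {s τ : ℝ} (hs : 7 / 8 ≤ s) (hτ : 0 ≤ τ) :
    Real.exp (-(s * τ)) ≤ Real.exp (-(7 / 8 * τ)) :=
  Real.exp_le_exp.2 (by nlinarith)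

lemma abs_exp_sub_exp_le {s s' τ : ℝ} (hs : 7 / 8 ≤ s) (hs' : 7 / 8 ≤ s') (hτ : 0 ≤ τ) :
    |Real.exp (-(s * τ)) - Real.exp (-(s' * τ))| ≤ 8 * |s - s'| * Real.exp (-(3 / 4 * τ)) := by
  wlog h : s ≤ s' generalizing s s'
  · rw [abs_sub_comm, abs_sub_comm s]; exact this hs' hs (not_le.1 h).le
  have h1 : Real.exp (-(s' * τ)) ≤ Real.exp (-(s * τ)) := Real.exp_le_exp.2 (by nlinarith)
  have h2 := exp_neg_mul_le hs hτ
  have h3 := Real.add_one_le_exp (-((s' - s) * τ))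
  have h4 : Real.exp (-(s' * τ)) = Real.exp (-(s * τ)) * Real.exp (-((s' - s) * τ)) := by
    rw [← Real.exp_add]; congr 1; ring
  have h5 := (mul_exp_le hτ).1
  have h6 := Real.exp_pos (-(s * τ))
  rw [abs_of_nonneg (by linarith), abs_sub_comm, abs_of_nonneg (by linarith : 0 ≤ s' - s)]
  calc Real.exp (-(s * τ)) - Real.exp (-(s' * τ)) ≤ (s' - s) * τ * Real.exp (-(s * τ)) := by
        rw [h4]; nlinarith
    _ ≤ (s' - s) * τ * Real.exp (-(7 / 8 * τ)) := by
        exact mul_le_mul_of_nonneg_left h2 (mul_nonneg (by linarith) hτ)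
    _ ≤ _ := by nlinarith

lemma weightDecay_rpow_sub_rpow {s s' : ℝ} (hs : 7 / 8 ≤ s) (hs1 : s ≤ 9 / 8) (hs' : 7 / 8 ≤ s') :
    WeightDecay (fun x => x ^ s - x ^ s') (3 / 4) (10 * |s - s'|) := by
  refine ⟨fun τ => -s * Real.exp (-(s * τ)) - -s' * Real.exp (-(s' * τ)), fun τ hτ => ?_⟩
  simp only [exp_neg_rpow]
  have h1 := abs_exp_sub_exp_le hs hs' hτ.le
  have h0 := Real.exp_pos (-(3 / 4 * τ))
  refine ⟨(hasDerivAt_exp_neg_mul s τ).sub (hasDerivAt_exp_neg_mul s' τ), ?_, ?_⟩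
  · have := abs_nonneg (s - s'); nlinarith
  · have e : -s * Real.exp (-(s * τ)) - -s' * Real.exp (-(s' * τ)) =
        -(s * (Real.exp (-(s * τ)) - Real.exp (-(s' * τ)))) - (s - s') * Real.exp (-(s' * τ)) := by
      ring
    have h2 : Real.exp (-(s' * τ)) ≤ Real.exp (-(3 / 4 * τ)) := Real.exp_le_exp.2 (by nlinarith)
    have h3 := Real.exp_pos (-(s' * τ))
    have h4 : |(s - s') * Real.exp (-(s' * τ))| ≤ |s - s'| * Real.exp (-(3 / 4 * τ)) := by
      rw [abs_mul, abs_of_pos h3]; exact mul_le_mul_of_nonneg_left h2 (abs_nonneg _)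
    have h5 : |-(s * (Real.exp (-(s * τ)) - Real.exp (-(s' * τ))))| ≤
        9 / 8 * (8 * |s - s'| * Real.exp (-(3 / 4 * τ))) := by
      rw [abs_neg, abs_mul, abs_of_nonneg (by linarith : (0 : ℝ) ≤ s)]
      exact mul_le_mul hs1 h1 (abs_nonneg _) (by norm_num)
    rw [e]
    refine (abs_sub _ _).trans ?_
    linarith

lemma hasDerivAt_mul_exp_neg (τ : ℝ) : HasDerivAt (fun τ => Real.log (Real.exp (-τ)) * Real.exp (-τ))
    (-Real.exp (-τ) + τ * Real.exp (-τ)) τ := by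
  simp only [Real.log_exp]
  have h1 := (hasDerivAt_id' τ).fun_neg
  have h2 := h1.fun_mul h1.exp
  have e : -Real.exp (-τ) + τ * Real.exp (-τ) = -1 * Real.exp (-τ) + -τ * (Real.exp (-τ) * -1) := by
    ring
  rw [e]; exact h2

lemma weightDecay_log_mul : WeightDecay (fun x => Real.log x * x) (3 / 4) 9 := by
  refine ⟨fun τ => -Real.exp (-τ) + τ * Real.exp (-τ), fun τ hτ => ?_⟩
  have h0 := Real.exp_pos (-τ)
  have h1 := (mul_exp_le hτ.le).1
  have h2 : Real.exp (-τ) ≤ Real.exp (-(7 / 8 * τ)) := Real.exp_le_exp.2 (by linarith)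
  have h3 : Real.exp (-τ) ≤ Real.exp (-(3 / 4 * τ)) := Real.exp_le_exp.2 (by linarith)
  have h4 : τ * Real.exp (-τ) ≤ 8 * Real.exp (-(3 / 4 * τ)) :=
    (mul_le_mul_of_nonneg_left h2 hτ.le).trans h1
  have h5 : 0 ≤ τ * Real.exp (-τ) := by positivity
  refine ⟨hasDerivAt_mul_exp_neg τ, ?_, ?_⟩
  · simp only [Real.log_exp]
    rw [neg_mul, abs_neg, abs_of_nonneg h5]; linarith
  · rw [abs_le]; constructor <;> linarith

/-- With x = exp(-τ) and h = s - 1 the weight is exp(-τ) (exp(-hτ) - 1 + hτ), of size h² τ² exp(-τ +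
|h| τ). For |h| ≤ 1/8 the quadratic factor in τ is absorbed by `mul_exp_le`. -/
lemma weightDecay_second {s : ℝ} (hs : |s - 1| ≤ 1 / 8) :
    WeightDecay (fun x => (x ^ s - x ^ (1 : ℝ)) - (s - 1) * (Real.log x * x)) (3 / 4)
      (200 * (s - 1) ^ 2) := by
  set h := s - 1 with hh
  refine ⟨fun τ => (-s * Real.exp (-(s * τ)) - -1 * Real.exp (-(1 * τ))) -
    h * (-Real.exp (-τ) + τ * Real.exp (-τ)), fun τ hτ => ?_⟩
  have hd := ((hasDerivAt_exp_neg_mul s τ).sub (hasDerivAt_exp_neg_mul 1 τ)).sub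
    ((hasDerivAt_mul_exp_neg τ).const_mul h)
  obtain ⟨m1, m2⟩ := mul_exp_le hτ.le
  have h0 := Real.exp_pos (-(3 / 4 * τ))
  obtain ⟨b1, b2⟩ := abs_le.1 hs
  have key : |Real.exp (-(s * τ)) - Real.exp (-(1 * τ)) - h * (-τ * Real.exp (-τ))| ≤
      128 * h ^ 2 * Real.exp (-(3 / 4 * τ)) := by
    have e1 : Real.exp (-(s * τ)) = Real.exp (-τ) * Real.exp (-(h * τ)) := by
      rw [← Real.exp_add]; congr 1; rw [hh]; ring
    have e2 : Real.exp (-(s * τ)) - Real.exp (-(1 * τ)) - h * (-τ * Real.exp (-τ)) =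
        Real.exp (-τ) * (Real.exp (-(h * τ)) - 1 - -(h * τ)) := by rw [e1, one_mul]; ring
    rw [e2, abs_mul, abs_of_pos (Real.exp_pos _)]
    have e3 := abs_exp_sub_one_sub_le (-(h * τ))
    have e4 : Real.exp |-(h * τ)| ≤ Real.exp (τ / 8) := by
      refine Real.exp_le_exp.2 ?_
      rw [abs_neg, abs_mul, abs_of_pos hτ]; nlinarith
    have e5 : Real.exp (-τ) * Real.exp (τ / 8) = Real.exp (-(7 / 8 * τ)) := by
      rw [← Real.exp_add]; congr 1; ring
    calc Real.exp (-τ) * |Real.exp (-(h * τ)) - 1 - -(h * τ)|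
        ≤ Real.exp (-τ) * ((-(h * τ)) ^ 2 * Real.exp (τ / 8)) := by
          refine mul_le_mul_of_nonneg_left (e3.trans ?_) (Real.exp_pos _).le
          exact mul_le_mul_of_nonneg_left e4 (sq_nonneg _)
      _ = h ^ 2 * (τ ^ 2 * Real.exp (-(7 / 8 * τ))) := by rw [← e5]; ring
      _ ≤ h ^ 2 * (128 * Real.exp (-(3 / 4 * τ))) := mul_le_mul_of_nonneg_left m2 (sq_nonneg _)
      _ = _ := by ring
  simp only [exp_neg_rpow]
  refine ⟨hd, ?_, ?_⟩
  · rw [Real.log_exp]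
    nlinarith [sq_nonneg h]
  · have e : (-s * Real.exp (-(s * τ)) - -1 * Real.exp (-(1 * τ))) -
        h * (-Real.exp (-τ) + τ * Real.exp (-τ)) =
        -(s * (Real.exp (-(s * τ)) - Real.exp (-(1 * τ)) - h * (-τ * Real.exp (-τ)))) +
          h ^ 2 * (τ * Real.exp (-τ)) := by
      rw [hh, one_mul]; ring
    have h2 : Real.exp (-τ) ≤ Real.exp (-(7 / 8 * τ)) := Real.exp_le_exp.2 (by linarith)
    have h3 : τ * Real.exp (-τ) ≤ 8 * Real.exp (-(3 / 4 * τ)) :=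
      (mul_le_mul_of_nonneg_left h2 hτ.le).trans m1
    have h4 : 0 ≤ τ * Real.exp (-τ) := mul_nonneg hτ.le (Real.exp_pos _).le
    rw [e]
    refine (abs_add_le _ _).trans ?_
    rw [abs_neg, abs_mul, abs_of_nonneg (by linarith : 0 ≤ s),
      abs_of_nonneg (mul_nonneg (sq_nonneg h) h4)]
    have h5 : s * |Real.exp (-(s * τ)) - Real.exp (-(1 * τ)) - h * (-τ * Real.exp (-τ))| ≤
        9 / 8 * (128 * h ^ 2 * Real.exp (-(3 / 4 * τ))) :=
      mul_le_mul (by linarith) key (abs_nonneg _) (by norm_num)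
    nlinarith [sq_nonneg h, mul_le_mul_of_nonneg_left h3 (sq_nonneg h)]

namespace LabelledIdealPolygon

variable {Γ₀ : Subgroup SL(2, ℝ)} {𝒜 : Type*} (Ω : LabelledIdealPolygon Γ₀ 𝒜) [Finite 𝒜]

/-- Here τ = 2 log ‖den‖ = -log |D F_W|. Its distortion is bounded uniformly in W: `den` is affine
with slope |β| = O(n), while its modulus on the domain is at least of order n. -/
lemma exists_tau_bounds : ∃ c K : ℝ, 0 < c ∧ c ≤ 1 ∧ 0 < K ∧ ∀ a, ∀ W ∈ Ω.words a,
    1 ≤ W.length ∧ ∀ ξ ∈ Ω.arc a, ∃ τ : ℝ, derivNorm (Ω.word W) ξ = Real.exp (-τ) ∧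
      Real.log (1 + c * (W.length : ℝ) ^ 2) ≤ τ ∧
      (τ ≤ K + 2 * Real.log W.length) ∧
      ∀ ζ ∈ Ω.arc a, ∀ τ' : ℝ, derivNorm (Ω.word W) ζ = Real.exp (-τ') →
        |τ - τ'| ≤ K * dist ξ ζ := by
  obtain ⟨c, C, hc, hC, h⟩ := Ω.exists_den_bounds
  have hc' : 0 < min c 1 := lt_min hc one_pos
  refine ⟨min c 1, 2 * |Real.log C| + 2 * C / √c + 1, hc', min_le_right _ _, by positivity,
    fun a W hW => ?_⟩
  obtain ⟨-, -, -, hn⟩ := h a W hW _ (Ω.xiL_mem_arc a)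
  have hn' : (1 : ℝ) ≤ W.length := by exact_mod_cast hn
  have hpos : ∀ ξ : Circle, 0 < ‖den (Ω.word W) ξ‖ := fun ξ => norm_pos_iff.2 (den_ne_zero _ ξ)
  have hexp : ∀ ξ : Circle, derivNorm (Ω.word W) ξ =
      Real.exp (-(2 * Real.log ‖den (Ω.word W) ξ‖)) := fun ξ => by
    rw [Real.exp_neg, mul_comm, Real.exp_mul, Real.exp_log (hpos ξ), derivNorm]; norm_num
  refine ⟨hn, fun ξ hξ => ⟨2 * Real.log ‖den (Ω.word W) ξ‖, hexp ξ, ?_, ?_, fun ζ hζ τ' hτ' => ?_⟩⟩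
  · have h1 := (h a W hW ξ hξ).1
    have h2 : 2 * Real.log ‖den (Ω.word W) ξ‖ = Real.log (‖den (Ω.word W) ξ‖ ^ 2) := by
      rw [Real.log_pow]; norm_num
    rw [h2]
    refine Real.log_le_log (by positivity) (le_trans ?_ h1)
    have : min c 1 ≤ c := min_le_left _ _
    nlinarith [sq_nonneg (W.length : ℝ)]
  · have h1 := (h a W hW ξ hξ).2.1
    have h2 := Real.log_le_log (hpos ξ) h1
    rw [Real.log_mul hC.ne' (by positivity)] at h2
    have h3 := le_abs_self (Real.log C)
    have h4 : 0 ≤ 2 * C / √c := by positivity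
    linarith
  · rw [hexp ζ, Real.exp_eq_exp, neg_inj] at hτ'
    rw [← hτ', ← mul_sub, abs_mul, abs_two]
    have hlow : ∀ z ∈ Ω.arc a, √c * W.length ≤ ‖den (Ω.word W) z‖ := by
      intro z hz
      refine le_of_sq_le_sq ?_ (norm_nonneg _)
      rw [mul_pow, Real.sq_sqrt hc.le]
      linarith [(h a W hW z hz).1]
    have hm : 0 < √c * W.length := by positivity
    have hlog : ∀ x ∈ Ω.arc a, ∀ y ∈ Ω.arc a,
        Real.log ‖den (Ω.word W) x‖ - Real.log ‖den (Ω.word W) y‖ ≤ C / √c * dist x y := by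
      intro x hx y hy
      rw [← Real.log_div (hpos x).ne' (hpos y).ne']
      refine (Real.log_le_sub_one_of_pos (div_pos (hpos x) (hpos y))).trans ?_
      have h1 : ‖den (Ω.word W) x‖ - ‖den (Ω.word W) y‖ ≤ C * W.length * dist x y := by
        refine (norm_sub_norm_le _ _).trans ?_
        rw [den_sub, norm_mul]
        refine mul_le_mul (h a W hW x hx).2.2.1 ?_ (norm_nonneg _) (by positivity)
        rw [← dist_eq_norm]; exact le_rfl
      have h2 : ‖den (Ω.word W) x‖ / ‖den (Ω.word W) y‖ - 1 =
          (‖den (Ω.word W) x‖ - ‖den (Ω.word W) y‖) / ‖den (Ω.word W) y‖ := by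
        rw [sub_div, div_self (hpos y).ne']
      rw [h2, div_le_iff₀ (hpos y)]
      refine h1.trans ?_
      have h3 : C / √c * dist x y * (√c * W.length) ≤ C / √c * dist x y * ‖den (Ω.word W) y‖ :=
        mul_le_mul_of_nonneg_left (hlow y hy) (by positivity)
      have h4 : C / √c * dist x y * (√c * W.length) = C * W.length * dist x y := by
        field_simp
      linarith
    have h1 := hlog ξ hξ ζ hζ
    have h2 := hlog ζ hζ ξ hξ
    rw [dist_comm] at h2
    have h3 : |Real.log ‖den (Ω.word W) ξ‖ - Real.log ‖den (Ω.word W) ζ‖| ≤ C / √c * dist ξ ζ :=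
      abs_le.2 ⟨by linarith, h1⟩
    have h4 : 0 ≤ 2 * |Real.log C| * dist ξ ζ := by positivity
    have h5 : (2 * |Real.log C| + 2 * C / √c + 1) * dist ξ ζ =
      2 * |Real.log C| * dist ξ ζ + 2 * (C / √c * dist ξ ζ) + dist ξ ζ := by ring
    have h6 : 0 ≤ dist ξ ζ := dist_nonneg
    linarith

/-- Bounds for decaying weights in terms of the number of letters. -/
lemma exists_weight_bounds (S : ℝ) : ∃ K : ℝ, 0 < K ∧ ∀ σ ∈ Icc 0 S, ∀ M w, WeightDecay w σ M →
    ∀ a, ∀ W ∈ Ω.words a, ∀ ξ ∈ Ω.arc a,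
      |w (derivNorm (Ω.word W) ξ)| ≤ K * M * (W.length : ℝ) ^ (-(2 * σ)) ∧ ∀ ζ ∈ Ω.arc a,
      |w (derivNorm (Ω.word W) ξ) - w (derivNorm (Ω.word W) ζ)| ≤
        K * M * (W.length : ℝ) ^ (-(2 * σ)) * dist ξ ζ := by
  obtain ⟨c, K, hc, hc1, hK, h⟩ := Ω.exists_tau_bounds
  refine ⟨(K + 1) * c ^ (-S), by positivity, ?_⟩
  rintro σ ⟨hσ0, hσS⟩ M w ⟨u', hu⟩ a W hW ξ hξ
  obtain ⟨hn, hτ⟩ := h a W hW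
  have hn' : (0 : ℝ) < W.length := by exact_mod_cast hn
  set t₀ := Real.log (1 + c * (W.length : ℝ) ^ 2) with ht₀
  have ht₀0 : 0 < t₀ := Real.log_pos (by have : 0 < c * (W.length : ℝ) ^ 2 := by positivity
                                         linarith)
  have hM : 0 ≤ M := by
    have h1 := (hu 1 one_pos).2.1
    have h2 := (abs_nonneg _).trans h1
    exact nonneg_of_mul_nonneg_left h2 (Real.exp_pos _)
  -- The factor c^(-σ) is at most c^(-S) because c ≤ 1, which makes the bound uniform in σ.
  have hexp : ∀ τ ≥ t₀, Real.exp (-(σ * τ)) ≤ c ^ (-S) * (W.length : ℝ) ^ (-(2 * σ)) := by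
    intro τ hτ
    have h1 : Real.exp (-(σ * τ)) ≤ Real.exp (Real.log (c * (W.length : ℝ) ^ 2) * (-σ)) := by
      refine Real.exp_le_exp.2 ?_
      have : Real.log (c * (W.length : ℝ) ^ 2) ≤ t₀ :=
        Real.log_le_log (by positivity) (by linarith)
      nlinarith
    refine h1.trans ?_
    rw [Real.exp_mul, Real.exp_log (by positivity), Real.mul_rpow hc.le (by positivity)]
    have h2 : ((W.length : ℝ) ^ 2) ^ (-σ) = (W.length : ℝ) ^ (-(2 * σ)) := by
      rw [← Real.rpow_natCast, ← Real.rpow_mul hn'.le]; congr 1; push_cast; ring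
    rw [h2]
    exact mul_le_mul_of_nonneg_right (Real.rpow_le_rpow_of_exponent_ge hc hc1 (by linarith))
      (by positivity)
  set B := c ^ (-S) * (W.length : ℝ) ^ (-(2 * σ)) with hB
  have hB0 : 0 ≤ B := by positivity
  have e : (K + 1) * c ^ (-S) * M * (W.length : ℝ) ^ (-(2 * σ)) = (K + 1) * M * B := by
    rw [hB]; ring
  rw [e]
  have hMB : 0 ≤ M * B := by positivity
  obtain ⟨τ, hτ1, hτ2, -, hτ3⟩ := hτ ξ hξ
  refine ⟨?_, fun ζ hζ => ?_⟩
  · rw [hτ1]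
    have := (hu τ (ht₀0.trans_le hτ2)).2.1
    have h2 := mul_le_mul_of_nonneg_left (hexp τ hτ2) hM
    nlinarith
  · obtain ⟨τ', hτ1', hτ2', -, -⟩ := hτ ζ hζ
    have h1 := hτ3 ζ hζ τ' hτ1'
    rw [hτ1, hτ1']
    -- Mean value inequality on [t₀, ∞), where the derivative bound is uniform.
    have h2 := (convex_Ici t₀).norm_image_sub_le_of_norm_hasDerivWithin_le
      (f := fun τ => w (Real.exp (-τ))) (f' := u') (C := M * B)
      (fun x hx => (hu x (ht₀0.trans_le hx)).1.hasDerivWithinAt)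
      (fun x hx => (hu x (ht₀0.trans_le hx)).2.2.trans
        (mul_le_mul_of_nonneg_left (hexp x hx) hM)) (Set.mem_Ici.2 hτ2') (Set.mem_Ici.2 hτ2)
    rw [Real.norm_eq_abs, Real.norm_eq_abs] at h2
    refine h2.trans ((mul_le_mul_of_nonneg_left h1 hMB).trans ?_)
    have : 0 ≤ dist ξ ζ := dist_nonneg
    nlinarith [mul_nonneg hMB this]

end LabelledIdealPolygon

end BowenSeries

/-! ### Tail sums, existence and norms of the operators. -/

namespace BowenSeries

open Complex MeasureTheory Set

/-- Dominates the terms by differences of n^(-1/2), so that tails telescope. -/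
lemma rpow_neg_three_halves_le {n : ℕ} (hn : 1 ≤ n) :
    (n : ℝ) ^ (-(3 / 2 : ℝ)) ≤ 4 * ((n : ℝ) ^ (-(1 / 2 : ℝ)) - ((n + 1 : ℕ) : ℝ) ^ (-(1 / 2 : ℝ))) := by
  have h1 : (1 : ℝ) ≤ n := by exact_mod_cast hn
  have e1 : ∀ x : ℝ, 0 < x → x ^ (-(1 / 2 : ℝ)) = (√x)⁻¹ := fun x hx => by
    rw [Real.rpow_neg hx.le, Real.sqrt_eq_rpow]
  have e2 : (n : ℝ) ^ (-(3 / 2 : ℝ)) = (√n * n)⁻¹ := by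
    rw [mul_inv, ← e1 n (by linarith), ← Real.rpow_neg_one (n : ℝ), ← Real.rpow_add (by linarith)]
    norm_num
  rw [e2, e1 _ (by linarith), e1 _ (by positivity)]
  push_cast
  set x := √(n : ℝ) with hx
  set y := √((n : ℝ) + 1) with hy
  have hx0 : 0 < x := Real.sqrt_pos.2 (by linarith)
  have hy0 : 0 < y := Real.sqrt_pos.2 (by linarith)
  have hx2 : x ^ 2 = n := Real.sq_sqrt (by linarith)
  have hy2 : y ^ 2 = n + 1 := Real.sq_sqrt (by linarith)
  have e3 : x⁻¹ - y⁻¹ = (x * y * (x + y))⁻¹ := by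
    field_simp
    linear_combination hy2 - hx2
  rw [e3, ← hx2, ← div_eq_mul_inv, inv_le_comm₀ (by positivity) (by positivity), inv_div]
  rw [div_le_iff₀ (by norm_num)]
  have hxy : x ≤ y := Real.sqrt_le_sqrt (by linarith)
  have hyx : y ≤ 3 / 2 * x := by
    refine le_of_sq_le_sq ?_ (by positivity)
    rw [mul_pow, hx2, hy2]; nlinarith
  have hx3 : 0 < x * x := by positivity
  have : x * y * (x + y) ≤ x * (3 / 2 * x) * (x + 3 / 2 * x) := by gcongr
  nlinarith [mul_pos hx3 hx0]

/-- For n ≥ N and σ ≥ 3/4 one has n^(-2σ) ≤ N^(-(2σ-3/2)) n^(-3/2), and the last factor telescopes.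
The constant does not depend on σ. -/
lemma tsum_tail_le {N : ℕ} (hN : 1 ≤ N) {σ : ℝ} (hσ : 3 / 4 ≤ σ) :
    Summable (fun n : ℕ => if N ≤ n then (n : ℝ) ^ (-(2 * σ)) else 0) ∧
    ∑' n : ℕ, (if N ≤ n then (n : ℝ) ^ (-(2 * σ)) else 0) ≤ 4 * (N : ℝ) ^ (-(2 * σ - 1)) := by
  have hN' : (0 : ℝ) < N := by exact_mod_cast hN
  have h0 : ∀ n : ℕ, 0 ≤ (if N ≤ n then (n : ℝ) ^ (-(2 * σ)) else 0) := fun n => by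
    split_ifs <;> positivity
  have key : ∀ n : ℕ, ∑ i ∈ Finset.range n, (if N ≤ i then (i : ℝ) ^ (-(2 * σ)) else 0) ≤
      4 * (N : ℝ) ^ (-(2 * σ - 3 / 2)) *
        ((N : ℝ) ^ (-(1 / 2 : ℝ)) - ((max n N : ℕ) : ℝ) ^ (-(1 / 2 : ℝ))) := by
    intro n
    induction n with
    | zero => simp
    | succ n ih =>
      rw [Finset.sum_range_succ]
      split_ifs with h
      · rw [max_eq_left h] at ih
        rw [max_eq_left (by omega : N ≤ n + 1)]
        have hn : (0 : ℝ) < n := hN'.trans_le (by exact_mod_cast h)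
        have h1 := rpow_neg_three_halves_le (hN.trans h)
        have h2 : (n : ℝ) ^ (-(2 * σ)) = (n : ℝ) ^ (-(2 * σ - 3 / 2)) * (n : ℝ) ^ (-(3 / 2 : ℝ)) := by
          rw [← Real.rpow_add hn]; congr 1; ring
        have h3 : (n : ℝ) ^ (-(2 * σ - 3 / 2)) ≤ (N : ℝ) ^ (-(2 * σ - 3 / 2)) :=
          Real.rpow_le_rpow_of_nonpos hN' (by exact_mod_cast h) (by linarith)
        have h4 : (n : ℝ) ^ (-(2 * σ)) ≤ (N : ℝ) ^ (-(2 * σ - 3 / 2)) *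
            (4 * ((n : ℝ) ^ (-(1 / 2 : ℝ)) - ((n + 1 : ℕ) : ℝ) ^ (-(1 / 2 : ℝ)))) := by
          rw [h2]
          exact mul_le_mul h3 h1 (by positivity) (by positivity)
        linarith
      · have : max (n + 1) N = max n N := by omega
        rw [this, add_zero]; exact ih
  have hbound : ∀ n : ℕ, ∑ i ∈ Finset.range n, (if N ≤ i then (i : ℝ) ^ (-(2 * σ)) else 0) ≤
      4 * (N : ℝ) ^ (-(2 * σ - 1)) := by
    intro n
    refine (key n).trans ?_
    have h1 : (N : ℝ) ^ (-(2 * σ - 1)) = (N : ℝ) ^ (-(2 * σ - 3 / 2)) * (N : ℝ) ^ (-(1 / 2 : ℝ)) := by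
      rw [← Real.rpow_add hN']; congr 1; ring
    rw [h1, ← mul_assoc]
    refine mul_le_mul_of_nonneg_left ?_ (by positivity)
    have : 0 ≤ ((max n N : ℕ) : ℝ) ^ (-(1 / 2 : ℝ)) := by positivity
    linarith
  exact ⟨summable_of_sum_range_le h0 hbound, Real.tsum_le_of_sum_range_le h0 hbound⟩

lemma WeightDecay.nonneg {w : ℝ → ℝ} {σ M : ℝ} (h : WeightDecay w σ M) : 0 ≤ M := by
  obtain ⟨u', hu⟩ := h
  have h1 := (hu 1 one_pos).2.1
  exact nonneg_of_mul_nonneg_left ((abs_nonneg _).trans h1) (Real.exp_pos _)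

namespace LabelledIdealPolygon

variable {Γ₀ : Subgroup SL(2, ℝ)} {𝒜 : Type*} (Ω : LabelledIdealPolygon Γ₀ 𝒜) [Finite 𝒜]

/-- The general form of the existence results for weighted operators: `b` selects the numbers of
letters of the words in question. -/
lemma exists_weightedOp_of_decay (S : ℝ) : ∃ K : ℝ, 0 < K ∧ ∀ (P : ℕ → Prop) [DecidablePred P],
    ∀ (𝒱 : 𝒜 → Set (List 𝒜)), (∀ a, 𝒱 a ⊆ Ω.words a) → (∀ a, ∀ W ∈ 𝒱 a, P W.length) →
    ∀ σ ∈ Icc 0 S, ∀ w M, WeightDecay w σ M →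
    Summable (fun n : ℕ => if P n then (n : ℝ) ^ (-(2 * σ)) else 0) →
    ∃ L : Ω.PLip →L[ℂ] Ω.PLip, IsWeightedOp 𝒱 w L ∧
      ‖L‖ ≤ K * M * ∑' n : ℕ, (if P n then (n : ℝ) ^ (-(2 * σ)) else 0) := by
  obtain ⟨K₁, hK₁, h₁⟩ := Ω.exists_weightedOp
  obtain ⟨K₂, hK₂, h₂⟩ := Ω.exists_weight_bounds S
  refine ⟨K₁ * K₂, by positivity, fun P _ 𝒱 h𝒱 hP σ hσ w M hw hs => ?_⟩
  have hM := hw.nonneg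
  obtain ⟨L, hL, hL'⟩ := h₁ 𝒱 h𝒱 w
    (fun n => K₂ * M * (if P n then (n : ℝ) ^ (-(2 * σ)) else 0))
    (fun n => by split_ifs <;> positivity) (hs.mul_left _)
    (fun a W hW ξ hξ => by
      rw [if_pos (hP a W hW)]; exact (h₂ σ hσ M w hw a W (h𝒱 a hW) ξ hξ).1)
    (fun a W hW ξ hξ ζ hζ => by
      rw [if_pos (hP a W hW)]; exact (h₂ σ hσ M w hw a W (h𝒱 a hW) ξ hξ).2 ζ hζ)
  refine ⟨L, hL, hL'.trans_eq ?_⟩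
  rw [tsum_mul_left]; ring

/-- Operators with summable weights. -/
lemma exists_weightedOp_summable {σ : ℝ} (hσ : 1 / 2 < σ) : ∃ K : ℝ, 0 < K ∧
    ∀ (𝒱 : 𝒜 → Set (List 𝒜)), (∀ a, 𝒱 a ⊆ Ω.words a) → ∀ w M, WeightDecay w σ M →
    ∃ L : Ω.PLip →L[ℂ] Ω.PLip, IsWeightedOp 𝒱 w L ∧ ‖L‖ ≤ K * M := by
  obtain ⟨K, hK, h⟩ := Ω.exists_weightedOp_of_decay σ
  set S := ∑' n : ℕ, (if True then (n : ℝ) ^ (-(2 * σ)) else 0) with hS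
  have hS0 : 0 ≤ S := tsum_nonneg fun n => by split_ifs <;> positivity
  have hsum : Summable (fun n : ℕ => if True then (n : ℝ) ^ (-(2 * σ)) else 0) := by
    simp only [if_true]; exact Real.summable_nat_rpow.2 (by linarith)
  refine ⟨K * S + 1, by positivity, fun 𝒱 h𝒱 w M hw => ?_⟩
  obtain ⟨L, hL, hL'⟩ := h (fun _ => True) 𝒱 h𝒱 (fun _ _ _ => trivial) σ ⟨by linarith, le_rfl⟩ w M hw
    hsum
  refine ⟨L, hL, hL'.trans ?_⟩
  have := hw.nonneg
  nlinarith

lemma exists_weightedOp_finite {σ : ℝ} (hσ : 0 ≤ σ) (N : ℕ) (𝒱 : 𝒜 → Set (List 𝒜))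
    (h𝒱 : ∀ a, 𝒱 a ⊆ Ω.words a) (hN : ∀ a, ∀ W ∈ 𝒱 a, W.length ≤ N) {w : ℝ → ℝ} {M : ℝ}
    (hw : WeightDecay w σ M) : ∃ L : Ω.PLip →L[ℂ] Ω.PLip, IsWeightedOp 𝒱 w L := by
  obtain ⟨K, hK, h⟩ := Ω.exists_weightedOp_of_decay σ
  obtain ⟨L, hL, -⟩ := h (· ≤ N) 𝒱 h𝒱 hN σ ⟨hσ, le_rfl⟩ w M hw
    (summable_of_ne_finset_zero (s := Finset.range (N + 1)) fun n hn => if_neg (by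
      simpa [Nat.lt_succ_iff] using hn))
  exact ⟨L, hL⟩

lemma exists_weightedOp_tail : ∃ K : ℝ, 0 < K ∧ ∀ N : ℕ, 1 ≤ N →
    ∀ (𝒱 : 𝒜 → Set (List 𝒜)), (∀ a, 𝒱 a ⊆ Ω.words a) → (∀ a, ∀ W ∈ 𝒱 a, N ≤ W.length) →
    ∀ s ∈ Icc (7 / 8 : ℝ) (9 / 8), ∃ L : Ω.PLip →L[ℂ] Ω.PLip,
      IsWeightedOp 𝒱 (fun x => x ^ s) L ∧ ‖L‖ ≤ K * (N : ℝ) ^ (-(2 * s - 1)) := by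
  obtain ⟨K, hK, h⟩ := Ω.exists_weightedOp_of_decay (9 / 8)
  refine ⟨K * 3 * 4, by positivity, fun N hN 𝒱 h𝒱 hlen s hs => ?_⟩
  obtain ⟨h1, h2⟩ := tsum_tail_le hN (σ := s) (by linarith [hs.1])
  obtain ⟨L, hL, hL'⟩ := h (N ≤ ·) 𝒱 h𝒱 hlen s ⟨by linarith [hs.1], hs.2⟩ _ _
    (weightDecay_rpow (by linarith [hs.1])) h1
  refine ⟨L, hL, hL'.trans ?_⟩
  have h3 : K * (1 + s) ≤ K * 3 := by nlinarith [hs.2]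
  have h4 : 0 ≤ ∑' n : ℕ, (if N ≤ n then (n : ℝ) ^ (-(2 * s)) else 0) :=
    tsum_nonneg fun n => by split_ifs <;> positivity
  calc _ ≤ K * 3 * ∑' n : ℕ, (if N ≤ n then (n : ℝ) ^ (-(2 * s)) else 0) :=
        mul_le_mul_of_nonneg_right h3 h4
    _ ≤ K * 3 * (4 * (N : ℝ) ^ (-(2 * s - 1))) := by gcongr
    _ = _ := by ring

variable {Γ : Subgroup SL(2, ℝ)} {p : ℕ} {A : Fin p → SL(2, ℝ)}

omit [Finite 𝒜] in
variable {Ω} in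
lemma wordsLE_subset (T : EReal) (a : 𝒜) : Ω.wordsLE Γ A T a ⊆ Ω.words a := fun _ h => h.1

omit [Finite 𝒜] in
variable {Ω} in
lemma wordsLE_top : Ω.wordsLE Γ A ⊤ = Ω.words := by
  funext a; ext W; simp [wordsLE]

/-- For T < ∞ the words have a bounded number of letters by `exists_length_bounds`, so the sums are
finite and every s ≥ 0 is admitted. -/
lemma isWeightedOp_transferOp (hle : Γ₀ ≤ Γ) (hΓ : DiscreteTopology Γ)
    (hA : IsCuspRepresentatives Γ A) {s : ℝ} {T : EReal} (h : 1 / 2 < s ∨ 0 ≤ s ∧ T < ⊤) :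
    IsWeightedOp (Ω.wordsLE Γ A T) (fun x => x ^ s) (Ω.transferOp Γ A s T) := by
  suffices ∃ L, IsWeightedOp (Ω.wordsLE Γ A T) (fun x => x ^ s) L by
    obtain ⟨L, hL⟩ := this
    rw [transferOp, hL.weightedOp_eq]; exact hL
  rcases h with h | ⟨h, hT⟩
  · obtain ⟨K, -, hK⟩ := Ω.exists_weightedOp_summable h
    obtain ⟨L, hL, -⟩ := hK (Ω.wordsLE Γ A T) (wordsLE_subset T) _ _ (weightDecay_rpow (by linarith))
    exact ⟨L, hL⟩
  · obtain ⟨C, hC, hlen⟩ := Ω.exists_length_bounds hle hΓ hA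
    obtain ⟨t, ht⟩ : ∃ t : ℝ, T ≤ t := by
      induction T with
      | bot => exact ⟨0, bot_le⟩
      | coe t => exact ⟨t, le_rfl⟩
      | top => exact absurd hT (lt_irrefl _)
    refine Ω.exists_weightedOp_finite h ⌊C * (t + 1)⌋₊ _ (wordsLE_subset T) (fun a W hW => ?_)
      (weightDecay_rpow h)
    refine Nat.le_floor ((hlen W hW.1.1).2.2.trans ?_)
    have : Ω.length Γ A W ≤ t := EReal.coe_le_coe_iff.1 (hW.2.trans ht)
    nlinarith

lemma isWeightedOp_deltaOp {s : ℝ} {T : EReal} (h : 1 / 2 < s) :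
    IsWeightedOp (Ω.wordsGT Γ A T) (fun x => x ^ s) (Ω.deltaOp Γ A s T) := by
  obtain ⟨K, -, hK⟩ := Ω.exists_weightedOp_summable h
  obtain ⟨L, hL, -⟩ := hK (Ω.wordsGT Γ A T) (fun a => Set.sdiff_subset) _ _
    (weightDecay_rpow (by linarith))
  rw [deltaOp, hL.weightedOp_eq]; exact hL

lemma isWeightedOp_derivativeOp :
    IsWeightedOp Ω.words (fun x => Real.log x * x) Ω.derivativeOp := by
  obtain ⟨K, -, hK⟩ := Ω.exists_weightedOp_summable (by norm_num : (1 / 2 : ℝ) < 3 / 4)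
  obtain ⟨L, hL, -⟩ := hK Ω.words (fun a => Subset.rfl) _ _ weightDecay_log_mul
  rw [derivativeOp, hL.weightedOp_eq]; exact hL

/-- A difference of weighted operators over the same words is the weighted operator of the
difference of the weights; words are only omitted for smaller T, so the bound is uniform in T. -/
lemma exists_norm_transferOp_sub_le (hle : Γ₀ ≤ Γ) (hΓ : DiscreteTopology Γ)
    (hA : IsCuspRepresentatives Γ A) : ∃ K : ℝ, 0 < K ∧ ∀ s ∈ Icc (7 / 8 : ℝ) (9 / 8),
    ∀ s' ∈ Icc (7 / 8 : ℝ) (9 / 8), ∀ T : EReal,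
    ‖Ω.transferOp Γ A s T - Ω.transferOp Γ A s' T‖ ≤ K * |s - s'| := by
  obtain ⟨K, hK, h⟩ := Ω.exists_weightedOp_summable (by norm_num : (1 / 2 : ℝ) < 3 / 4)
  refine ⟨K * 10, by positivity, fun s hs s' hs' T => ?_⟩
  obtain ⟨L, hL, hL'⟩ := h (Ω.wordsLE Γ A T) (wordsLE_subset T) _ _
    (weightDecay_rpow_sub_rpow hs.1 hs.2 hs'.1)
  have h1 := Ω.isWeightedOp_transferOp hle hΓ hA (T := T) (Or.inl (by linarith [hs.1] : 1 / 2 < s))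
  have h2 := Ω.isWeightedOp_transferOp hle hΓ hA (T := T) (Or.inl (by linarith [hs'.1] : 1 / 2 < s'))
  rw [(h1.sub h2).unique hL, mul_assoc]; exact hL'

lemma exists_norm_transferOp_expansion (hle : Γ₀ ≤ Γ) (hΓ : DiscreteTopology Γ)
    (hA : IsCuspRepresentatives Γ A) : ∃ K : ℝ, 0 < K ∧ ∀ s : ℝ, |s - 1| ≤ 1 / 8 →
    ‖Ω.transferOp Γ A s ⊤ - Ω.transferOp Γ A 1 ⊤ - ((s - 1 : ℝ) : ℂ) • Ω.derivativeOp‖ ≤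
      K * (s - 1) ^ 2 := by
  obtain ⟨K, hK, h⟩ := Ω.exists_weightedOp_summable (by norm_num : (1 / 2 : ℝ) < 3 / 4)
  refine ⟨K * 200, by positivity, fun s hs => ?_⟩
  obtain ⟨L, hL, hL'⟩ := h Ω.words (fun a => Subset.rfl) _ _ (weightDecay_second hs)
  have hs1 : 1 / 2 < s := by linarith [(abs_le.1 hs).1]
  have h1 := Ω.isWeightedOp_transferOp hle hΓ hA (T := ⊤) (Or.inl hs1)
  have h2 := Ω.isWeightedOp_transferOp hle hΓ hA (T := ⊤)
    (Or.inl (by norm_num : (1 / 2 : ℝ) < 1))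
  rw [wordsLE_top] at h1 h2
  have h3 := Ω.isWeightedOp_derivativeOp
  rw [((h1.sub h2).sub (h3.const_smul (s - 1))).unique hL, mul_assoc]; exact hL'

lemma transferOp_top_eq (hle : Γ₀ ≤ Γ) (hΓ : DiscreteTopology Γ) (hA : IsCuspRepresentatives Γ A)
    {s : ℝ} (hs : 1 / 2 < s) (T : EReal) :
    Ω.transferOp Γ A s ⊤ = Ω.transferOp Γ A s T + Ω.deltaOp Γ A s T := by
  have h1 := Ω.isWeightedOp_transferOp hle hΓ hA (T := ⊤) (Or.inl hs)
  have h2 := Ω.isWeightedOp_transferOp hle hΓ hA (T := T) (Or.inl hs)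
  have h3 : IsWeightedOp (Ω.wordsGT Γ A T) _ _ := Ω.isWeightedOp_deltaOp (T := T) hs
  have h4 := h2.add_disjoint h3 fun a => Set.disjoint_sdiff_right
  have h5 : (fun a => Ω.wordsLE Γ A T a ∪ Ω.wordsGT Γ A T a) = Ω.words :=
    funext fun a => Set.union_sdiff_cancel (wordsLE_subset T a)
  rw [h5] at h4
  rw [wordsLE_top] at h1
  exact h1.unique h4

/-- A word of length greater than T has at least T/(C+1) letters, so the tail of the series starts
there. The factor (C+1)^(2s-1) is at most (C+1)² for s ≤ 9/8. -/
lemma exists_norm_deltaOp_le (hle : Γ₀ ≤ Γ) (hΓ : DiscreteTopology Γ)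
    (hA : IsCuspRepresentatives Γ A) : ∃ K : ℝ, 0 < K ∧ ∀ s ∈ Icc (7 / 8 : ℝ) (9 / 8),
    ∀ T : ℝ, 1 ≤ T → ‖Ω.deltaOp Γ A s T‖ ≤ K * T ^ (-(2 * s - 1)) := by
  obtain ⟨K, hK, h⟩ := Ω.exists_weightedOp_tail
  obtain ⟨C, hC, hlen⟩ := Ω.exists_length_bounds hle hΓ hA
  refine ⟨K * (C + 1) ^ 2, by positivity, fun s hs T hT => ?_⟩
  set N : ℕ := ⌈T / (C + 1)⌉₊ with hN
  have hT0 : 0 < T / (C + 1) := by positivity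
  have hN1 : 1 ≤ N := Nat.one_le_iff_ne_zero.2 (Nat.ceil_pos.2 hT0).ne'
  have hlong : ∀ a, ∀ W ∈ Ω.wordsGT Γ A T a, N ≤ W.length := fun a W hW => by
    refine Nat.ceil_le.2 ?_
    obtain ⟨l0, l1, -⟩ := hlen W hW.1.1
    have h5 : T < Ω.length Γ A W := by
      by_contra! hcon
      exact hW.2 ⟨hW.1, EReal.coe_le_coe_iff.2 hcon⟩
    rw [div_le_iff₀ (by linarith)]
    have : (0 : ℝ) ≤ W.length := Nat.cast_nonneg _
    nlinarith
  obtain ⟨L, hL, hL'⟩ := h N hN1 (Ω.wordsGT Γ A T) (fun a => Set.sdiff_subset) hlong s hs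
  have h3 : IsWeightedOp (Ω.wordsGT Γ A T) _ _ :=
    Ω.isWeightedOp_deltaOp (Γ := Γ) (A := A) (T := T) (by linarith [hs.1] : 1 / 2 < s)
  rw [h3.unique hL]
  refine hL'.trans ?_
  rw [mul_assoc]
  refine mul_le_mul_of_nonneg_left ?_ hK.le
  have h4 : (N : ℝ) ^ (-(2 * s - 1)) ≤ (T / (C + 1)) ^ (-(2 * s - 1)) :=
    Real.rpow_le_rpow_of_nonpos hT0 (Nat.le_ceil _) (by linarith [hs.1])
  refine h4.trans ?_
  rw [Real.div_rpow (by linarith) (by linarith), div_eq_mul_inv, mul_comm]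
  refine mul_le_mul_of_nonneg_right ?_ (by positivity)
  rw [Real.rpow_neg (by linarith), inv_inv, ← Real.rpow_two]
  exact Real.rpow_le_rpow_of_exponent_le (by linarith) (by linarith [hs.2])

end LabelledIdealPolygon

end BowenSeries

namespace BowenSeries

open Complex MeasureTheory Set

/-! ### Integration over the circle -/

instance : MeasurableSpace Circle := borel Circle
instance : BorelSpace Circle := ⟨rfl⟩

/-- The length measure on the circle, of total mass `2π`. -/
def arcMeasure : Measure Circle := (volume.restrict (Ioc 0 (2 * Real.pi))).map cw

lemma measurable_cw : Measurable cw := continuous_cw.measurable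

instance : IsFiniteMeasure arcMeasure := by
  rw [arcMeasure]; infer_instance

instance : NullSingletonClass arcMeasure := by
  refine ⟨fun v => ?_⟩
  rw [arcMeasure, Measure.map_apply measurable_cw (measurableSet_singleton v),
    Measure.restrict_apply (measurable_cw (measurableSet_singleton v))]
  refine Set.Subsingleton.measure_zero (fun s hs t ht => ?_) _
  refine cw_injOn (hs.1.trans (Eq.symm ht.1)) ?_
  rw [abs_lt]
  constructor <;> linarith [hs.2.1, hs.2.2, ht.2.1, ht.2.2]

lemma integral_arcMeasure {f : Circle → ℂ} (hf : Measurable f) :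
    ∫ ξ, f ξ ∂arcMeasure = circInt f := by
  rw [arcMeasure, integral_map measurable_cw.aemeasurable hf.aestronglyMeasurable, circInt,
    intervalIntegral.integral_of_le (by positivity)]

lemma measure_arcMeasure_univ : arcMeasure.real univ = 2 * Real.pi := by
  rw [Measure.real, arcMeasure, Measure.map_apply measurable_cw MeasurableSet.univ]
  simp [Real.pi_pos.le]

lemma arcMeasure_pos {s : Set Circle} {a b : ℝ} (hab : a < b) (h : cw '' Ioo a b ⊆ s) :
    0 < arcMeasure s := by
  obtain ⟨k, hk⟩ : ∃ k : ℤ, a + k * (2 * Real.pi) ∈ Ico 0 (0 + 2 * Real.pi) := by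
    obtain ⟨k, hk, -⟩ := existsUnique_add_zsmul_mem_Ico Real.two_pi_pos a 0
    exact ⟨k, by simpa using hk⟩
  set a' := a + k * (2 * Real.pi) with ha'
  set d := min (b - a) (2 * Real.pi - a') with hd
  have hd0 : 0 < d := lt_min (by linarith) (by linarith [hk.2])
  have hsub : Ioo a' (a' + d) ⊆ cw ⁻¹' (cw '' Ioo a b) ∩ Ioc 0 (2 * Real.pi) := by
    intro t ht
    refine ⟨⟨t - k * (2 * Real.pi), ⟨by linarith [ht.1], ?_⟩, ?_⟩, by linarith [hk.1, ht.1], ?_⟩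
    · have := min_le_left (b - a) (2 * Real.pi - a')
      linarith [ht.2]
    · have := cw_add_int (t - k * (2 * Real.pi)) k
      rw [← this]; congr 1; ring
    · have := min_le_right (b - a) (2 * Real.pi - a')
      linarith [ht.2]
  refine lt_of_lt_of_le ?_ (measure_mono h)
  have h1 : 0 < volume (Ioo a' (a' + d)) := by rw [Real.volume_Ioo]; simpa using hd0
  have h2 : (volume.restrict (Ioc 0 (2 * Real.pi))) (cw ⁻¹' (cw '' Ioo a b)) ≤
      arcMeasure (cw '' Ioo a b) := Measure.le_map_apply measurable_cw.aemeasurable _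
  refine lt_of_lt_of_le h1 (le_trans ?_ h2)
  exact (measure_mono hsub).trans (Measure.le_restrict_apply _ _)

namespace LabelledIdealPolygon

variable {Γ₀ : Subgroup SL(2, ℝ)} {𝒜 : Type*} (Ω : LabelledIdealPolygon Γ₀ 𝒜)

lemma measurableSet_arc (a : 𝒜) : MeasurableSet (Ω.arc a) := by
  have h : Ω.arc a = {ξ : Circle | ‖den (Ω.F (Ω.hat a)) ξ‖ < 1} ∪ {Ω.xiL a} := by
    ext ξ
    constructor
    · rintro ⟨t, ht, rfl⟩
      rcases eq_or_lt_of_le ht.1 with h | h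
      · right; rw [← h]; rfl
      · left; exact (Ω.norm_den_lt_one_iff a _).2 ⟨t, ⟨h, ht.2⟩, rfl⟩
    · rintro (h | h)
      · exact mem_arc_of_norm_den_lt_one h
      · rw [mem_singleton_iff.1 h]; exact Ω.xiL_mem_arc a
  rw [h]
  refine MeasurableSet.union (IsOpen.measurableSet ?_) (measurableSet_singleton _)
  exact isOpen_lt (((continuous_den _).comp continuous_circle_coe).norm) continuous_const

lemma arcMeasure_arc_pos (a : 𝒜) : 0 < arcMeasure (Ω.arc a) :=
  arcMeasure_pos (Ω.lo_lt_hi a) (Set.image_mono Ioo_subset_Ico_self)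

variable [Finite 𝒜]
variable {Ω}

lemma measurable_coe (f : Ω.PLip) : Measurable (f : Circle → ℂ) := by
  refine measurable_of_isOpen fun U hU => ?_
  have h : f ⁻¹' U = ⋃ a, (f ⁻¹' U ∩ Ω.arc a) := by
    rw [← Set.inter_iUnion]
    refine (Set.inter_eq_left.2 fun ξ _ => Set.mem_iUnion.2 ⟨_, Ω.mem_arc_letter ξ⟩).symm
  rw [h]
  refine MeasurableSet.iUnion fun a => ?_
  obtain ⟨K, hK⟩ := f.2 a
  obtain ⟨V, hV, hVU⟩ := continuousOn_iff'.1 hK.continuousOn U hU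
  rw [hVU]
  exact hV.measurableSet.inter (Ω.measurableSet_arc a)

lemma integrable_of_bound {g : Circle → ℂ} (hg : Measurable g) {C : ℝ} (hC : ∀ ξ, ‖g ξ‖ ≤ C) :
    Integrable g arcMeasure :=
  Integrable.of_bound hg.aestronglyMeasurable C (Filter.Eventually.of_forall hC)

lemma integrable_coe (f : Ω.PLip) : Integrable (f : Circle → ℂ) arcMeasure :=
  integrable_of_bound (measurable_coe f) (norm_apply_le f)

variable (Ω) in
/-- Integration over the circle. -/
def integralCLM : Ω.PLip →L[ℂ] ℂ :=
  LinearMap.mkContinuous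
    { toFun := fun f => ∫ ξ, f ξ ∂arcMeasure
      map_add' := fun f g => integral_add (integrable_coe f) (integrable_coe g)
      map_smul' := fun c f => integral_const_mul c _ } (2 * Real.pi) fun f => by
    have h := norm_integral_le_of_norm_le_const (μ := arcMeasure)
      (Filter.Eventually.of_forall (norm_apply_le f))
    rw [measure_arcMeasure_univ, mul_comm] at h
    refine h.trans (mul_le_mul_of_nonneg_left ?_ (by positivity))
    rw [norm_def]; linarith [lipConst_nonneg f]

lemma integralCLM_apply (f : Ω.PLip) : Ω.integralCLM f = ∫ ξ, f ξ ∂arcMeasure := rfl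

variable (Ω)

omit [Finite 𝒜] in
lemma integral_eq_sum_arc {g : Circle → ℂ} (hg : Integrable g arcMeasure)
    (s : Finset 𝒜) : ∫ ξ in ⋃ a ∈ s, Ω.arc a, g ξ ∂arcMeasure =
      ∑ a ∈ s, ∫ ξ in Ω.arc a, g ξ ∂arcMeasure :=
  integral_biUnion_finset s (fun a _ => Ω.measurableSet_arc a)
    (fun _ _ _ _ hab => Set.disjoint_left.2 fun _ h h' => hab (eq_of_mem_arc h h'))
    fun _ _ => hg.integrableOn

/-- The integral over `[b]` of the transferred function. -/
def arcIntegral (f : Ω.PLip) (V : List 𝒜) (b : 𝒜) : ℂ :=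
  ∫ ξ in Ω.arc b, (derivNorm (Ω.word V) ξ : ℂ) * f (circleMap (Ω.word V) ξ) ∂arcMeasure

lemma exists_derivNorm_le (G : SL(2, ℝ)) : ∃ C : ℝ, ∀ ξ : Circle, derivNorm G ξ ≤ C := by
  obtain ⟨C, hC⟩ := isCompact_univ.exists_bound_of_continuousOn
    (f := fun ξ : Circle => derivNorm G ξ) (continuous_derivNorm G).continuousOn
  exact ⟨C, fun ξ => (le_abs_self _).trans (hC ξ (mem_univ _))⟩

lemma measurable_transfer (f : Ω.PLip) (G : SL(2, ℝ)) :
    Measurable fun ξ : Circle => (derivNorm G ξ : ℂ) * f (circleMap G ξ) :=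
  (Complex.measurable_ofReal.comp (continuous_derivNorm G).measurable).mul
    ((measurable_coe f).comp (continuous_circleMap G).measurable)

lemma integrable_transfer (f : Ω.PLip) (G : SL(2, ℝ)) :
    Integrable (fun ξ : Circle => (derivNorm G ξ : ℂ) * f (circleMap G ξ)) arcMeasure := by
  obtain ⟨C, hC⟩ := exists_derivNorm_le G
  refine integrable_of_bound (Ω.measurable_transfer f G) (C := C * supNorm f) fun ξ => ?_
  rw [norm_mul, Complex.norm_real, Real.norm_of_nonneg (derivNorm_pos G ξ).le]
  exact mul_le_mul (hC ξ) (norm_apply_le f _) (norm_nonneg _) ((derivNorm_pos G ξ).le.trans (hC ξ))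

open Classical in
-- Substitution of F_b, which maps the complement of [b̂], the union of the arcs [c] with c ≠ b̂,
-- onto [b].
lemma arcIntegral_eq_sum [Fintype 𝒜] (f : Ω.PLip) (V : List 𝒜) (b : 𝒜) :
    Ω.arcIntegral f V b = ∑ c, if c ≠ Ω.hat b then Ω.arcIntegral f (V ++ [b]) c else 0 := by
  set G := Ω.word V with hG
  have hword : Ω.word (V ++ [b]) = G * Ω.F b := by rw [word_append, word_singleton]
  have hU : (⋃ c ∈ Finset.univ.filter (· ≠ Ω.hat b), Ω.arc c) = (Ω.arc (Ω.hat b))ᶜ := by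
    ext ξ
    simp only [Finset.mem_filter, Finset.mem_univ, true_and, mem_iUnion, exists_prop, mem_compl_iff]
    constructor
    · rintro ⟨c, hc, hξ⟩ h; exact hc (eq_of_mem_arc hξ h)
    · intro h
      exact ⟨Ω.letter ξ, fun h' => h (h' ▸ Ω.mem_arc_letter ξ), Ω.mem_arc_letter ξ⟩
  rw [← Finset.sum_filter]
  simp only [arcIntegral]
  rw [← Ω.integral_eq_sum_arc (Ω.integrable_transfer f _), hU,
    ← integral_indicator (Ω.measurableSet_arc b), ← integral_indicator (Ω.measurableSet_arc _).compl,
    integral_arcMeasure ((Ω.measurable_transfer f _).indicator (Ω.measurableSet_arc b)),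
    integral_arcMeasure ((Ω.measurable_transfer f _).indicator (Ω.measurableSet_arc _).compl),
    ← circInt_comp (Ω.F b)]
  congr 1
  funext ξ
  rw [hword]
  by_cases h : ξ ∈ Ω.arc (Ω.hat b)
  · rw [indicator_of_notMem (by rwa [circleMap_F_mem_arc_iff, not_not]),
      indicator_of_notMem (by simpa using h), mul_zero]
  · rw [indicator_of_mem ((Ω.circleMap_F_mem_arc_iff b ξ).2 h), indicator_of_mem (by simpa using h),
      derivNorm_mul, circleMap_mul]
    push_cast; ring

end LabelledIdealPolygon

end BowenSeries

/-! ### Invariance of the integral under the transfer operator. -/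

namespace BowenSeries

open Complex MeasureTheory Set

namespace LabelledIdealPolygon

variable {Γ₀ : Subgroup SL(2, ℝ)} {𝒜 : Type*} (Ω : LabelledIdealPolygon Γ₀ 𝒜) [Finite 𝒜]

variable (𝒜) in
/-- The words with `n` letters. -/
def wordsOfLength (n : ℕ) : Finset (List 𝒜) := (List.finite_length_eq 𝒜 n).toFinset

lemma mem_wordsOfLength {n : ℕ} {W : List 𝒜} : W ∈ wordsOfLength 𝒜 n ↔ W.length = n := by
  simp [wordsOfLength]

lemma sum_wordsOfLength_succ [Fintype 𝒜] {E : Type*} [AddCommMonoid E] (φ : List 𝒜 → E) (n : ℕ) :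
    ∑ W ∈ wordsOfLength 𝒜 (n + 1), φ W = ∑ V ∈ wordsOfLength 𝒜 n, ∑ b, φ (V ++ [b]) := by
  rw [← Finset.sum_product']
  symm
  refine Finset.sum_bij (fun q _ => q.1 ++ [q.2]) ?_ ?_ ?_ fun _ _ => rfl
  · rintro ⟨V, b⟩ h
    simp only [Finset.mem_product, mem_wordsOfLength] at h ⊢
    simp [h.1]
  · rintro ⟨V, b⟩ _ ⟨V', b'⟩ _ h
    simpa using h
  · intro W hW
    rw [mem_wordsOfLength] at hW
    obtain rfl | ⟨V, b, rfl⟩ := List.eq_nil_or_concat W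
    · simp at hW
    exact ⟨(V, b), by simp [mem_wordsOfLength] at hW ⊢; exact hW, by simp⟩

omit [Finite 𝒜] in
-- On [b] the map F_b̂ does not contract, so translating by twice `ct` does not increase the modulus
-- of the coordinate, which determines its sign.
lemma sgn_mul_xcoord_vtx_le {e : Bool} {b : 𝒜} {ξ : Circle} (h : ξ ∈ Ω.arc b)
    (hv : ξ ≠ Ω.vtx e b) : sgn e * xcoord (Ω.vtx e b) ξ ≤ 0 := by
  obtain ⟨t, ht, rfl⟩ := h
  have h1 := Ω.norm_den_le_one b (Ico_subset_Icc_self ht)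
  have h2 := Ω.shift_F (!e) (Ω.hat b)
  rw [Bool.not_not, Ω.hat_hat, ct_hat, sgn_not] at h2
  have h3 : ‖den (Ω.F (Ω.hat b)) (Ω.vtx e b)‖ = 1 := by
    have := Ω.norm_den_F_vtx e (Ω.hat b)
    rwa [Ω.hat_hat] at this
  have h4 := norm_den_sq h3 hv
  have h5 : ‖den (Ω.F (Ω.hat b)) (cw t)‖ ^ 2 ≤ 1 := pow_le_one₀ (norm_nonneg _) h1
  change ‖den (Ω.F (Ω.hat b)) (cw t)‖ ^ 2 = _ at h4
  rw [h4, div_le_one (by positivity)] at h5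
  have h6 := Ω.ct_pos b
  change sgn e * xcoord (Ω.vtx e b) (cw t) ≤ 0
  change 1 + (xcoord (Ω.vtx e b) (cw t) + _) ^ 2 ≤ 1 + xcoord (Ω.vtx e b) (cw t) ^ 2 at h5
  set x := xcoord (Ω.vtx e b) (cw t)
  set τ := shift (Ω.F (Ω.hat b)) (Ω.vtx e b)
  have h7 : sgn e * τ = 2 * Ω.ct b := by linarith
  have h8 : (sgn e * τ) * (2 * (sgn e * x) + sgn e * τ) ≤ 0 := by
    have : (sgn e * τ) * (2 * (sgn e * x) + sgn e * τ) = sgn e ^ 2 * (τ * (2 * x + τ)) := by ring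
    rw [this, sgn_sq, one_mul]; nlinarith
  rw [h7] at h8
  nlinarith

/-- The derivatives of the maps of the words of right or left type tend to zero on the last arc. -/
lemma derivNorm_sideWord_le {e : Bool} {a : 𝒜} {n : ℕ} {ξ : Circle}
    (h : ξ ∈ Ω.arc ((Ω.step e)^[n] a)) (hv : ξ ≠ Ω.vtx e ((Ω.step e)^[n] a)) :
    derivNorm (Ω.word (Ω.sideWord e a n)) ξ ≤ 1 ∧
    derivNorm (Ω.word (Ω.sideWord e a n)) ξ ≤
      (1 + xcoord (Ω.vtx e ((Ω.step e)^[n] a)) ξ ^ 2) * (1 + Ω.sideShift e a n ^ 2)⁻¹ := by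
  obtain ⟨-, h2, h3⟩ := Ω.sideWord_spec e a n
  have h1 := Ω.sgn_mul_xcoord_vtx_le h hv
  have h4 := norm_den_sq h2 hv
  set G := Ω.word (Ω.sideWord e a n)
  set x := xcoord (Ω.vtx e ((Ω.step e)^[n] a)) ξ
  set t := Ω.sideShift e a n
  have ht : 0 ≤ t := by
    rcases Nat.eq_zero_or_pos n with rfl | hn
    · simp [t, sideShift]
    · exact (Ω.sideShift_pos e a hn.ne').le
  have e1 : (x + shift G (Ω.vtx e ((Ω.step e)^[n] a))) ^ 2 = (sgn e * x - t) ^ 2 := by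
    rw [← one_mul ((x + _) ^ 2), ← sgn_sq e, ← mul_pow, mul_add, h3]; ring
  have e2 : x ^ 2 = (sgn e * x) ^ 2 := by rw [mul_pow, sgn_sq, one_mul]
  rw [derivNorm, h4, e1, inv_div, e2]
  set y := sgn e * x
  constructor
  · rw [div_le_one (by positivity)]; nlinarith
  · rw [← div_eq_mul_inv]
    exact div_le_div_of_nonneg_left (by positivity) (by positivity) (by nlinarith [sq_nonneg y])

/-- Dominated convergence: on the arc of the last letter the derivatives are at most 1 and decay at
every point that is not a vertex. The decay is not uniform, since the derivative is 1 at the vertex.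
-/
lemma tendsto_arcIntegral (f : Ω.PLip) (e : Bool) (a : 𝒜) :
    Filter.Tendsto (fun n => Ω.arcIntegral f (Ω.sideWord e a n) ((Ω.step e)^[n] a))
      Filter.atTop (nhds 0) := by
  have := Fintype.ofFinite 𝒜
  obtain ⟨c, C, hc, hC, hct⟩ := Ω.exists_ct_bounds
  have hshift : Filter.Tendsto (fun n => (1 + Ω.sideShift e a n ^ 2)⁻¹) Filter.atTop (nhds 0) := by
    refine Filter.Tendsto.inv_tendsto_atTop ?_
    refine Filter.tendsto_atTop_add_const_left _ _ ?_
    refine (Filter.tendsto_pow_atTop two_ne_zero).comp ?_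
    refine Filter.tendsto_atTop_mono (f := fun n : ℕ => (n : ℝ) * (2 * c)) (fun n => ?_)
      (tendsto_natCast_atTop_atTop.atTop_mul_const (by positivity))
    have : ∑ k ∈ Finset.range n, 2 * c ≤ Ω.sideShift e a n :=
      Finset.sum_le_sum fun k _ => by linarith [(hct ((Ω.step e)^[k] a)).1]
    simpa using this
  have hae : ∀ᵐ ξ ∂arcMeasure, ∀ b, ξ ≠ Ω.vtx e b := by
    rw [ae_all_iff]
    intro b
    have : arcMeasure {Ω.vtx e b} = 0 := measure_singleton _
    exact measure_eq_zero_iff_ae_notMem.1 this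
  have h0 : (0 : ℂ) = ∫ _ξ, (0 : ℂ) ∂arcMeasure := by simp
  simp only [arcIntegral, ← integral_indicator (Ω.measurableSet_arc _)]
  rw [h0]
  refine tendsto_integral_of_dominated_convergence (fun _ => supNorm f)
    (fun n => ((Ω.measurable_transfer f _).indicator
      (Ω.measurableSet_arc _)).aestronglyMeasurable) (integrable_const _) (fun n => ?_) ?_
  · filter_upwards [hae] with ξ hξ
    by_cases h : ξ ∈ Ω.arc ((Ω.step e)^[n] a)
    · rw [indicator_of_mem h, norm_mul, Complex.norm_real, Real.norm_of_nonneg (derivNorm_pos _ ξ).le]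
      have h1 := (Ω.derivNorm_sideWord_le h (hξ _)).1
      exact (mul_le_of_le_one_left (norm_nonneg _) h1).trans (norm_apply_le f _)
    · rw [indicator_of_notMem h, norm_zero]; exact supNorm_nonneg f
  · filter_upwards [hae] with ξ hξ
    -- The arc varies with n, so the bound is summed over all letters to get rid of n.
    set X := ∑ b, (1 + xcoord (Ω.vtx e b) ξ ^ 2) with hX
    refine squeeze_zero_norm (a := fun n => X * (1 + Ω.sideShift e a n ^ 2)⁻¹ * supNorm f)
      (fun n => ?_) (by simpa using (hshift.const_mul X).mul_const (supNorm f))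
    have hX0 : 0 ≤ X := Finset.sum_nonneg fun b _ => by positivity
    by_cases h : ξ ∈ Ω.arc ((Ω.step e)^[n] a)
    · rw [indicator_of_mem h, norm_mul, Complex.norm_real, Real.norm_of_nonneg (derivNorm_pos _ ξ).le]
      refine mul_le_mul ?_ (norm_apply_le f _) (norm_nonneg _) (by positivity)
      refine (Ω.derivNorm_sideWord_le h (hξ _)).2.trans ?_
      refine mul_le_mul_of_nonneg_right ?_ (by positivity)
      exact Finset.single_le_sum (f := fun b => 1 + xcoord (Ω.vtx e b) ξ ^ 2)
        (fun b _ => by positivity) (Finset.mem_univ _)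
    · rw [indicator_of_notMem h, norm_zero]
      have := supNorm_nonneg f
      positivity

open Classical in
/-- The part of the integral which is not yet transferred by words with at most `n` letters. -/
def remainder [Fintype 𝒜] (f : Ω.PLip) (n : ℕ) : ℂ :=
  ∑ V ∈ wordsOfLength 𝒜 n, ∑ b, if Ω.IsCuspidal (V ++ [b]) then Ω.arcIntegral f V b else 0

open Classical in
/-- The part of the integral of the transferred function which is due to the words with
`n` letters. -/
def lengthPart [Fintype 𝒜] (f : Ω.PLip) (n : ℕ) : ℂ :=
  ∑ W ∈ wordsOfLength 𝒜 n, ∑ c, if W ∈ Ω.words c then Ω.arcIntegral f W c else 0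

lemma isCuspidal_of_append {V : List 𝒜} {b c : 𝒜} (h : Ω.IsCuspidal (V ++ [b] ++ [c])) :
    Ω.IsCuspidal (V ++ [b]) ∧ c ≠ Ω.hat b := by
  rw [isCuspidal_iff] at h ⊢
  obtain ⟨-, e, he⟩ := h
  rw [IsSide, List.isChain_append] at he
  refine ⟨⟨by simp, e, he.1⟩, ?_⟩
  have := he.2.2 b (by simp) c (by simp)
  rw [this]; exact Ω.step_ne_hat e b

/-- Each integral over [b] splits into the letters c ≠ b̂. Either c prolongs the cuspidal word and
stays in the remainder, or the transition to c is allowed and the term belongs to the transferred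
function. -/
lemma remainder_eq [Fintype 𝒜] (f : Ω.PLip) (n : ℕ) :
    Ω.remainder f n = Ω.lengthPart f (n + 1) + Ω.remainder f (n + 1) := by
  classical
  rw [remainder, lengthPart, remainder, sum_wordsOfLength_succ, sum_wordsOfLength_succ,
    ← Finset.sum_add_distrib]
  refine Finset.sum_congr rfl fun V _ => ?_
  rw [← Finset.sum_add_distrib]
  refine Finset.sum_congr rfl fun b _ => ?_
  rw [← Finset.sum_add_distrib]
  by_cases hc : Ω.IsCuspidal (V ++ [b])
  · rw [if_pos hc, arcIntegral_eq_sum]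
    refine Finset.sum_congr rfl fun c _ => ?_
    have h1 := Ω.allowed_append_iff_not_isCuspidal V b c
    have h2 : V ++ [b] ∈ Ω.words c ↔ Ω.Allowed (V ++ [b]) c := ⟨fun h => h.2, fun h => ⟨hc, h⟩⟩
    by_cases h3 : c = Ω.hat b
    · have h4 : ¬ Ω.IsCuspidal (V ++ [b] ++ [c]) := fun h => (Ω.isCuspidal_of_append h).2 h3
      rw [if_neg (not_not.2 h3), if_neg (by rw [h2, h1]; exact fun h => h.1 h3), if_neg h4, add_zero]
    · by_cases h4 : Ω.IsCuspidal (V ++ [b] ++ [c])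
      · rw [if_pos h3, if_neg (by rw [h2, h1]; exact fun h => h.2 h4), if_pos h4, zero_add]
      · rw [if_pos h3, if_pos (by rw [h2, h1]; exact ⟨h3, h4⟩), if_neg h4, add_zero]
  · rw [if_neg hc]
    symm
    refine Finset.sum_eq_zero fun c _ => ?_
    rw [if_neg (fun h => hc h.1), if_neg (fun h => hc (Ω.isCuspidal_of_append h).1), add_zero]

/-- For each n only the words given by a type and a first letter contribute, finitely many sequences
that all tend to 0. -/
lemma tendsto_remainder [Fintype 𝒜] (f : Ω.PLip) :
    Filter.Tendsto (Ω.remainder f) Filter.atTop (nhds 0) := by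
  classical
  have h1 : Filter.Tendsto (fun n => ∑ q : Bool × 𝒜,
      ‖Ω.arcIntegral f (Ω.sideWord q.1 q.2 n) ((Ω.step q.1)^[n] q.2)‖) Filter.atTop (nhds 0) := by
    have := tendsto_finsetSum Finset.univ fun (q : Bool × 𝒜) _ =>
      (Ω.tendsto_arcIntegral f q.1 q.2).norm
    simpa using this
  refine squeeze_zero_norm (fun n => ?_) h1
  rw [remainder, ← Finset.sum_product', ← Finset.sum_filter]
  refine (norm_sum_le _ _).trans ?_
  have hsub : (Finset.filter (fun q : List 𝒜 × 𝒜 => Ω.IsCuspidal (q.1 ++ [q.2]))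
      (wordsOfLength 𝒜 n ×ˢ Finset.univ)) ⊆
      Finset.image (fun q : Bool × 𝒜 => (Ω.sideWord q.1 q.2 n, (Ω.step q.1)^[n] q.2))
        Finset.univ := by
    rintro ⟨V, b⟩ h
    simp only [Finset.mem_filter, Finset.mem_product, mem_wordsOfLength, Finset.mem_univ,
      and_true] at h
    obtain ⟨e, a, m, h2⟩ := (Ω.isCuspidal_iff_exists _).1 h.2
    have h3 : m = n := by
      have := congr_arg List.length h2
      rw [length_sideWord, List.length_append, h.1] at this
      simpa using this.symm
    subst h3
    rw [sideWord_succ'] at h2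
    obtain ⟨h4, h5⟩ := List.append_inj' h2 rfl
    refine Finset.mem_image.2 ⟨(e, a), Finset.mem_univ _, ?_⟩
    rw [h4]; simp at h5; rw [h5]
  refine (Finset.sum_le_sum_of_subset_of_nonneg hsub fun _ _ _ => norm_nonneg _).trans ?_
  exact Finset.sum_image_le_of_nonneg (fun _ _ => norm_nonneg _)

/-- The measure of length is invariant under the dual of the transfer operator. -/
lemma integral_eq_of_isWeightedOp {L : Ω.PLip →L[ℂ] Ω.PLip}
    (hL : IsWeightedOp Ω.words (fun x => x ^ (1 : ℝ)) L) (f : Ω.PLip) :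
    Ω.integralCLM (L f) = Ω.integralCLM f := by
  classical
  have := Fintype.ofFinite 𝒜
  have htot : ∀ g : Ω.PLip, Ω.integralCLM g = ∑ c, ∫ ξ in Ω.arc c, g ξ ∂arcMeasure := by
    intro g
    rw [← Ω.integral_eq_sum_arc (integrable_coe g), integralCLM_apply]
    have : (⋃ a ∈ (Finset.univ : Finset 𝒜), Ω.arc a) = univ :=
      Set.eq_univ_of_forall fun ξ => Set.mem_iUnion₂.2 ⟨_, Finset.mem_univ _, Ω.mem_arc_letter ξ⟩
    rw [this, Measure.restrict_univ]
  -- Every word with one letter is cuspidal, so nothing has been transferred yet.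
  have h0 : Ω.remainder f 0 = Ω.integralCLM f := by
    have e : wordsOfLength 𝒜 0 = {[]} := by
      ext W; simp [mem_wordsOfLength]
    rw [remainder, e, Finset.sum_singleton, htot]
    refine Finset.sum_congr rfl fun b _ => ?_
    rw [List.nil_append, if_pos ((Ω.isCuspidal_iff _).2 ⟨by simp, true, List.isChain_singleton _⟩), arcIntegral]
    simp only [word, List.map_nil, List.prod_nil, circleMap_one]
    simp [derivNorm, den_one]
  have hp0 : Ω.lengthPart f 0 = 0 := by
    refine Finset.sum_eq_zero fun W hW => Finset.sum_eq_zero fun c _ => if_neg fun h => ?_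
    rw [mem_wordsOfLength, List.length_eq_zero_iff] at hW
    exact h.1.1 hW
  have hrec : ∀ N, Ω.integralCLM f = ∑ n ∈ Finset.range (N + 1), Ω.lengthPart f n +
      Ω.remainder f N := by
    intro N
    induction N with
    | zero => simp [hp0, h0]
    | succ N ih => rw [ih, Finset.sum_range_succ _ (N + 1), add_assoc, ← remainder_eq]
  have hlim : Filter.Tendsto (fun N => ∑ n ∈ Finset.range (N + 1), Ω.lengthPart f n) Filter.atTop
      (nhds (Ω.integralCLM f)) := by
    have h1 := (Ω.tendsto_remainder f).const_sub (Ω.integralCLM f)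
    rw [sub_zero] at h1
    refine h1.congr fun N => ?_
    rw [hrec N]; ring
  refine tendsto_nhds_unique ?_ hlim
  -- Sum and integral are exchanged, the terms being dominated by n⁻².
  have hsum : ∀ c, HasSum ((Ω.words c).indicator fun W => Ω.arcIntegral f W c)
      (∫ ξ in Ω.arc c, L f ξ ∂arcMeasure) := by
    intro c
    rw [← hasSum_subtype_iff_indicator]
    obtain ⟨K, hK, hb⟩ := Ω.exists_weight_bounds 1
    have hbd : ∀ W : Ω.words c, ∀ ξ ∈ Ω.arc c,
        ‖(derivNorm (Ω.word W) ξ : ℂ) * f (circleMap (Ω.word W) ξ)‖ ≤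
          K * (1 + 1) * ((W : List 𝒜).length : ℝ) ^ (-(2 * 1) : ℝ) * supNorm f := by
      intro W ξ hξ
      have h1 := (hb 1 ⟨zero_le_one, le_rfl⟩ _ _ (weightDecay_rpow zero_le_one) c W W.2 ξ hξ).1
      rw [Real.rpow_one] at h1
      rw [norm_mul, Complex.norm_real]
      exact mul_le_mul h1 (norm_apply_le f _) (norm_nonneg _) (by positivity)
    have hsm := (Ω.summable_words (b := fun n : ℕ => (n : ℝ) ^ (-(2 * 1) : ℝ))
      (fun n => by positivity) (Real.summable_nat_rpow.2 (by norm_num)) (Subset.refl (Ω.words c))).1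
    have hI : ∀ W : Ω.words c, Integrable (fun ξ : Circle => (derivNorm (Ω.word W) ξ : ℂ) *
        f (circleMap (Ω.word W) ξ)) (arcMeasure.restrict (Ω.arc c)) :=
      fun W => (Ω.integrable_transfer f _).integrableOn
    have hS := hasSum_integral_of_summable_integral_norm hI (by
      refine Summable.of_nonneg_of_le (fun W => integral_nonneg fun _ => norm_nonneg _) (fun W => ?_)
        ((((hsm.mul_left (K * (1 + 1))).mul_right (supNorm f)).mul_right
          (arcMeasure.real (Ω.arc c))))
      have h1 := norm_setIntegral_le_of_norm_le_const (μ := arcMeasure) (s := Ω.arc c)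
        (f := fun ξ : Circle => ‖(derivNorm (Ω.word W) ξ : ℂ) * f (circleMap (Ω.word W) ξ)‖)
        (measure_lt_top _ _) (fun ξ hξ => (norm_norm _).trans_le (hbd W ξ hξ))
      exact (le_abs_self _).trans h1)
    have hcongr : ∫ ξ in Ω.arc c, L f ξ ∂arcMeasure = ∫ ξ in Ω.arc c, ∑' W : Ω.words c,
        (derivNorm (Ω.word W) ξ : ℂ) * f (circleMap (Ω.word W) ξ) ∂arcMeasure := by
      refine setIntegral_congr_fun (Ω.measurableSet_arc c) fun ξ hξ => ?_
      have := hL f c ξ hξ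
      simp only [Real.rpow_one] at this
      exact this.tsum_eq.symm
    rw [hcongr]
    exact hS
  -- The words with at most N letters exhaust all words, so the unconditional sums may be evaluated
  -- along N.
  have hU : Filter.Tendsto (fun N => (Finset.range (N + 1)).biUnion (wordsOfLength 𝒜))
      Filter.atTop Filter.atTop := by
    refine Filter.tendsto_atTop_finset_of_monotone (fun m n h => ?_) fun W =>
      ⟨W.length, Finset.mem_biUnion.2 ⟨W.length, by simp, mem_wordsOfLength.2 rfl⟩⟩
    exact Finset.biUnion_subset_biUnion_of_subset_left _ (Finset.range_mono (by omega))
  rw [htot (L f)]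
  have h2 := tendsto_finsetSum Finset.univ fun (c : 𝒜) _ => (hsum c).comp hU
  refine h2.congr fun N => ?_
  simp only [Function.comp]
  rw [Finset.sum_comm, Finset.sum_biUnion]
  · refine Finset.sum_congr rfl fun n _ => ?_
    simp only [lengthPart, indicator]
  · intro m _ n _ hmn
    refine Finset.disjoint_left.2 fun W hm hn => hmn ?_
    rw [mem_wordsOfLength] at hm hn
    rw [← hm, hn]

end LabelledIdealPolygon

end BowenSeries

namespace BowenSeries

open Complex MeasureTheory Set

lemma dist_circle_le_two (ξ ζ : Circle) : dist ξ ζ ≤ 2 := by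
  change dist (ξ : ℂ) (ζ : ℂ) ≤ 2
  rw [dist_eq_norm]
  refine (norm_sub_le _ _).trans ?_
  rw [Circle.norm_coe, Circle.norm_coe]; norm_num

namespace LabelledIdealPolygon

variable {Γ₀ : Subgroup SL(2, ℝ)} {𝒜 : Type*} (Ω : LabelledIdealPolygon Γ₀ 𝒜) [Finite 𝒜]

/-! ### Mixing -/

/-- One of the words of type e with 2, 3 or 4 letters is allowed. A failure means that a is the next
letter of the orbit or the inverse of the last one; three failures in a row contradict that neither
the involution nor the orbit has a fixed point. -/
lemma exists_allowed_sideWord {e : Bool} {c : 𝒜} (hc : Ω.step e c ≠ c) (a : 𝒜) :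
    ∃ n ≤ 2, Ω.sideWord e c (n + 2) ∈ Ω.words a := by
  set x : ℕ → 𝒜 := fun n => (Ω.step e)^[n] c with hx
  have hxs : ∀ n, x (n + 1) = Ω.step e (x n) := fun n => Function.iterate_succ_apply' _ _ _
  have hfix : ∀ n, x (n + 1) ≠ x n := by
    intro n
    induction n with
    | zero => exact hc
    | succ n ih => rw [hxs (n + 1), hxs n]; exact fun h => ih ((hxs n).trans ((Ω.step e).injective h))
  have hall : ∀ n, a ≠ Ω.hat (x (n + 1)) → a ≠ x (n + 2) → Ω.sideWord e c (n + 2) ∈ Ω.words a := by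
    intro n h1 h2
    refine ⟨(Ω.isCuspidal_iff_exists _).2 ⟨e, c, n + 1, rfl⟩, ?_⟩
    have hw : Ω.sideWord e c (n + 2) = Ω.sideWord e c (n + 1) ++ [x (n + 1)] := Ω.sideWord_succ' e c _
    rw [hw, allowed_append_iff]
    refine ⟨h1, fun e' he' => ?_⟩
    rw [← hw] at he'
    rcases Bool.eq_or_eq_not e' e with rfl | rfl
    · rw [← hxs]; exact h2
    · exfalso
      rw [sideWord_succ, sideWord_succ, IsSide, List.isChain_cons_cons] at he'
      have := he'.1
      cases e
      · exact Ω.step_true_ne_step_false c this.symm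
      · exact Ω.step_true_ne_step_false c this
  by_contra! hcon
  have hor : ∀ n ≤ 2, a = Ω.hat (x (n + 1)) ∨ a = x (n + 2) := fun n hn => by
    by_contra! h
    exact hcon n hn (hall n h.1 h.2)
  have hstep : ∀ n, Ω.hat (x n) ≠ x (n + 1) := fun n h => Ω.step_ne_hat e _ ((hxs n).symm.trans h.symm)
  have hinj : ∀ {b d : 𝒜}, Ω.hat b = Ω.hat d → b = d := fun {b d} h => by
    rw [← Ω.hat_hat b, h, Ω.hat_hat]
  have key : ∀ n, x (n + 2) = x n → a = Ω.hat (x (n + 1)) → a = x (n + 1) → False := fun n _ h h' =>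
    Ω.hat_ne _ (h.symm.trans h')
  rcases hor 0 (by omega) with h0 | h0 <;> rcases hor 1 (by omega) with h1 | h1
  · exact hfix 1 (hinj (h1.symm.trans h0))
  · rcases hor 2 (by omega) with h2 | h2
    · have h3 : x 3 = x 1 := hinj (h2.symm.trans h0)
      exact Ω.hat_ne (x 1) (by rw [← h0, h1]; exact h3)
    · exact hfix 3 (h2.symm.trans h1)
  · rcases hor 2 (by omega) with h2 | h2
    · exact hfix 2 (hinj (h2.symm.trans h1))
    · exact Ω.hat_ne (x 2) (h1.symm.trans h0)
  · exact hfix 2 (h1.symm.trans h0)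

/-- The two steps differ at c, so at least one of them moves c. Every arc is thus mapped into every
other one by a single branch with bounded derivative, which replaces an irreducibility argument. -/
lemma exists_words_head (a c : 𝒜) : ∃ W ∈ Ω.words a, W.length ≤ 4 ∧ W.head? = some c := by
  have : ∃ e, Ω.step e c ≠ c := by
    by_contra! h
    exact Ω.step_true_ne_step_false c ((h true).trans (h false).symm)
  obtain ⟨e, he⟩ := this
  obtain ⟨n, hn, hW⟩ := Ω.exists_allowed_sideWord he a
  exact ⟨_, hW, by rw [length_sideWord]; omega, by simp [sideWord_succ]⟩

/-! ### The cone of functions with bounded distortion -/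

variable {Ω}

/-- Non-negative functions whose logarithm is `K`-Lipschitz on the arcs `[a]`. -/
def IsCone (K : ℝ) (f : Ω.PLip) : Prop :=
  (∀ ξ, (f ξ).im = 0 ∧ 0 ≤ (f ξ).re) ∧
    ∀ a, ∀ ξ ∈ Ω.arc a, ∀ ζ ∈ Ω.arc a, (f ξ).re ≤ Real.exp (K * dist ξ ζ) * (f ζ).re

variable (Ω) in
/-- The constant function `1`. -/
def one : Ω.PLip :=
  ⟨fun _ => 1, fun _ => ⟨0, LipschitzOnWith.of_dist_le_mul fun x _ y _ => by simp⟩⟩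

omit [Finite 𝒜] in
lemma one_apply (ξ : Circle) : Ω.one ξ = 1 := rfl

lemma integralCLM_one : Ω.integralCLM Ω.one = 2 * Real.pi := by
  rw [integralCLM_apply]
  simp only [one_apply, integral_const, measure_arcMeasure_univ]
  simp

lemma re_integralCLM (f : Ω.PLip) : (Ω.integralCLM f).re = ∫ ξ, (f ξ).re ∂arcMeasure := by
  rw [integralCLM_apply]
  exact (integral_re (integrable_coe f)).symm

lemma im_integralCLM (f : Ω.PLip) (h : ∀ ξ, (f ξ).im = 0) : (Ω.integralCLM f).im = 0 := by
  rw [integralCLM_apply]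
  have := integral_im (integrable_coe f)
  refine this.symm.trans ?_
  change ∫ ξ, (f ξ).im ∂arcMeasure = 0
  simp [h]

lemma re_integralCLM_nonneg {f : Ω.PLip} (h : ∀ ξ, 0 ≤ (f ξ).re) : 0 ≤ (Ω.integralCLM f).re := by
  rw [re_integralCLM]; exact integral_nonneg h

lemma integrable_re (f : Ω.PLip) : Integrable (fun ξ => (f ξ).re) arcMeasure := (integrable_coe f).re

lemma re_integralCLM_le {f : Ω.PLip} {s : ℝ} (h : ∀ ξ, (f ξ).re ≤ s) :
    (Ω.integralCLM f).re ≤ 2 * Real.pi * s := by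
  rw [re_integralCLM]
  refine (integral_mono (integrable_re f) (integrable_const s) h).trans ?_
  rw [integral_const, measure_arcMeasure_univ, smul_eq_mul]

lemma exists_le_apply {f : Ω.PLip} (h : ∀ ξ, 0 ≤ (f ξ).re) :
    ∃ ζ, (Ω.integralCLM f).re / (4 * Real.pi) ≤ (f ζ).re := by
  by_contra! hcon
  have h1 := re_integralCLM_le fun ξ => (hcon ξ).le
  have hpi := Real.pi_pos
  have h2 : 2 * Real.pi * ((Ω.integralCLM f).re / (4 * Real.pi)) = (Ω.integralCLM f).re / 2 := by
    field_simp; ring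
  have h3 := re_integralCLM_nonneg h
  have h4 : (Ω.integralCLM f).re = 0 := by linarith
  have h5 := hcon 1
  rw [h4, zero_div] at h5
  linarith [h 1]

omit [Finite 𝒜] in
lemma IsCone.re_le {K : ℝ} {f : Ω.PLip} (hK : 0 ≤ K) (hf : IsCone K f) {a : 𝒜} {ξ ζ : Circle}
    (hξ : ξ ∈ Ω.arc a) (hζ : ζ ∈ Ω.arc a) : (f ξ).re ≤ Real.exp (2 * K) * (f ζ).re :=
  (hf.2 a ξ hξ ζ hζ).trans (mul_le_mul_of_nonneg_right
    (Real.exp_le_exp.2 (by nlinarith [dist_circle_le_two ξ ζ])) (hf.1 ζ).2)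

omit [Finite 𝒜] in
lemma norm_eq_abs_re {f : Ω.PLip} {ξ : Circle} (h : (f ξ).im = 0) : ‖f ξ‖ = |(f ξ).re| := by
  have : f ξ = ((f ξ).re : ℂ) := Complex.ext rfl (by simp [h])
  rw [this, Complex.norm_real]; simp

variable (Ω) in
-- Distances are at most 2, so on an arc a cone function varies by a factor of at most exp(2K) and
-- is controlled by its integral over this arc. The Lipschitz constant then follows from the
-- inequality that defines the cone.
lemma exists_cone_norm_le {K : ℝ} (hK : 0 ≤ K) : ∃ B > 0, ∀ f : Ω.PLip, IsCone K f →
    ‖f‖ ≤ B * (Ω.integralCLM f).re := by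
  obtain ⟨μ, hμ, hμ'⟩ : ∃ μ > 0, ∀ a, μ ≤ arcMeasure.real (Ω.arc a) := by
    have : Nonempty 𝒜 := ⟨Ω.letter 1⟩
    obtain ⟨a, ha⟩ := Finite.exists_min fun a => arcMeasure.real (Ω.arc a)
    exact ⟨_, ENNReal.toReal_pos (Ω.arcMeasure_arc_pos a).ne' (measure_ne_top _ _), ha⟩
  set S := Real.exp (2 * K) / μ with hS
  have hS0 : 0 < S := by positivity
  refine ⟨S + K * Real.exp (2 * K) * S, by positivity, fun f hf => ?_⟩
  have hM := re_integralCLM_nonneg fun ξ => (hf.1 ξ).2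
  set M := (Ω.integralCLM f).re with hMdef
  have hsup : ∀ ξ, (f ξ).re ≤ S * M := by
    intro ξ
    have h1 : Real.exp (-(2 * K)) * (f ξ).re * arcMeasure.real (Ω.arc (Ω.letter ξ)) ≤ M := by
      rw [hMdef, re_integralCLM]
      refine le_trans ?_ (setIntegral_le_integral (s := Ω.arc (Ω.letter ξ)) (integrable_re f)
        (Filter.Eventually.of_forall fun ζ => (hf.1 ζ).2))
      have h2 : ∫ _ζ in Ω.arc (Ω.letter ξ), Real.exp (-(2 * K)) * (f ξ).re ∂arcMeasure =
          Real.exp (-(2 * K)) * (f ξ).re * arcMeasure.real (Ω.arc (Ω.letter ξ)) := by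
        rw [setIntegral_const, smul_eq_mul, mul_comm]
      rw [← h2]
      refine setIntegral_mono_on (integrable_const _) (integrable_re f).integrableOn
        (Ω.measurableSet_arc _) fun ζ hζ => ?_
      rw [Real.exp_neg, inv_mul_le_iff₀ (Real.exp_pos _)]
      exact hf.re_le hK (Ω.mem_arc_letter ξ) hζ
    have h3 : Real.exp (-(2 * K)) * (f ξ).re * μ ≤ M :=
      le_trans (mul_le_mul_of_nonneg_left (hμ' _) (mul_nonneg (Real.exp_pos _).le (hf.1 ξ).2)) h1
    rw [Real.exp_neg] at h3
    rw [hS, div_mul_eq_mul_div, le_div_iff₀ hμ]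
    have h4 := mul_le_mul_of_nonneg_left h3 (Real.exp_pos (2 * K)).le
    have h5 : Real.exp (2 * K) * ((Real.exp (2 * K))⁻¹ * (f ξ).re * μ) = (f ξ).re * μ := by
      field_simp
    linarith
  rw [add_mul]
  refine norm_le_of_bounds (fun ξ => ?_) (by positivity) fun a ξ hξ ζ hζ => ?_
  · rw [norm_eq_abs_re (hf.1 ξ).1, abs_of_nonneg (hf.1 ξ).2]; exact hsup ξ
  · have key : ∀ x ∈ Ω.arc a, ∀ y ∈ Ω.arc a,
        (f x).re - (f y).re ≤ K * Real.exp (2 * K) * S * M * dist x y := by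
      intro x hx y hy
      have h1 := hf.2 a x hx y hy
      have hd : 0 ≤ K * dist x y := mul_nonneg hK dist_nonneg
      have h2 : Real.exp (K * dist x y) - 1 ≤ K * dist x y * Real.exp (2 * K) := by
        have h3 := Real.add_one_le_exp (-(K * dist x y))
        have h4 : Real.exp (K * dist x y) * Real.exp (-(K * dist x y)) = 1 := by
          rw [← Real.exp_add]; simp
        have h5 : Real.exp (K * dist x y) ≤ Real.exp (2 * K) :=
          Real.exp_le_exp.2 (by nlinarith [dist_circle_le_two x y])
        have h6 := Real.exp_pos (K * dist x y)
        nlinarith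
      have h7 := hsup y
      calc (f x).re - (f y).re ≤ (Real.exp (K * dist x y) - 1) * (f y).re := by linarith
        _ ≤ K * dist x y * Real.exp (2 * K) * (f y).re := mul_le_mul_of_nonneg_right h2 (hf.1 y).2
        _ ≤ K * dist x y * Real.exp (2 * K) * (S * M) :=
            mul_le_mul_of_nonneg_left h7 (by positivity)
        _ = _ := by ring
    have h1 : f ξ - f ζ = (((f ξ).re - (f ζ).re : ℝ) : ℂ) :=
      Complex.ext (by simp) (by simp [(hf.1 ξ).1, (hf.1 ζ).1])
    rw [dist_eq_norm, h1, Complex.norm_real, Real.norm_eq_abs, abs_le]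
    have k1 := key ξ hξ ζ hζ
    have k2 := key ζ hζ ξ hξ
    rw [dist_comm] at k2
    constructor <;> linarith

omit [Finite 𝒜] in
-- Subtracting a constant increases the logarithmic Lipschitz constant; the difference between K - 1
-- and K pays for this when the constant is small compared to the minimum of the function.
lemma IsCone.sub_const {K κ M ε : ℝ} {h : Ω.PLip} (hK : 1 ≤ K) (hh : IsCone (K - 1) h)
    (hM : 0 ≤ κ * M) (hlow : ∀ ξ, κ * M ≤ (h ξ).re) (hε0 : 0 ≤ ε)
    (hε : ε * (K * Real.exp 2) ≤ κ * M) : IsCone K (h - (ε : ℂ) • Ω.one) := by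
  have hre : ∀ ξ, ((h - (ε : ℂ) • Ω.one) ξ).re = (h ξ).re - ε := fun ξ => by
    rw [coe_sub, coe_smul, one_apply]; simp
  have hε1 : ε ≤ κ * M := by
    have h1 := Real.add_one_le_exp (2 : ℝ)
    have h2 : 1 ≤ K * Real.exp 2 := by nlinarith
    exact (le_mul_of_one_le_right hε0 h2).trans hε
  refine ⟨fun ξ => ⟨?_, ?_⟩, fun a ξ hξ ζ hζ => ?_⟩
  · rw [coe_sub, coe_smul, one_apply]; simp [(hh.1 ξ).1]
  · rw [hre]; linarith [hlow ξ]
  · rw [hre, hre]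
    set d := dist ξ ζ with hd
    have hd0 : 0 ≤ d := dist_nonneg
    have hd2 : d ≤ 2 := dist_circle_le_two ξ ζ
    have h1 := hh.2 a ξ hξ ζ hζ
    rw [← hd] at h1
    have e1 : Real.exp (K * d) = Real.exp ((K - 1) * d) * Real.exp d := by
      rw [← Real.exp_add]; congr 1; ring
    have h2 : d ≤ Real.exp d - 1 := by linarith [Real.add_one_le_exp d]
    have h3 : Real.exp (K * d) - 1 ≤ K * d * Real.exp (K * d) := by
      have h3 := Real.add_one_le_exp (-(K * d))
      have h4 : Real.exp (K * d) * Real.exp (-(K * d)) = 1 := by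
        rw [← Real.exp_add]; simp
      have h6 := Real.exp_pos (K * d)
      nlinarith
    have h4 : Real.exp (K * d) ≤ Real.exp ((K - 1) * d) * Real.exp 2 := by
      rw [e1]
      exact mul_le_mul_of_nonneg_left (Real.exp_le_exp.2 hd2) (Real.exp_pos _).le
    have h5 := Real.exp_pos ((K - 1) * d)
    have h6 : ε * (Real.exp (K * d) - 1) ≤ Real.exp ((K - 1) * d) * (Real.exp d - 1) * (h ζ).re := by
      calc ε * (Real.exp (K * d) - 1) ≤ ε * (K * d * (Real.exp ((K - 1) * d) * Real.exp 2)) := by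
            refine mul_le_mul_of_nonneg_left (h3.trans ?_) hε0
            exact mul_le_mul_of_nonneg_left h4 (by positivity)
        _ = ε * (K * Real.exp 2) * (Real.exp ((K - 1) * d) * d) := by ring
        _ ≤ κ * M * (Real.exp ((K - 1) * d) * d) :=
            mul_le_mul_of_nonneg_right hε (by positivity)
        _ ≤ κ * M * (Real.exp ((K - 1) * d) * (Real.exp d - 1)) :=
            mul_le_mul_of_nonneg_left (mul_le_mul_of_nonneg_left h2 h5.le) hM
        _ ≤ (h ζ).re * (Real.exp ((K - 1) * d) * (Real.exp d - 1)) :=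
            mul_le_mul_of_nonneg_right (hlow ζ) (mul_nonneg h5.le (hd0.trans h2))
        _ = _ := by ring
    rw [e1] at h6 ⊢
    nlinarith

variable (Ω) in
-- The squared denominator is at least 1 + c already for words with one letter, so every branch
-- contracts by θ = 1/(1+c).
lemma exists_distortion : ∃ D θ : ℝ, 0 < D ∧ 0 < θ ∧ θ < 1 ∧ ∀ a, ∀ W ∈ Ω.words a,
    ∀ ξ ∈ Ω.arc a, derivNorm (Ω.word W) ξ ≤ θ ∧ ∀ ζ ∈ Ω.arc a,
      derivNorm (Ω.word W) ξ ≤ Real.exp (D * dist ξ ζ) * derivNorm (Ω.word W) ζ ∧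
      dist (circleMap (Ω.word W) ξ) (circleMap (Ω.word W) ζ) ≤ θ * dist ξ ζ := by
  obtain ⟨c, C, hc, hC, h⟩ := Ω.exists_den_bounds
  obtain ⟨c', D, hc', -, hD, h'⟩ := Ω.exists_tau_bounds
  have hθ1 : (1 + c)⁻¹ < 1 := inv_lt_one_of_one_lt₀ (by linarith)
  have hlow : ∀ a, ∀ W ∈ Ω.words a, ∀ ξ ∈ Ω.arc a, 1 + c ≤ ‖den (Ω.word W) ξ‖ ^ 2 := by
    intro a W hW ξ hξ
    obtain ⟨h1, -, -, h2⟩ := h a W hW ξ hξ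
    have h3 : (1 : ℝ) ≤ W.length := by exact_mod_cast h2
    linarith [le_mul_of_one_le_right hc.le (one_le_pow₀ (n := 2) h3)]
  refine ⟨D, (1 + c)⁻¹, hD, by positivity, hθ1, fun a W hW ξ hξ => ⟨?_, fun ζ hζ => ⟨?_, ?_⟩⟩⟩
  · exact inv_anti₀ (by positivity) (hlow a W hW ξ hξ)
  · obtain ⟨τ, h1, -, -, h2⟩ := (h' a W hW).2 ξ hξ
    obtain ⟨τ', h3, -, -, -⟩ := (h' a W hW).2 ζ hζ
    rw [h1, h3, ← Real.exp_add]
    have := (abs_le.1 (h2 ζ hζ τ' h3)).1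
    exact Real.exp_le_exp.2 (by linarith)
  · rw [dist_circleMap, div_eq_inv_mul]
    refine mul_le_mul_of_nonneg_right ?_ dist_nonneg
    refine inv_anti₀ (by positivity) ?_
    refine le_of_sq_le_sq ?_ (by positivity)
    rw [mul_pow, sq (1 + c)]
    exact mul_le_mul (hlow a W hW ξ hξ) (hlow a W hW ζ hζ) (by positivity) (by positivity)

end LabelledIdealPolygon

end BowenSeries

namespace BowenSeries

open Complex MeasureTheory Set

namespace LabelledIdealPolygon

variable {Γ₀ : Subgroup SL(2, ℝ)} {𝒜 : Type*} {Ω : LabelledIdealPolygon Γ₀ 𝒜} [Finite 𝒜]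

/-! ### Positivity of weighted operators -/

lemma IsWeightedOp.hasSum_re {𝒱 : 𝒜 → Set (List 𝒜)} {w : ℝ → ℝ} {L : Ω.PLip →L[ℂ] Ω.PLip}
    (hL : IsWeightedOp 𝒱 w L) (f : Ω.PLip) {a : 𝒜} {ξ : Circle} (hξ : ξ ∈ Ω.arc a) :
    HasSum (fun W : 𝒱 a => w (derivNorm (Ω.word W) ξ) * (f (circleMap (Ω.word W) ξ)).re)
      (L f ξ).re := by
  have := Complex.hasSum_re (hL f a ξ hξ)
  simpa only [Complex.re_ofReal_mul] using this

lemma IsWeightedOp.im_eq_zero {𝒱 : 𝒜 → Set (List 𝒜)} {w : ℝ → ℝ} {L : Ω.PLip →L[ℂ] Ω.PLip}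
    (hL : IsWeightedOp 𝒱 w L) {f : Ω.PLip} (hf : ∀ ξ, (f ξ).im = 0) (ξ : Circle) :
    (L f ξ).im = 0 := by
  have := Complex.hasSum_im (hL f _ ξ (Ω.mem_arc_letter ξ))
  simp only [Complex.im_ofReal_mul, hf, mul_zero] at this
  exact this.unique hasSum_zero

lemma IsWeightedOp.le_re {𝒱 : 𝒜 → Set (List 𝒜)} {w : ℝ → ℝ} {L : Ω.PLip →L[ℂ] Ω.PLip}
    (hL : IsWeightedOp 𝒱 w L) (hw : ∀ x > 0, 0 ≤ w x) {f : Ω.PLip} (hf : ∀ ξ, 0 ≤ (f ξ).re)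
    {a : 𝒜} {ξ : Circle} (hξ : ξ ∈ Ω.arc a) {W : List 𝒜} (hW : W ∈ 𝒱 a) :
    w (derivNorm (Ω.word W) ξ) * (f (circleMap (Ω.word W) ξ)).re ≤ (L f ξ).re :=
  le_hasSum (hL.hasSum_re f hξ) ⟨W, hW⟩ fun _ _ => mul_nonneg (hw _ (derivNorm_pos _ _)) (hf _)

lemma IsWeightedOp.re_nonneg {𝒱 : 𝒜 → Set (List 𝒜)} {w : ℝ → ℝ} {L : Ω.PLip →L[ℂ] Ω.PLip}
    (hL : IsWeightedOp 𝒱 w L) (hw : ∀ x > 0, 0 ≤ w x) {f : Ω.PLip} (hf : ∀ ξ, 0 ≤ (f ξ).re)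
    (ξ : Circle) : 0 ≤ (L f ξ).re :=
  (hL.hasSum_re f (Ω.mem_arc_letter ξ)).nonneg fun _ =>
    mul_nonneg (hw _ (derivNorm_pos _ _)) (hf _)

variable {L : Ω.PLip →L[ℂ] Ω.PLip}

/-- In each summand the derivative contributes D and the contracted argument of f contributes θK;
the inequality is preserved by sums. -/
lemma IsCone.map {K D θ : ℝ} (hK : 0 ≤ K) (hdist : ∀ a, ∀ W ∈ Ω.words a,
    ∀ ξ ∈ Ω.arc a, derivNorm (Ω.word W) ξ ≤ θ ∧ ∀ ζ ∈ Ω.arc a,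
      derivNorm (Ω.word W) ξ ≤ Real.exp (D * dist ξ ζ) * derivNorm (Ω.word W) ζ ∧
      dist (circleMap (Ω.word W) ξ) (circleMap (Ω.word W) ζ) ≤ θ * dist ξ ζ)
    (hL : IsWeightedOp Ω.words (fun x => x ^ (1 : ℝ)) L) {f : Ω.PLip} (hf : IsCone K f) :
    IsCone (D + θ * K) (L f) := by
  refine ⟨fun ξ => ⟨hL.im_eq_zero (fun ξ => (hf.1 ξ).1) ξ,
    hL.re_nonneg (fun x hx => by positivity) (fun ξ => (hf.1 ξ).2) ξ⟩, fun a ξ hξ ζ hζ => ?_⟩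
  have h1 := hL.hasSum_re f hξ
  have h2 := (hL.hasSum_re f hζ).mul_left (Real.exp ((D + θ * K) * dist ξ ζ))
  simp only [Real.rpow_one] at h1 h2
  refine hasSum_le (fun W => ?_) h1 h2
  obtain ⟨c, -, hc⟩ := Ω.exists_mapsTo W.2
  obtain ⟨d1, d2⟩ := (hdist a W W.2 ξ hξ).2 ζ hζ
  have h3 := hf.2 c _ (hc ξ hξ) _ (hc ζ hζ)
  have h4 : Real.exp (K * dist (circleMap (Ω.word W) ξ) (circleMap (Ω.word W) ζ)) ≤
      Real.exp (θ * K * dist ξ ζ) := Real.exp_le_exp.2 (by nlinarith)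
  have h5 := (hf.1 (circleMap (Ω.word W) ζ)).2
  have e : Real.exp ((D + θ * K) * dist ξ ζ) =
      Real.exp (D * dist ξ ζ) * Real.exp (θ * K * dist ξ ζ) := by
    rw [← Real.exp_add]; congr 1; ring
  rw [e]
  calc _ ≤ (Real.exp (D * dist ξ ζ) * derivNorm (Ω.word W) ζ) *
        (Real.exp (θ * K * dist ξ ζ) * (f (circleMap (Ω.word W) ζ)).re) :=
        mul_le_mul d1 (h3.trans (mul_le_mul_of_nonneg_right h4 h5)) (hf.1 _).2
          (mul_nonneg (Real.exp_pos _).le (derivNorm_pos _ _).le)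
    _ = _ := by ring

variable (Ω) in
-- One summand suffices: a word with at most four letters that maps the arc of ξ into an arc where f
-- somewhere reaches half of its mean value.
lemma exists_cone_lower {K : ℝ} (hK : 0 ≤ K) : ∃ κ > 0, ∀ L : Ω.PLip →L[ℂ] Ω.PLip,
    IsWeightedOp Ω.words (fun x => x ^ (1 : ℝ)) L → ∀ f : Ω.PLip, IsCone K f → ∀ ξ,
    κ * (Ω.integralCLM f).re ≤ (L f ξ).re := by
  obtain ⟨c, C, hc, hC, h⟩ := Ω.exists_den_bounds
  refine ⟨((C * 4) ^ 2)⁻¹ * (Real.exp (-(2 * K)) / (4 * Real.pi)), by positivity,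
    fun L hL f hf ξ => ?_⟩
  have hM := re_integralCLM_nonneg fun ξ => (hf.1 ξ).2
  obtain ⟨ζ, hζ⟩ := exists_le_apply fun ξ => (hf.1 ξ).2
  obtain ⟨W, hW, hlen, hhead⟩ := Ω.exists_words_head (Ω.letter ξ) (Ω.letter ζ)
  obtain ⟨c', hc', hmaps⟩ := Ω.exists_mapsTo hW
  obtain rfl : c' = Ω.letter ζ := by rw [hhead] at hc'; simpa using hc'.symm
  have h1 := hL.le_re (fun x hx => by positivity) (fun ξ => (hf.1 ξ).2) (Ω.mem_arc_letter ξ) hW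
  rw [Real.rpow_one] at h1
  refine le_trans ?_ h1
  have h2 := hf.re_le hK (Ω.mem_arc_letter ζ) (hmaps ξ (Ω.mem_arc_letter ξ))
  have h3 : ((C * 4) ^ 2)⁻¹ ≤ derivNorm (Ω.word W) ξ := by
    refine inv_anti₀ (pow_pos (norm_pos_iff.2 (den_ne_zero _ ξ)) 2) ?_
    refine pow_le_pow_left₀ (norm_nonneg _) ?_ 2
    refine ((h _ W hW ξ (Ω.mem_arc_letter ξ)).2.1).trans ?_
    exact mul_le_mul_of_nonneg_left (by exact_mod_cast hlen) hC.le
  rw [mul_assoc]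
  refine mul_le_mul h3 ?_ (by positivity) (derivNorm_pos _ _).le
  rw [Real.exp_neg, div_mul_eq_mul_div, mul_div_assoc, inv_mul_le_iff₀ (Real.exp_pos _)]
  exact hζ.trans h2

/-! ### Complex conjugation -/

variable (Ω) in
/-- Complex conjugation on `ℬ`. -/
def conjPLip (f : Ω.PLip) : Ω.PLip :=
  ⟨fun ξ => starRingEnd ℂ (f ξ), fun a => by
    obtain ⟨K, hK⟩ := f.2 a
    refine ⟨K, LipschitzOnWith.of_dist_le_mul fun x hx y hy => ?_⟩
    refine le_trans (le_of_eq ?_) (hK.dist_le_mul x hx y hy)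
    rw [dist_eq_norm, dist_eq_norm, ← map_sub, RCLike.norm_conj]⟩

omit [Finite 𝒜] in
lemma conjPLip_apply (f : Ω.PLip) (ξ : Circle) : Ω.conjPLip f ξ = starRingEnd ℂ (f ξ) := rfl

lemma norm_conjPLip_le (f : Ω.PLip) : ‖Ω.conjPLip f‖ ≤ ‖f‖ := by
  refine norm_le_of_bounds (fun ξ => ?_) (lipConst_nonneg f) fun a x hx y hy => ?_
  · rw [conjPLip_apply, RCLike.norm_conj]; exact norm_apply_le f ξ
  · rw [conjPLip_apply, conjPLip_apply, dist_eq_norm, ← map_sub, RCLike.norm_conj, ← dist_eq_norm]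
    exact dist_apply_le f hx hy

lemma IsWeightedOp.map_conj {𝒱 : 𝒜 → Set (List 𝒜)} {w : ℝ → ℝ} {L : Ω.PLip →L[ℂ] Ω.PLip}
    (hL : IsWeightedOp 𝒱 w L) (f : Ω.PLip) : L (Ω.conjPLip f) = Ω.conjPLip (L f) := by
  refine Subtype.ext (funext fun ξ => ?_)
  have h1 := hL (Ω.conjPLip f) _ ξ (Ω.mem_arc_letter ξ)
  have h2 := (hL f _ ξ (Ω.mem_arc_letter ξ)).map (starRingEnd ℂ) Complex.continuous_conj
  refine h1.unique ?_
  convert h2 using 2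
  · simp [conjPLip_apply]
  · rfl

lemma integralCLM_conj (f : Ω.PLip) :
    Ω.integralCLM (Ω.conjPLip f) = starRingEnd ℂ (Ω.integralCLM f) := by
  rw [integralCLM_apply, integralCLM_apply, ← integral_conj]; rfl

variable (Ω) in
/-- The real part of an element of `ℬ`. -/
def rePLip (f : Ω.PLip) : Ω.PLip := (1 / 2 : ℂ) • (f + Ω.conjPLip f)

omit [Finite 𝒜] in
lemma rePLip_apply (f : Ω.PLip) (ξ : Circle) : Ω.rePLip f ξ = ((f ξ).re : ℂ) := by
  rw [rePLip, coe_smul, coe_add, conjPLip_apply, Complex.add_conj]; push_cast; ring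

lemma norm_rePLip_le (f : Ω.PLip) : ‖Ω.rePLip f‖ ≤ ‖f‖ := by
  rw [rePLip, norm_smul]
  have := norm_add_le f (Ω.conjPLip f)
  have := norm_conjPLip_le f
  norm_num; linarith

omit [Finite 𝒜] in
lemma eq_rePLip (f : Ω.PLip) : f = Ω.rePLip f + I • Ω.rePLip (-I • f) := by
  refine Subtype.ext (funext fun ξ => ?_)
  rw [coe_add, coe_smul, rePLip_apply, rePLip_apply, coe_smul]
  refine Complex.ext ?_ ?_ <;> simp

lemma integralCLM_rePLip {f : Ω.PLip} (h : Ω.integralCLM f = 0) : Ω.integralCLM (Ω.rePLip f) = 0 := by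
  rw [rePLip, map_smul, map_add, integralCLM_conj, h]; simp

/-! ### The spectral gap -/

omit [Finite 𝒜] in
lemma isCone_one {K : ℝ} (hK : 0 ≤ K) : IsCone K Ω.one :=
  ⟨fun ξ => by rw [one_apply]; simp, fun a ξ hξ ζ hζ => by
    rw [one_apply, one_apply, Complex.one_re, mul_one]
    exact Real.one_le_exp (mul_nonneg hK dist_nonneg)⟩

omit [Finite 𝒜] in
lemma IsCone.mono {K K' : ℝ} (h : K ≤ K') {f : Ω.PLip} (hf : IsCone K f) : IsCone K' f :=
  ⟨hf.1, fun a ξ hξ ζ hζ => (hf.2 a ξ hξ ζ hζ).trans (mul_le_mul_of_nonneg_right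
    (Real.exp_le_exp.2 (mul_le_mul_of_nonneg_right h dist_nonneg)) (hf.1 ζ).2)⟩

/-- A real function becomes an element of the cone after adding a constant. -/
lemma isCone_add_const {K : ℝ} (hK : 1 ≤ K) {f : Ω.PLip} (hf : ∀ ξ, (f ξ).im = 0) :
    IsCone K (f + ((2 * ‖f‖ : ℝ) : ℂ) • Ω.one) := by
  have hre : ∀ ξ, ((f + ((2 * ‖f‖ : ℝ) : ℂ) • Ω.one) ξ).re = (f ξ).re + 2 * ‖f‖ := fun ξ => by
    rw [coe_add, coe_smul, one_apply, Complex.add_re, Complex.re_ofReal_mul]; simp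
  have hb : ∀ ξ, |(f ξ).re| ≤ ‖f‖ := fun ξ => by
    rw [← norm_eq_abs_re (hf ξ)]
    refine (norm_apply_le f ξ).trans ?_
    rw [norm_def]; linarith [lipConst_nonneg f]
  refine ⟨fun ξ => ⟨?_, ?_⟩, fun a ξ hξ ζ hζ => ?_⟩
  · rw [coe_add, coe_smul, one_apply, Complex.add_im, Complex.im_ofReal_mul, hf]; simp
  · rw [hre]; linarith [(abs_le.1 (hb ξ)).1, norm_nonneg f]
  · rw [hre, hre]
    have h1 := dist_apply_le f hξ hζ
    have h2 : (f ξ).re - (f ζ).re ≤ ‖f‖ * dist ξ ζ := by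
      refine ((Complex.re_le_norm (f ξ - f ζ)).trans ?_)
      rw [← dist_eq_norm]
      refine h1.trans (mul_le_mul_of_nonneg_right ?_ dist_nonneg)
      rw [norm_def]; linarith [supNorm_nonneg f]
    have h3 := Real.add_one_le_exp (K * dist ξ ζ)
    have h4 := (abs_le.1 (hb ζ)).1
    have h5 : 0 ≤ dist ξ ζ := dist_nonneg
    have h6 : ‖f‖ * dist ξ ζ ≤ (K * dist ξ ζ) * ((f ζ).re + 2 * ‖f‖) := by
      have : ‖f‖ ≤ (f ζ).re + 2 * ‖f‖ := by linarith
      have h7 : dist ξ ζ ≤ K * dist ξ ζ := by nlinarith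
      nlinarith [norm_nonneg f, mul_le_mul this h7 h5 (by linarith [norm_nonneg f])]
    have h8 : 0 ≤ (f ζ).re + 2 * ‖f‖ := by linarith [norm_nonneg f]
    nlinarith

/-- Geometric convergence of the iterates of the transfer operator. -/
lemma exists_gap_of_isWeightedOp (hL : IsWeightedOp Ω.words (fun x => x ^ (1 : ℝ)) L) :
    ∃ C τ κ : ℝ, 0 < C ∧ 0 ≤ τ ∧ τ < 1 ∧ 0 < κ ∧
      (∀ f : Ω.PLip, Ω.integralCLM f = 0 → ∀ n : ℕ, ‖(L ^ n) f‖ ≤ C * τ ^ n * ‖f‖) ∧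
      ∀ n : ℕ, ∀ ξ, ((L ^ n) Ω.one ξ).im = 0 ∧ κ ≤ ((L ^ (n + 1)) Ω.one ξ).re := by
  obtain ⟨D, θ, hD, hθ0, hθ1, hdist⟩ := Ω.exists_distortion
  -- Chosen such that D + θK = K - 1: the operator maps the cone of K into that of K - 1 and leaves
  -- room for `IsCone.sub_const`.
  set K := (D + 1) / (1 - θ) with hKdef
  have h1θ : 0 < 1 - θ := by linarith
  have hKe : D + θ * K = K - 1 := by
    rw [hKdef]; field_simp; ring
  have hK1 : 1 ≤ K := by rw [hKdef, le_div_iff₀ h1θ]; linarith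
  have hK0 : 0 ≤ K := by linarith
  obtain ⟨κ, hκ, hlow⟩ := Ω.exists_cone_lower hK0
  obtain ⟨B, hB, hnorm⟩ := Ω.exists_cone_norm_le hK0
  have hpi := Real.pi_pos
  have hmap : ∀ f : Ω.PLip, IsCone K f → IsCone (K - 1) (L f) := fun f hf => by
    rw [← hKe]; exact hf.map hK0 hdist hL
  have hint := Ω.integral_eq_of_isWeightedOp hL
  set κ' := κ / (K * Real.exp 2) with hκ'
  have hκ'0 : 0 < κ' := by positivity
  have hκK : κ' * (K * Real.exp 2) = κ := by rw [hκ']; field_simp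
  -- The proportion of the integral which remains after the constant, of integral 2π κ' times that
  -- of f, is removed.
  set τ := 1 - 2 * Real.pi * κ' with hτ
  -- one step
  have hstep : ∀ f : Ω.PLip, IsCone K f → ∃ h : Ω.PLip, IsCone K h ∧
      L f = h + ((κ' * (Ω.integralCLM f).re : ℝ) : ℂ) • Ω.one ∧
      (Ω.integralCLM h).re = τ * (Ω.integralCLM f).re := by
    intro f hf
    have hM := re_integralCLM_nonneg fun ξ => (hf.1 ξ).2
    refine ⟨L f - ((κ' * (Ω.integralCLM f).re : ℝ) : ℂ) • Ω.one,
      (hmap f hf).sub_const hK1 (by positivity) (hlow L hL f hf) (by positivity) ?_,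
      (sub_add_cancel _ _).symm, ?_⟩
    · rw [← hκK]; linarith
    · rw [map_sub, map_smul, hint, integralCLM_one, smul_eq_mul, Complex.sub_re,
        Complex.re_ofReal_mul]
      have : (2 * (Real.pi : ℂ)).re = 2 * Real.pi := by simp
      rw [this, hτ]; ring
  have hτ0 : 0 ≤ τ := by
    obtain ⟨h, hh, -, he⟩ := hstep Ω.one (isCone_one hK0)
    have h1 := re_integralCLM_nonneg fun ξ => (hh.1 ξ).2
    rw [he, integralCLM_one] at h1
    have : (2 * (Real.pi : ℂ)).re = 2 * Real.pi := by simp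
    rw [this] at h1
    exact nonneg_of_mul_nonneg_left h1 (by positivity)
  have hτ1 : τ < 1 := by rw [hτ]; have : 0 < 2 * Real.pi * κ' := by positivity
                         linarith
  -- Functions with equal integrals lose the same constant, which cancels in the difference, and the
  -- remaining parts have equal integrals again.
  have hpair : ∀ n : ℕ, ∀ f₁ f₂ : Ω.PLip, IsCone K f₁ → IsCone K f₂ →
      (Ω.integralCLM f₁).re = (Ω.integralCLM f₂).re →
      ‖(L ^ n) (f₁ - f₂)‖ ≤ 2 * B * τ ^ n * (Ω.integralCLM f₁).re := by
    intro n
    induction n with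
    | zero =>
      intro f₁ f₂ h₁ h₂ he
      have k1 := hnorm f₁ h₁
      have k2 := hnorm f₂ h₂
      rw [← he] at k2
      have := norm_sub_le f₁ f₂
      simp only [pow_zero, one_apply_eq_self, mul_one]
      linarith
    | succ n ih =>
      intro f₁ f₂ h₁ h₂ he
      obtain ⟨g₁, k1, k2, k3⟩ := hstep f₁ h₁
      obtain ⟨g₂, l1, l2, l3⟩ := hstep f₂ h₂
      have e : (L ^ (n + 1)) (f₁ - f₂) = (L ^ n) (g₁ - g₂) := by
        rw [pow_succ, mul_apply_eq_comp, map_sub, k2, l2, he, add_sub_add_right_eq_sub]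
      rw [e]
      have := ih g₁ g₂ k1 l1 (by rw [k3, l3, he])
      rw [k3] at this
      calc _ ≤ _ := this
        _ = _ := by ring
  have hreal : ∀ n : ℕ, ∀ f : Ω.PLip, (∀ ξ, (f ξ).im = 0) → Ω.integralCLM f = 0 →
      ‖(L ^ n) f‖ ≤ 8 * Real.pi * B * τ ^ n * ‖f‖ := by
    intro n f hf h0
    have h1 := hpair n (f + ((2 * ‖f‖ : ℝ) : ℂ) • Ω.one) (((2 * ‖f‖ : ℝ) : ℂ) • Ω.one)
      (isCone_add_const hK1 hf) ?_ ?_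
    · rw [add_sub_cancel_right, map_add, h0, zero_add, map_smul, integralCLM_one, smul_eq_mul,
        Complex.re_ofReal_mul] at h1
      have : (2 * (Real.pi : ℂ)).re = 2 * Real.pi := by simp
      rw [this] at h1
      linarith
    · refine ⟨fun ξ => ?_, fun a ξ hξ ζ hζ => ?_⟩
      · rw [coe_smul, one_apply, mul_one, Complex.ofReal_im, Complex.ofReal_re]
        exact ⟨rfl, by positivity⟩
      · rw [coe_smul, coe_smul, one_apply, one_apply, mul_one, Complex.ofReal_re]
        refine le_mul_of_one_le_left (by positivity) ?_
        exact Real.one_le_exp (mul_nonneg hK0 dist_nonneg)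
    · rw [map_add, h0, zero_add]
  have hiter : ∀ n : ℕ, IsCone K ((L ^ n) Ω.one) ∧ Ω.integralCLM ((L ^ n) Ω.one) = 2 * Real.pi := by
    intro n
    induction n with
    | zero => exact ⟨isCone_one hK0, integralCLM_one⟩
    | succ n ih =>
      rw [pow_succ', mul_apply_eq_comp, hint]
      exact ⟨(hmap _ ih.1).mono (by linarith), ih.2⟩
  refine ⟨16 * Real.pi * B, τ, κ * (2 * Real.pi), by positivity, hτ0, hτ1, by positivity,
    fun f hf n => ?_, fun n ξ => ⟨((hiter n).1.1 ξ).1, ?_⟩⟩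
  · have h1 := hreal n (Ω.rePLip f) (fun ξ => by rw [rePLip_apply]; exact Complex.ofReal_im _)
      (integralCLM_rePLip hf)
    have h2 := hreal n (Ω.rePLip (-I • f)) (fun ξ => by rw [rePLip_apply]; exact Complex.ofReal_im _)
      (integralCLM_rePLip (by rw [map_smul, hf, smul_zero]))
    have h3 := norm_rePLip_le f
    have h4 := norm_rePLip_le (-I • f)
    rw [norm_smul, norm_neg, Complex.norm_I, one_mul] at h4
    have hc : 0 ≤ 8 * Real.pi * B * τ ^ n := by positivity
    have h5 : ‖(L ^ n) f‖ ≤ ‖(L ^ n) (Ω.rePLip f)‖ + ‖(L ^ n) (Ω.rePLip (-I • f))‖ := by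
      conv_lhs => rw [eq_rePLip f, map_add, map_smul]
      refine (norm_add_le _ _).trans ?_
      rw [norm_smul, Complex.norm_I, one_mul]
    have h6 := mul_le_mul_of_nonneg_left h3 hc
    have h7 := mul_le_mul_of_nonneg_left h4 hc
    linarith
  · have h1 := hlow L hL _ (hiter n).1 ξ
    rw [(hiter n).2] at h1
    have : (2 * (Real.pi : ℂ)).re = 2 * Real.pi := by simp
    rw [this] at h1
    rw [pow_succ', mul_apply_eq_comp]; exact h1

/-- The invariant density. -/
lemma exists_invariant_density (hL : IsWeightedOp Ω.words (fun x => x ^ (1 : ℝ)) L) :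
    ∃ g : Ω.PLip, L g = g ∧ Ω.integralCLM g = 1 ∧ ∃ κ > 0, ∀ ξ, (g ξ).im = 0 ∧ κ ≤ (g ξ).re := by
  obtain ⟨C, τ, κ, hC, hτ0, hτ1, hκ, hgap, hpos⟩ := exists_gap_of_isWeightedOp hL
  have hint := Ω.integral_eq_of_isWeightedOp hL
  have hpi := Real.pi_pos
  -- The function L 1 - 1 has integral 0, so successive iterates of 1 differ by geometrically
  -- decaying terms.
  have hcau : CauchySeq fun n => (L ^ n) Ω.one := by
    refine cauchySeq_of_le_geometric τ (C * ‖L Ω.one - Ω.one‖) hτ1 fun n => ?_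
    have h1 := hgap (L Ω.one - Ω.one) (by rw [map_sub, hint, sub_self]) n
    rw [dist_comm, dist_eq_norm]
    have e : (L ^ (n + 1)) Ω.one - (L ^ n) Ω.one = (L ^ n) (L Ω.one - Ω.one) := by
      rw [map_sub, pow_succ, mul_apply_eq_comp]
    rw [e]; linarith
  obtain ⟨g, hg⟩ := cauchySeq_tendsto_of_complete hcau
  have hLg : L g = g := by
    refine tendsto_nhds_unique ?_ (hg.comp (Filter.tendsto_add_atTop_nat 1))
    refine ((L.continuous.tendsto g).comp hg).congr fun n => ?_
    simp only [Function.comp]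
    rw [pow_succ', mul_apply_eq_comp]
  have hmn : ∀ n, Ω.integralCLM ((L ^ n) Ω.one) = 2 * Real.pi := by
    intro n
    induction n with
    | zero => exact integralCLM_one
    | succ n ih => rw [pow_succ', mul_apply_eq_comp, hint, ih]
  have hmg : Ω.integralCLM g = 2 * Real.pi := by
    refine tendsto_nhds_unique ((Ω.integralCLM.continuous.tendsto g).comp hg) ?_
    refine tendsto_const_nhds.congr fun n => (hmn n).symm
  have hev : ∀ ξ, Filter.Tendsto (fun n => (L ^ n) Ω.one ξ) Filter.atTop (nhds (g ξ)) := by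
    intro ξ
    rw [tendsto_iff_norm_sub_tendsto_zero] at hg ⊢
    refine squeeze_zero (fun _ => norm_nonneg _) (fun n => ?_) hg
    rw [← coe_sub]
    refine (norm_apply_le _ ξ).trans ?_
    rw [norm_def]; linarith [lipConst_nonneg ((L ^ n) Ω.one - g)]
  refine ⟨((2 * Real.pi)⁻¹ : ℂ) • g, by rw [map_smul, hLg], ?_, (2 * Real.pi)⁻¹ * κ, by positivity,
    fun ξ => ?_⟩
  · rw [map_smul, hmg, smul_eq_mul, inv_mul_cancel₀]
    exact_mod_cast (by positivity : (2 * Real.pi : ℝ) ≠ 0)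
  · have e : (((2 * Real.pi)⁻¹ : ℂ) • g) ξ = (((2 * Real.pi)⁻¹ : ℝ) : ℂ) * g ξ := by
      rw [coe_smul]; push_cast; rfl
    rw [e, Complex.im_ofReal_mul, Complex.re_ofReal_mul]
    constructor
    · have h1 := ((Complex.continuous_im.tendsto _).comp (hev ξ))
      have h2 : (g ξ).im = 0 := by
        refine tendsto_nhds_unique h1 (tendsto_const_nhds.congr fun n => ?_)
        exact (hpos n ξ).1.symm
      rw [h2, mul_zero]
    · refine mul_le_mul_of_nonneg_left ?_ (by positivity)
      have h1 := ((Complex.continuous_re.tendsto _).comp (hev ξ)).comp (Filter.tendsto_add_atTop_nat 1)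
      exact ge_of_tendsto' h1 fun n => (hpos n ξ).2

end LabelledIdealPolygon

end BowenSeries

namespace BowenSeries

open Complex MeasureTheory Set

/-! ### Perturbation of a simple isolated eigenvalue -/

section Perturbation

variable {E : Type*} [NormedAddCommGroup E] [NormedSpace ℂ E] [CompleteSpace E]

/-- The operator `x ↦ ℓ x • g`. -/
abbrev rankOne (ℓ : E →L[ℂ] ℂ) (g : E) : E →L[ℂ] E := ContinuousLinearMap.smulRight ℓ g

omit [CompleteSpace E] in
lemma mem_resolventSet_mul {a : E →L[ℂ] E} {z : ℂ} (h : z ∈ resolventSet ℂ a) :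
    (algebraMap ℂ (E →L[ℂ] E) z - a) * resolvent a z = 1 ∧
      resolvent a z * (algebraMap ℂ (E →L[ℂ] E) z - a) = 1 :=
  ⟨Ring.mul_inverse_cancel _ h, Ring.inverse_mul_cancel _ h⟩

omit [CompleteSpace E] in
lemma resolvent_apply {a : E →L[ℂ] E} {z : ℂ} (h : z ∈ resolventSet ℂ a) (x : E) :
    z • resolvent a z x - a (resolvent a z x) = x ∧ resolvent a z (z • x - a x) = x := by
  obtain ⟨h1, h2⟩ := mem_resolventSet_mul h
  have h1' := congr_arg (fun T : E →L[ℂ] E => T x) h1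
  have h2' := congr_arg (fun T : E →L[ℂ] E => T x) h2
  simpa [Algebra.algebraMap_eq_smul_one] using And.intro h1' h2'

/-- The resolvent tends to 0 at infinity and is continuous on the compact rest of the region. -/
lemma exists_resolvent_bound {R : E →L[ℂ] E} {ρ : ℝ} (hρ : ∀ z : ℂ, ρ ≤ ‖z‖ → z ∈ resolventSet ℂ R) :
    ∃ M : ℝ, 1 ≤ M ∧ ∀ z : ℂ, ρ ≤ ‖z‖ → ‖resolvent R z‖ ≤ M := by
  have h1 := (spectrum.resolvent_tendsto_cobounded R (𝕜 := ℂ)).norm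
  rw [norm_zero] at h1
  have h2 := h1.eventually (gt_mem_nhds one_pos)
  obtain ⟨B, -, hB⟩ := (Metric.hasBasis_cobounded_compl_closedBall (0 : ℂ)).eventually_iff.1 h2
  have hc : IsCompact (Metric.closedBall (0 : ℂ) B ∩ {z | ρ ≤ ‖z‖}) :=
    (isCompact_closedBall _ _).inter_right (isClosed_le continuous_const continuous_norm)
  obtain ⟨M, hM⟩ := hc.exists_bound_of_continuousOn (f := fun z => resolvent R z) fun z hz =>
    (spectrum.hasDerivAt_resolvent_const_left (hρ z hz.2)).continuousAt.continuousWithinAt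
  refine ⟨max M 1, le_max_right _ _, fun z hz => ?_⟩
  by_cases h : z ∈ Metric.closedBall (0 : ℂ) B
  · exact (hM z ⟨h, hz⟩).trans (le_max_left _ _)
  · exact (hB h).le.trans (le_max_right _ _)

/-- Neumann series for the factor 1 - resolvent R₀ z * (R - R₀), of distance at most 1/2 from 1. -/
lemma resolvent_perturb {R₀ R : E →L[ℂ] E} {z : ℂ} {M : ℝ} (hM : 0 < M)
    (hz : z ∈ resolventSet ℂ R₀) (hb : ‖resolvent R₀ z‖ ≤ M) (h : ‖R - R₀‖ ≤ 1 / (2 * M)) :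
    z ∈ resolventSet ℂ R ∧ ‖resolvent R z‖ ≤ 2 * M ∧
      resolvent R z - resolvent R₀ z = resolvent R₀ z * (R - R₀) * resolvent R z := by
  obtain ⟨h1, h2⟩ := mem_resolventSet_mul hz
  have hsmall : ‖resolvent R₀ z * (R - R₀)‖ ≤ 1 / 2 := by
    refine (norm_mul_le _ _).trans ((mul_le_mul hb h (norm_nonneg _) hM.le).trans_eq ?_)
    field_simp
  have hmem : z ∈ resolventSet ℂ R := by
    have e : algebraMap ℂ (E →L[ℂ] E) z - R =
        (algebraMap ℂ (E →L[ℂ] E) z - R₀) * (1 - resolvent R₀ z * (R - R₀)) := by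
      rw [mul_sub, mul_one, ← mul_assoc, h1, one_mul]; abel
    rw [spectrum.mem_resolventSet_iff, e]
    exact (spectrum.mem_resolventSet_iff.1 hz).mul
      (isUnit_one_sub_of_norm_lt_one (hsmall.trans_lt (by norm_num)))
  obtain ⟨h3, h4⟩ := mem_resolventSet_mul hmem
  have hid : resolvent R z - resolvent R₀ z = resolvent R₀ z * (R - R₀) * resolvent R z := by
    have e : R - R₀ = (algebraMap ℂ (E →L[ℂ] E) z - R₀) - (algebraMap ℂ (E →L[ℂ] E) z - R) := by abel
    rw [e, mul_sub, h2, sub_mul, one_mul, mul_assoc, h3, mul_one]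
  refine ⟨hmem, ?_, hid⟩
  have h5 : ‖resolvent R z‖ ≤ M + 1 / 2 * ‖resolvent R z‖ := by
    have e : resolvent R z = resolvent R₀ z + resolvent R₀ z * (R - R₀) * resolvent R z := by
      rw [← hid]; abel
    conv_lhs => rw [e]
    refine (norm_add_le _ _).trans (add_le_add hb ((norm_mul_le _ _).trans ?_))
    exact mul_le_mul_of_nonneg_right hsmall (norm_nonneg _)
  linarith

omit [CompleteSpace E] in
lemma resolvent_sub_resolvent {R : E →L[ℂ] E} {z w : ℂ} (hz : z ∈ resolventSet ℂ R)
    (hw : w ∈ resolventSet ℂ R) :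
    resolvent R z - resolvent R w = (w - z) • (resolvent R z * resolvent R w) := by
  obtain ⟨h1, h2⟩ := mem_resolventSet_mul hz
  obtain ⟨h3, h4⟩ := mem_resolventSet_mul hw
  have e : (algebraMap ℂ (E →L[ℂ] E) w - R) - (algebraMap ℂ (E →L[ℂ] E) z - R) =
      (w - z) • (1 : E →L[ℂ] E) := by
    rw [sub_sub_sub_cancel_right, ← map_sub, Algebra.algebraMap_eq_smul_one]
  have h5 : resolvent R z * ((algebraMap ℂ (E →L[ℂ] E) w - R) - (algebraMap ℂ (E →L[ℂ] E) z - R)) *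
      resolvent R w = resolvent R z - resolvent R w := by
    rw [mul_sub, sub_mul, mul_assoc, h3, mul_one, h2, one_mul]
  rw [← h5, e, mul_smul_comm, mul_one, smul_mul_assoc]

/-- A decomposition `L = lam • g ⊗ ℓ + R` such that the spectrum of `R` is contained in the disc of
radius `ρ`. -/
structure SpectralSplit (L : E →L[ℂ] E) (ρ : ℝ) (lam : ℂ) (g : E) (ℓ : E →L[ℂ] ℂ) : Prop where
  apply_eq : L g = lam • g
  dual_eq : ∀ x, ℓ (L x) = lam * ℓ x
  pairing : ℓ g = 1
  resolvent : ∀ z : ℂ, ρ ≤ ‖z‖ → z ∈ resolventSet ℂ (L - lam • rankOne ℓ g)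

/-- Persistence of a simple isolated eigenvalue under small perturbations. -/
lemma exists_spectralSplit {L₀ : E →L[ℂ] E} {ρ : ℝ} (hρ0 : 0 < ρ) (hρ1 : ρ < 1) {g₀ : E}
    {m : E →L[ℂ] ℂ} (h₀ : SpectralSplit L₀ ρ 1 g₀ m) :
    ∃ d C : ℝ, 0 < d ∧ 0 < C ∧ ∀ L : E →L[ℂ] E, ‖L - L₀‖ ≤ d → ∃ lam g ℓ,
      SpectralSplit L ρ lam g ℓ ∧ m g = 1 ∧ ‖lam - 1‖ ≤ C * ‖L - L₀‖ ∧
        ‖g - g₀‖ ≤ C * ‖L - L₀‖ ∧ ‖ℓ - m‖ ≤ C * ‖L - L₀‖ := by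
  obtain ⟨hg₀, hm, hmg, hres⟩ := h₀
  rw [one_smul] at hg₀ hres
  simp only [one_mul] at hm
  set R₀ := L₀ - rankOne m g₀ with hR₀
  obtain ⟨M, hM1, hMb⟩ := exists_resolvent_bound hres
  set K := max M (max ‖m‖ ‖g₀‖) with hK
  have hMK : M ≤ K := le_max_left _ _
  have hmK : ‖m‖ ≤ K := (le_max_left _ _).trans (le_max_right _ _)
  have hgK : ‖g₀‖ ≤ K := (le_max_right _ _).trans (le_max_right _ _)
  have hK1 : 1 ≤ K := hM1.trans hMK
  have hK0 : 0 < K := by linarith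
  -- The disc of this radius about 1 stays outside the disc of radius ρ about 0.
  set r := (1 - ρ) / 2 with hr
  have hr0 : 0 < r := by rw [hr]; linarith
  have hr1 : r ≤ 1 / 2 := by rw [hr]; linarith
  refine ⟨r / (200 * K ^ 9), 100 * K ^ 7, by positivity, by positivity, fun L hL => ?_⟩
  set D := ‖L - L₀‖ with hD
  have hD0 : 0 ≤ D := norm_nonneg _
  have hDr : 200 * K ^ 9 * D ≤ r := by
    rw [le_div_iff₀ (by positivity)] at hL; linarith
  have hpow : ∀ k ≤ 9, K ^ k * D ≤ K ^ 9 * D := fun k hk =>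
    mul_le_mul_of_nonneg_right (pow_le_pow_right₀ hK1 hk) hD0
  -- In R₀ the eigenvalue 1 is moved to 0, so its resolvent is bounded for |z| ≥ ρ. R inherits this,
  -- and L is a rank one perturbation of R.
  set R := L - rankOne m g₀ with hR
  have hRR : R - R₀ = L - L₀ := by rw [hR, hR₀]; abel
  have hb : ∀ z : ℂ, ρ ≤ ‖z‖ → ‖resolvent R₀ z‖ ≤ K := fun z hz => (hMb z hz).trans hMK
  have hRs : ‖R - R₀‖ ≤ 1 / (2 * K) := by
    rw [hRR, le_div_iff₀ (by positivity)]
    have := hpow 1 (by norm_num)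
    rw [pow_one] at this
    linarith
  have hpert := fun z hz => resolvent_perturb hK0 (hres z hz) (hb z hz) hRs
  have hE : ∀ z : ℂ, ρ ≤ ‖z‖ → ‖resolvent R z - resolvent R₀ z‖ ≤ 2 * K ^ 2 * D := by
    intro z hz
    obtain ⟨-, p2, p3⟩ := hpert z hz
    rw [p3, hRR]
    calc _ ≤ ‖resolvent R₀ z‖ * ‖L - L₀‖ * ‖resolvent R z‖ :=
          (norm_mul_le _ _).trans (mul_le_mul_of_nonneg_right (norm_mul_le _ _) (norm_nonneg _))
      _ ≤ K * D * (2 * K) := by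
          gcongr
          exact hb z hz
      _ = _ := by ring
  have hElip : ∀ z w : ℂ, ρ ≤ ‖z‖ → ρ ≤ ‖w‖ →
      ‖(resolvent R z - resolvent R₀ z) - (resolvent R w - resolvent R₀ w)‖ ≤
        6 * K ^ 3 * D * ‖z - w‖ := by
    intro z w hz hw
    obtain ⟨p1, p2, p3⟩ := hpert z hz
    obtain ⟨q1, q2, q3⟩ := hpert w hw
    have e : (resolvent R z - resolvent R₀ z) - (resolvent R w - resolvent R₀ w) =
        (resolvent R₀ z - resolvent R₀ w) * (L - L₀) * resolvent R z +
          resolvent R₀ w * (L - L₀) * (resolvent R z - resolvent R w) := by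
      rw [p3, q3, hRR]
      generalize L - L₀ = T
      simp only [sub_mul, mul_sub]
      abel
    have n1 : ‖resolvent R₀ z - resolvent R₀ w‖ ≤ ‖z - w‖ * (K * K) := by
      rw [resolvent_sub_resolvent (hres z hz) (hres w hw), norm_smul, norm_sub_rev]
      refine mul_le_mul_of_nonneg_left ((norm_mul_le _ _).trans ?_) (norm_nonneg _)
      exact mul_le_mul (hb z hz) (hb w hw) (norm_nonneg _) hK0.le
    have n2 : ‖resolvent R z - resolvent R w‖ ≤ ‖z - w‖ * (2 * K * (2 * K)) := by
      rw [resolvent_sub_resolvent p1 q1, norm_smul, norm_sub_rev]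
      refine mul_le_mul_of_nonneg_left ((norm_mul_le _ _).trans ?_) (norm_nonneg _)
      exact mul_le_mul p2 q2 (norm_nonneg _) (by positivity)
    have hw' := hb w hw
    rw [e]
    calc _ ≤ ‖resolvent R₀ z - resolvent R₀ w‖ * ‖L - L₀‖ * ‖resolvent R z‖ +
          ‖resolvent R₀ w‖ * ‖L - L₀‖ * ‖resolvent R z - resolvent R w‖ := by
          refine (norm_add_le _ _).trans (add_le_add ?_ ?_) <;>
          exact (norm_mul_le _ _).trans (mul_le_mul_of_nonneg_right (norm_mul_le _ _) (norm_nonneg _))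
      _ ≤ ‖z - w‖ * (K * K) * D * (2 * K) + K * D * (‖z - w‖ * (2 * K * (2 * K))) := by gcongr
      _ = _ := by ring
  have hball : ∀ z ∈ Metric.closedBall (1 : ℂ) r, ρ ≤ ‖z‖ ∧ 1 / 2 ≤ ‖z‖ ∧ ‖z‖ ≤ 2 := by
    intro z hz
    rw [Metric.mem_closedBall, dist_eq_norm] at hz
    have h1 := norm_sub_norm_le (1 : ℂ) z
    have h2 := norm_sub_norm_le z 1
    rw [norm_one] at h1 h2
    rw [norm_sub_rev] at h1
    refine ⟨?_, by linarith, by linarith⟩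
    rw [hr] at hz; linarith
  have hN0 : ∀ z : ℂ, ρ ≤ ‖z‖ → resolvent R₀ z g₀ = z⁻¹ • g₀ := by
    intro z hz
    have hz0 : z ≠ 0 := norm_pos_iff.1 (hρ0.trans_le hz)
    have h1 := (resolvent_apply (hres z hz) g₀).2
    have h2 : R₀ g₀ = 0 := by
      rw [hR₀, sub_apply, hg₀, ContinuousLinearMap.smulRight_apply, hmg, one_smul,
        sub_self]
    rw [h2, sub_zero, map_smul] at h1
    rw [eq_inv_smul_iff₀ hz0]; exact h1
  have hmN0 : ∀ z : ℂ, ρ ≤ ‖z‖ → m.comp (resolvent R₀ z) = z⁻¹ • m := by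
    intro z hz
    have hz0 : z ≠ 0 := norm_pos_iff.1 (hρ0.trans_le hz)
    refine ContinuousLinearMap.ext fun x => ?_
    have h1 := congr_arg m (resolvent_apply (hres z hz) x).1
    have h2 : ∀ y, m (R₀ y) = 0 := fun y => by
      rw [hR₀, sub_apply, map_sub, hm, ContinuousLinearMap.smulRight_apply,
        map_smul, hmg, smul_eq_mul, mul_one, sub_self]
    rw [map_sub, h2, sub_zero, map_smul] at h1
    change m (resolvent R₀ z x) = z⁻¹ • m x
    rw [eq_inv_smul_iff₀ hz0]; exact h1
  -- the equation for the eigenvalue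
  let Φ : ℂ → ℂ := fun z => z * m (resolvent R z g₀)
  have hΦ : ∀ z : ℂ, ρ ≤ ‖z‖ → Φ z - 1 = z * m ((resolvent R z - resolvent R₀ z) g₀) := by
    intro z hz
    have hz0 : z ≠ 0 := norm_pos_iff.1 (hρ0.trans_le hz)
    rw [sub_apply, map_sub, hN0 z hz, map_smul, hmg, smul_eq_mul, mul_one,
      mul_sub, mul_inv_cancel₀ hz0]
  have hmE : ∀ T : E →L[ℂ] E, ‖m (T g₀)‖ ≤ K ^ 2 * ‖T‖ := fun T => by
    calc ‖m (T g₀)‖ ≤ ‖m‖ * (‖T‖ * ‖g₀‖) := (m.le_opNorm _).trans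
          (mul_le_mul_of_nonneg_left (T.le_opNorm _) (norm_nonneg _))
      _ ≤ K * (‖T‖ * K) := by gcongr
      _ = _ := by ring
  have hΦ1 : ∀ z ∈ Metric.closedBall (1 : ℂ) r, ‖Φ z - 1‖ ≤ 4 * K ^ 4 * D := by
    intro z hz
    obtain ⟨b1, b2, b3⟩ := hball z hz
    rw [hΦ z b1, norm_mul]
    calc ‖z‖ * _ ≤ 2 * (K ^ 2 * (2 * K ^ 2 * D)) := by
          refine mul_le_mul b3 ((hmE _).trans ?_) (norm_nonneg _) (by norm_num)
          exact mul_le_mul_of_nonneg_left (hE z b1) (by positivity)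
      _ = _ := by ring
  have hmaps : MapsTo Φ (Metric.closedBall 1 r) (Metric.closedBall 1 r) := by
    intro z hz
    rw [Metric.mem_closedBall, dist_eq_norm]
    refine (hΦ1 z hz).trans ?_
    have := hpow 4 (by norm_num)
    nlinarith
  have hlip : ∀ z ∈ Metric.closedBall (1 : ℂ) r, ∀ w ∈ Metric.closedBall (1 : ℂ) r,
      ‖Φ z - Φ w‖ ≤ 1 / 2 * ‖z - w‖ := by
    intro z hz w hw
    obtain ⟨b1, b2, b3⟩ := hball z hz
    obtain ⟨c1, c2, c3⟩ := hball w hw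
    have e : Φ z - Φ w = (z - w) * m ((resolvent R z - resolvent R₀ z) g₀) +
        w * m (((resolvent R z - resolvent R₀ z) - (resolvent R w - resolvent R₀ w)) g₀) := by
      have : Φ z - Φ w = (Φ z - 1) - (Φ w - 1) := by ring
      rw [this, hΦ z b1, hΦ w c1, sub_apply (resolvent R z - resolvent R₀ z),
        map_sub m ((resolvent R z - resolvent R₀ z) g₀)]
      ring
    rw [e]
    have k1 : ‖m ((resolvent R z - resolvent R₀ z) g₀)‖ ≤ K ^ 2 * (2 * K ^ 2 * D) :=
      (hmE _).trans (mul_le_mul_of_nonneg_left (hE z b1) (by positivity))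
    have k2 : ‖m (((resolvent R z - resolvent R₀ z) - (resolvent R w - resolvent R₀ w)) g₀)‖ ≤
        K ^ 2 * (6 * K ^ 3 * D * ‖z - w‖) :=
      (hmE _).trans (mul_le_mul_of_nonneg_left (hElip z w b1 c1) (by positivity))
    have hn := norm_nonneg (z - w)
    calc _ ≤ ‖z - w‖ * (K ^ 2 * (2 * K ^ 2 * D)) + 2 * (K ^ 2 * (6 * K ^ 3 * D * ‖z - w‖)) := by
          refine (norm_add_le _ _).trans ?_
          rw [norm_mul, norm_mul]
          refine add_le_add (mul_le_mul_of_nonneg_left k1 hn) ?_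
          exact mul_le_mul c3 k2 (norm_nonneg _) (by norm_num)
      _ = (2 * (K ^ 4 * D) + 12 * (K ^ 5 * D)) * ‖z - w‖ := by ring
      _ ≤ 1 / 2 * ‖z - w‖ := by
          refine mul_le_mul_of_nonneg_right ?_ hn
          have := hpow 4 (by norm_num)
          have := hpow 5 (by norm_num)
          linarith
  -- At a fixed point m(g) = 1 holds for g = resolvent R lam g₀, and then L g = R g + m(g) g₀ = lam
  -- g. Since Φ = 1 for the unperturbed operator, Φ is a contraction of the disc.
  obtain ⟨lam, hlamB, hfix, -⟩ := ContractingWith.exists_fixedPoint' (K := 1 / 2)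
    (Metric.isClosed_closedBall (x := (1 : ℂ)) (ε := r)).isComplete hmaps
    ⟨by
      rw [← NNReal.coe_lt_coe]; norm_num, LipschitzWith.of_dist_le_mul fun z w => by
      have := hlip z z.2 w w.2
      simpa [Subtype.dist_eq, dist_eq_norm] using this⟩
    (Metric.mem_closedBall_self hr0.le) (edist_ne_top _ _)
  obtain ⟨b1, b2, b3⟩ := hball lam hlamB
  have hlam0 : lam ≠ 0 := norm_pos_iff.1 (hρ0.trans_le b1)
  have hroot : m (resolvent R lam g₀) = 1 := by
    have h1 : lam * m (resolvent R lam g₀) = lam * 1 := by rw [mul_one]; exact hfix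
    exact mul_left_cancel₀ hlam0 h1
  have hlam1 : ‖lam - 1‖ ≤ 4 * K ^ 4 * D := by
    have := hΦ1 lam hlamB
    rwa [hfix.eq] at this
  have hinv : ‖lam⁻¹ - 1‖ ≤ 8 * K ^ 4 * D := by
    have e : lam⁻¹ - 1 = lam⁻¹ * (1 - lam) := by field_simp
    rw [e, norm_mul, norm_inv, norm_sub_rev]
    have : ‖lam‖⁻¹ ≤ 2 := by
      rw [inv_le_comm₀ (by linarith) (by norm_num)]; linarith
    calc _ ≤ 2 * (4 * K ^ 4 * D) := mul_le_mul this hlam1 (norm_nonneg _) (by norm_num)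
      _ = _ := by ring
  obtain ⟨p1, p2, -⟩ := hpert lam b1
  set g := resolvent R lam g₀ with hg
  have hLR : ∀ x, L x = R x + m x • g₀ := fun x => by
    rw [hR, sub_apply, ContinuousLinearMap.smulRight_apply]; abel
  have hgeq : L g = lam • g := by
    rw [hLR, hroot, one_smul]
    have := (resolvent_apply p1 g₀).1
    rw [← hg, sub_eq_iff_eq_add] at this
    rw [this]; abel
  have hgg : ‖g - g₀‖ ≤ 10 * K ^ 5 * D := by
    have e : g - g₀ = (resolvent R lam - resolvent R₀ lam) g₀ + (lam⁻¹ - 1) • g₀ := by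
      rw [sub_apply, hN0 lam b1, sub_smul, one_smul, ← hg]; abel
    rw [e]
    calc _ ≤ 2 * K ^ 2 * D * K + 8 * K ^ 4 * D * K := by
          refine (norm_add_le _ _).trans (add_le_add ?_ ?_)
          · refine (ContinuousLinearMap.le_opNorm _ _).trans ?_
            exact mul_le_mul (hE lam b1) hgK (norm_nonneg _) (by positivity)
          · rw [norm_smul]
            exact mul_le_mul hinv hgK (norm_nonneg _) (by positivity)
      _ = 2 * (K ^ 3 * D) + 8 * (K ^ 5 * D) := by ring
      _ ≤ _ := by
          have : K ^ 3 * D ≤ K ^ 5 * D :=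
            mul_le_mul_of_nonneg_right (pow_le_pow_right₀ hK1 (by norm_num)) hD0
          linarith
  -- The same computation on the dual side gives the left eigenvector; it is normalized afterwards
  -- by ν g, which is close to 1.
  set ν := m.comp (resolvent R lam) with hν
  have hνL : ∀ x, ν (L x) = lam * ν x := by
    intro x
    rw [hLR, map_add, map_smul]
    have h1 : ν g₀ = 1 := hroot
    have h2 := congr_arg m (resolvent_apply p1 x).2
    rw [h1, smul_eq_mul, mul_one]
    change ν (lam • x - R x) = m x at h2
    rw [map_sub, map_smul, smul_eq_mul] at h2
    rw [← h2]; ring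
  have hνm : ‖ν - m‖ ≤ 10 * K ^ 5 * D := by
    have e : ν - m = m.comp (resolvent R lam - resolvent R₀ lam) + (lam⁻¹ - 1) • m := by
      rw [ContinuousLinearMap.comp_sub, hmN0 lam b1, ← hν]
      module
    rw [e]
    calc _ ≤ K * (2 * K ^ 2 * D) + 8 * K ^ 4 * D * K := by
          refine (norm_add_le _ _).trans (add_le_add ?_ ?_)
          · refine (ContinuousLinearMap.opNorm_comp_le _ _).trans ?_
            exact mul_le_mul hmK (hE lam b1) (norm_nonneg _) (by positivity)
          · rw [norm_smul]
            exact mul_le_mul hinv hmK (norm_nonneg _) (by positivity)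
      _ = 2 * (K ^ 3 * D) + 8 * (K ^ 5 * D) := by ring
      _ ≤ _ := by
          have : K ^ 3 * D ≤ K ^ 5 * D :=
            mul_le_mul_of_nonneg_right (pow_le_pow_right₀ hK1 (by norm_num)) hD0
          linarith
  have hgn : ‖g‖ ≤ 2 * K := by
    have h1 := norm_add_le (g - g₀) g₀
    rw [sub_add_cancel] at h1
    have := hpow 5 (by norm_num)
    linarith
  have hνg : ‖ν g - 1‖ ≤ 20 * K ^ 6 * D := by
    have e : ν g - 1 = (ν - m) g := by rw [sub_apply, hroot]
    rw [e]
    calc _ ≤ 10 * K ^ 5 * D * (2 * K) := (ContinuousLinearMap.le_opNorm _ _).trans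
          (mul_le_mul hνm hgn (norm_nonneg _) (by positivity))
      _ = _ := by ring
  have hνg2 : 1 / 2 ≤ ‖ν g‖ := by
    have h1 := norm_sub_norm_le (1 : ℂ) (ν g)
    rw [norm_one, norm_sub_rev] at h1
    have := hpow 6 (by norm_num)
    linarith
  have hνg0 : ν g ≠ 0 := norm_pos_iff.1 (by linarith)
  have hνgi : ‖(ν g)⁻¹‖ ≤ 2 := by
    rw [norm_inv, inv_le_comm₀ (by linarith) (by norm_num)]; linarith
  set ℓ := (ν g)⁻¹ • ν with hℓ
  have hℓm : ‖ℓ - m‖ ≤ 60 * K ^ 7 * D := by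
    have e : ℓ - m = (ν g)⁻¹ • (ν - m) + ((ν g)⁻¹ * (1 - ν g)) • m := by
      rw [mul_sub, inv_mul_cancel₀ hνg0, hℓ, mul_one]; module
    rw [e]
    calc _ ≤ 2 * (10 * K ^ 5 * D) + 2 * (20 * K ^ 6 * D) * K := by
          refine (norm_add_le _ _).trans (add_le_add ?_ ?_)
          · rw [norm_smul]
            exact mul_le_mul hνgi hνm (norm_nonneg _) (by norm_num)
          · rw [norm_smul, norm_mul, norm_sub_rev]
            refine mul_le_mul ?_ hmK (norm_nonneg _) (by positivity)
            exact mul_le_mul hνgi hνg (norm_nonneg _) (by norm_num)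
      _ = 20 * (K ^ 5 * D) + 40 * (K ^ 7 * D) := by ring
      _ ≤ _ := by
          have : K ^ 5 * D ≤ K ^ 7 * D :=
            mul_le_mul_of_nonneg_right (pow_le_pow_right₀ hK1 (by norm_num)) hD0
          linarith
  have hℓn : ‖ℓ‖ ≤ 2 * K := by
    have h1 := norm_add_le (ℓ - m) m
    rw [sub_add_cancel] at h1
    have := hpow 7 (by norm_num)
    linarith
  -- Once the eigenvalue is removed the operator is near R₀, so the region |z| ≥ ρ still belongs to
  -- the resolvent set.
  have hnear : ‖L - lam • rankOne ℓ g - R₀‖ ≤ 1 / (2 * K) := by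
    have e : L - lam • rankOne ℓ g - R₀ = (L - L₀) - ((lam - 1) • rankOne ℓ g +
        rankOne ℓ (g - g₀) + rankOne (ℓ - m) g₀) := by
      refine ContinuousLinearMap.ext fun x => ?_
      simp only [hR₀, sub_apply, add_apply,
        smul_apply, ContinuousLinearMap.smulRight_apply, smul_sub, sub_smul,
        one_smul]
      abel
    rw [e]
    have n1 : ‖(lam - 1) • rankOne ℓ g‖ ≤ 4 * K ^ 4 * D * (2 * K * (2 * K)) := by
      rw [norm_smul, ContinuousLinearMap.norm_smulRight_apply]
      gcongr
    have n2 : ‖rankOne ℓ (g - g₀)‖ ≤ 2 * K * (10 * K ^ 5 * D) := by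
      rw [ContinuousLinearMap.norm_smulRight_apply]
      gcongr
    have n3 : ‖rankOne (ℓ - m) g₀‖ ≤ 60 * K ^ 7 * D * K := by
      rw [ContinuousLinearMap.norm_smulRight_apply]
      gcongr
    have n4 : ‖L - lam • rankOne ℓ g - R₀‖ ≤ D + (4 * K ^ 4 * D * (2 * K * (2 * K)) +
        2 * K * (10 * K ^ 5 * D) + 60 * K ^ 7 * D * K) := by
      rw [e]
      refine (norm_sub_le _ _).trans (add_le_add le_rfl ?_)
      exact (norm_add_le _ _).trans (add_le_add ((norm_add_le _ _).trans (add_le_add n1 n2)) n3)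
    rw [e] at n4
    refine n4.trans ?_
    rw [le_div_iff₀ (by positivity)]
    have i1 := hpow 1 (by norm_num)
    have i7 := hpow 7 (by norm_num)
    have : (D + (4 * K ^ 4 * D * (2 * K * (2 * K)) + 2 * K * (10 * K ^ 5 * D) + 60 * K ^ 7 * D * K)) *
        (2 * K) = 2 * (K ^ 1 * D) + 72 * (K ^ 7 * D) + 120 * (K ^ 9 * D) := by ring
    rw [this]
    linarith
  refine ⟨lam, g, ℓ, ⟨hgeq, fun x => ?_, ?_, fun z hz => ?_⟩, hroot, ?_, ?_, ?_⟩
  · rw [hℓ, smul_apply, smul_apply, hνL, smul_eq_mul,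
      smul_eq_mul]; ring
  · rw [hℓ, smul_apply, smul_eq_mul, inv_mul_cancel₀ hνg0]
  · exact (resolvent_perturb hK0 (hres z hz) (hb z hz) hnear).1
  · have : K ^ 4 * D ≤ K ^ 7 * D :=
      mul_le_mul_of_nonneg_right (pow_le_pow_right₀ hK1 (by norm_num)) hD0
    have h7 : 0 ≤ K ^ 7 * D := by positivity
    linarith
  · have : K ^ 5 * D ≤ K ^ 7 * D :=
      mul_le_mul_of_nonneg_right (pow_le_pow_right₀ hK1 (by norm_num)) hD0
    have h7 : 0 ≤ K ^ 7 * D := by positivity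
    linarith
  · have h7 : 0 ≤ K ^ 7 * D := by positivity
    linarith

end Perturbation

end BowenSeries

namespace BowenSeries

open Complex MeasureTheory Set

/-! ### Consequences of splitting off a simple eigenvalue. -/

section Split

variable {E : Type*} [NormedAddCommGroup E] [NormedSpace ℂ E]

lemma isUnit_one_sub_smul_rankOne {ℓ : E →L[ℂ] ℂ} {g : E} (h : ℓ g = 1) {c : ℂ} (hc : c ≠ 1) :
    IsUnit (1 - c • rankOne ℓ g) := by
  have hQ : rankOne ℓ g * rankOne ℓ g = rankOne ℓ g := by
    refine ContinuousLinearMap.ext fun x => ?_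
    simp [h]
  have hc' : 1 - c ≠ 0 := sub_ne_zero.2 hc.symm
  set Q := rankOne ℓ g
  have h1 : (1 - c • Q) * (1 + (c / (1 - c)) • Q) = 1 := by
    have : (1 - c • Q) * (1 + (c / (1 - c)) • Q) =
        1 + (c / (1 - c) - c - c * (c / (1 - c))) • Q := by
      simp only [sub_mul, mul_add, one_mul, mul_one, smul_mul_smul_comm, hQ]
      module
    rw [this, show c / (1 - c) - c - c * (c / (1 - c)) = 0 by field_simp; ring, zero_smul, add_zero]
  have h2 : (1 + (c / (1 - c)) • Q) * (1 - c • Q) = 1 := by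
    have : (1 + (c / (1 - c)) • Q) * (1 - c • Q) =
        1 + (c / (1 - c) - c - c * (c / (1 - c))) • Q := by
      simp only [add_mul, mul_sub, one_mul, mul_one, smul_mul_smul_comm, hQ]
      module
    rw [this, show c / (1 - c) - c - c * (c / (1 - c)) = 0 by field_simp; ring, zero_smul, add_zero]
  exact ⟨⟨_, _, h1, h2⟩, rfl⟩

/-- Splitting off a simple eigenvalue changes the resolvent set only at that eigenvalue and `0`. -/
lemma mem_resolventSet_iff_split {L : E →L[ℂ] E} {lam : ℂ} {g : E} {ℓ : E →L[ℂ] ℂ}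
    (hg : L g = lam • g) (h1 : ℓ g = 1) {z : ℂ} (hz : z ≠ 0) (hne : z ≠ lam) :
    z ∈ resolventSet ℂ L ↔ z ∈ resolventSet ℂ (L - lam • rankOne ℓ g) := by
  have hu := isUnit_one_sub_smul_rankOne h1 (c := lam / z) (by
    rw [Ne, div_eq_one_iff_eq hz]; exact hne.symm)
  -- The factorization holds because the split operator annihilates g.
  have e : algebraMap ℂ (E →L[ℂ] E) z - L =
      (algebraMap ℂ (E →L[ℂ] E) z - (L - lam • rankOne ℓ g)) * (1 - (lam / z) • rankOne ℓ g) := by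
    refine ContinuousLinearMap.ext fun x => ?_
    simp only [Algebra.algebraMap_eq_smul_one, sub_apply, smul_apply, mul_apply_eq_comp,
      one_apply_eq_self, ContinuousLinearMap.smulRight_apply, map_sub, map_smul, hg, h1, smul_sub]
    match_scalars <;> field_simp; ring
  rw [spectrum.mem_resolventSet_iff, spectrum.mem_resolventSet_iff, e]
  exact Units.isUnit_mul_units _ hu.unit

namespace SpectralSplit

variable {L : E →L[ℂ] E} {ρ : ℝ} {lam : ℂ} {g : E} {ℓ : E →L[ℂ] ℂ} (h : SpectralSplit L ρ lam g ℓ)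

include h

lemma ne_zero : g ≠ 0 := by
  rintro rfl
  simpa using h.pairing

lemma mem_resolventSet (hρ : 0 < ρ) {z : ℂ} (hz : ρ ≤ ‖z‖) (hne : z ≠ lam) :
    z ∈ resolventSet ℂ L :=
  (mem_resolventSet_iff_split h.apply_eq h.pairing (norm_pos_iff.1 (hρ.trans_le hz)) hne).2
    (h.resolvent z hz)

lemma eigenvalue (hρ : 0 < ρ) {z : ℂ} {v : E} (hv : v ≠ 0) (hz : L v = z • v) (hne : z ≠ lam) :
    ‖z‖ < ρ := by
  by_contra! hlt
  have := (resolvent_apply (h.mem_resolventSet hρ hlt hne) v).2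
  rw [hz, sub_self, map_zero] at this
  exact hv this.symm

/-- On the invariant subspace ker ℓ the operator L agrees with the split operator, for which lam is
a regular value. So L - lam is injective there, which gives algebraic simplicity. -/
lemma eq_zero_of_pow (hlam : ρ ≤ ‖lam‖) (k : ℕ) : ∀ u : E, ℓ u = 0 →
    ((((L : E →ₗ[ℂ] E) - lam • (1 : Module.End ℂ E)) ^ k) u = 0) → u = 0 := by
  induction k with
  | zero => intro u _ h1; simpa using h1
  | succ k ih =>
    intro u hu h1
    rw [pow_succ] at h1
    have h2 := ih ((((L : E →ₗ[ℂ] E) - lam • (1 : Module.End ℂ E))) u)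
      (by simp [h.dual_eq, hu]) h1
    have h3 : L u - lam • u = 0 := h2
    have h4 := (resolvent_apply (h.resolvent lam hlam) u).2
    have h5 : lam • u - (L - lam • rankOne ℓ g) u = 0 := by
      rw [sub_apply, smul_apply, ContinuousLinearMap.smulRight_apply, hu, zero_smul, smul_zero,
        sub_zero, ← neg_sub, h3, neg_zero]
    rw [h5, map_zero] at h4
    exact h4.symm

lemma maxGenEigenspace_eq (hlam : ρ ≤ ‖lam‖) :
    Module.End.maxGenEigenspace (L : E →ₗ[ℂ] E) lam = Submodule.span ℂ {g} := by
  ext u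
  rw [Module.End.mem_maxGenEigenspace, Submodule.mem_span_singleton]
  constructor
  · rintro ⟨k, hk⟩
    refine ⟨ℓ u, (sub_eq_zero.1 (h.eq_zero_of_pow hlam (k + 1) (u - ℓ u • g) ?_ ?_)).symm⟩
    · simp [h.pairing]
    · rw [map_sub, map_smul, pow_succ', Module.End.mul_apply, hk, map_zero, ← pow_succ', pow_succ,
        Module.End.mul_apply]
      have : ((L : E →ₗ[ℂ] E) - lam • (1 : Module.End ℂ E)) g = 0 := by simp [h.apply_eq]
      rw [this, map_zero, smul_zero, sub_zero]
  · rintro ⟨c, rfl⟩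
    exact ⟨1, by simp [h.apply_eq]⟩

lemma finrank_maxGenEigenspace (hlam : ρ ≤ ‖lam‖) :
    Module.finrank ℂ (Module.End.maxGenEigenspace (L : E →ₗ[ℂ] E) lam) = 1 := by
  rw [h.maxGenEigenspace_eq hlam, finrank_span_singleton h.ne_zero]

lemma eq_smul (hlam : ρ ≤ ‖lam‖) {v : E} (hv : L v = lam • v) : v = ℓ v • g := by
  refine sub_eq_zero.1 (h.eq_zero_of_pow hlam 1 _ ?_ ?_)
  · simp [h.pairing]
  · rw [pow_one, map_sub, map_smul]
    have h1 : ∀ w : E, L w = lam • w → ((L : E →ₗ[ℂ] E) - lam • (1 : Module.End ℂ E)) w = 0 :=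
      fun w hw => by simp [hw]
    rw [h1 v hv, h1 g h.apply_eq, smul_zero, sub_zero]

/-- The resolvent of the split operator preserves ker ℓ and inverts z - L there, also at z = lam. -/
lemma sub_apply_resolvent (hρ : 0 < ρ) {z : ℂ} (hz : ρ ≤ ‖z‖) {u : E} (hu : ℓ u = 0) :
    z • _root_.resolvent (L - lam • rankOne ℓ g) z u -
      L (_root_.resolvent (L - lam • rankOne ℓ g) z u) = u := by
  have hz0 : z ≠ 0 := norm_pos_iff.1 (hρ.trans_le hz)
  have h1 := (resolvent_apply (h.resolvent z hz) u).1
  set v := _root_.resolvent (L - lam • rankOne ℓ g) z u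
  have hv : ℓ v = 0 := by
    have h2 := congr_arg ℓ h1
    rw [hu, map_sub, map_smul, sub_apply, map_sub, h.dual_eq, smul_apply,
      ContinuousLinearMap.smulRight_apply, map_smul, map_smul, h.pairing] at h2
    simp only [smul_eq_mul, mul_one, sub_self, sub_zero] at h2
    exact (mul_eq_zero.1 h2).resolve_left hz0
  conv_rhs => rw [← h1, sub_apply, smul_apply, ContinuousLinearMap.smulRight_apply, hv, zero_smul,
    smul_zero, sub_zero]

lemma resolvent_apply_of_dual (hρ : 0 < ρ) {z : ℂ} (hz : ρ ≤ ‖z‖) (hne : z ≠ lam) {u : E}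
    (hu : ℓ u = 0) :
    _root_.resolvent L z u = _root_.resolvent (L - lam • rankOne ℓ g) z u := by
  have h4 := (resolvent_apply (h.mem_resolventSet hρ hz hne)
    (_root_.resolvent (L - lam • rankOne ℓ g) z u)).2
  rwa [h.sub_apply_resolvent hρ hz hu] at h4

/-- The spectral projector at the eigenvalue vanishes on the kernel of the dual eigenvector. -/
lemma circleIntegral_resolvent_apply [CompleteSpace E] {ε : ℝ} (hε : 0 ≤ ε) (hρ : 0 < ρ)
    (hρε : ρ ≤ 1 - ε) (hlam : ‖lam - 1‖ < ε) {u : E} (hu : ℓ u = 0) :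
    (∮ z in C(1, ε), _root_.resolvent L z) u = 0 := by
  have hball : ∀ z ∈ Metric.closedBall (1 : ℂ) ε, ρ ≤ ‖z‖ := by
    intro z hz
    rw [Metric.mem_closedBall, dist_eq_norm, norm_sub_rev] at hz
    have h1 := norm_sub_norm_le (1 : ℂ) z
    rw [norm_one] at h1
    linarith
  have hsph : ∀ z ∈ Metric.sphere (1 : ℂ) ε, z ≠ lam := by
    rintro z hz rfl
    rw [mem_sphere_iff_norm] at hz
    exact hlam.ne hz
  have hcont : ContinuousOn (fun z => _root_.resolvent L z) (Metric.sphere (1 : ℂ) ε) :=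
    fun z hz => (spectrum.hasDerivAt_resolvent_const_left (h.mem_resolventSet hρ
      (hball z (Metric.sphere_subset_closedBall hz)) (hsph z hz))).continuousAt.continuousWithinAt
  have hint := (hcont.circleIntegrable hε).out
  have h1 : (∮ z in C(1, ε), _root_.resolvent L z) u = ∮ z in C(1, ε), _root_.resolvent L z u :=
    ((ContinuousLinearMap.apply ℂ E u).intervalIntegral_comp_comm hint).symm
  rw [h1, circleIntegral.integral_congr hε fun z hz => h.resolvent_apply_of_dual hρ
    (hball z (Metric.sphere_subset_closedBall hz)) (hsph z hz) hu]
  -- On ker ℓ the resolvent extends holomorphically across lam, so Cauchy's theorem applies on the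
  -- whole disc.
  have hd : ∀ z ∈ Metric.closedBall (1 : ℂ) ε, DifferentiableAt ℂ
      (fun z => _root_.resolvent (L - lam • rankOne ℓ g) z u) z := fun z hz =>
    (((ContinuousLinearMap.apply ℂ E u).hasFDerivAt.comp_hasDerivAt z
      (spectrum.hasDerivAt_resolvent_const_left
        (h.resolvent z (hball z hz)))).differentiableAt)
  exact Complex.circleIntegral_eq_zero_of_differentiable_on_off_countable hε countable_empty
    (fun z hz => (hd z hz).continuousAt.continuousWithinAt)
    fun z hz => hd z (Metric.ball_subset_closedBall hz.1)

end SpectralSplit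

/-! ### Operators with a spectral gap -/

/-- If z is in the spectrum of a, then zⁿ is in that of aⁿ, so |z|ⁿ is at most of order τⁿ. -/
lemma mem_resolventSet_of_norm_pow_le {B : Type*} [NormedRing B] [NormedAlgebra ℂ B]
    [CompleteSpace B] {a : B} {C τ : ℝ} (hτ : 0 ≤ τ) (ha : ∀ n : ℕ, ‖a ^ n‖ ≤ C * τ ^ n) {z : ℂ}
    (hz : τ < ‖z‖) : z ∈ resolventSet ℂ a := by
  by_contra hmem
  have hz0 : 0 < ‖z‖ := hτ.trans_lt hz
  have h1 : ∀ n : ℕ, 1 ≤ C * ‖(1 : B)‖ * (τ / ‖z‖) ^ n := by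
    intro n
    have := spectrum.norm_le_norm_mul_of_mem (spectrum.pow_mem_pow a n hmem)
    rw [norm_pow] at this
    rw [div_pow, ← mul_div_assoc, le_div_iff₀ (by positivity), one_mul]
    calc _ ≤ _ := this
      _ ≤ C * τ ^ n * ‖(1 : B)‖ := mul_le_mul_of_nonneg_right (ha n) (norm_nonneg _)
      _ = _ := by ring
  have h2 := (tendsto_pow_atTop_nhds_zero_of_lt_one (by positivity) ((div_lt_one hz0).2 hz)).const_mul
    (C * ‖(1 : B)‖)
  rw [mul_zero] at h2
  exact absurd (ge_of_tendsto' h2 h1) (by norm_num)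

variable [CompleteSpace E] {L : E →L[ℂ] E} {g : E} {m : E →L[ℂ] ℂ} {C τ : ℝ}

lemma mem_resolventSet_of_gap (hg : L g = g) (hm : ∀ x, m (L x) = m x) (h1 : m g = 1)
    (hτ : 0 ≤ τ) (hgap : ∀ f, m f = 0 → ∀ n : ℕ, ‖(L ^ n) f‖ ≤ C * τ ^ n * ‖f‖) {z : ℂ}
    (hz : τ < ‖z‖) : z ∈ resolventSet ℂ (L - rankOne m g) := by
  set R := L - rankOne m g
  have hC : 0 ≤ |C| := abs_nonneg C
  have hgap' : ∀ f, m f = 0 → ∀ n : ℕ, ‖(L ^ n) f‖ ≤ |C| * τ ^ n * ‖f‖ := fun f hf n =>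
    (hgap f hf n).trans (by gcongr; exact le_abs_self C)
  have hmR : ∀ x, m (R x) = 0 := fun x => by simp [R, hm, h1]
  -- After the first application R lives on the kernel of m; the correction is only present for n =
  -- 0.
  have hR : ∀ (n : ℕ) x, (R ^ n) x = (L ^ n) (x - m x • g) + if n = 0 then m x • g else 0 := by
    intro n x
    induction n generalizing x with
    | zero => simp
    | succ n ih =>
      rw [pow_succ, mul_apply_eq_comp, ih, hmR, pow_succ, mul_apply_eq_comp, map_sub L, map_smul L, hg]
      simp [R]
  refine mem_resolventSet_of_norm_pow_le (C := |C| * (1 + ‖m‖ * ‖g‖) + ‖m‖ * ‖g‖) hτ (fun n => ?_) hz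
  refine ContinuousLinearMap.opNorm_le_bound _ (by positivity) fun x => ?_
  have e1 : ‖m x • g‖ ≤ ‖m‖ * ‖g‖ * ‖x‖ := by
    rw [norm_smul]
    nlinarith [m.le_opNorm x, norm_nonneg g]
  have e2 : ‖x - m x • g‖ ≤ (1 + ‖m‖ * ‖g‖) * ‖x‖ := (norm_sub_le _ _).trans (by linarith)
  have e3 := hgap' (x - m x • g) (by simp [h1]) n
  rw [hR]
  have e4 : ‖if n = 0 then m x • g else 0‖ ≤ ‖m‖ * ‖g‖ * τ ^ n * ‖x‖ := by
    split_ifs with hn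
    · subst hn; simpa using e1
    · simp; positivity
  calc _ ≤ |C| * τ ^ n * ((1 + ‖m‖ * ‖g‖) * ‖x‖) + ‖m‖ * ‖g‖ * τ ^ n * ‖x‖ :=
        (norm_add_le _ _).trans (add_le_add (e3.trans (by gcongr)) e4)
    _ = _ := by ring

lemma spectrum_subset_of_gap (hg : L g = g) (hm : ∀ x, m (L x) = m x) (h1 : m g = 1)
    (hτ : 0 ≤ τ) (hgap : ∀ f, m f = 0 → ∀ n : ℕ, ‖(L ^ n) f‖ ≤ C * τ ^ n * ‖f‖) :
    spectrum ℂ L ⊆ {1} ∪ Metric.closedBall 0 τ := by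
  intro z hz
  by_contra hcon
  rw [mem_union, mem_singleton_iff, mem_closedBall_zero_iff, not_or, not_le] at hcon
  have h2 := mem_resolventSet_of_gap hg hm h1 hτ hgap hcon.2
  refine hz ((mem_resolventSet_iff_split (lam := 1) (by rw [one_smul, hg]) h1
    (norm_pos_iff.1 (hτ.trans_lt hcon.2)) hcon.1).2 ?_)
  rwa [one_smul]

/-- If the spectrum lies in `{1} ∪ B(0, ρ)` and `m` has a nontrivial kernel then `ρ > 0`. -/
lemma pos_of_spectrum_subset (hm : ∀ x, m (L x) = m x) (hτ : 0 ≤ τ) (hτ1 : τ < 1)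
    (hgap : ∀ f, m f = 0 → ∀ n : ℕ, ‖(L ^ n) f‖ ≤ C * τ ^ n * ‖f‖) {ρ : ℝ}
    (hL : spectrum ℂ L ⊆ {1} ∪ Metric.ball 0 ρ) {f₀ : E} (hf₀ : f₀ ≠ 0) (hmf₀ : m f₀ = 0) :
    0 < ρ := by
  let V : Submodule ℂ E := LinearMap.ker (m : E →ₗ[ℂ] ℂ)
  have hV : ∀ x, x ∈ V ↔ m x = 0 := fun x => LinearMap.mem_ker
  have hVc : IsClosed (V : Set E) := m.isClosed_ker
  have : CompleteSpace V := hVc.completeSpace_coe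
  have : Nontrivial V := ⟨⟨⟨f₀, (hV _).2 hmf₀⟩, 0, fun h => hf₀ (congr_arg Subtype.val h)⟩⟩
  let T : V →L[ℂ] V := (L.comp V.subtypeL).codRestrict V fun x => by
    rw [hV]; change m (L x) = 0; rw [hm]; exact (hV _).1 x.2
  have hT : ∀ x : V, ((T x : V) : E) = L x := fun x => rfl
  have hTn : ∀ (n : ℕ) (x : V), (((T ^ n) x : V) : E) = (L ^ n) x := by
    intro n
    induction n with
    | zero => intro x; rfl
    | succ n ih => intro x; rw [pow_succ, mul_apply_eq_comp, ih, hT, pow_succ, mul_apply_eq_comp]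
  -- The restriction T of L to ker m has spectrum. By the decay it does not contain 1, and its
  -- points belong to the spectrum of L because away from 1 the resolvent of L preserves ker m.
  obtain ⟨z, hz⟩ := spectrum.nonempty T
  have hz1 : z ≠ 1 := by
    rintro rfl
    refine hz (mem_resolventSet_of_norm_pow_le (C := |C|) hτ (fun n => ?_) (by simpa using hτ1))
    refine ContinuousLinearMap.opNorm_le_bound _ (by positivity) fun x => ?_
    change ‖(((T ^ n) x : V) : E)‖ ≤ _
    rw [hTn]
    refine (hgap x ((hV _).1 x.2) n).trans ?_
    gcongr
    · exact le_abs_self C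
    · exact le_rfl
  have hzL : z ∈ spectrum ℂ L := by
    by_contra hcon
    have hres : z ∈ resolventSet ℂ L := not_not.1 hcon
    have hmS : ∀ x, m x = 0 → m (resolvent L z x) = 0 := by
      intro x hx
      have h2 := congr_arg m (resolvent_apply hres x).1
      rw [hx, map_sub, map_smul, hm, smul_eq_mul, ← sub_one_mul] at h2
      exact (mul_eq_zero.1 h2).resolve_left (sub_ne_zero.2 hz1)
    let S : V →L[ℂ] V := ((resolvent L z).comp V.subtypeL).codRestrict V fun x => by
      rw [hV]; exact hmS _ ((hV _).1 x.2)
    refine hz (spectrum.mem_resolventSet_iff.2 ⟨⟨_, S, ?_, ?_⟩, rfl⟩)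
    · refine ContinuousLinearMap.ext fun x => Subtype.ext ?_
      simpa [Algebra.algebraMap_eq_smul_one, S, T] using (resolvent_apply hres (x : E)).1
    · refine ContinuousLinearMap.ext fun x => Subtype.ext ?_
      simpa [Algebra.algebraMap_eq_smul_one, S, T] using (resolvent_apply hres (x : E)).2
  have h2 := (hL hzL).resolve_left hz1
  exact Metric.pos_of_mem_ball h2

/-- The radius ρ comes from the given inclusion of the spectrum and may be smaller than τ; the decay
is needed only at z = 1, which the inclusion does not exclude. -/
lemma spectralSplit_of_gap (hg : L g = g) (hm : ∀ x, m (L x) = m x) (h1 : m g = 1)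
    (hτ : 0 ≤ τ) (hτ1 : τ < 1) (hgap : ∀ f, m f = 0 → ∀ n : ℕ, ‖(L ^ n) f‖ ≤ C * τ ^ n * ‖f‖)
    {ρ : ℝ} (hρ : 0 < ρ) (hL : spectrum ℂ L ⊆ {1} ∪ Metric.ball 0 ρ) : SpectralSplit L ρ 1 g m := by
  refine ⟨by rw [one_smul, hg], fun x => by rw [hm, one_mul], h1, fun z hz => ?_⟩
  by_cases hz1 : z = 1
  · rw [hz1, one_smul]
    exact mem_resolventSet_of_gap hg hm h1 hτ hgap (by simpa using hτ1)
  · refine (mem_resolventSet_iff_split (by rw [one_smul, hg]) h1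
      (norm_pos_iff.1 (hρ.trans_le hz)) hz1).1 ?_
    by_contra hcon
    have := (hL hcon).resolve_left hz1
    rw [mem_ball_zero_iff] at this
    linarith

end Split

end BowenSeries

namespace BowenSeries

open Complex MeasureTheory Set

namespace LabelledIdealPolygon

variable {Γ₀ : Subgroup SL(2, ℝ)} {𝒜 : Type*} {Ω : LabelledIdealPolygon Γ₀ 𝒜} [Finite 𝒜]

/-! ### Leading eigenvalues -/

lemma IsLeadingPair.ne_zero {L : Ω.PLip →L[ℂ] Ω.PLip} {lam : ℝ} {g : Ω.PLip}
    (h : IsLeadingPair L lam g) : g ≠ 0 := by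
  rintro rfl
  have := (h.2.1 1).1
  rw [coe_zero] at this
  exact lt_irrefl _ this

lemma IsLeadingPair.hasEigenvalue {L : Ω.PLip →L[ℂ] Ω.PLip} {lam : ℝ} {g : Ω.PLip}
    (h : IsLeadingPair L lam g) : Module.End.HasEigenvalue (L : Ω.PLip →ₗ[ℂ] Ω.PLip) lam :=
  Module.End.hasEigenvalue_of_hasEigenvector
    (Module.End.hasEigenvector_iff.2 ⟨Module.End.mem_eigenspace_iff.2 h.2.2.1, h.ne_zero⟩)

/-- Two different leading eigenvalues would each be strictly smaller than the other. So the choice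
in `leadingEigenvalue` is immaterial. -/
lemma IsLeadingPair.eq {L : Ω.PLip →L[ℂ] Ω.PLip} {lam lam' : ℝ} {g g' : Ω.PLip}
    (h : IsLeadingPair L lam g) (h' : IsLeadingPair L lam' g') : lam = lam' := by
  by_contra hne
  have h1 := h.2.2.2.2 lam' h'.hasEigenvalue fun h => hne (by exact_mod_cast h.symm)
  have h2 := h'.2.2.2.2 lam h.hasEigenvalue fun h => hne (by exact_mod_cast h)
  rw [Complex.norm_real, Real.norm_eq_abs, abs_of_pos h'.1] at h1
  rw [Complex.norm_real, Real.norm_eq_abs, abs_of_pos h.1] at h2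
  exact lt_asymm h1 h2

lemma IsLeadingPair.leadingEigenvalue_eq {L : Ω.PLip →L[ℂ] Ω.PLip} {lam : ℝ} {g : Ω.PLip}
    (h : IsLeadingPair L lam g) : leadingEigenvalue L = lam := by
  have hex : ∃ lam : ℝ, ∃ g : Ω.PLip, IsLeadingPair L lam g := ⟨lam, g, h⟩
  rw [leadingEigenvalue, dif_pos hex]
  obtain ⟨g', hg'⟩ := hex.choose_spec
  exact hg'.eq h

lemma exists_isLeadingPair {L : Ω.PLip →L[ℂ] Ω.PLip} (h : leadingEigenvalue L ≠ 0) :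
    ∃ g, IsLeadingPair L (leadingEigenvalue L) g := by
  by_cases hex : ∃ lam : ℝ, ∃ g : Ω.PLip, IsLeadingPair L lam g
  · obtain ⟨lam, g, hg⟩ := hex
    exact ⟨g, hg.leadingEigenvalue_eq ▸ hg⟩
  · exact absurd (by rw [leadingEigenvalue, dif_neg hex]) h

lemma isLeadingPair_of_split {L : Ω.PLip →L[ℂ] Ω.PLip} {ρ lam : ℝ} {g : Ω.PLip}
    {ℓ : Ω.PLip →L[ℂ] ℂ} (h : SpectralSplit L ρ lam g ℓ) (hρ : 0 < ρ) (hlam : ρ ≤ lam)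
    (hg : ∀ ξ, 0 < (g ξ).re ∧ (g ξ).im = 0) : IsLeadingPair L lam g := by
  have hn : ‖(lam : ℂ)‖ = lam := by
    rw [Complex.norm_real, Real.norm_eq_abs, abs_of_pos (hρ.trans_le hlam)]
  refine ⟨hρ.trans_le hlam, hg, h.apply_eq, h.finrank_maxGenEigenspace (by rwa [hn]),
    fun z hz hne => ?_⟩
  obtain ⟨v, hv⟩ := hz.exists_hasEigenvector
  exact (h.eigenvalue hρ hv.2 hv.apply_eq_smul hne).trans_le hlam

/-- The component along the leading eigenvector is given by the dual eigenvector. -/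
lemma isComponent_of_split {L B : Ω.PLip →L[ℂ] Ω.PLip} {ρ ε lam β : ℝ} {g g' : Ω.PLip}
    {ℓ : Ω.PLip →L[ℂ] ℂ} (h : SpectralSplit L ρ lam g ℓ) (hε : 0 ≤ ε) (hρ : 0 < ρ)
    (hρε : ρ ≤ 1 - ε) (hlam : |lam - 1| < ε) (hβ : ℓ (B g) = β) (hg' : L g' = (lam : ℂ) • g') :
    IsComponent (spectralProjector ε L) g' (B g') β := by
  have hlam' : ‖(lam : ℂ) - 1‖ < ε := by
    rw [← Complex.ofReal_one, ← Complex.ofReal_sub, Complex.norm_real]; exact hlam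
  have hlamρ : ρ ≤ ‖(lam : ℂ)‖ := by
    rw [Complex.norm_real]
    refine le_trans ?_ (le_abs_self lam)
    linarith [(abs_lt.1 hlam).1]
  refine ⟨B g' - (β : ℂ) • g', ?_, by abel⟩
  have hu : ℓ (B g' - (β : ℂ) • g') = 0 := by
    rw [h.eq_smul hlamρ hg', map_smul, map_sub, map_smul, map_smul, map_smul, hβ, h.pairing]
    simp only [smul_eq_mul]; ring
  rw [spectralProjector, smul_apply, h.circleIntegral_resolvent_apply hε hρ hρε hlam' hu, smul_zero]

/-! ### Reality -/

omit [Finite 𝒜] in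
lemma im_eq_zero_iff_conj (f : Ω.PLip) : (∀ ξ, (f ξ).im = 0) ↔ Ω.conjPLip f = f := by
  constructor
  · intro h
    exact Subtype.ext (funext fun ξ => Complex.conj_eq_iff_im.2 (h ξ))
  · intro h ξ
    rw [← Complex.conj_eq_iff_im, ← conjPLip_apply, h]

omit [Finite 𝒜] in
lemma conjPLip_smul (c : ℂ) (f : Ω.PLip) :
    Ω.conjPLip (c • f) = starRingEnd ℂ c • Ω.conjPLip f :=
  Subtype.ext (funext fun ξ => by
    change starRingEnd ℂ (c * f ξ) = starRingEnd ℂ c * starRingEnd ℂ (f ξ)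
    rw [map_mul])

omit [Finite 𝒜] in
lemma conjPLip_sub (f f' : Ω.PLip) : Ω.conjPLip (f - f') = Ω.conjPLip f - Ω.conjPLip f' :=
  Subtype.ext (funext fun ξ => by
    change starRingEnd ℂ (f ξ - f' ξ) = starRingEnd ℂ (f ξ) - starRingEnd ℂ (f' ξ)
    rw [map_sub])

variable {𝒱 : 𝒜 → Set (List 𝒜)} {w : ℝ → ℝ} {L : Ω.PLip →L[ℂ] Ω.PLip} {ρ : ℝ} {lam : ℂ}
  {g : Ω.PLip} {ℓ : Ω.PLip →L[ℂ] ℂ}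

/-- The operator commutes with conjugation, so conj lam is an eigenvalue of the same modulus, and
lam is the only one of modulus at least ρ. -/
lemma conj_eigenvalue_of_split (hL : IsWeightedOp 𝒱 w L) (h : SpectralSplit L ρ lam g ℓ)
    (hρ : 0 < ρ) (hlam : ρ ≤ ‖lam‖) : lam.im = 0 := by
  rw [← Complex.conj_eq_iff_im]
  by_contra hne
  have h1 : L (Ω.conjPLip g) = starRingEnd ℂ lam • Ω.conjPLip g := by
    rw [hL.map_conj, h.apply_eq, conjPLip_smul]
  have h2 : Ω.conjPLip g ≠ 0 := by
    intro h0
    apply h.ne_zero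
    refine Subtype.ext (funext fun ξ => ?_)
    have h3 : Ω.conjPLip g ξ = 0 := by rw [h0, coe_zero]
    rw [conjPLip_apply, map_eq_zero] at h3
    exact h3
  have := h.eigenvalue hρ h2 h1 hne
  rw [RCLike.norm_conj] at this
  linarith

/-- By simplicity conj g is a multiple of g; the normalized integral shows that the factor is 1. -/
lemma im_eigenvector_of_split (hL : IsWeightedOp 𝒱 w L) (h : SpectralSplit L ρ lam g ℓ)
    (hρ : 0 < ρ) (hlam : ρ ≤ ‖lam‖) (hm : Ω.integralCLM g = 1) (ξ : Circle) : (g ξ).im = 0 := by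
  have hreal := Complex.conj_eq_iff_im.2 (conj_eigenvalue_of_split hL h hρ hlam)
  have h1 : L (Ω.conjPLip g) = lam • Ω.conjPLip g := by
    rw [hL.map_conj, h.apply_eq, conjPLip_smul, hreal]
  have h2 := h.eq_smul hlam h1
  have h3 := congr_arg Ω.integralCLM h2
  rw [integralCLM_conj, map_smul, hm, map_one, smul_eq_mul, mul_one] at h3
  rw [← h3, one_smul] at h2
  exact (im_eq_zero_iff_conj g).2 h2 ξ

/-- The function f - ℓ(f) g is in the range of lam - L. So is its conjugate, and applying ℓ to it
gives conj (ℓ f) = ℓ f. -/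
lemma im_dual_of_split (hL : IsWeightedOp 𝒱 w L) (h : SpectralSplit L ρ lam g ℓ)
    (hρ : 0 < ρ) (hlam : ρ ≤ ‖lam‖) (hm : Ω.integralCLM g = 1) {f : Ω.PLip}
    (hf : ∀ ξ, (f ξ).im = 0) : (ℓ f).im = 0 := by
  have hreal := Complex.conj_eq_iff_im.2 (conj_eigenvalue_of_split hL h hρ hlam)
  have hg := (im_eq_zero_iff_conj g).1 (im_eigenvector_of_split hL h hρ hlam hm)
  obtain ⟨v, hv⟩ : ∃ v, lam • v - L v = f - ℓ f • g :=
    ⟨_, h.sub_apply_resolvent hρ hlam (by simp [h.pairing])⟩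
  have h1 := congr_arg (fun u => ℓ (Ω.conjPLip u)) hv
  simp only [conjPLip_sub, conjPLip_smul, ← hL.map_conj, hreal, hg, (im_eq_zero_iff_conj f).1 hf,
    map_sub, map_smul, h.dual_eq, h.pairing, smul_eq_mul, mul_one, sub_self] at h1
  exact Complex.conj_eq_iff_im.1 (sub_eq_zero.1 h1.symm).symm

/-! ### Eigenvalue one for different exponents -/

variable (Ω) in
-- Otherwise a and its two neighbours are the whole alphabet, but a fixed point free involution does
-- not exist on three letters.
lemma exists_letter_avoiding (a : 𝒜) :
    ∃ b, Ω.hat b ≠ a ∧ Ω.hat b ≠ Ω.succ a ∧ Ω.succ (Ω.hat b) ≠ a := by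
  obtain ⟨p, hp⟩ : ∃ p, Ω.succ p = a := Ω.succEquiv.surjective a
  by_contra! hcon
  have key : ∀ b, b = a ∨ b = Ω.succ a ∨ b = p := by
    intro b
    by_contra! h
    have := hcon (Ω.hat b) (by rw [Ω.hat_hat]; exact h.1) (by rw [Ω.hat_hat]; exact h.2.1)
    rw [Ω.hat_hat, ← hp] at this
    exact h.2.2 (Ω.succ_injective this)
  have hpa : p ≠ a := by rintro rfl; exact Ω.succ_ne _ hp
  have hsa := Ω.succ_ne a
  have hps : p ≠ Ω.succ a := by
    intro h
    rw [h] at hp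
    exact Ω.succ_succ_ne a hp
  have h1 := key (Ω.hat a)
  have h2 := key (Ω.hat (Ω.succ a))
  have h3 := key (Ω.hat p)
  have i1 := Ω.hat_ne a
  have i2 := Ω.hat_ne (Ω.succ a)
  have i3 := Ω.hat_ne p
  have j1 := Ω.hat_hat a
  have j2 := Ω.hat_hat (Ω.succ a)
  have j3 := Ω.hat_hat p
  grind

variable (Ω) in
/-- For any arc there is an admissible branch which maps its closure into the interior of an arc. -/
lemma exists_singleton_word (a : 𝒜) : ∃ b, [b] ∈ Ω.words a ∧
    ∃ K : Set Circle, IsCompact K ∧ K ⊆ Ω.arc b ∧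
      ∀ ξ ∈ Ω.arc a, circleMap (Ω.word [b]) ξ ∈ K := by
  obtain ⟨b, h1, h2, h3⟩ := Ω.exists_letter_avoiding a
  refine ⟨b, ⟨?_, b, rfl, h1.symm, fun _ => ⟨?_, ?_⟩, fun h => ?_, fun h => ?_⟩,
    circleMap (Ω.F b) '' (cw '' Icc (Ω.lo a) (Ω.hi a)), ?_, ?_, ?_⟩
  · exact (Ω.isCuspidal_iff _).2 ⟨List.cons_ne_nil _ _, true, List.isChain_singleton _⟩
  · rw [next_iff]; exact h3.symm
  · rw [next_iff]; exact h2
  · exact absurd h.1 (by norm_num)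
  · exact absurd h.1 (by norm_num)
  · exact (isCompact_Icc.image continuous_cw).image (continuous_circleMap _)
  · rintro _ ⟨_, ⟨t, ht, rfl⟩, rfl⟩
    rw [circleMap_F_mem_arc_iff]
    intro hmem
    rcases ht.2.eq_or_lt with h | h
    · have := Ω.xiL_mem_arc (Ω.succ a)
      rw [xiL_succ, xiR_eq, ← h] at this
      exact h2 (eq_of_mem_arc hmem this)
    · exact h1 (eq_of_mem_arc hmem ⟨t, ⟨ht.1, h⟩, rfl⟩)
  · rintro _ ⟨t, ht, rfl⟩
    rw [word_singleton]
    exact mem_image_of_mem _ ⟨t, Ico_subset_Icc_self ht, rfl⟩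

/-- On a right-open arc a positive Lipschitz function may tend to 0 at the missing end. A single
branch that maps the closed arc into the inside of another one gives f ≥ L f ≥ w · f∘F_b, with f
evaluated on a compact set. -/
lemma exists_pos_le_re {𝒱 : 𝒜 → Set (List 𝒜)} {w : ℝ → ℝ} {L : Ω.PLip →L[ℂ] Ω.PLip}
    (hL : IsWeightedOp 𝒱 w L) (hw : ∀ x > 0, 0 < w x) (hwc : ContinuousOn w (Ioi 0))
    (h𝒱 : ∀ a b, [b] ∈ Ω.words a → [b] ∈ 𝒱 a) {f : Ω.PLip}
    (hf : ∀ ξ, 0 < (f ξ).re) (hLf : ∀ ξ, (L f ξ).re ≤ (f ξ).re) : ∃ c > 0, ∀ ξ, c ≤ (f ξ).re := by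
  have key : ∀ a, ∃ c > 0, ∀ ξ ∈ Ω.arc a, c ≤ (f ξ).re := by
    intro a
    obtain ⟨b, hb, K, hK, hKb, hKm⟩ := Ω.exists_singleton_word a
    have hne : K.Nonempty := ⟨_, hKm _ (Ω.xiL_mem_arc a)⟩
    obtain ⟨k, hk⟩ := f.2 b
    obtain ⟨ζ, hζ, hmin⟩ := hK.exists_isMinOn hne
      (f := fun ξ => (f ξ).re) (Complex.continuous_re.comp_continuousOn (hk.continuousOn.mono hKb))
    obtain ⟨x, -, hx⟩ := isCompact_univ.exists_isMinOn univ_nonempty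
      (f := fun ξ : Circle => w (derivNorm (Ω.word [b]) ξ))
      (hwc.comp (continuous_derivNorm _).continuousOn fun ξ _ => derivNorm_pos _ ξ)
    refine ⟨w (derivNorm (Ω.word [b]) x) * (f ζ).re,
      mul_pos (hw _ (derivNorm_pos _ _)) (hf ζ), fun ξ hξ => ?_⟩
    refine le_trans ?_ ((hL.le_re (fun x hx => (hw x hx).le) (fun ξ => (hf ξ).le) hξ
      (h𝒱 a b hb)).trans (hLf ξ))
    exact mul_le_mul (hx (mem_univ ξ)) (hmin (hKm ξ hξ)) (hf ζ).le (hw _ (derivNorm_pos _ _)).le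
  choose c hc hcf using key
  have : Nonempty 𝒜 := ⟨Ω.letter 1⟩
  obtain ⟨a, ha⟩ := Finite.exists_min c
  exact ⟨c a, hc a, fun ξ => (ha _).trans (hcf _ ξ (Ω.mem_arc_letter ξ))⟩

/-- The exponent for which `1` is the leading eigenvalue is unique. -/
lemma not_lt_of_fixed {𝒱 : 𝒜 → Set (List 𝒜)} (h𝒱 : ∀ a, 𝒱 a ⊆ Ω.words a)
    (h𝒱' : ∀ a b, [b] ∈ Ω.words a → [b] ∈ 𝒱 a) {s s' : ℝ} {L L' : Ω.PLip →L[ℂ] Ω.PLip}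
    (hL : IsWeightedOp 𝒱 (fun x => x ^ s) L) (hL' : IsWeightedOp 𝒱 (fun x => x ^ s') L')
    {g g' : Ω.PLip} (hg : ∀ ξ, 0 < (g ξ).re) (hg' : ∀ ξ, 0 < (g' ξ).re) (hLg : L g = g)
    (hLg' : L' g' = g') : ¬ s < s' := by
  intro hlt
  obtain ⟨D, θ, -, hθ0, hθ1, hdist⟩ := Ω.exists_distortion
  obtain ⟨c, hc, hcg⟩ := exists_pos_le_re hL (fun x hx => by positivity)
    (fun x hx => (Real.continuousAt_rpow_const x s (Or.inl hx.ne')).continuousWithinAt) h𝒱' hg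
    fun ξ => by rw [hLg]
  set κ := θ ^ (s' - s) with hκ
  have hκ0 : 0 < κ := by positivity
  have hκ1 : κ < 1 := Real.rpow_lt_one hθ0.le hθ1 (by linarith)
  -- Derivatives are at most θ, so x^s' ≤ θ^(s'-s) x^s: applying both operators improves a bound g'
  -- ≤ r g by the factor κ < 1. Iteration would force g' ≤ 0.
  have hstep : ∀ r : ℝ, 0 ≤ r → (∀ ξ, (g' ξ).re ≤ r * (g ξ).re) →
      ∀ ξ, (g' ξ).re ≤ κ * r * (g ξ).re := by
    intro r hr h ξ
    have h1 := hL'.hasSum_re g' (Ω.mem_arc_letter ξ)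
    have h2 := (hL.hasSum_re g (Ω.mem_arc_letter ξ)).mul_left (κ * r)
    rw [hLg'] at h1
    rw [hLg] at h2
    refine hasSum_le (fun W => ?_) h1 h2
    have hd := derivNorm_pos (Ω.word (W : List 𝒜)) ξ
    have h3 : derivNorm (Ω.word (W : List 𝒜)) ξ ^ s' ≤
        κ * derivNorm (Ω.word (W : List 𝒜)) ξ ^ s := by
      have e : s' = (s' - s) + s := by ring
      conv_lhs => rw [e, Real.rpow_add hd]
      refine mul_le_mul_of_nonneg_right ?_ (by positivity)
      exact Real.rpow_le_rpow hd.le (hdist _ _ (h𝒱 _ W.2) ξ (Ω.mem_arc_letter ξ)).1 (by linarith)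
    calc _ ≤ κ * derivNorm (Ω.word (W : List 𝒜)) ξ ^ s *
          (r * (g (circleMap (Ω.word (W : List 𝒜)) ξ)).re) :=
          mul_le_mul h3 (h _) (hg' _).le (by positivity)
      _ = _ := by ring
  have hit : ∀ n : ℕ, ∀ ξ, (g' ξ).re ≤ κ ^ n * (‖g'‖ / c) * (g ξ).re := by
    intro n
    induction n with
    | zero =>
      intro ξ
      rw [pow_zero, one_mul, div_mul_eq_mul_div, le_div_iff₀ hc]
      refine mul_le_mul (((Complex.re_le_norm _).trans (norm_apply_le g' ξ)).trans ?_) (hcg ξ) hc.le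
        (norm_nonneg _)
      rw [norm_def]
      linarith [lipConst_nonneg g']
    | succ n ih =>
      intro ξ
      refine (hstep _ (by positivity) ih ξ).trans_eq (by ring)
  have h2 := ((tendsto_pow_atTop_nhds_zero_of_lt_one hκ0.le hκ1).mul_const
    (‖g'‖ / c)).mul_const (g 1).re
  rw [zero_mul, zero_mul] at h2
  exact absurd (ge_of_tendsto' h2 fun n => hit n 1) (not_le.2 (hg' 1))

end LabelledIdealPolygon

end BowenSeries

namespace BowenSeries

open Complex MeasureTheory Set

namespace LabelledIdealPolygon

variable {Γ₀ : Subgroup SL(2, ℝ)} {𝒜 : Type*} {Ω : LabelledIdealPolygon Γ₀ 𝒜} [Finite 𝒜]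

/-! ### Perturbation of the transfer operator -/

/-- Spectral data of an operator `L` near `L₁`, where `g₀` is the invariant density of `L₁`: the
leading eigenvalue, its eigenvector normalized by the integral, and the dual eigenvector. -/
structure LeadingSplit (L₁ : Ω.PLip →L[ℂ] Ω.PLip) (g₀ : Ω.PLip) (ε B : ℝ)
    (L : Ω.PLip →L[ℂ] Ω.PLip) (lam : ℝ) (g : Ω.PLip) (ℓ : Ω.PLip →L[ℂ] ℂ) : Prop where
  split : SpectralSplit L (1 - 2 * ε) lam g ℓ
  integral_eq : Ω.integralCLM g = 1
  pos : ∀ ξ, 0 < (g ξ).re ∧ (g ξ).im = 0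
  abs_sub_lt : |lam - 1| < ε
  norm_le : ‖g‖ ≤ B
  norm_sub_le : ‖g - g₀‖ ≤ B * ‖L - L₁‖
  norm_dual_le : ‖ℓ‖ ≤ B
  norm_dual_sub_le : ‖ℓ - Ω.integralCLM‖ * B ≤ 1 / 2
  dual_im : ∀ f : Ω.PLip, (∀ ξ, (f ξ).im = 0) → (ℓ f).im = 0

variable {L₁ : Ω.PLip →L[ℂ] Ω.PLip}

variable (Ω) in
-- The indicator of an arc minus its mean value; it shows that the kernel of the integral is
-- nontrivial, as `pos_of_spectrum_subset` requires.
lemma exists_ne_zero_integral_eq_zero : ∃ f : Ω.PLip, f ≠ 0 ∧ Ω.integralCLM f = 0 := by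
  classical
  set a := Ω.letter 1
  let χ : Ω.PLip := ⟨fun ξ => if ξ ∈ Ω.arc a then 1 else 0, fun b => by
    refine ⟨0, LipschitzOnWith.of_dist_le_mul fun x hx y hy => ?_⟩
    by_cases hb : b = a
    · subst hb; simp [hx, hy]
    · have : ∀ z ∈ Ω.arc b, z ∉ Ω.arc a := fun z hz hz' => hb (eq_of_mem_arc hz hz')
      simp [this x hx, this y hy]⟩
  have hpi : (2 * Real.pi : ℂ) ≠ 0 := by simp [Real.pi_ne_zero]
  refine ⟨χ - (Ω.integralCLM χ / (2 * Real.pi)) • Ω.one, fun h => ?_, ?_⟩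
  · have h1 : (χ - (Ω.integralCLM χ / (2 * Real.pi)) • Ω.one) (Ω.xiL a) = 0 := by rw [h, coe_zero]
    have h2 : (χ - (Ω.integralCLM χ / (2 * Real.pi)) • Ω.one) (Ω.xiL (Ω.hat a)) = 0 := by
      rw [h, coe_zero]
    rw [coe_sub, coe_smul, one_apply, sub_eq_zero] at h1 h2
    have h3 : χ (Ω.xiL a) = 1 := if_pos (Ω.xiL_mem_arc a)
    have h4 : χ (Ω.xiL (Ω.hat a)) = 0 :=
      if_neg fun h => Ω.hat_ne a (eq_of_mem_arc (Ω.xiL_mem_arc _) h)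
    rw [h3] at h1
    rw [h4, ← h1] at h2
    exact zero_ne_one h2
  · rw [map_sub, map_smul, integralCLM_one, smul_eq_mul, div_mul_cancel₀ _ hpi, sub_self]

lemma exists_leadingSplit (hL₁ : IsWeightedOp Ω.words (fun x => x ^ (1 : ℝ)) L₁) {ε : ℝ}
    (hε : 0 < ε) (hspec : spectrum ℂ L₁ ⊆ {1} ∪ Metric.ball 0 (1 - 2 * ε)) :
    0 < 1 - 2 * ε ∧ ∃ g₀ : Ω.PLip, ∃ B d : ℝ, 1 ≤ B ∧ 0 < d ∧
      LeadingSplit L₁ g₀ ε B L₁ 1 g₀ Ω.integralCLM ∧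
      ∀ (𝒱 : 𝒜 → Set (List 𝒜)) (w : ℝ → ℝ) (L : Ω.PLip →L[ℂ] Ω.PLip), IsWeightedOp 𝒱 w L →
        ‖L - L₁‖ ≤ d → ∃ lam g ℓ, LeadingSplit L₁ g₀ ε B L lam g ℓ := by
  obtain ⟨C₀, τ, -, -, hτ0, hτ1, -, hgap, -⟩ := exists_gap_of_isWeightedOp hL₁
  obtain ⟨g₀, hg₀, hm₀, κ, hκ, hpos⟩ := exists_invariant_density hL₁
  have hint := Ω.integral_eq_of_isWeightedOp hL₁
  obtain ⟨f₀, hf₀, hmf₀⟩ := Ω.exists_ne_zero_integral_eq_zero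
  have hρ := pos_of_spectrum_subset hint hτ0 hτ1 hgap hspec hf₀ hmf₀
  have hbase := spectralSplit_of_gap hg₀ hint hm₀ hτ0 hτ1 hgap hρ hspec
  obtain ⟨d₀, C, hd₀, hC, hpert⟩ := exists_spectralSplit hρ (by linarith) hbase
  set B := max C (max (‖g₀‖ + 1) (‖Ω.integralCLM‖ + 1)) with hB
  have hCB : C ≤ B := le_max_left _ _
  have hgB : ‖g₀‖ + 1 ≤ B := (le_max_left _ _).trans (le_max_right _ _)
  have hmB : ‖Ω.integralCLM‖ + 1 ≤ B := (le_max_right _ _).trans (le_max_right _ _)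
  have hB1 : 1 ≤ B := by linarith [norm_nonneg g₀]
  -- κ/2 keeps the eigenvector positive, ε/2 keeps the eigenvalue in the disc, and 1/(2B) keeps ℓ g'
  -- away from 0 for any two operators near L₁.
  set μ := min (min (κ / 2) (ε / 2)) (1 / (2 * B)) with hμ
  have hμ0 : 0 < μ := by positivity
  have hμκ : μ ≤ κ / 2 := (min_le_left _ _).trans (min_le_left _ _)
  have hμε : μ ≤ ε / 2 := (min_le_left _ _).trans (min_le_right _ _)
  have hμB : μ ≤ 1 / (2 * B) := min_le_right _ _
  have hμ1 : μ ≤ 1 := hμB.trans (by rw [div_le_one (by positivity)]; linarith)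
  refine ⟨hρ, g₀, B, min d₀ (μ / C), hB1, by positivity, ⟨by simpa using hbase, hm₀,
    fun ξ => ⟨hκ.trans_le (hpos ξ).2, (hpos ξ).1⟩, by simpa using hε, by linarith, by simp,
    by linarith, by simp, fun f hf => Ω.im_integralCLM f hf⟩, fun 𝒱 w L hL hd => ?_⟩
  obtain ⟨lam, g, ℓ, hs, hmg, h1, h2, h3⟩ := hpert L (hd.trans (min_le_left _ _))
  have hX : C * ‖L - L₁‖ ≤ μ := by
    have := hd.trans (min_le_right _ _)
    rw [le_div_iff₀ hC] at this
    linarith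
  have hlam : 1 - 2 * ε ≤ ‖lam‖ := by
    have h4 := norm_sub_norm_le (1 : ℂ) lam
    rw [norm_one, norm_sub_rev] at h4
    linarith
  have hreal : lam = (lam.re : ℂ) :=
    Complex.ext rfl (by rw [conj_eigenvalue_of_split hL hs hρ hlam, Complex.ofReal_im])
  have him := im_eigenvector_of_split hL hs hρ hlam hmg
  refine ⟨lam.re, g, ℓ, hreal ▸ hs, hmg, fun ξ => ⟨?_, him ξ⟩, ?_, ?_, ?_, ?_, ?_,
    fun f hf => im_dual_of_split hL hs hρ hlam hmg hf⟩
  · have h4 : ‖(g - g₀) ξ‖ ≤ κ / 2 := by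
      refine (norm_apply_le _ ξ).trans ?_
      have := norm_def (g - g₀)
      linarith [lipConst_nonneg (g - g₀)]
    have h5 := (abs_le.1 ((Complex.abs_re_le_norm _).trans h4)).1
    rw [coe_sub, Complex.sub_re] at h5
    linarith [(hpos ξ).2]
  · rw [hreal, ← Complex.ofReal_one, ← Complex.ofReal_sub, Complex.norm_real] at h1
    exact h1.trans_lt (by linarith)
  · have := norm_add_le (g - g₀) g₀
    rw [sub_add_cancel] at this
    linarith
  · exact h2.trans (mul_le_mul_of_nonneg_right hCB (norm_nonneg _))
  · have := norm_add_le (ℓ - Ω.integralCLM) Ω.integralCLM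
    rw [sub_add_cancel] at this
    linarith
  · have := mul_le_mul_of_nonneg_right ((h3.trans hX).trans hμB) (by linarith : (0 : ℝ) ≤ B)
    refine this.trans_eq (by field_simp)

namespace LeadingSplit

variable {g₀ : Ω.PLip} {ε B : ℝ} {L L' : Ω.PLip →L[ℂ] Ω.PLip} {lam lam' : ℝ} {g g' : Ω.PLip}
  {ℓ ℓ' : Ω.PLip →L[ℂ] ℂ}

lemma isLeadingPair (h : LeadingSplit L₁ g₀ ε B L lam g ℓ) (hε : 0 < ε) (hρ : 0 < 1 - 2 * ε) :
    IsLeadingPair L lam g :=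
  isLeadingPair_of_split h.split hρ (by linarith [(abs_lt.1 h.abs_sub_lt).1]) h.pos

lemma leadingEigenvalue_eq (h : LeadingSplit L₁ g₀ ε B L lam g ℓ) (hε : 0 < ε)
    (hρ : 0 < 1 - 2 * ε) : leadingEigenvalue L = lam :=
  (h.isLeadingPair hε hρ).leadingEigenvalue_eq

lemma sphere_subset (h : LeadingSplit L₁ g₀ ε B L lam g ℓ) (hε : 0 < ε) (hρ : 0 < 1 - 2 * ε) :
    Metric.sphere (1 : ℂ) ε ⊆ resolventSet ℂ L := by
  intro z hz
  rw [mem_sphere_iff_norm] at hz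
  refine h.split.mem_resolventSet hρ ?_ ?_
  · have h4 := norm_sub_norm_le (1 : ℂ) z
    rw [norm_one, norm_sub_rev] at h4
    linarith
  · rintro rfl
    rw [← Complex.ofReal_one, ← Complex.ofReal_sub, Complex.norm_real] at hz
    exact h.abs_sub_lt.ne hz

lemma isComponent (h : LeadingSplit L₁ g₀ ε B L lam g ℓ) (hε : 0 < ε) (hρ : 0 < 1 - 2 * ε)
    {A : Ω.PLip →L[ℂ] Ω.PLip} {β : ℝ} (hβ : ℓ (A g) = β) (hg' : IsLeadingPair L lam g') :
    IsComponent (spectralProjector ε L) g' (A g') β :=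
  isComponent_of_split h.split hε.le hρ (by linarith) h.abs_sub_lt hβ hg'.2.2.1

lemma dual_apply_sub_one (h : LeadingSplit L₁ g₀ ε B L lam g ℓ)
    (h' : LeadingSplit L₁ g₀ ε B L' lam' g' ℓ') : ‖ℓ g' - 1‖ ≤ 1 / 2 := by
  have e : ℓ g' - 1 = (ℓ - Ω.integralCLM) g' := by rw [sub_apply, h'.integral_eq]
  rw [e]
  refine le_trans ?_ h.norm_dual_sub_le
  exact (ContinuousLinearMap.le_opNorm _ _).trans
    (mul_le_mul_of_nonneg_left h'.norm_le (norm_nonneg _))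

lemma half_le_dual_apply (h : LeadingSplit L₁ g₀ ε B L lam g ℓ)
    (h' : LeadingSplit L₁ g₀ ε B L' lam' g' ℓ') : 1 / 2 ≤ ‖ℓ g'‖ := by
  have h1 := h.dual_apply_sub_one h'
  have h2 := norm_sub_norm_le (1 : ℂ) (ℓ g')
  rw [norm_one, norm_sub_rev] at h2
  linarith

/-- An exact formula: the eigenvalue equation of L' is paired with the left eigenvector of L. By
`half_le_dual_apply` one may divide by ℓ g'. -/
lemma sub_mul_dual_apply (h : LeadingSplit L₁ g₀ ε B L lam g ℓ)
    (h' : LeadingSplit L₁ g₀ ε B L' lam' g' ℓ') :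
    ((lam' - lam : ℝ) : ℂ) * ℓ g' = ℓ ((L' - L) g') := by
  rw [sub_apply, map_sub, h'.split.apply_eq, h.split.dual_eq, map_smul, smul_eq_mul]
  push_cast; ring

lemma abs_sub_le (h : LeadingSplit L₁ g₀ ε B L lam g ℓ)
    (h' : LeadingSplit L₁ g₀ ε B L' lam' g' ℓ') : |lam' - lam| ≤ 2 * B ^ 2 * ‖L' - L‖ := by
  have hB : 0 ≤ B := (norm_nonneg _).trans h.norm_le
  have h1 := congr_arg norm (h.sub_mul_dual_apply h')
  rw [norm_mul, Complex.norm_real, Real.norm_eq_abs] at h1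
  have h2 : ‖ℓ ((L' - L) g')‖ ≤ B * (‖L' - L‖ * B) := by
    refine (ℓ.le_opNorm _).trans (mul_le_mul h.norm_dual_le ?_ (norm_nonneg _) hB)
    exact (ContinuousLinearMap.le_opNorm _ _).trans
      (mul_le_mul_of_nonneg_left h'.norm_le (norm_nonneg _))
  have h3 := mul_le_mul_of_nonneg_left (h.half_le_dual_apply h') (abs_nonneg (lam' - lam))
  nlinarith

/-- First order expansion of the leading eigenvalue with a quadratic error. -/
lemma abs_sub_add_le (h : LeadingSplit L₁ g₀ ε B L lam g ℓ)
    (h' : LeadingSplit L₁ g₀ ε B L' lam' g' ℓ') {β : ℝ} (hβ : ℓ ((L - L') g) = β) :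
    |lam' - (lam - β)| ≤ 2 * B * (1 + B ^ 2) * ‖L - L'‖ * ‖g' - g‖ := by
  have hB : 0 ≤ B := (norm_nonneg _).trans h.norm_le
  set Δ := L - L' with hΔ
  have h1 : ((lam' - lam : ℝ) : ℂ) * ℓ g' = -ℓ (Δ g') := by
    rw [h.sub_mul_dual_apply h', ← neg_sub L L', neg_apply, map_neg]
  -- In the exact formula g' is replaced by g; every error term has a factor L - L' and a factor g'
  -- - g.
  have h2 : ((lam' - (lam - β) : ℝ) : ℂ) * ℓ g' = -ℓ (Δ (g' - g)) + β * ℓ (g' - g) := by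
    rw [map_sub Δ, map_sub, map_sub, hβ, h.split.pairing]
    push_cast at h1 ⊢
    linear_combination h1
  have h3 := congr_arg norm h2
  rw [norm_mul, Complex.norm_real, Real.norm_eq_abs] at h3
  have h4 : ∀ u, ‖ℓ (Δ u)‖ ≤ B * (‖Δ‖ * ‖u‖) := fun u =>
    (ℓ.le_opNorm _).trans (mul_le_mul h.norm_dual_le (Δ.le_opNorm _) (norm_nonneg _) hB)
  have h5 : ‖ℓ (g' - g)‖ ≤ B * ‖g' - g‖ :=
    (ℓ.le_opNorm _).trans (mul_le_mul_of_nonneg_right h.norm_dual_le (norm_nonneg _))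
  have h6 : ‖(β : ℂ)‖ ≤ B * (‖Δ‖ * B) := by
    rw [← hβ]
    refine (h4 g).trans ?_
    have := h.norm_le
    gcongr
  have h7 : |lam' - (lam - β)| * ‖ℓ g'‖ ≤
      B * (‖Δ‖ * ‖g' - g‖) + B * (‖Δ‖ * B) * (B * ‖g' - g‖) := by
    rw [h3]
    refine (norm_add_le _ _).trans (add_le_add (by rw [norm_neg]; exact h4 _) ?_)
    rw [norm_mul]
    exact mul_le_mul h6 h5 (norm_nonneg _) (by positivity)
  have h8 := mul_le_mul_of_nonneg_left (h.half_le_dual_apply h') (abs_nonneg (lam' - (lam - β)))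
  linarith

/-- Both eigenvectors are compared with g₀, since the perturbation theorem is centred at L₁. This is
the origin of the two terms in the final error bound. -/
lemma norm_eigenvector_sub_le (h : LeadingSplit L₁ g₀ ε B L lam g ℓ)
    (h' : LeadingSplit L₁ g₀ ε B L' lam' g' ℓ') :
    ‖g' - g‖ ≤ B * (2 * ‖L - L₁‖ + ‖L - L'‖) := by
  have hB : 0 ≤ B := (norm_nonneg _).trans h.norm_le
  have h1 : ‖L' - L₁‖ ≤ ‖L - L₁‖ + ‖L - L'‖ := by
    have := _root_.norm_sub_le (L - L₁) (L - L')
    rwa [sub_sub_sub_cancel_left] at this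
  have h2 := _root_.norm_sub_le (g' - g₀) (g - g₀)
  rw [sub_sub_sub_cancel_right] at h2
  have h3 := mul_le_mul_of_nonneg_left h1 hB
  linarith [h.norm_sub_le, h'.norm_sub_le]

/-- Integrating the eigenvalue equation gives 1 = lam + ∫ Δ g, and Δ is positive. -/
lemma le_one (hint : ∀ f, Ω.integralCLM (L₁ f) = Ω.integralCLM f)
    (h : LeadingSplit L₁ g₀ ε B L lam g ℓ) {𝒱 : 𝒜 → Set (List 𝒜)} {w : ℝ → ℝ}
    {Δ : Ω.PLip →L[ℂ] Ω.PLip} (hΔ : IsWeightedOp 𝒱 w Δ) (hw : ∀ x > 0, 0 ≤ w x)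
    (hL : L₁ = L + Δ) : lam ≤ 1 := by
  have h1 := hint g
  rw [hL, add_apply, map_add, h.split.apply_eq, map_smul, h.integral_eq, smul_eq_mul, mul_one] at h1
  have h2 := congr_arg Complex.re h1
  rw [Complex.add_re, Complex.ofReal_re, Complex.one_re] at h2
  have h3 := re_integralCLM_nonneg fun ξ => hΔ.re_nonneg hw (fun ξ => (h.pos ξ).1.le) ξ
  linarith

/-- Second order expansion of the leading eigenvalue along a differentiable family. -/
lemma abs_sub_le_sq (hint : ∀ f, Ω.integralCLM (L₁ f) = Ω.integralCLM f)
    (h : LeadingSplit L₁ g₀ ε B L lam g ℓ) {A : Ω.PLip →L[ℂ] Ω.PLip} {t δ K K' : ℝ}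
    (hδ : Ω.integralCLM (A g₀) = δ) (hK : ‖L - L₁‖ ≤ K * |t|)
    (hK' : ‖L - L₁ - (t : ℂ) • A‖ ≤ K' * t ^ 2) :
    |lam - (1 + δ * t)| ≤ ‖Ω.integralCLM‖ * B * (‖A‖ * K + K') * |t| ^ 2 := by
  have hB : 0 ≤ B := (norm_nonneg _).trans h.norm_le
  set m := Ω.integralCLM
  set R := L - L₁ - (t : ℂ) • A with hR
  -- The integral is the left eigenvector of L₁ and g has integral 1, so lam - 1 is the integral of
  -- (L - L₁) g without a denominator.
  have h1 : ((lam - (1 + δ * t) : ℝ) : ℂ) = t * m (A (g - g₀)) + m (R g) := by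
    have h2 : m (R g) = lam - 1 - t * m (A g) := by
      rw [hR, sub_apply, sub_apply, smul_apply, map_sub, map_sub, map_smul, h.split.apply_eq, hint,
        map_smul, h.integral_eq, smul_eq_mul, smul_eq_mul, mul_one]
    rw [h2, map_sub, map_sub, hδ]
    push_cast; ring
  have h2 := congr_arg norm h1
  rw [Complex.norm_real, Real.norm_eq_abs] at h2
  rw [h2]
  have h3 : ‖m (A (g - g₀))‖ ≤ ‖m‖ * (‖A‖ * (B * (K * |t|))) :=
    (m.le_opNorm _).trans (mul_le_mul_of_nonneg_left ((A.le_opNorm _).trans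
      (mul_le_mul_of_nonneg_left (h.norm_sub_le.trans (mul_le_mul_of_nonneg_left hK hB))
        (norm_nonneg _))) (norm_nonneg _))
  have h4 : ‖m (R g)‖ ≤ ‖m‖ * (K' * t ^ 2 * B) :=
    (m.le_opNorm _).trans (mul_le_mul_of_nonneg_left ((R.le_opNorm _).trans
      (mul_le_mul hK' h.norm_le (norm_nonneg _) ((norm_nonneg _).trans hK'))) (norm_nonneg _))
  refine (norm_add_le _ _).trans ((add_le_add ?_ h4).trans_eq
    (b := |t| * (‖m‖ * (‖A‖ * (B * (K * |t|)))) + ‖m‖ * (K' * t ^ 2 * B)) ?_)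
  · rw [norm_mul, Complex.norm_real, Real.norm_eq_abs]
    exact mul_le_mul_of_nonneg_left h3 (abs_nonneg _)
  · rw [← sq_abs t]; ring

end LeadingSplit

/-- The derivative of the leading eigenvalue is negative. -/
lemma exists_integral_derivative_neg (hL₁ : IsWeightedOp Ω.words (fun x => x ^ (1 : ℝ)) L₁)
    {A : Ω.PLip →L[ℂ] Ω.PLip} (hA : IsWeightedOp Ω.words (fun x => Real.log x * x) A) {g : Ω.PLip}
    (hg : L₁ g = g) (hpos : ∀ ξ, 0 < (g ξ).re ∧ (g ξ).im = 0) (hm : Ω.integralCLM g = 1) :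
    ∃ δ < (0 : ℝ), Ω.integralCLM (A g) = δ := by
  obtain ⟨D, θ, -, hθ0, hθ1, hdist⟩ := Ω.exists_distortion
  refine ⟨(Ω.integralCLM (A g)).re, ?_, Complex.ext rfl ?_⟩
  -- Each logarithm is at most log θ < 0, so A g ≤ log θ · L₁ g = log θ · g.
  · have h1 : ∀ ξ, (A g ξ).re ≤ Real.log θ * (g ξ).re := by
      intro ξ
      have h1 := hA.hasSum_re g (Ω.mem_arc_letter ξ)
      have h2 := (hL₁.hasSum_re g (Ω.mem_arc_letter ξ)).mul_left (Real.log θ)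
      rw [hg] at h2
      refine hasSum_le (fun W => ?_) h1 h2
      have hd := derivNorm_pos (Ω.word (W : List 𝒜)) ξ
      rw [Real.rpow_one, mul_assoc]
      refine mul_le_mul_of_nonneg_right ?_ (mul_nonneg hd.le (hpos _).1.le)
      exact Real.log_le_log hd (hdist _ _ W.2 ξ (Ω.mem_arc_letter ξ)).1
    have h2 := re_integralCLM_nonneg (f := (Real.log θ : ℂ) • g - A g) fun ξ => by
      rw [coe_sub, coe_smul, Complex.sub_re, Complex.re_ofReal_mul]; linarith [h1 ξ]
    rw [map_sub, map_smul, hm, smul_eq_mul, mul_one, Complex.sub_re, Complex.ofReal_re] at h2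
    linarith [Real.log_neg hθ0 hθ1]
  · rw [Complex.ofReal_im]
    exact Ω.im_integralCLM _ (hA.im_eq_zero fun ξ => (hpos ξ).2)

end LabelledIdealPolygon

end BowenSeries

/-! ### The exponent s_T and the conclusion. -/

namespace BowenSeries

open Complex MeasureTheory Set

namespace LabelledIdealPolygon

variable {Γ₀ : Subgroup SL(2, ℝ)} {𝒜 : Type*} {Ω : LabelledIdealPolygon Γ₀ 𝒜} [Finite 𝒜]
variable {Γ : Subgroup SL(2, ℝ)} {p : ℕ} {A : Fin p → SL(2, ℝ)}

omit [Finite 𝒜] in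
lemma singleton_mem_wordsLE {T : EReal} (hT : 0 ≤ T) {a b : 𝒜} (h : [b] ∈ Ω.words a) :
    [b] ∈ Ω.wordsLE Γ A T a :=
  ⟨h, by simpa [length] using hT⟩

lemma eq_of_leadingEigenvalue_eq_one (hle : Γ₀ ≤ Γ) (hΓ : DiscreteTopology Γ)
    (hA : IsCuspRepresentatives Γ A) {T s s' : ℝ} (hT : 0 ≤ T) (hs : 0 ≤ s) (hs' : 0 ≤ s')
    (h : leadingEigenvalue (Ω.transferOp Γ A s T) = 1)
    (h' : leadingEigenvalue (Ω.transferOp Γ A s' T) = 1) : s = s' := by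
  have key : ∀ r, 0 ≤ r → leadingEigenvalue (Ω.transferOp Γ A r T) = 1 →
      ∃ g : Ω.PLip, (∀ ξ, 0 < (g ξ).re) ∧ Ω.transferOp Γ A r T g = g := by
    intro r _ h
    obtain ⟨g, hg⟩ := exists_isLeadingPair (h.trans_ne one_ne_zero)
    refine ⟨g, fun ξ => (hg.2.1 ξ).1, ?_⟩
    rw [hg.2.2.1, h, Complex.ofReal_one, one_smul]
  obtain ⟨g, hg, hLg⟩ := key s hs h
  obtain ⟨g', hg', hLg'⟩ := key s' hs' h'
  have hL := Ω.isWeightedOp_transferOp hle hΓ hA (s := s) (T := T) (Or.inr ⟨hs, EReal.coe_lt_top T⟩)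
  have hL' := Ω.isWeightedOp_transferOp hle hΓ hA (s := s') (T := T)
    (Or.inr ⟨hs', EReal.coe_lt_top T⟩)
  have hT' : (0 : EReal) ≤ T := by exact_mod_cast hT
  rcases lt_trichotomy s s' with hlt | heq | hlt
  · exact absurd hlt (not_lt_of_fixed (wordsLE_subset _) (fun a b => singleton_mem_wordsLE hT') hL hL'
      hg hg' hLg hLg')
  · exact heq
  · exact absurd hlt (not_lt_of_fixed (wordsLE_subset _) (fun a b => singleton_mem_wordsLE hT') hL' hL
      hg' hg hLg' hLg)

lemma exists_spectral_gap {L : Ω.PLip →L[ℂ] Ω.PLip}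
    (hL : IsWeightedOp Ω.words (fun x => x ^ (1 : ℝ)) L) :
    ∃ ε : ℝ, 0 < ε ∧ spectrum ℂ L ⊆ {1} ∪ Metric.ball 0 (1 - 2 * ε) := by
  obtain ⟨C, τ, -, -, hτ0, hτ1, -, hgap, -⟩ := exists_gap_of_isWeightedOp hL
  obtain ⟨g, hg, hm, -⟩ := exists_invariant_density hL
  -- Then 1 - 2ε = (1 + τ)/2 exceeds τ.
  refine ⟨(1 - τ) / 4, by linarith,
    (spectrum_subset_of_gap hg (Ω.integral_eq_of_isWeightedOp hL) hm hτ0 hgap).trans ?_⟩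
  exact union_subset_union_right _ (Metric.closedBall_subset_ball (by linarith))

/-- The perturbation theorem for the truncated transfer operators. -/
lemma leading_eigenvalue_expansion (hle : Γ₀ ≤ Γ) (hΓ : DiscreteTopology Γ)
    (hA : IsCuspRepresentatives Γ A) {ε : ℝ} (hε : 0 < ε)
    (hspec : spectrum ℂ (Ω.transferOp Γ A 1 ⊤) ⊆ {1} ∪ Metric.ball 0 (1 - 2 * ε)) :
    ∃ η > (0 : ℝ), ∃ T₀ > (0 : ℝ), ∃ C : ℝ,
      (∀ (s : ℝ) (T : EReal), |s - 1| ≤ η → (T₀ : EReal) ≤ T →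
        (∃ g, IsLeadingPair (Ω.transferOp Γ A s T)
          (leadingEigenvalue (Ω.transferOp Γ A s T)) g) ∧
        |leadingEigenvalue (Ω.transferOp Γ A s T) - 1| < ε ∧
        Metric.sphere (1 : ℂ) ε ⊆ resolventSet ℂ (Ω.transferOp Γ A s T)) ∧
      (∃ δ < (0 : ℝ),
        (∀ g, IsLeadingPair (Ω.transferOp Γ A 1 ⊤) 1 g →
          IsComponent (spectralProjector ε (Ω.transferOp Γ A 1 ⊤)) g (Ω.derivativeOp g) δ) ∧
        ∀ s : ℝ, |s - 1| ≤ η →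
          |leadingEigenvalue (Ω.transferOp Γ A s ⊤) - (1 + δ * (s - 1))| ≤ C * |s - 1| ^ 2) ∧
      ∀ T : ℝ, T₀ ≤ T → ∃ sT ∈ Set.Icc (0 : ℝ) 1,
        leadingEigenvalue (Ω.transferOp Γ A sT T) = 1 ∧
        (∀ s ∈ Set.Icc (0 : ℝ) 1, leadingEigenvalue (Ω.transferOp Γ A s T) = 1 → s = sT) ∧
        9 / 10 < sT ∧ |sT - 1| ≤ η ∧
        ∃ β : ℝ,
          (∀ g, IsLeadingPair (Ω.transferOp Γ A sT ⊤)
              (leadingEigenvalue (Ω.transferOp Γ A sT ⊤)) g →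
            IsComponent (spectralProjector ε (Ω.transferOp Γ A sT ⊤)) g
              (Ω.deltaOp Γ A sT T g) β) ∧
          |leadingEigenvalue (Ω.transferOp Γ A sT T) -
              (leadingEigenvalue (Ω.transferOp Γ A sT ⊤) - β)| ≤
            C * T ^ (-(2 * sT - 1)) * (|sT - 1| + T ^ (-(2 * sT - 1))) := by
  have hop : ∀ s : ℝ, |s - 1| ≤ 1 / 20 → ∀ T : EReal,
      IsWeightedOp (Ω.wordsLE Γ A T) (fun x => x ^ s) (Ω.transferOp Γ A s T) := fun s hs T =>
    Ω.isWeightedOp_transferOp hle hΓ hA (Or.inl (by linarith [(abs_le.1 hs).1]))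
  have hL₁ : IsWeightedOp Ω.words (fun x => x ^ (1 : ℝ)) (Ω.transferOp Γ A 1 ⊤) := by
    have := hop 1 (by norm_num) ⊤
    rwa [wordsLE_top] at this
  have hint := Ω.integral_eq_of_isWeightedOp hL₁
  obtain ⟨hρ, g₀, B, d, hB1, hd, hbase, hnear⟩ := exists_leadingSplit hL₁ hε hspec
  obtain ⟨K₁, hK₁, h₁⟩ := Ω.exists_norm_transferOp_sub_le hle hΓ hA
  obtain ⟨K₂, hK₂, h₂⟩ := Ω.exists_norm_transferOp_expansion hle hΓ hA
  obtain ⟨K₃, hK₃, h₃⟩ := Ω.exists_norm_deltaOp_le hle hΓ hA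
  obtain ⟨δ, hδ, hδ'⟩ := exists_integral_derivative_neg hL₁ Ω.isWeightedOp_derivativeOp
    (hbase.split.apply_eq.trans (by rw [Complex.ofReal_one, one_smul])) hbase.pos hbase.integral_eq
  set C₁ := ‖Ω.integralCLM‖ * B * (‖Ω.derivativeOp‖ * K₁ + K₂) with hC₁
  have hC₁0 : 0 ≤ C₁ := by positivity
  set C₂ := 2 * B * (1 + B ^ 2) * K₃ * (B * (2 * K₁ + K₃)) with hC₂
  have hC₂0 : 0 ≤ C₂ := by positivity
  -- 1/20 keeps s in the range of the estimates and s_T above 9/10, d/(2 K₁) leaves half of d to the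
  -- truncation, and the last entry makes the quadratic error at s = 1 - η at most half of the
  -- linear term.
  set η := min (1 / 20) (min (d / (2 * K₁)) (-δ / (2 * (C₁ + 1)))) with hη
  have hη0 : 0 < η := by
    have : 0 < -δ := by linarith
    positivity
  have hη1 : η ≤ 1 / 20 := min_le_left _ _
  have hη2 : K₁ * η ≤ d / 2 := by
    have h : η ≤ d / (2 * K₁) := (min_le_right _ _).trans (min_le_left _ _)
    rw [le_div_iff₀ (by positivity)] at h
    linarith
  have hη3 : C₁ * η ≤ -δ / 2 := by
    have h : η ≤ -δ / (2 * (C₁ + 1)) := (min_le_right _ _).trans (min_le_right _ _)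
    rw [le_div_iff₀ (by positivity)] at h
    nlinarith
  have hIcc : ∀ s : ℝ, |s - 1| ≤ η → s ∈ Icc (7 / 8 : ℝ) (9 / 8) := fun s hs => by
    have := abs_le.1 (hs.trans hη1)
    constructor <;> linarith [this.1, this.2]
  -- the truncation error
  obtain ⟨T₀, hT₀1, hT₀⟩ : ∃ T₀ : ℝ, 1 ≤ T₀ ∧ ∀ s : ℝ, |s - 1| ≤ η → ∀ T : ℝ, T₀ ≤ T →
      ‖Ω.deltaOp Γ A s T‖ ≤ min (d / 2) (-δ * η / (4 * B ^ 2)) := by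
    have hpos : 0 < min (d / 2) (-δ * η / (4 * B ^ 2)) / K₃ := by
      have : 0 < -δ := by linarith
      positivity
    -- For |s - 1| ≤ η the exponent 2s - 1 is above 1/2, so T^(-1/2) bounds all truncation errors at
    -- once.
    have h4 := (tendsto_rpow_neg_atTop (by norm_num : (0 : ℝ) < 1 / 2)).eventually
      (gt_mem_nhds hpos)
    obtain ⟨T₁, hT₁⟩ := Filter.eventually_atTop.1 h4
    refine ⟨max 1 T₁, le_max_left _ _, fun s hs T hT => ?_⟩
    have h5 : 1 ≤ T := (le_max_left _ _).trans hT
    have h6 := hT₁ T ((le_max_right _ _).trans hT)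
    rw [lt_div_iff₀ hK₃] at h6
    refine (h₃ s (hIcc s hs) T h5).trans (le_trans ?_ h6.le)
    rw [mul_comm]
    refine mul_le_mul_of_nonneg_right (Real.rpow_le_rpow_of_exponent_le h5 ?_) hK₃.le
    linarith [(hIcc s hs).1]
  have h1top : ∀ s : ℝ, |s - 1| ≤ η →
      ‖Ω.transferOp Γ A s ⊤ - Ω.transferOp Γ A 1 ⊤‖ ≤ K₁ * |s - 1| := fun s hs =>
    h₁ s (hIcc s hs) 1 (by norm_num) ⊤
  have hdelta : ∀ s : ℝ, |s - 1| ≤ η → ∀ T : EReal,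
      Ω.transferOp Γ A s ⊤ = Ω.transferOp Γ A s T + Ω.deltaOp Γ A s T := fun s hs T =>
    Ω.transferOp_top_eq hle hΓ hA (by linarith [(hIcc s hs).1]) T
  have hdist : ∀ (s : ℝ) (T : EReal), |s - 1| ≤ η → (T₀ : EReal) ≤ T →
      ‖Ω.transferOp Γ A s T - Ω.transferOp Γ A 1 ⊤‖ ≤ d := by
    intro s T hs hT
    have h4 := (h1top s hs).trans (mul_le_mul_of_nonneg_left hs hK₁.le)
    induction T with
    | bot => exact absurd hT (not_le.2 (EReal.bot_lt_coe T₀))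
    | top => linarith
    | coe T =>
      have h5 := (hT₀ s hs T (EReal.coe_le_coe_iff.1 hT)).trans (min_le_left _ _)
      have h6 : Ω.transferOp Γ A s T - Ω.transferOp Γ A 1 ⊤ =
          (Ω.transferOp Γ A s ⊤ - Ω.transferOp Γ A 1 ⊤) - Ω.deltaOp Γ A s T := by
        rw [hdelta s hs T]; abel
      rw [h6]
      refine (norm_sub_le _ _).trans ?_
      linarith
  have hsplit : ∀ (s : ℝ) (T : EReal), |s - 1| ≤ η → (T₀ : EReal) ≤ T → ∃ g ℓ,
      LeadingSplit (Ω.transferOp Γ A 1 ⊤) g₀ ε B (Ω.transferOp Γ A s T)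
        (leadingEigenvalue (Ω.transferOp Γ A s T)) g ℓ := by
    intro s T hs hT
    obtain ⟨lam, g, ℓ, h⟩ := hnear _ _ _ (hop s (hs.trans hη1) T) (hdist s T hs hT)
    exact ⟨g, ℓ, (h.leadingEigenvalue_eq hε hρ).symm ▸ h⟩
  have hexp : ∀ s : ℝ, |s - 1| ≤ η →
      |leadingEigenvalue (Ω.transferOp Γ A s ⊤) - (1 + δ * (s - 1))| ≤ C₁ * |s - 1| ^ 2 := by
    intro s hs
    obtain ⟨g, ℓ, h⟩ := hsplit s ⊤ hs le_top
    exact h.abs_sub_le_sq hint hδ' (h1top s hs) (h₂ s (hs.trans (by linarith)))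
  refine ⟨η, hη0, T₀, by linarith, C₁ + C₂, fun s T hs hT => ?_, ⟨δ, hδ, fun g hg => ?_,
    fun s hs => ?_⟩, fun T hT => ?_⟩
  · obtain ⟨g, ℓ, h⟩ := hsplit s T hs hT
    exact ⟨⟨g, h.isLeadingPair hε hρ⟩, h.abs_sub_lt, h.sphere_subset hε hρ⟩
  · exact hbase.isComponent hε hρ hδ' hg
  · exact (hexp s hs).trans (mul_le_mul_of_nonneg_right (by linarith) (by positivity))
  have hT1 : 1 ≤ T := hT₀1.trans hT
  have hT' : (T₀ : EReal) ≤ T := EReal.coe_le_coe_iff.2 hT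
  -- At s = 1 the truncation only removes a positive operator from one that preserves the integral.
  have hle1 : leadingEigenvalue (Ω.transferOp Γ A 1 T) ≤ 1 := by
    obtain ⟨g, ℓ, h⟩ := hsplit 1 T (by simpa using hη0.le) hT'
    exact h.le_one hint (Ω.isWeightedOp_deltaOp (T := T) (by norm_num)) (fun x hx => by positivity)
      (hdelta 1 (by simpa using hη0.le) T)
  have hη' : |1 - η - 1| ≤ η := by rw [sub_sub_cancel_left, abs_neg, abs_of_pos hη0]
  -- As δ < 0, λ(1-η, ∞) exceeds 1 by at least -δη/2, and by the choice of T₀ the truncation costs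
  -- at most -δη/2.
  have hge1 : 1 ≤ leadingEigenvalue (Ω.transferOp Γ A (1 - η) T) := by
    obtain ⟨g, ℓ, h⟩ := hsplit (1 - η) ⊤ hη' le_top
    obtain ⟨g', ℓ', h'⟩ := hsplit (1 - η) T hη' hT'
    have h4 := h.abs_sub_le h'
    rw [hdelta (1 - η) hη' T, sub_add_cancel_left, norm_neg, ← hdelta (1 - η) hη' T] at h4
    have h5 := (hT₀ (1 - η) hη' T hT).trans (min_le_right _ _)
    rw [le_div_iff₀ (by positivity)] at h5
    have h6 := (abs_le.1 h4).1
    have h7 := (abs_le.1 (hexp (1 - η) hη')).1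
    rw [sub_sub_cancel_left, abs_neg, abs_of_pos hη0] at h7
    nlinarith
  have hcont : ContinuousOn (fun s => leadingEigenvalue (Ω.transferOp Γ A s T)) (Icc (1 - η) 1) := by
    refine (LipschitzOnWith.of_dist_le_mul (K := ⟨2 * B ^ 2 * K₁, by positivity⟩)
      fun s hs s' hs' => ?_).continuousOn
    have habs : ∀ r ∈ Icc (1 - η) 1, |r - 1| ≤ η := fun r hr => by
      rw [abs_le]; constructor <;> linarith [hr.1, hr.2]
    obtain ⟨g, ℓ, h⟩ := hsplit s T (habs s hs) hT'
    obtain ⟨g', ℓ', h'⟩ := hsplit s' T (habs s' hs') hT'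
    rw [Real.dist_eq, Real.dist_eq]
    refine (h'.abs_sub_le h).trans ?_
    change _ ≤ 2 * B ^ 2 * K₁ * |s - s'|
    rw [mul_assoc _ K₁]
    exact mul_le_mul_of_nonneg_left (h₁ s (hIcc s (habs s hs)) s' (hIcc s' (habs s' hs')) T)
      (by positivity)
  obtain ⟨sT, hsT, hsT1⟩ := intermediate_value_Icc' (by linarith : 1 - η ≤ 1) hcont ⟨hle1, hge1⟩
  change leadingEigenvalue (Ω.transferOp Γ A sT T) = 1 at hsT1
  have hsη : |sT - 1| ≤ η := by rw [abs_le]; constructor <;> linarith [hsT.1, hsT.2]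
  refine ⟨sT, ⟨by linarith [hsT.1], hsT.2⟩, hsT1, fun s hs h => ?_, by linarith [hsT.1], hsη, ?_⟩
  -- Uniqueness on all of [0, 1], beyond the perturbative range, is the comparison of positive
  -- eigenfunctions.
  · exact eq_of_leadingEigenvalue_eq_one hle hΓ hA (by linarith) hs.1 (by linarith [hsT.1]) h hsT1
  obtain ⟨g, ℓ, h⟩ := hsplit sT ⊤ hsη le_top
  obtain ⟨g', ℓ', h'⟩ := hsplit sT T hsη hT'
  have hΔ : Ω.transferOp Γ A sT ⊤ - Ω.transferOp Γ A sT T = Ω.deltaOp Γ A sT T := by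
    rw [hdelta sT hsη T, add_sub_cancel_left]
  have him : (ℓ (Ω.deltaOp Γ A sT T g)).im = 0 := by
    refine h.dual_im _ (IsWeightedOp.im_eq_zero (Ω.isWeightedOp_deltaOp (T := T) ?_)
      fun ξ => (h.pos ξ).2)
    linarith [(hIcc sT hsη).1]
  have hβ : ℓ (Ω.deltaOp Γ A sT T g) = ((ℓ (Ω.deltaOp Γ A sT T g)).re : ℂ) :=
    Complex.ext rfl (by rw [him, Complex.ofReal_im])
  refine ⟨(ℓ (Ω.deltaOp Γ A sT T g)).re, fun g₁ hg₁ => h.isComponent hε hρ hβ hg₁, ?_⟩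
  refine (h.abs_sub_add_le h' (by rw [hΔ]; exact hβ)).trans ?_
  have e1 := h.norm_eigenvector_sub_le h'
  rw [hΔ] at e1 ⊢
  have e2 := h₃ sT (hIcc sT hsη) T hT1
  have e3 := h1top sT hsη
  set x := T ^ (-(2 * sT - 1)) with hx
  have hx0 : 0 ≤ x := by positivity
  have e4 : ‖g' - g‖ ≤ B * (2 * K₁ + K₃) * (|sT - 1| + x) := by
    refine e1.trans ?_
    rw [mul_assoc]
    refine mul_le_mul_of_nonneg_left ?_ (by linarith)
    nlinarith [abs_nonneg (sT - 1), mul_nonneg hK₁.le hx0, mul_nonneg hK₃.le (abs_nonneg (sT - 1))]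
  calc _ ≤ 2 * B * (1 + B ^ 2) * (K₃ * x) * (B * (2 * K₁ + K₃) * (|sT - 1| + x)) := by
        gcongr
    _ = C₂ * x * (|sT - 1| + x) := by rw [hC₂]; ring
    _ ≤ (C₁ + C₂) * x * (|sT - 1| + x) := by
        gcongr
        linarith

end LabelledIdealPolygon

end BowenSeries

end

theorem mainTheorem7 (Γ Γ₀ : Subgroup SL(2, ℝ)) (hΓ : IsNonuniformLattice Γ) (hle : Γ₀ ≤ Γ)
    (hfin : Γ₀.relIndex Γ ≠ 0) (hfree : IsFreeGroup Γ₀) {𝒜 : Type*} [Finite 𝒜]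
    (Ω : LabelledIdealPolygon Γ₀ 𝒜) {p : ℕ} (A : Fin p → SL(2, ℝ))
    (hA : IsCuspRepresentatives Γ A) :
    (∀ (s : ℝ) (T : EReal), 0 < T → (1 / 2 < s ∨ 0 ≤ s ∧ T < ⊤) →
      IsWeightedOp (Ω.wordsLE Γ A T) (fun x => x ^ s) (Ω.transferOp Γ A s T)) ∧
    (∀ s T : ℝ, 0 < T → 1 / 2 < s →
      IsWeightedOp (Ω.wordsGT Γ A T) (fun x => x ^ s) (Ω.deltaOp Γ A s T)) ∧
    IsWeightedOp Ω.words (fun x => Real.log x * x) Ω.derivativeOp ∧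
    leadingEigenvalue (Ω.transferOp Γ A 1 ⊤) = 1 ∧
    (∃ ε₀ : ℝ, 0 < ε₀ ∧
      spectrum ℂ (Ω.transferOp Γ A 1 ⊤) ⊆ {1} ∪ Metric.ball 0 (1 - 2 * ε₀)) ∧
    ∀ ε₀ : ℝ, 0 < ε₀ →
      spectrum ℂ (Ω.transferOp Γ A 1 ⊤) ⊆ {1} ∪ Metric.ball 0 (1 - 2 * ε₀) →
      ∃ η > (0 : ℝ), ∃ T₀ > (0 : ℝ), ∃ C : ℝ,
        (∀ (s : ℝ) (T : EReal), |s - 1| ≤ η → (T₀ : EReal) ≤ T →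
          (∃ g, IsLeadingPair (Ω.transferOp Γ A s T)
            (leadingEigenvalue (Ω.transferOp Γ A s T)) g) ∧
          |leadingEigenvalue (Ω.transferOp Γ A s T) - 1| < ε₀ ∧
          Metric.sphere (1 : ℂ) ε₀ ⊆ resolventSet ℂ (Ω.transferOp Γ A s T)) ∧
        (∃ δ < (0 : ℝ),
          (∀ g, IsLeadingPair (Ω.transferOp Γ A 1 ⊤) 1 g →
            IsComponent (spectralProjector ε₀ (Ω.transferOp Γ A 1 ⊤)) g (Ω.derivativeOp g) δ) ∧
          ∀ s : ℝ, |s - 1| ≤ η →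
            |leadingEigenvalue (Ω.transferOp Γ A s ⊤) - (1 + δ * (s - 1))| ≤ C * |s - 1| ^ 2) ∧
        ∀ T : ℝ, T₀ ≤ T → ∃ sT ∈ Set.Icc (0 : ℝ) 1,
          leadingEigenvalue (Ω.transferOp Γ A sT T) = 1 ∧
          (∀ s ∈ Set.Icc (0 : ℝ) 1, leadingEigenvalue (Ω.transferOp Γ A s T) = 1 → s = sT) ∧
          9 / 10 < sT ∧ |sT - 1| ≤ η ∧
          ∃ β : ℝ,
            (∀ g, IsLeadingPair (Ω.transferOp Γ A sT ⊤)
                (leadingEigenvalue (Ω.transferOp Γ A sT ⊤)) g →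
              IsComponent (spectralProjector ε₀ (Ω.transferOp Γ A sT ⊤)) g
                (Ω.deltaOp Γ A sT T g) β) ∧
            |leadingEigenvalue (Ω.transferOp Γ A sT T) -
                (leadingEigenvalue (Ω.transferOp Γ A sT ⊤) - β)| ≤
              C * T ^ (-(2 * sT - 1)) * (|sT - 1| + T ^ (-(2 * sT - 1))) := by
  have hop := @isWeightedOp_transferOp Γ₀ 𝒜 Ω _ Γ p A hle hΓ.1 hA
  have hL₁ : IsWeightedOp Ω.words (fun x => x ^ (1 : ℝ)) (Ω.transferOp Γ A 1 ⊤) := by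
    have := hop (s := 1) (T := ⊤) (Or.inl (by norm_num))
    rwa [wordsLE_top] at this
  refine ⟨fun s T _ h => hop h, fun s T _ h => Ω.isWeightedOp_deltaOp h,
    Ω.isWeightedOp_derivativeOp, ?_, exists_spectral_gap hL₁,
    fun ε hε hspec => leading_eigenvalue_expansion hle hΓ.1 hA hε hspec⟩
  obtain ⟨ε, hε, hspec⟩ := exists_spectral_gap hL₁
  obtain ⟨hρ, g₀, B, d, -, -, hbase, -⟩ := exists_leadingSplit hL₁ hε hspec
  exact hbase.leadingEigenvalue_eq hε hρ
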